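/- Fix a mass $m>0$. Let $\mathcal P=\{p\in\mathbb Z^3: p_1+p_2+p_3=0\}$ and, for $p\in\mathcal P$, $C_0(p)=1/(p_1^2+p_2^2+p_3^2+m^2)$. *The model.* Let $T=(T_p)_{p\in\mathbb Z^3}$ be the centred complex Gaussian field with independent components and $\mathbb E[T_p\bar T_{p}]=C_0(p)$ if $p\in\mathcal P$, $T_p=0$ otherwise (closure constraint). For $i=1,2,3$ let $\mathbb M^i_{ab}=\sum T_{p}\bar T_{p'}$, the sum running over $p,p'\in\mathbb Z^3$ with $p_i=b$, $p'_i=a$ and $p_j=p'_j$ for $j\ne i$. For $\mathrm{Re}\,\lambda\ge 0$ the partition function of the $U(1)$-$T^4_3$ model is $\mathbb E\big[\exp(-\lambda\sum_{i=1}^3\mathrm{tr}(\mathbb M^i)^2)\big]$. Its intermediate field representation is $$Z(\lambda)=\int d\nu(\tau)\,e^{-W(\tau)},\qquad W(\tau)=\sum_{p\in\mathcal P}\ln\big(1-i\sqrt{2\lambda}\,C_0(p)\Gamma(p)\big),\qquad \Gamma(p)=\sum_{i=1}^3\tau_i(p_i),$$ where the $\tau_i(q)$ ($i=1,2,3$,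 $q\in\mathbb Z$) are independent standard real Gaussian variables under $\nu$, and the sum defining $W$ is the limit as $N\to\infty$ of the sums over $p\in\mathcal P$ with $\max_i|p_i|\le N$. *The expansion.* Let $R(p)=C_0(p)/(1-i\sqrt{2\lambda}\,C_0(p)\Gamma(p))$, and write $R_k(p)$ for $R(p)$ evaluated at the $k$-th replica $\tau^{(k)}$ of $\tau$. For a tree $\mathcal T$ on the labelled vertices $1,\dots,n$, $n\ge2$, with degrees $c(k)$, let $$\mathcal A_{\mathcal T}(\lambda)=\frac{(-2\lambda)^{n-1}}{n!}\int_{[0,1]^{n-1}}\prod_{l\in\mathcal T}dw_l\int d\nu_{X^{\mathcal T}(w)}(\tau)\sum_{p^{(1)},\dots,p^{(n)}\in\mathcal P}\ \prod_{k=1}^n (c(k)-1)!\,R_k(p^{(k)})^{c(k)}\prod_{l=\{s,t\}\in\mathcal T}\Big(\sum_{i=1}^3\delta_{p^{(s)}_i,\,p^{(t)}_i}\Big),$$ where $\nu_X$ is the centred Gaussian measure on $n$ replicas with covariance $\mathbb E[\tau^{(k)}_i(q)\tau^{(k')}_j(q')]=\delta_{ij}\delta_{qq'}X_{kk'}$,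 and $X^{\mathcal T}(w)$ is the BKAR matrix: $X_{kk}=1$ and $X_{kk'}$ is the minimum of the $w_l$ along the path from $k$ to $k'$ in $\mathcal T$. Let $F_0(\lambda)=-\int d\nu(\tau)\,W(\tau)$ be the one-vertex term. *The domain.* Let $K_1=\sum_{p\in\mathcal P}C_0(p)^2$, $K_2=\sum_{p\in\mathcal P,\,p_1=0}C_0(p)$, and let $D$ be the set of $\lambda=\rho e^{i\phi}$ with $\rho>0$, $-\pi<\phi<\pi$ and $$|\lambda|<\frac1K,\qquad K=\frac{12\sqrt{\pi/e}\,\sup(K_1,K_2)}{\cos^2(\phi/2)}.$$ **Theorem.** $D$ is the interior of a cardioid: it is open, connected and bounded, and its boundary is the curve $\rho=\cos^2(\phi/2)/\big(12\sqrt{\pi/e}\,\sup(K_1,K_2)\big)$. For $\lambda\in D$ the partition function is well defined (the series for $W$ converges almost surely, $W$ and $e^{-W}$ are integrable), and it equals $\mathbb E\big[\exp(-\lambda\sum_i\mathrm{tr}(\mathbb M^i)^2)\big]$ if moreover $\mathrm{Re}\,\lambda\ge0$. The free energy $F=\ln Z$ exists as an analytic function on $D$ ($e^F=Z$, with $F(\lambda)=\ln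 Z(\lambda)$ real for real $\lambda\in D$). For every $\lambda\in D$ all amplitudes $\mathcal A_{\mathcal T}(\lambda)$ are well defined (the matrices $X^{\mathcal T}(w)$ are positive semidefinite, the sums over modes converge absolutely and the integrals exist), and the tree expansion of the free energy converges absolutely to it: $$\sum_{n\ge2}\ \sum_{\mathcal T}|\mathcal A_{\mathcal T}(\lambda)|<\infty,\qquad F(\lambda)=F_0(\lambda)+\sum_{n\ge2}\ \sum_{\mathcal T}\mathcal A_{\mathcal T}(\lambda).$$ -/

import Mathlib

open MeasureTheory ProbabilityTheory Filter Topology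
open scoped Nat

noncomputable section

namespace TGFT

/-! ### The tensor field and its partition function -/

/-- A triple of Fourier modes of `U(1)³`. -/
abbrev Mode := Fin 3 → ℤ

/-- The squared length of a triple of Fourier modes. -/
def sqNorm (p : Mode) : ℝ := ∑ i, (p i : ℝ) ^ 2

/-- `C₀(p) = 1 / (p² + m²)`. -/
def C0 (m : ℝ) (p : Mode) : ℝ := 1 / (sqNorm p + m ^ 2)

/-- The diagonal entry of the propagator, `δ(p₁ + p₂ + p₃) / (p² + m²)`; the delta is the
closure constraint. -/
def propagator (m : ℝ) (p : Mode) : ℝ := if ∑ i, p i = 0 then C0 m p else 0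

/-- The modes that satisfy the closure constraint. -/
abbrev ClosedMode := {p : Mode // ∑ i, p i = 0}

/-- Independent standard real Gaussian variables, two for each triple of modes. -/
def fieldNoise : Measure (Mode × Fin 2 → ℝ) :=
  Measure.infinitePi fun _ => gaussianReal 0 1

/-- The Fourier components `T_p` of the tensor field: under `fieldNoise` they are independent
centred complex Gaussian variables with `E[T_p * conj T_p] = propagator m p` and
`E[T_p * T_p] = 0`. -/
def tensorField (m : ℝ) (x : Mode × Fin 2 → ℝ) (p : Mode) : ℂ :=
  (Real.sqrt (propagator m p / 2) : ℂ) * ((x (p, 0) : ℂ) + Complex.I * (x (p, 1) : ℂ))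

open Classical in
/-- The matrix `M^i` of colour `i`, obtained by contracting `T` with its conjugate on the two
indices of colours `j ≠ i`. -/
def colourMatrix (i : Fin 3) (T : Mode → ℂ) (a b : ℤ) : ℂ :=
  ∑' pq : Mode × Mode,
    if pq.1 i = b ∧ pq.2 i = a ∧ ∀ j, j ≠ i → pq.1 j = pq.2 j
    then T pq.1 * (starRingEnd ℂ) (T pq.2) else 0

/-- The sum over the three colours of the quartic melonic invariants `tr (M^i)²`. -/
def quarticInvariant (T : Mode → ℂ) : ℂ :=
  ∑ i : Fin 3, ∑' ab : ℤ × ℤ, colourMatrix i T ab.1 ab.2 * colourMatrix i T ab.2 ab.1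

/-- The partition function of the tensor field, `∫ dμ_C exp (-S_int)`
(for `Re lam ≥ 0`, where `|exp (-S_int)| ≤ 1`). -/
def fieldPartitionFunction (m : ℝ) (lam : ℂ) : ℂ :=
  ∫ x, Complex.exp (-lam * quarticInvariant (tensorField m x)) ∂fieldNoise

/-! ### The intermediate field representation -/

/-- A configuration of the three real intermediate vector fields `τ_i(q)`. -/
abbrev VectorFields := Fin 3 × ℤ → ℝ

/-- The Gaussian measure with covariance `E[τ_i(q) τ_j(q')] = δ_{ij} δ_{qq'}`. -/
def vectorGaussian : Measure VectorFields :=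
  Measure.infinitePi fun _ => gaussianReal 0 1

/-- `Γ(p) = τ₁(p₁) + τ₂(p₂) + τ₃(p₃)`. -/
def Gam (τ : VectorFields) (p : Mode) : ℝ := ∑ i, τ (i, p i)

/-- The principal square root `√(2 lam)`. -/
def sqrtTwo (lam : ℂ) : ℂ := (2 * lam) ^ (1 / 2 : ℂ)

/-- `1 - i √(2 lam) C₀(p) Γ(p)`. -/
def denom (m : ℝ) (lam : ℂ) (τ : VectorFields) (p : Mode) : ℂ :=
  1 - Complex.I * sqrtTwo lam * (C0 m p : ℂ) * (Gam τ p : ℂ)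

/-- The closed modes with all components between `-N` and `N`. -/
def modeBox (N : ℕ) : Finset Mode :=
  (Finset.Icc (fun _ => -(N : ℤ)) (fun _ => (N : ℤ))).filter fun p => ∑ i, p i = 0

/-- The loop-vertex potential with the modes cut off at `N`. -/
def cutPotential (m : ℝ) (lam : ℂ) (N : ℕ) (τ : VectorFields) : ℂ :=
  ∑ p ∈ modeBox N, Complex.log (denom m lam τ p)

/-- The potential `W(τ) = ∑_{p closed} log (1 - i √(2 lam) C₀(p) Γ(p))`. The series does not
converge absolutely: it is the limit of the sums over growing boxes of modes. -/
def potential (m : ℝ) (lam : ℂ) (τ : VectorFields) : ℂ :=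
  limUnder atTop fun N : ℕ => cutPotential m lam N τ

/-- The partition function in the intermediate field representation. -/
def partitionFunction (m : ℝ) (lam : ℂ) : ℂ :=
  ∫ τ, Complex.exp (-potential m lam τ) ∂vectorGaussian

/-- The potential is almost surely given by a convergent series, and it and `exp (-W)` are
integrable. -/
def PotentialWellDefined (m : ℝ) (lam : ℂ) : Prop :=
  (∀ᵐ τ ∂vectorGaussian,
    Tendsto (fun N : ℕ => cutPotential m lam N τ) atTop (𝓝 (potential m lam τ))) ∧
  Integrable (potential m lam) vectorGaussian ∧
  Integrable (fun τ => Complex.exp (-potential m lam τ)) vectorGaussian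

/-! ### The tree expansion -/

/-- The term of the expansion with a single vertex. -/
def oneVertexTerm (m : ℝ) (lam : ℂ) : ℂ :=
  ∫ τ, -potential m lam τ ∂vectorGaussian

/-- The resolvent `R(p) = C₀(p) / (1 - i √(2 lam) C₀(p) Γ(p))`. -/
def resolvent (m : ℝ) (lam : ℂ) (τ : VectorFields) (p : Mode) : ℂ :=
  (C0 m p : ℂ) / denom m lam τ p

/-- Trees on `n ≥ 2` labelled vertices. -/
abbrev LabelledTree :=
  Σ n : {n : ℕ // 2 ≤ n}, {T : SimpleGraph (Fin n) // T.IsTree}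

section Trees

variable {n : ℕ}

open Classical in
/-- The infimum of the parameters `w_l ∈ [0, 1]` along the path from `i` to `j` in a forest: it is
`1` if `i = j` and `0` if there is no path. -/
def pathInf (T : SimpleGraph (Fin n)) (w : T.edgeSet → ℝ) (i j : Fin n) : ℝ :=
  if h : ∃ p : T.Walk i j, p.IsPath then
    (h.choose.edges.attach.map fun e =>
      w ⟨e.1, h.choose.edges_subset_edgeSet e.2⟩).foldr min 1
  else 0

/-- The interpolated replica covariance `X^T(w)` of the forest formula. -/
def interpolation (T : SimpleGraph (Fin n)) (w : T.edgeSet → ℝ) : Matrix (Fin n) (Fin n) ℝ :=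
  Matrix.of fun i j => pathInf T w i j

/-- A configuration of `n` replicas of the intermediate vector fields. -/
abbrev ReplicaFields (n : ℕ) := Fin 3 × ℤ → EuclideanSpace ℝ (Fin n)

/-- The Gaussian measure with covariance
`E[τ_{i,k}(q) τ_{j,l}(q')] = δ_{ij} δ_{qq'} X_{kl}`. -/
def replicaGaussian (X : Matrix (Fin n) (Fin n) ℝ) : Measure (ReplicaFields n) :=
  Measure.infinitePi fun _ => multivariateGaussian 0 X

/-- The vector fields of the `k`-th replica. -/
def replica (τ : ReplicaFields n) (k : Fin n) : VectorFields := fun iq => τ iq k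

/-- The number `∑_i δ_{p_i q_i}` of common components. -/
def sharedModes (p q : Mode) : ℕ := (Finset.univ.filter fun i => p i = q i).card

lemma sharedModes_comm (p q : Mode) : sharedModes p q = sharedModes q p := by
  simp only [sharedModes, eq_comm]

/-- The factor `∑_i δ_{p_{s(l) i} p_{t(l) i}}` of an edge `l`. -/
def edgeFactor (p : Fin n → ClosedMode) (l : Sym2 (Fin n)) : ℕ :=
  Sym2.lift ⟨fun a b => sharedModes (p a) (p b), fun _ _ => sharedModes_comm _ _⟩ l

open Classical in
/-- The contribution of a choice of one closed mode for each vertex: each vertex of degree `c`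
carries `(c - 1)! R(p)^c`, and each edge its sum of Kronecker deltas. -/
def treeTerm (m : ℝ) (lam : ℂ) (T : SimpleGraph (Fin n)) (τ : ReplicaFields n)
    (p : Fin n → ClosedMode) : ℂ :=
  (∏ k, ((T.degree k - 1)! : ℂ) * resolvent m lam (replica τ k) (p k) ^ T.degree k) *
    ∏ l : T.edgeSet, (edgeFactor p l : ℂ)

/-- The Gaussian expectation at fixed interpolation parameters. -/
def treeExpectation (m : ℝ) (lam : ℂ) (T : SimpleGraph (Fin n)) (w : T.edgeSet → ℝ) : ℂ :=
  ∫ τ, (∑' p : Fin n → ClosedMode, treeTerm m lam T τ p) ∂(replicaGaussian (interpolation T w))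

/-- The cube `[0, 1]^{edges}` of interpolation parameters. -/
def parameterCube (T : SimpleGraph (Fin n)) : Set (T.edgeSet → ℝ) :=
  Set.Icc 0 1

open Classical in
/-- The term of a tree on `n` labelled vertices in the expansion of the free energy. -/
def treeAmplitude (m : ℝ) (lam : ℂ) (T : SimpleGraph (Fin n)) : ℂ :=
  (-2 * lam) ^ (n - 1) / (n ! : ℂ) * ∫ w in parameterCube T, treeExpectation m lam T w

open Classical in
/-- All operations in the definition of the amplitude of `T` are meaningful: the interpolated
covariances are positive, the sum over modes converges absolutely, and both integrands are
integrable. -/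
def AmplitudeWellDefined (m : ℝ) (lam : ℂ) (T : SimpleGraph (Fin n)) : Prop :=
  (∀ w ∈ parameterCube T, (interpolation T w).PosSemidef) ∧
  (∀ τ : ReplicaFields n, Summable fun p => ‖treeTerm m lam T τ p‖) ∧
  (∀ w ∈ parameterCube T,
    Integrable (fun τ => ∑' p : Fin n → ClosedMode, treeTerm m lam T τ p)
      (replicaGaussian (interpolation T w))) ∧
  IntegrableOn (treeExpectation m lam T) (parameterCube T)

end Trees

/-! ### The cardioid -/

/-- `K₁(m) = ∑_{p closed} C₀(p)²`. -/
def K1 (m : ℝ) : ℝ := ∑' p : ClosedMode, C0 m p ^ 2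

/-- `K₂(m) = ∑_{p closed, p₁ = 0} C₀(p)`. -/
def K2 (m : ℝ) : ℝ := ∑' p : {p : ClosedMode // p.1 0 = 0}, C0 m p.1

/-- The numerator `12 √(π / e) sup (K₁, K₂)` of the constant `K`. -/
def Knum (m : ℝ) : ℝ := 12 * Real.sqrt (Real.pi / Real.exp 1) * max (K1 m) (K2 m)

/-- `K = 12 √(π / e) sup (K₁, K₂) / cos² (θ / 2)`. -/
def K (m θ : ℝ) : ℝ := Knum m / Real.cos (θ / 2) ^ 2

/-- The couplings `lam = ρ e^{iθ}`, `ρ > 0`, `-π < θ < π`, with `|lam| < 1 / K`. -/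
def domain (m : ℝ) : Set ℂ :=
  {lam | ∃ ρ θ : ℝ, 0 < ρ ∧ -Real.pi < θ ∧ θ < Real.pi ∧
    lam = ρ * Complex.exp (Complex.I * θ) ∧ ‖lam‖ < 1 / K m θ}

/-- The cardioid with polar equation `ρ = cos² (θ / 2) / (12 √(π / e) sup (K₁, K₂))`. -/
def cardioid (m : ℝ) : Set ℂ :=
  Set.range fun θ : ℝ =>
    ((Real.cos (θ / 2) ^ 2 / Knum m : ℝ) : ℂ) * Complex.exp (Complex.I * θ)

end TGFT

end

/-! The expansion is read as the cluster expansion of a classical gas with repulsive interactions.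
Put μ = λ^(-1/2). The identity -log(1 - ix/b) = ∫_0^∞ e^(-tb) (e^(itx) - 1) dt/t
(`integral_vertex`), with b = μ/C₀(p) and x = √2 Γ(p), turns -W into an integral of characters of
the Gaussian field over "particles" y = (p, t), a closed mode with a proper time. Expanding e^(-W)
and averaging over τ gives Gaussian factors exp(-‖∑ v(y)‖²/2), where v(p, t) is √2 t times the
indicator of the components of p. The squares 3t² go into the weight of a single particle. The cross
terms form a pair interaction exp(-⟨v, v'⟩) with ⟨v, v'⟩ ≥ 0. Hence ln Z is the sum of the
integrated Ursell functions of this gas (`integral_exp_eq_exp_tsum`).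

The Ursell functions are sums over trees (`sum_treeWeight`): the forest interpolation and the Ursell
functions solve the same contraction equation. Since the inner products are nonnegative, all trees
on n vertices contribute to the Ursell function with the same sign (-1)^(n-1). This has two
consequences. On integration over proper times, ∫ t^(c-1) e^(-tb) dt = (c-1)!/b^c produces the
vertex factor (c-1)! R^c, so each amplitude is exactly the tree term of the gas
(`treeAmplitude_eq`). And since the modulus of a particle weight at μ is the weight at Re μ,
absolute convergence of the tree sum for all complex μ with Re μ ≥ κ follows from a bound on the
cluster coefficients at the single real value κ, where nothing cancels between trees. As Re λ^(-1/2)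
= cos(φ/2)/√ρ, the half plane Re μ > √`Knum` is the cardioid (`mem_domain_iff`).

The bound at κ = √`Knum` comes from the recursion for the gas with an extra root vector T
(`rootedSum_succ`): the root absorbs one particle at a time. A function that dominates one step of
the recursion bounds all of its partial sums (`sum_rootedSum_le`). The function used is ∏_p (1 + √2
f_p ⟨e_p, T⟩), with f_p a multiple of C₀(p)/κ. One step closes because the integral over proper time
is then the integral of an exact derivative (`lintegral_rate_exp`) and the integral over the
interpolation parameter gives back the product (`lintegral_deriv_prod`). What is needed is f_p
(κ/C₀(p) - u_p) ≥ 1, with u_p the rate due to the other modes (`one_le_rateWeight_mul`); this is an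
elementary estimate of lattice sums by K₁ and K₂ that uses only 12 √(π/e) ≥ 12.8.

All identities are first proved with finitely many modes and proper times above ε; the tree bounds
are uniform, so both cutoffs can be removed. For W itself, the part linear in Γ converges almost
surely through fourth moments and the quadratic remainder is summable
(`ae_exists_tendsto_boxPotential`). Uniform second moments of W and of e^(-W) in the boxes
(`exists_lintegral_sq_le`) give convergence of the expectations. The tensor field enters through the
Gaussian decoupling of the quartic term: for λ > 0 in a box it is an exchange of two integrals, then
the box is removed, and the identity theorem and continuity extend the equality to Re λ ≥ 0
(`partitionFunction_eq_field`). -/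

open MeasureTheory ProbabilityTheory Filter Topology
open scoped Nat

noncomputable section

namespace TGFT

set_option linter.unusedSectionVars false

section

open Real

/-! ### Ursell functions of a pair potential and their contraction equation -/

section Ursell

open Finset

variable {ι H : Type*} [LinearOrder ι] [OrderBot ι] [NormedAddCommGroup H] [InnerProductSpace ℝ H]
  {A : Finset ι} {p : ι × ι}

/-- The sum of the inner products of the pairs of distinct members of a family of vectors. -/
def pairEnergy (x : ι → H) (A : Finset ι) : ℝ :=
  (‖∑ a ∈ A, x a‖ ^ 2 - ∑ a ∈ A, ‖x a‖ ^ 2) / 2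

/-- The Boltzmann factor of a family of vectors whose pair potential is the inner product. -/
def boltz (s : ℝ) (x : ι → H) (A : Finset ι) : ℝ := exp (-(s * pairEnergy x A))

/-- The Ursell functions (connected parts) of the Boltzmann factors, rooted at `⊥`. -/
def ursell (s : ℝ) (x : ι → H) : Finset ι → ℝ
  | A => boltz s x A - ∑ A' ∈ (A.ssubsets.filter (⊥ ∈ ·)).attach,
      ursell s x A'.1 * boltz s x (A \ A'.1)
termination_by A => A.card
decreasing_by exact Finset.card_lt_card (Finset.mem_ssubsets.1 (Finset.mem_filter.1 A'.2).1)

lemma ursell_eq (s : ℝ) (x : ι → H) (A : Finset ι) :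
    ursell s x A = boltz s x A -
      ∑ A' ∈ A.ssubsets with ⊥ ∈ A', ursell s x A' * boltz s x (A \ A') := by
  rw [ursell, sum_attach (A.ssubsets.filter (⊥ ∈ ·)) (fun A' => ursell s x A' * boltz s x (A \ A'))]

lemma boltz_empty (s : ℝ) (x : ι → H) : boltz s x ∅ = 1 := by simp [boltz, pairEnergy]

lemma boltz_eq_sum (s : ℝ) (x : ι → H) (hA : ⊥ ∈ A) :
    boltz s x A = ∑ A' ∈ A.powerset with ⊥ ∈ A', ursell s x A' * boltz s x (A \ A') := by
  have h : A.powerset.filter (⊥ ∈ ·) = insert A (A.ssubsets.filter (⊥ ∈ ·)) := by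
    ext B
    simp only [mem_filter, mem_powerset, mem_insert, mem_ssubsets]
    constructor
    · rintro ⟨h1, h2⟩
      rcases eq_or_ssubset_of_subset h1 with h | h
      · exact Or.inl h
      · exact Or.inr ⟨h, h2⟩
    · rintro (rfl | ⟨h1, h2⟩)
      · exact ⟨Subset.rfl, hA⟩
      · exact ⟨h1.subset, h2⟩
  rw [h, sum_insert (by simp), ursell_eq s x A, sdiff_self]
  simp [boltz_empty]

lemma pairEnergy_congr {x x' : ι → H} (h : ∀ a ∈ A, x a = x' a) :
    pairEnergy x A = pairEnergy x' A := by
  unfold pairEnergy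
  rw [sum_congr rfl h, sum_congr rfl fun a ha => congrArg (fun v => ‖v‖ ^ 2) (h a ha)]

lemma boltz_congr (s : ℝ) {x x' : ι → H} (h : ∀ a ∈ A, x a = x' a) :
    boltz s x A = boltz s x' A := by
  rw [boltz, boltz, pairEnergy_congr h]

lemma ursell_congr (s : ℝ) {x x' : ι → H} (h : ∀ a ∈ A, x a = x' a) :
    ursell s x A = ursell s x' A := by
  induction A using Finset.strongInduction with
  | H A ih =>
    rw [ursell_eq, ursell_eq, boltz_congr s h]
    congr 1
    refine sum_congr rfl fun B hB => ?_
    have hBA := mem_ssubsets.1 (mem_filter.1 hB).1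
    rw [ih B hBA fun a ha => h a (hBA.subset ha), boltz_congr s fun a ha => h a (sdiff_subset ha)]

lemma pairEnergy_map {κ : Type*} [LinearOrder κ] (e : κ ↪ ι) (x : ι → H)
    (A : Finset κ) : pairEnergy x (A.map e) = pairEnergy (x ∘ e) A := by
  simp [pairEnergy]

lemma boltz_map {κ : Type*} [LinearOrder κ] (s : ℝ) (e : κ ↪ ι) (x : ι → H)
    (A : Finset κ) : boltz s x (A.map e) = boltz s (x ∘ e) A := by
  simp [boltz, pairEnergy_map]

/-- The recursion depends on the order of the labels only through the root, so a relabelling needs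
only to preserve `⊥`. -/
lemma ursell_map {κ : Type*} [LinearOrder κ] [OrderBot κ] (s : ℝ) (e : κ ↪ ι) (he : e ⊥ = ⊥)
    (x : ι → H) (A : Finset κ) : ursell s x (A.map e) = ursell s (x ∘ e) A := by
  induction A using Finset.strongInduction with
  | H A ih =>
    rw [ursell_eq, ursell_eq, boltz_map]
    congr 1
    symm
    refine sum_bij (fun B _ => B.map e) ?_ ?_ ?_ ?_
    · intro B hB
      simp only [mem_filter, mem_ssubsets] at hB ⊢
      refine ⟨?_, ?_⟩
      · rw [ssubset_iff_subset_ne] at hB ⊢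
        exact ⟨map_subset_map.2 hB.1.1, fun h => hB.1.2 (map_injective e h)⟩
      · rw [← he]; exact mem_map_of_mem e hB.2
    · intro B _ C _ h
      exact map_injective e h
    · intro C hC
      simp only [mem_filter, mem_ssubsets] at hC
      obtain ⟨B, hB, rfl⟩ := subset_map_iff.1 hC.1.subset
      refine ⟨B, ?_, rfl⟩
      simp only [mem_filter, mem_ssubsets]
      refine ⟨?_, ?_⟩
      · rw [ssubset_iff_subset_ne]
        exact ⟨hB, fun h => hC.1.ne (by rw [h])⟩
      · have := hC.2
        rw [← he, Finset.mem_map'] at this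
        exact this
    · intro B hB
      have hBA := mem_ssubsets.1 (mem_filter.1 hB).1
      rw [ih B hBA, ← boltz_map, Finset.map_sdiff]

/-- The increasing pairs of a finite set. -/
def pairs (A : Finset ι) : Finset (ι × ι) := (A ×ˢ A).filter fun p => p.1 < p.2

lemma mem_pairs :
    p ∈ pairs A ↔ p.1 ∈ A ∧ p.2 ∈ A ∧ p.1 < p.2 := by
  simp [pairs, and_assoc]

lemma sum_product_eq_sum_pairs {α : Type*} [LinearOrder α] {f : α → α → ℝ}
    (hf : ∀ a b, f a b = f b a) (A : Finset α) :
    ∑ p ∈ A ×ˢ A, f p.1 p.2 = ∑ a ∈ A, f a a + 2 * ∑ p ∈ pairs A, f p.1 p.2 := by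
  have h2 : ∑ p ∈ A ×ˢ A, f p.1 p.2 = ∑ p ∈ pairs A, f p.1 p.2 +
      (∑ p ∈ (A ×ˢ A).filter (fun p => p.2 < p.1), f p.1 p.2 + ∑ p ∈ A.diag, f p.1 p.2) := by
    rw [← sum_filter_add_sum_filter_not (A ×ˢ A) (fun p => p.1 < p.2)]
    congr 1
    rw [← sum_filter_add_sum_filter_not _ (fun p => p.2 < p.1), filter_filter, filter_filter]
    congr 1
    · refine sum_congr (filter_congr fun p _ => ?_) fun _ _ => rfl
      constructor
      · exact fun h => h.2
      · exact fun h => ⟨not_lt.2 h.le, h⟩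
    · refine sum_congr ?_ fun _ _ => rfl
      ext p
      simp only [mem_filter, mem_product, mem_diag, not_lt]
      constructor
      · rintro ⟨h, h1, h2⟩
        exact ⟨h.1, le_antisymm h2 h1⟩
      · rintro ⟨h, h1⟩
        exact ⟨⟨h, h1 ▸ h⟩, h1.ge, h1.le⟩
  have h3 : ∑ p ∈ (A ×ˢ A).filter (fun p => p.2 < p.1), f p.1 p.2 = ∑ p ∈ pairs A, f p.1 p.2 := by
    refine sum_nbij' Prod.swap Prod.swap ?_ ?_ ?_ ?_ ?_
    · intro p hp; simp [pairs] at hp ⊢; tauto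
    · intro p hp; simp [pairs] at hp ⊢; tauto
    · simp
    · simp
    · intro p _; exact hf _ _
  rw [h2, h3, sum_diag]
  ring

lemma pairEnergy_eq_sum_pairs (x : ι → H) (A : Finset ι) :
    pairEnergy x A = ∑ p ∈ pairs A, inner ℝ (x p.1) (x p.2) := by
  have h1 : ‖∑ a ∈ A, x a‖ ^ 2 = ∑ p ∈ A ×ˢ A, (inner ℝ (x p.1) (x p.2) : ℝ) := by
    rw [← real_inner_self_eq_norm_sq, sum_inner, sum_product]
    simp [inner_sum]
  rw [pairEnergy, h1, sum_product_eq_sum_pairs (f := fun a b => inner ℝ (x a) (x b))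
    fun a b => real_inner_comm _ _]
  simp only [real_inner_self_eq_norm_sq]
  ring

/-- The family of vectors in which the second member of a pair is added to the first. -/
def mergePair (x : ι → H) (p : ι × ι) : ι → H := Function.update x p.1 (x p.1 + x p.2)

lemma sum_erase_mergePair {M : Type*} [AddCommMonoid M] (g : H → M) (x : ι → H) (hp : p ∈ pairs A) :
    ∑ a ∈ A.erase p.2, g (mergePair x p a) =
      g (x p.1 + x p.2) + ∑ a ∈ (A.erase p.2).erase p.1, g (x a) := by
  obtain ⟨h1, h2, h3⟩ := mem_pairs.1 hp
  have h1' : p.1 ∈ A.erase p.2 := mem_erase.2 ⟨h3.ne, h1⟩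
  rw [← add_sum_erase _ _ h1']
  congr 1
  · simp [mergePair]
  · refine sum_congr rfl fun a ha => ?_
    rw [mergePair, Function.update_of_ne (mem_erase.1 ha).1]

lemma sum_erase_erase {M : Type*} [AddCommMonoid M] (g : ι → M) (hp : p ∈ pairs A) :
    ∑ a ∈ A, g a = g p.2 + (g p.1 + ∑ a ∈ (A.erase p.2).erase p.1, g a) := by
  obtain ⟨h1, h2, h3⟩ := mem_pairs.1 hp
  rw [← add_sum_erase _ _ h2, ← add_sum_erase _ _ (mem_erase.2 ⟨h3.ne, h1⟩)]

/-- A merge keeps the total vector and changes only the squared norms of the members, which is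
exactly the inner product of the merged pair. -/
lemma pairEnergy_mergePair (x : ι → H) (hp : p ∈ pairs A) :
    pairEnergy x A = inner ℝ (x p.1) (x p.2) + pairEnergy (mergePair x p) (A.erase p.2) := by
  have a1 := sum_erase_mergePair id x hp
  have a2 := sum_erase_erase x hp
  have b1 := sum_erase_mergePair (fun v => ‖v‖ ^ 2) x hp
  have b2 := sum_erase_erase (fun a => ‖x a‖ ^ 2) hp
  simp only [id] at a1
  unfold pairEnergy
  rw [a1, a2, b1, b2]
  have : x p.2 + (x p.1 + ∑ a ∈ (A.erase p.2).erase p.1, x a) =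
    x p.1 + x p.2 + ∑ a ∈ (A.erase p.2).erase p.1, x a := by abel
  rw [this, norm_add_sq_real (x p.1) (x p.2)]
  ring

/-- The weight of the contraction of a pair. -/
def pairTerm (s : ℝ) (x : ι → H) (p : ι × ι) : ℝ :=
  -inner ℝ (x p.1) (x p.2) * exp (-(s * inner ℝ (x p.1) (x p.2)))

/-- The derivative brings down the energy, a sum over pairs. For each pair its own Boltzmann factor
is split off, and what remains is the Boltzmann factor of the merged family. -/
lemma hasDerivAt_boltz (x : ι → H) (A : Finset ι) (s : ℝ) :
    HasDerivAt (fun s => boltz s x A)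
      (∑ p ∈ pairs A, pairTerm s x p * boltz s (mergePair x p) (A.erase p.2)) s := by
  have h : HasDerivAt (fun s : ℝ => boltz s x A)
      (exp (-(s * pairEnergy x A)) * (-(1 * pairEnergy x A))) s :=
    (((hasDerivAt_id s).mul_const _).neg).exp
  convert h using 1
  rw [one_mul, pairEnergy_eq_sum_pairs x A, ← sum_neg_distrib, mul_sum, ← pairEnergy_eq_sum_pairs]
  refine sum_congr rfl fun p hp => ?_
  rw [pairTerm, boltz, pairEnergy_mergePair x hp, mul_add, neg_add, exp_add]
  ring

lemma pairs_mono {A B : Finset ι} (h : A ⊆ B) :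
    pairs A = (pairs B).filter fun p => p.1 ∈ A ∧ p.2 ∈ A := by
  ext p
  simp only [mem_pairs, mem_filter]
  constructor
  · exact fun hp => ⟨⟨h hp.1, h hp.2.1, hp.2.2⟩, hp.1, hp.2.1⟩
  · exact fun hp => ⟨hp.2.1, hp.2.2, hp.1.2.2⟩

/-- Subsets that separate the pair contribute nothing. Those that do not are in bijection with the
subsets of the merged label set: erase `p.2`, and conversely put `p.2` back exactly when `p.1` is
present. Since `p.1 < p.2`, the erased label is never the root. -/
lemma sum_ssubsets_mergePair (s : ℝ) (x : ι → H) (hp : p ∈ pairs A) :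
    ∑ A' ∈ A.ssubsets with ⊥ ∈ A',
      ((if p.1 ∈ A' ∧ p.2 ∈ A' then
          ursell s (mergePair x p) (A'.erase p.2) * boltz s x (A \ A') else 0) +
        (if p.1 ∈ A \ A' ∧ p.2 ∈ A \ A' then
          ursell s x A' * boltz s (mergePair x p) ((A \ A').erase p.2) else 0)) =
    ∑ B ∈ (A.erase p.2).ssubsets with ⊥ ∈ B,
      ursell s (mergePair x p) B * boltz s (mergePair x p) (A.erase p.2 \ B) := by
  obtain ⟨h1, h2, h3⟩ := mem_pairs.1 hp
  have hbot : p.2 ≠ ⊥ := (bot_le.trans_lt h3).ne'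
  have hx : ∀ a, a ≠ p.1 → x a = mergePair x p a := fun a ha => by
    rw [mergePair, Function.update_of_ne ha]
  rw [← sum_filter_add_sum_filter_not _ (fun A' => (p.1 ∈ A' ↔ p.2 ∈ A'))]
  have hz : ∑ A' ∈ (A.ssubsets.filter (⊥ ∈ ·)).filter (fun A' => ¬ (p.1 ∈ A' ↔ p.2 ∈ A')),
      ((if p.1 ∈ A' ∧ p.2 ∈ A' then
          ursell s (mergePair x p) (A'.erase p.2) * boltz s x (A \ A') else 0) +
        (if p.1 ∈ A \ A' ∧ p.2 ∈ A \ A' then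
          ursell s x A' * boltz s (mergePair x p) ((A \ A').erase p.2) else 0)) = 0 := by
    refine sum_eq_zero fun A' hA' => ?_
    have := (mem_filter.1 hA').2
    rw [if_neg (by tauto), if_neg (by simp only [Finset.mem_sdiff]; tauto), add_zero]
  rw [hz, add_zero]
  refine sum_bij' (fun A' _ => A'.erase p.2)
    (fun B _ => if p.1 ∈ B then insert p.2 B else B) ?_ ?_ ?_ ?_ ?_
  · intro A' hA'
    simp only [mem_filter, mem_ssubsets] at hA' ⊢
    obtain ⟨⟨hs, hb⟩, hi⟩ := hA'
    refine ⟨?_, mem_erase.2 ⟨hbot.symm, hb⟩⟩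
    obtain ⟨c, hcA, hc⟩ := exists_of_ssubset hs
    rw [ssubset_iff_of_subset (erase_subset_erase _ hs.subset)]
    by_cases hcb : c = p.2
    · subst hcb
      exact ⟨p.1, mem_erase.2 ⟨h3.ne, h1⟩, fun h => hc (hi.1 (mem_erase.1 h).2)⟩
    · exact ⟨c, mem_erase.2 ⟨hcb, hcA⟩, fun h => hc (mem_erase.1 h).2⟩
  · intro B hB
    simp only [mem_filter, mem_ssubsets] at hB ⊢
    obtain ⟨hs, hb⟩ := hB
    have hbB : p.2 ∉ B := fun h => (mem_erase.1 (hs.subset h)).1 rfl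
    obtain ⟨c, hcA, hc⟩ := exists_of_ssubset hs
    have hBA : B ⊆ A := hs.subset.trans (erase_subset _ _)
    split_ifs with ha
    · refine ⟨⟨?_, mem_insert_of_mem hb⟩, by simp [ha]⟩
      rw [ssubset_iff_of_subset (insert_subset h2 hBA)]
      exact ⟨c, (mem_erase.1 hcA).2, by
        simp only [mem_insert, not_or]; exact ⟨(mem_erase.1 hcA).1, hc⟩⟩
    · refine ⟨⟨?_, hb⟩, by simp [ha, hbB]⟩
      rw [ssubset_iff_of_subset hBA]
      exact ⟨c, (mem_erase.1 hcA).2, hc⟩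
  · intro A' hA'
    have hi := (mem_filter.1 hA').2
    by_cases ha : p.1 ∈ A'
    · simp only [mem_erase, ha, and_true, h3.ne, ne_eq, not_false_eq_true, if_true]
      exact insert_erase (hi.1 ha)
    · simp only [mem_erase, ha, and_false, if_false]
      exact erase_eq_of_notMem fun h => ha (hi.2 h)
  · intro B hB
    have hs := mem_ssubsets.1 (mem_filter.1 hB).1
    have hbB : p.2 ∉ B := fun h => (mem_erase.1 (hs.subset h)).1 rfl
    split_ifs with ha
    · exact erase_insert hbB
    · exact erase_eq_of_notMem hbB
  · intro A' hA'
    have hi := (mem_filter.1 hA').2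
    by_cases ha : p.1 ∈ A'
    · have hb := hi.1 ha
      rw [if_pos ⟨ha, hb⟩, if_neg (by simp [ha]), add_zero]
      congr 1
      have : A.erase p.2 \ A'.erase p.2 = A \ A' := by
        ext c
        simp only [Finset.mem_sdiff, mem_erase]
        constructor
        · rintro ⟨⟨h, h'⟩, h''⟩
          exact ⟨h', fun hc => h'' ⟨h, hc⟩⟩
        · rintro ⟨h, h'⟩
          exact ⟨⟨fun hc => h' (hc ▸ hb), h⟩, fun hc => h' hc.2⟩
      rw [this]
      exact boltz_congr s fun a haa => hx a fun h => (Finset.mem_sdiff.1 haa).2 (h ▸ ha)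
    · have hb : p.2 ∉ A' := fun h => ha (hi.2 h)
      rw [if_neg (by tauto), if_pos (by simp [ha, hb, h1, h2]), zero_add,
        erase_eq_of_notMem hb, erase_sdiff_comm]
      congr 1
      exact ursell_congr s fun a haa => hx a fun h => ha (h ▸ haa)

/-- Apply the product rule to the defining recursion. For a fixed pair the terms recombine, by
`sum_ssubsets_mergePair`, into the recursion of the merged family. The Ursell functions therefore
obey the same contraction rule as the Boltzmann factors and differ only in their value at `s = 0`.
-/
lemma hasDerivAt_ursell (x : ι → H) (A : Finset ι) (s : ℝ) :
    HasDerivAt (fun s => ursell s x A)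
      (∑ p ∈ pairs A, pairTerm s x p * ursell s (mergePair x p) (A.erase p.2)) s := by
  induction A using Finset.strongInduction with
  | H A ih =>
    have h1 : HasDerivAt (fun s => ∑ A' ∈ A.ssubsets with ⊥ ∈ A',
        ursell s x A' * boltz s x (A \ A'))
        (∑ A' ∈ A.ssubsets with ⊥ ∈ A',
          ((∑ p ∈ pairs A', pairTerm s x p * ursell s (mergePair x p) (A'.erase p.2)) *
            boltz s x (A \ A') + ursell s x A' *
            (∑ p ∈ pairs (A \ A'), pairTerm s x p *
              boltz s (mergePair x p) ((A \ A').erase p.2)))) s := by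
      refine HasDerivAt.fun_sum fun A' hA' => ?_
      have hs := mem_ssubsets.1 (mem_filter.1 hA').1
      exact (ih A' hs).mul (hasDerivAt_boltz x (A \ A') s)
    have h2 := (hasDerivAt_boltz x A s).sub h1
    have hf : (fun s => ursell s x A) = fun s => boltz s x A -
      ∑ A' ∈ A.ssubsets with ⊥ ∈ A', ursell s x A' * boltz s x (A \ A') :=
      funext fun s => ursell_eq s x A
    rw [hf]
    refine h2.congr_deriv ?_
    have h3 : ∀ A' ∈ A.ssubsets.filter (⊥ ∈ ·),
        ((∑ p ∈ pairs A', pairTerm s x p * ursell s (mergePair x p) (A'.erase p.2)) *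
            boltz s x (A \ A') + ursell s x A' *
            (∑ p ∈ pairs (A \ A'), pairTerm s x p * boltz s (mergePair x p) ((A \ A').erase p.2))) =
        ∑ p ∈ pairs A, pairTerm s x p * ((if p.1 ∈ A' ∧ p.2 ∈ A' then
          ursell s (mergePair x p) (A'.erase p.2) * boltz s x (A \ A') else 0) +
        (if p.1 ∈ A \ A' ∧ p.2 ∈ A \ A' then
          ursell s x A' * boltz s (mergePair x p) ((A \ A').erase p.2) else 0)) := by
      intro A' hA'
      have hs := mem_ssubsets.1 (mem_filter.1 hA').1
      rw [pairs_mono hs.subset, pairs_mono (sdiff_subset : A \ A' ⊆ A), sum_filter, sum_filter,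
        sum_mul, mul_sum, ← sum_add_distrib]
      refine sum_congr rfl fun p _ => ?_
      split_ifs <;> ring
    rw [sum_congr rfl h3, sum_comm, ← sum_sub_distrib]
    refine sum_congr rfl fun p hp => ?_
    rw [← mul_sum, sum_ssubsets_mergePair s x hp, ursell_eq s (mergePair x p) (A.erase p.2)]
    ring

/-- Without interaction all Boltzmann factors are `1`, and only the root alone is connected. -/
lemma ursell_zero (x : ι → H) (hA : ⊥ ∈ A) :
    ursell 0 x A = if A = {⊥} then 1 else 0 := by
  induction A using Finset.strongInduction with
  | H A ih =>
    rw [ursell_eq]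
    have hb : ∀ B : Finset ι, boltz 0 x B = 1 := fun B => by simp [boltz]
    simp only [hb, mul_one]
    rw [sum_congr rfl fun B hB => ih B (mem_ssubsets.1 (mem_filter.1 hB).1) (mem_filter.1 hB).2,
      sum_ite_eq']
    by_cases h : A = {⊥}
    · subst h; simp
    · rw [if_pos, if_neg h]
      · ring
      · simp only [mem_filter, mem_ssubsets, mem_singleton, and_true]
        rw [ssubset_iff_subset_ne]
        exact ⟨singleton_subset_iff.2 hA, fun h' => h h'.symm⟩

lemma continuous_pairTerm (x : ι → H) (p : ι × ι) : Continuous fun s => pairTerm s x p := by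
  unfold pairTerm; fun_prop

lemma continuous_ursell_left (x : ι → H) (A : Finset ι) : Continuous fun s => ursell s x A :=
  continuous_iff_continuousAt.2 fun s => (hasDerivAt_ursell x A s).continuousAt

/-- The Ursell functions solve the contraction equation. -/
lemma ursell_integral_eq (x : ι → H) (hA : ⊥ ∈ A) (s : ℝ) :
    ursell s x A = (if A = {⊥} then 1 else 0) + ∫ w in (0 : ℝ)..s,
      ∑ p ∈ pairs A, pairTerm w x p * ursell w (mergePair x p) (A.erase p.2) := by
  rw [intervalIntegral.integral_eq_sub_of_hasDerivAt (fun w _ => hasDerivAt_ursell x A w),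
    ursell_zero x hA]
  · ring
  · refine Continuous.intervalIntegrable ?_ _ _
    exact continuous_finsetSum _ fun p _ =>
      (continuous_pairTerm x p).mul (continuous_ursell_left _ _)

end Ursell

/-! ### Path infima in a tree and positivity of the interpolated covariance -/

section PathInf

open Finset

variable {n : ℕ} {T : SimpleGraph (Fin n)}
  {a : ℝ}

lemma le_foldr_min_one_iff (l : List ℝ) :
    a ≤ l.foldr min 1 ↔ a ≤ 1 ∧ ∀ x ∈ l, a ≤ x := by
  induction l with
  | nil => simp
  | cons b l ih => simp [ih]; tauto

/-- The edges of a graph whose parameter is at least `a`. -/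
def levelGraph (T : SimpleGraph (Fin n)) (w : T.edgeSet → ℝ) (a : ℝ) : SimpleGraph (Fin n) where
  Adj i j := ∃ h : s(i, j) ∈ T.edgeSet, a ≤ w ⟨s(i, j), h⟩
  symm := by
    constructor
    rintro i j ⟨h, ha⟩
    refine ⟨by rwa [Sym2.eq_swap], ?_⟩
    convert ha using 3
    exact Sym2.eq_swap
  loopless := by
    constructor
    rintro i ⟨h, _⟩
    exact T.irrefl ((SimpleGraph.mem_edgeSet _).1 h)

lemma levelGraph_le (T : SimpleGraph (Fin n)) (w : T.edgeSet → ℝ) (a : ℝ) :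
    levelGraph T w a ≤ T := by
  rintro i j ⟨h, _⟩
  exact h

lemma mem_edgeSet_levelGraph {w : T.edgeSet → ℝ}
    {e : Sym2 (Fin n)} : e ∈ (levelGraph T w a).edgeSet ↔ ∃ h : e ∈ T.edgeSet, a ≤ w ⟨e, h⟩ := by
  induction e with
  | _ i j => rfl

lemma pathInf_le_one (T : SimpleGraph (Fin n)) (w : T.edgeSet → ℝ) (i j : Fin n) :
    pathInf T w i j ≤ 1 := by
  unfold pathInf
  split_ifs with h
  · exact ((le_foldr_min_one_iff _).1 le_rfl).1
  · exact zero_le_one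

lemma pathInf_nonneg (T : SimpleGraph (Fin n)) {w : T.edgeSet → ℝ} (hw : ∀ e, 0 ≤ w e)
    (i j : Fin n) : 0 ≤ pathInf T w i j := by
  unfold pathInf
  split_ifs with h
  · rw [le_foldr_min_one_iff]
    refine ⟨zero_le_one, fun x hx => ?_⟩
    obtain ⟨e, _, rfl⟩ := List.mem_map.1 hx
    exact hw _
  · exact le_rfl

/-- A path in the level graph is a path in the tree, hence the only one. This removes the chosen
path from the definition: later properties of `pathInf` on trees are read off from reachability at
each level. -/
lemma le_pathInf_iff (hT : T.IsTree) (w : T.edgeSet → ℝ) (ha : a ≤ 1) (i j : Fin n) :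
    a ≤ pathInf T w i j ↔ (levelGraph T w a).Reachable i j := by
  have h : ∃ p : T.Walk i j, p.IsPath := (hT.existsUnique_path i j).exists
  unfold pathInf
  rw [dif_pos h, le_foldr_min_one_iff]
  constructor
  · rintro ⟨_, hp⟩
    refine ⟨h.choose.transfer _ fun e he => ?_⟩
    refine mem_edgeSet_levelGraph.2 ⟨h.choose.edges_subset_edgeSet he, ?_⟩
    exact hp _ (List.mem_map.2 ⟨⟨e, he⟩, List.mem_attach _ _, rfl⟩)
  · intro hr
    refine ⟨ha, fun x hx => ?_⟩
    obtain ⟨e, _, rfl⟩ := List.mem_map.1 hx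
    obtain ⟨p, hp⟩ := hr.exists_isPath
    have hq := hp.mapLe (levelGraph_le T w a)
    have heq : h.choose = p.mapLe (levelGraph_le T w a) :=
      congrArg Subtype.val ((hT.isAcyclic.subsingleton_path i j).elim ⟨_, h.choose_spec⟩ ⟨_, hq⟩)
    have he : e.1 ∈ p.edges := by
      rw [← SimpleGraph.Walk.edges_mapLe_eq_edges (levelGraph_le T w a)]
      exact heq ▸ e.2
    obtain ⟨_, h2⟩ := mem_edgeSet_levelGraph.1 (p.edges_subset_edgeSet he)
    exact h2

lemma pathInf_congr_of_levels (hT : T.IsTree) {w w' : T.edgeSet → ℝ}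
    {i j i' j' : Fin n} (h : ∀ a ≤ 1, (levelGraph T w a).Reachable i j ↔
      (levelGraph T w' a).Reachable i' j') : pathInf T w i j = pathInf T w' i' j' := by
  refine eq_of_forall_le_iff fun a => ?_
  by_cases ha : a ≤ 1
  · rw [le_pathInf_iff hT _ ha, le_pathInf_iff hT _ ha, h a ha]
  · have h1 := pathInf_le_one T w i j
    have h2 := pathInf_le_one T w' i' j'
    constructor <;> intro h <;> linarith

lemma pathInf_symm (hT : T.IsTree) (w : T.edgeSet → ℝ) (i j : Fin n) :
    pathInf T w i j = pathInf T w j i :=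
  pathInf_congr_of_levels hT fun _ _ => ⟨fun h => h.symm, fun h => h.symm⟩

lemma pathInf_self (hT : T.IsTree) (w : T.edgeSet → ℝ) (i : Fin n) :
    pathInf T w i i = 1 :=
  le_antisymm (pathInf_le_one _ _ _ _)
    ((le_pathInf_iff hT w le_rfl i i).2 (SimpleGraph.Reachable.refl i))

lemma continuous_foldr_min {X α : Type*} [TopologicalSpace X] (l : List α) (f : α → X → ℝ)
    (hf : ∀ a, Continuous (f a)) : Continuous fun x => (l.map fun a => f a x).foldr min 1 := by
  induction l with
  | nil => exact continuous_const
  | cons a l ih => exact (hf a).min ih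

lemma continuous_pathInf (T : SimpleGraph (Fin n)) (i j : Fin n) :
    Continuous fun w : T.edgeSet → ℝ => pathInf T w i j := by
  unfold pathInf
  split_ifs with h
  · exact continuous_foldr_min _ _ fun e => continuous_apply _
  · exact continuous_const

/-- The quadratic form of an equivalence relation is the sum of the squares of the sums over its
classes, here the connected components. -/
lemma sum_reachable_nonneg (G : SimpleGraph (Fin n)) [DecidableRel G.Reachable] (x : Fin n → ℝ) :
    0 ≤ ∑ i, ∑ j, if G.Reachable i j then x i * x j else 0 := by
  classical
  have : ∑ i, ∑ j, (if G.Reachable i j then x i * x j else 0) =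
      ∑ c : G.ConnectedComponent, (∑ i, if G.connectedComponentMk i = c then x i else 0) ^ 2 := by
    simp_rw [sq, sum_mul_sum]
    rw [Finset.sum_comm' (t' := univ) (s' := fun _ => univ) (by simp)]
    rw [Finset.sum_comm]
    conv_rhs => rw [Finset.sum_comm]
    refine sum_congr rfl fun i _ => ?_
    conv_rhs => rw [Finset.sum_comm]
    refine sum_congr rfl fun j _ => ?_
    simp only [ite_mul, mul_ite, zero_mul, mul_zero]
    rw [sum_ite_eq]
    simp only [mem_univ, if_true]
    simp only [SimpleGraph.ConnectedComponent.eq]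
  rw [this]
  exact sum_nonneg fun _ _ => sq_nonneg _

lemma integral_indicator_le {x : ℝ} (h0 : 0 ≤ x) (h1 : x ≤ 1) :
    ∫ a in (0 : ℝ)..1, (if a ≤ x then (1 : ℝ) else 0) = x := by
  have h : (fun a : ℝ => if a ≤ x then (1 : ℝ) else 0) = (Set.Iic x).indicator 1 := by
    ext a; simp [Set.indicator_apply]
  rw [h, intervalIntegral.integral_of_le zero_le_one, integral_indicator_one measurableSet_Iic,
    measureReal_restrict_apply measurableSet_Iic]
  have : Set.Iic x ∩ Set.Ioc 0 1 = Set.Ioc 0 x := by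
    ext a; simp only [Set.mem_inter_iff, Set.mem_Iic, Set.mem_Ioc]
    constructor
    · exact fun h => ⟨h.2.1, h.1⟩
    · exact fun h => ⟨h.2, h.1, h.2.trans h1⟩
  rw [this]; simp [h0]

/-- By the layer-cake formula the matrix is the integral over the level `a ∈ [0, 1]` of the
reachability matrices of the level graphs, each of which is positive. -/
lemma posSemidef_interpolation (hT : T.IsTree) {w : T.edgeSet → ℝ}
    (hw : w ∈ parameterCube T) : (interpolation T w).PosSemidef := by
  classical
  have hw0 : ∀ e, 0 ≤ w e := fun e => hw.1 e
  refine Matrix.PosSemidef.of_dotProduct_mulVec_nonneg ?_ fun x => ?_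
  · ext i j
    simp [interpolation, pathInf_symm hT w i j]
  · have key : ∀ i j, pathInf T w i j * (x i * x j) = ∫ a in (0 : ℝ)..1,
        (if (levelGraph T w a).Reachable i j then x i * x j else 0) := by
      intro i j
      conv_lhs => rw [← integral_indicator_le (pathInf_nonneg T hw0 i j) (pathInf_le_one T w i j),
        ← intervalIntegral.integral_mul_const]
      refine intervalIntegral.integral_congr fun a ha => ?_
      rw [Set.uIcc_of_le zero_le_one] at ha
      have := le_pathInf_iff hT w ha.2 i j
      by_cases h : a ≤ pathInf T w i j
      · simp [h, this.1 h]
      · simp [h, mt this.2 h]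
    have hint : ∀ i j, IntervalIntegrable (fun a =>
        (if (levelGraph T w a).Reachable i j then x i * x j else 0)) volume (0 : ℝ) 1 := by
      intro i j
      have h1 : IntervalIntegrable (fun a : ℝ => if a ≤ pathInf T w i j then x i * x j else 0)
          volume 0 1 := by
        rw [intervalIntegrable_iff_integrableOn_Ioc_of_le zero_le_one]
        refine Measure.integrableOn_of_bounded (M := |x i * x j|) (by simp) ?_ ?_
        · exact (Measurable.ite measurableSet_Iic measurable_const
            measurable_const).aestronglyMeasurable
        · refine .of_forall fun a => ?_
          split_ifs
          · exact le_rfl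
          · rw [norm_zero]; exact abs_nonneg _
      refine h1.congr_uIoo ?_
      intro a ha
      rw [Set.uIoo_of_le zero_le_one] at ha
      simp only [le_pathInf_iff hT w ha.2.le i j]
    have : star x ⬝ᵥ (interpolation T w).mulVec x = ∫ a in (0 : ℝ)..1,
        ∑ i, ∑ j, (if (levelGraph T w a).Reachable i j then x i * x j else 0) := by
      rw [intervalIntegral.integral_finsetSum]
      · simp only [dotProduct, Matrix.mulVec, interpolation, Matrix.of_apply, star_trivial]
        refine sum_congr rfl fun i _ => ?_
        rw [intervalIntegral.integral_finsetSum fun j _ => hint i j, mul_sum]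
        refine sum_congr rfl fun j _ => ?_
        rw [← key]; ring
      · intro i _
        have := IntervalIntegrable.sum univ fun j _ => hint i j
        refine this.congr ?_
        intro a _
        simp
    rw [this]
    exact intervalIntegral.integral_nonneg zero_le_one fun a _ => sum_reachable_nonneg _ _

end PathInf

/-! ### Splitting an integral over a cube by the largest coordinate -/

section Argmax

open Finset

variable {κ : Type*} [Fintype κ] [DecidableEq κ]

/-- The uniform distribution on a cube. -/
def uniformCube (κ : Type*) [Fintype κ] : Measure (κ → ℝ) :=
  Measure.pi fun _ => volume.restrict (Set.Icc (0 : ℝ) 1)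

instance : IsProbabilityMeasure (volume.restrict (Set.Icc (0 : ℝ) 1)) := ⟨by simp⟩

instance : IsProbabilityMeasure (uniformCube κ) := by unfold uniformCube; infer_instance

/-- Resampling one coordinate keeps the uniform law. It is used to separate the value of the largest
coordinate from the others, without changing the index set. -/
lemma measurePreserving_update (e : κ) :
    MeasurePreserving (fun aw : ℝ × (κ → ℝ) => Function.update aw.2 e aw.1)
      ((volume.restrict (Set.Icc (0 : ℝ) 1)).prod (uniformCube κ)) (uniformCube κ) := by
  have hm : Measurable (fun aw : ℝ × (κ → ℝ) => Function.update aw.2 e aw.1) := by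
    rw [measurable_pi_iff]
    intro i
    by_cases h : i = e
    · subst h; simpa using measurable_fst
    · simp only [Function.update_of_ne h]; fun_prop
  refine ⟨hm, ?_⟩
  symm
  refine Measure.pi_eq fun s hs => ?_
  rw [Measure.map_apply hm (MeasurableSet.univ_pi hs)]
  have : (fun aw : ℝ × (κ → ℝ) => Function.update aw.2 e aw.1) ⁻¹' (Set.univ.pi s) =
      s e ×ˢ (Set.univ.pi (Function.update s e Set.univ)) := by
    ext ⟨a, w⟩
    simp only [Set.mem_preimage, Set.mem_pi, Set.mem_univ, true_imp_iff, Set.mem_prod]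
    constructor
    · intro h
      refine ⟨by simpa using h e, fun i => ?_⟩
      by_cases hi : i = e
      · subst hi; simp
      · simpa [Function.update_of_ne hi] using h i
    · rintro ⟨h1, h2⟩ i
      by_cases hi : i = e
      · subst hi; simpa using h1
      · simpa [Function.update_of_ne hi] using h2 i
  rw [this, Measure.prod_prod, uniformCube, Measure.pi_pi, ← mul_prod_erase _ _ (mem_univ e),
    ← mul_prod_erase univ (fun i => (volume.restrict (Set.Icc (0 : ℝ) 1)) (s i))
      (mem_univ e)]
  simp only [Function.update_self, measure_univ, one_mul]
  congr 1
  refine prod_congr rfl fun i hi => ?_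
  rw [Function.update_of_ne (ne_of_mem_erase hi)]

lemma ae_uniformCube_ne {e e' : κ} (h : e ≠ e') : ∀ᵐ w ∂(uniformCube κ), w e ≠ w e' := by
  have hs : MeasurableSet {w : κ → ℝ | w e = w e'} :=
    measurableSet_eq_fun (measurable_pi_apply e) (measurable_pi_apply e')
  have mp := measurePreserving_update e
  have : uniformCube κ {w : κ → ℝ | w e = w e'} = 0 := by
    rw [← mp.measure_preimage hs.nullMeasurableSet]
    rw [Measure.measure_prod_null (mp.measurable hs), ]
    rw [← Measure.measure_prod_null (mp.measurable hs), Measure.prod_apply_symm (mp.measurable hs),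
      lintegral_eq_zero_iff (measurable_measure_prodMk_right (mp.measurable hs))]
    refine .of_forall fun w => ?_
    have : (fun a => (a, w)) ⁻¹' ((fun aw : ℝ × (κ → ℝ) => Function.update aw.2 e aw.1) ⁻¹'
        {w | w e = w e'}) ⊆ {w e'} := by
      intro a ha
      simpa [Function.update_of_ne h.symm] using ha
    exact measure_mono_null this (by simp)
  rw [ae_iff]
  simpa using this

lemma ae_uniformCube_mem : ∀ᵐ w ∂(uniformCube κ), ∀ e, w e ∈ Set.Icc (0 : ℝ) 1 := by
  rw [ae_all_iff]
  intro e
  have : ∀ᵐ a ∂(volume.restrict (Set.Icc (0 : ℝ) 1)), a ∈ Set.Icc (0 : ℝ) 1 :=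
    ae_restrict_mem measurableSet_Icc
  exact (measurePreserving_eval (fun _ : κ => volume.restrict (Set.Icc (0 : ℝ) 1)) e).quasiMeasurePreserving.ae this

/-- Decomposition of an integral over a cube according to the coordinate with the largest value. -/
lemma integral_lt_eq_sum_argmax (E : Finset κ) (hE : E.Nonempty) {s : ℝ} (hs0 : 0 ≤ s)
    (hs1 : s ≤ 1) (h : (κ → ℝ) → ℝ) (hm : Measurable h) (C : ℝ)
    (hC : ∀ w, (∀ e, w e ∈ Set.Icc (0 : ℝ) 1) → |h w| ≤ C) :
    ∫ w, (if ∀ e ∈ E, w e < s then h w else 0) ∂(uniformCube κ) =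
      ∑ e ∈ E, ∫ a in (0 : ℝ)..s, ∫ w,
        (if ∀ e' ∈ E.erase e, w e' < a then h (Function.update w e a) else 0) ∂(uniformCube κ) := by
  classical
  have hmeas : ∀ (E' : Finset κ) (b : (κ → ℝ) → ℝ), Measurable b →
      MeasurableSet {w : κ → ℝ | ∀ e ∈ E', w e < b w} := by
    intro E' b hb
    have : {w : κ → ℝ | ∀ e ∈ E', w e < b w} = ⋂ e ∈ E', {w | w e < b w} := by
      ext; simp
    rw [this]
    exact Finset.measurableSet_biInter _ fun e _ => measurableSet_lt (measurable_pi_apply e) hb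
  -- The part of the integrand on which `e` is the strict maximum among the coordinates in `E`; up
  -- to the null set of ties these parts add up to the whole.
  set g : κ → (κ → ℝ) → ℝ := fun e w =>
    if w e < s ∧ ∀ e' ∈ E.erase e, w e' < w e then h w else 0 with hg
  have hgm : ∀ e, Measurable (g e) := by
    intro e
    refine Measurable.ite ?_ hm measurable_const
    exact (measurableSet_lt (measurable_pi_apply e) measurable_const).inter
      (hmeas _ _ (measurable_pi_apply e))
  have hgi : ∀ e, Integrable (g e) (uniformCube κ) := by
    intro e
    refine Integrable.of_bound (hgm e).aestronglyMeasurable (max C 0) ?_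
    filter_upwards [ae_uniformCube_mem] with w hw
    simp only [hg]
    split_ifs
    · exact (hC w hw).trans (le_max_left _ _)
    · simp
  have hsum : ∀ᵐ w ∂(uniformCube κ), (if ∀ e ∈ E, w e < s then h w else 0) = ∑ e ∈ E, g e w := by
    have hne : ∀ᵐ w ∂(uniformCube κ), ∀ e e', e ≠ e' → w e ≠ w e' := by
      rw [ae_all_iff]; intro e; rw [ae_all_iff]; intro e'
      by_cases h : e = e'
      · simp [h]
      · filter_upwards [ae_uniformCube_ne h] with w hw _ using hw
    filter_upwards [hne] with w hw
    obtain ⟨e0, he0, hmax⟩ := E.exists_max_image w hE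
    have hlt : ∀ e' ∈ E.erase e0, w e' < w e0 := fun e' he' =>
      lt_of_le_of_ne (hmax e' (mem_of_mem_erase he')) (hw _ _ (ne_of_mem_erase he'))
    rw [sum_eq_single e0]
    · simp only [hg]
      congr 1
      rw [eq_iff_iff]
      constructor
      · exact fun h => ⟨h e0 he0, hlt⟩
      · exact fun h e he => (hmax e he).trans_lt h.1
    · intro e he hne
      simp only [hg]
      rw [if_neg]
      rintro ⟨_, h2⟩
      exact absurd (h2 e0 (mem_erase.2 ⟨hne.symm, he0⟩)) (not_lt.2 (hmax e he))
    · exact fun h => absurd he0 h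
  rw [integral_congr_ae hsum, integral_finsetSum _ fun e _ => hgi e]
  refine sum_congr rfl fun e he => ?_
  have mp := measurePreserving_update e
  have hi : Integrable (fun aw : ℝ × (κ → ℝ) => g e (Function.update aw.2 e aw.1))
      ((volume.restrict (Set.Icc (0 : ℝ) 1)).prod (uniformCube κ)) :=
    mp.integrable_comp_of_integrable (hgi e)
  have h0 : ∫ w, g e w ∂(uniformCube κ) = ∫ a, ∫ w, g e (Function.update w e a) ∂(uniformCube κ)
      ∂(volume.restrict (Set.Icc (0 : ℝ) 1)) := by
    rw [← integral_prod _ hi]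
    conv_lhs => rw [← mp.map_eq]
    exact integral_map mp.measurable.aemeasurable (by
      rw [mp.map_eq]; exact (hgm e).aestronglyMeasurable)
  rw [h0, intervalIntegral.integral_of_le hs0, integral_Icc_eq_integral_Ioc,
    ← Set.inter_eq_self_of_subset_right (Set.Ioc_subset_Ioc_right hs1 :
      Set.Ioc (0 : ℝ) s ⊆ Set.Ioc 0 1), ← setIntegral_indicator measurableSet_Ioc]
  have h1 : ∀ᵐ a ∂(volume.restrict (Set.Ioc (0 : ℝ) 1)), a ∈ Set.Ioc (0 : ℝ) 1 ∧ a ≠ s := by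
    refine (ae_restrict_mem measurableSet_Ioc).and (ae_restrict_of_ae ?_)
    rw [ae_iff]; simp
  refine integral_congr_ae ?_
  filter_upwards [h1] with a ha
  have hup : ∀ w : κ → ℝ, (∀ e' ∈ E.erase e, Function.update w e a e' < a) ↔
      ∀ e' ∈ E.erase e, w e' < a := by
    intro w
    refine forall₂_congr fun e' he' => ?_
    rw [Function.update_of_ne (ne_of_mem_erase he')]
  by_cases has : a < s
  · rw [Set.indicator_of_mem (show a ∈ Set.Ioc 0 s from ⟨ha.1.1, has.le⟩)]
    refine integral_congr_ae (.of_forall fun w => ?_)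
    simp only [hg, Function.update_self, has, true_and, hup]
  · rw [Set.indicator_of_notMem]
    · simp [hg, has]
    · exact fun h => ha.2 (le_antisymm h.2 (not_lt.1 has))

end Argmax

/-! ### Components of a forest, and the effect of adding an edge -/

section ForestFlow

open Finset
open scoped Classical
open SimpleGraph (edge edge_adj edge_le_iff edgeSet_sup edgeSet_edge_of_ne mem_edgeSet Reachable.refl)

variable {H : Type*} [NormedAddCommGroup H] [InnerProductSpace ℝ H] {n : ℕ} [NeZero n] (x : Fin n → H)
  {F T : SimpleGraph (Fin n)} {k l u v : Fin n}
  {a : ℝ}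

/-- The inner product of the vectors at the two ends of an edge. -/
def edgeInner {n : ℕ} (x : Fin n → H) (e : Sym2 (Fin n)) : ℝ :=
  Sym2.lift ⟨fun a b => inner ℝ (x a) (x b), fun _ _ => real_inner_comm _ _⟩ e

@[simp] lemma edgeInner_mk {n : ℕ} (x : Fin n → H) (a b : Fin n) :
    edgeInner x s(a, b) = inner ℝ (x a) (x b) := rfl

/-- The least vertex of the component of a vertex. -/
def compRep (F : SimpleGraph (Fin n)) (v : Fin n) : Fin n :=
  (univ.filter (F.Reachable v)).min' ⟨v, by simp⟩

lemma reachable_compRep (F : SimpleGraph (Fin n)) (v : Fin n) :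
    F.Reachable v (compRep F v) :=
  (mem_filter.1 (min'_mem (univ.filter (F.Reachable v)) _)).2

lemma compRep_le (h : F.Reachable v u) :
    compRep F v ≤ u :=
  min'_le _ _ (by simpa using h)

lemma compRep_eq {v m : Fin n} (h : F.Reachable v m)
    (hm : ∀ u, F.Reachable v u → m ≤ u) : compRep F v = m :=
  le_antisymm (compRep_le h) (hm _ (reachable_compRep F v))

lemma compRep_eq_iff :
    compRep F u = compRep F v ↔ F.Reachable u v := by
  constructor
  · intro h
    exact (reachable_compRep F u).trans (h ▸ (reachable_compRep F v).symm)
  · intro h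
    exact compRep_eq (h.trans (reachable_compRep F v)) fun w hw => compRep_le (h.symm.trans hw)

lemma compRep_compRep (F : SimpleGraph (Fin n)) (v : Fin n) :
    compRep F (compRep F v) = compRep F v :=
  compRep_eq_iff.2 (reachable_compRep F v).symm

/-- The least vertices of the components. -/
def compReps (F : SimpleGraph (Fin n)) : Finset (Fin n) := univ.image (compRep F)

lemma mem_compReps :
    v ∈ compReps F ↔ compRep F v = v := by
  simp only [compReps, mem_image, mem_univ, true_and]
  constructor
  · rintro ⟨u, rfl⟩; exact compRep_compRep F u
  · exact fun h => ⟨v, h⟩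

lemma bot_mem_compReps (F : SimpleGraph (Fin n)) : ⊥ ∈ compReps F :=
  mem_compReps.2 (le_antisymm (compRep_le (Reachable.refl _)) bot_le)

/-- The sum of the vectors in the component represented by a vertex. -/
def compSum (F : SimpleGraph (Fin n)) (v : Fin n) : H :=
  ∑ u with compRep F u = v, x u

lemma reachable_sup_edge {V : Type*} {F : SimpleGraph V} {k l : V}
    (h : ¬ F.Reachable k l) (u v : V) : (F ⊔ edge k l).Reachable u v ↔
      F.Reachable u v ∨ (F.Reachable u k ∧ F.Reachable l v) ∨
        (F.Reachable u l ∧ F.Reachable k v) := by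
  have hkl : (F ⊔ edge k l).Adj k l := by
    right
    rw [edge_adj]
    exact ⟨Or.inl ⟨rfl, rfl⟩, fun e => h (e ▸ Reachable.refl _)⟩
  constructor
  · rintro ⟨p⟩
    induction p with
    | nil => exact Or.inl (Reachable.refl _)
    | cons hadj p ih =>
      rcases hadj with hadj | hadj
      · have := hadj.reachable
        rcases ih with ih | ⟨i1, i2⟩ | ⟨i1, i2⟩
        · exact Or.inl (this.trans ih)
        · exact Or.inr (Or.inl ⟨this.trans i1, i2⟩)
        · exact Or.inr (Or.inr ⟨this.trans i1, i2⟩)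
      · rw [edge_adj] at hadj
        rcases hadj.1 with ⟨rfl, rfl⟩ | ⟨rfl, rfl⟩
        · rcases ih with ih | ⟨i1, i2⟩ | ⟨i1, i2⟩
          · exact Or.inr (Or.inl ⟨Reachable.refl _, ih⟩)
          · exact absurd i1.symm h
          · exact Or.inl i2
        · rcases ih with ih | ⟨i1, i2⟩ | ⟨i1, i2⟩
          · exact Or.inr (Or.inr ⟨Reachable.refl _, ih⟩)
          · exact Or.inl i2
          · exact absurd i1 h
  · have hm : ∀ {a b}, F.Reachable a b → (F ⊔ edge k l).Reachable a b :=
      fun hab => hab.mono le_sup_left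
    rintro (h1 | ⟨h1, h2⟩ | ⟨h1, h2⟩)
    · exact hm h1
    · exact (hm h1).trans (hkl.reachable.trans (hm h2))
    · exact (hm h1).trans (hkl.symm.reachable.trans (hm h2))

/-- The joined component keeps the smaller representative, just as `mergePair` keeps the smaller
label. This is what makes adding an edge to a forest correspond to a contraction. -/
lemma compRep_sup_edge (h : compRep F k < compRep F l) (v : Fin n) :
    compRep (F ⊔ edge k l) v =
      if compRep F v = compRep F l then compRep F k else compRep F v := by
  have hkl : ¬ F.Reachable k l := fun h' => h.ne (compRep_eq_iff.2 h')
  split_ifs with hv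
  · have hv' := compRep_eq_iff.1 hv
    refine compRep_eq ?_ fun u hu => ?_
    · rw [reachable_sup_edge hkl]
      exact Or.inr (Or.inr ⟨hv', reachable_compRep F k⟩)
    · rw [reachable_sup_edge hkl] at hu
      rcases hu with hu | ⟨h1, h2⟩ | ⟨h1, h2⟩
      · exact h.le.trans (compRep_le (hv'.symm.trans hu))
      · exact absurd (h1.symm.trans hv') hkl
      · exact compRep_le h2
  · refine compRep_eq ?_ fun u hu => ?_
    · rw [reachable_sup_edge hkl]
      exact Or.inl (reachable_compRep F v)
    · rw [reachable_sup_edge hkl] at hu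
      rcases hu with hu | ⟨h1, h2⟩ | ⟨h1, h2⟩
      · exact compRep_le hu
      · rw [compRep_eq_iff.2 h1]
        exact h.le.trans (compRep_le h2)
      · exact absurd (compRep_eq_iff.2 h1) hv

lemma compReps_sup_edge (h : compRep F k < compRep F l) :
    compReps (F ⊔ edge k l) = (compReps F).erase (compRep F l) := by
  ext v
  rw [mem_erase, mem_compReps, mem_compReps, compRep_sup_edge h]
  split_ifs with hv
  · constructor
    · intro h'
      rw [← h', compRep_compRep] at hv
      exact absurd hv h.ne
    · rintro ⟨h1, h2⟩
      exact absurd (h2.symm.trans hv) h1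
  · constructor
    · intro h'
      exact ⟨fun h1 => hv (h'.trans h1), h'⟩
    · exact fun h' => h'.2

lemma compSum_sup_edge (h : compRep F k < compRep F l) (hv : v ∈ (compReps F).erase (compRep F l)) :
    compSum x (F ⊔ edge k l) v =
      mergePair (compSum x F) (compRep F k, compRep F l) v := by
  obtain ⟨hv1, hv2⟩ := mem_erase.1 hv
  unfold compSum mergePair
  simp only [compRep_sup_edge h]
  by_cases hk : v = compRep F k
  · subst hk
    rw [Function.update_self, ← sum_union]
    · refine sum_congr ?_ fun _ _ => rfl
      ext u
      simp only [mem_filter, mem_univ, true_and, mem_union]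
      split_ifs with hu
      · simp [hu]
      · simp [hu]
    · rw [disjoint_filter]
      intro u _ h1 h2
      exact h.ne (h1.symm.trans h2)
  · rw [Function.update_of_ne hk]
    refine sum_congr ?_ fun _ _ => rfl
    ext u
    simp only [mem_filter, mem_univ, true_and]
    split_ifs with hu
    · constructor
      · exact fun h' => absurd h'.symm hk
      · exact fun h' => absurd (h'.symm.trans hu) hv1
    · rfl

/-- A sum over the unordered pairs that a map separates is a sum over the ordered pairs that it
maps to an increasing pair. -/
lemma sum_sym2_map_not_isDiag {V V' M : Type*} [Fintype V] [LinearOrder V'] [AddCommMonoid M]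
    (c : V → V') (g : Sym2 V → M) :
    ∑ e : Sym2 V with ¬ (e.map c).IsDiag, g e =
      ∑ p : V × V with c p.1 < c p.2, g s(p.1, p.2) := by
  symm
  refine sum_bij (fun p _ => s(p.1, p.2)) ?_ ?_ ?_ ?_
  · intro p hp
    simp only [mem_filter, mem_univ, true_and] at hp ⊢
    simp [hp.ne]
  · intro p hp q hq h
    simp only [mem_filter, mem_univ, true_and] at hp hq
    rcases Sym2.eq_iff.1 h with h | h
    · exact Prod.ext h.1 h.2
    · exact absurd (h.1 ▸ h.2 ▸ hp) hq.not_gt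
  · intro e he
    induction e with
    | _ u v =>
      simp only [mem_filter, mem_univ, true_and, Sym2.map_mk, Sym2.mk_isDiag_iff] at he
      rcases lt_or_gt_of_ne he with h | h
      · exact ⟨(u, v), by simpa using h, rfl⟩
      · exact ⟨(v, u), by simpa using h, Sym2.eq_swap⟩
  · intro _ _; rfl

/-- The parameters of the edges of a tree, with those of a subforest set to `1`. -/
def forestWeight (F T : SimpleGraph (Fin n)) (w : Sym2 (Fin n) → ℝ) :
    T.edgeSet → ℝ := fun e => if e.1 ∈ F.edgeSet then 1 else w e.1

/-- The interpolated interaction energy of the components of a forest. -/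
def crossEnergy (F T : SimpleGraph (Fin n)) (w : Sym2 (Fin n) → ℝ) : ℝ :=
  ∑ p ∈ pairs univ with ¬ F.Reachable p.1 p.2,
    pathInf T (forestWeight F T w) p.1 p.2 * inner ℝ (x p.1) (x p.2)

/-- The pairs joined by the new edge have one vertex in each of the two components, so by
bilinearity their inner products add up to that of the component sums. -/
lemma sum_pairs_joined (h : compRep F k < compRep F l) :
    ∑ p ∈ pairs univ with ¬ F.Reachable p.1 p.2 ∧ (F ⊔ edge k l).Reachable p.1 p.2,
      (inner ℝ (x p.1) (x p.2) : ℝ) =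
    inner ℝ (compSum x F (compRep F k)) (compSum x F (compRep F l)) := by
  have hkl : ¬ F.Reachable k l := fun h' => h.ne (compRep_eq_iff.2 h')
  have hj : ∀ p : Fin n × Fin n,
      (¬ F.Reachable p.1 p.2 ∧ (F ⊔ edge k l).Reachable p.1 p.2) ↔
        (s(p.1, p.2)).map (compRep F) = s(compRep F k, compRep F l) := by
    intro p
    rw [reachable_sup_edge hkl, Sym2.map_mk, Sym2.eq_iff, compRep_eq_iff, compRep_eq_iff,
      compRep_eq_iff, compRep_eq_iff]
    constructor
    · rintro ⟨h1, h2 | h2 | h2⟩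
      · exact absurd h2 h1
      · exact Or.inl ⟨h2.1, h2.2.symm⟩
      · exact Or.inr ⟨h2.1, h2.2.symm⟩
    · rintro (⟨h1, h2⟩ | ⟨h1, h2⟩)
      · exact ⟨fun h' => hkl (h1.symm.trans (h'.trans h2)), Or.inr (Or.inl ⟨h1, h2.symm⟩)⟩
      · exact ⟨fun h' => hkl (h2.symm.trans (h'.symm.trans h1)), Or.inr (Or.inr ⟨h1, h2.symm⟩)⟩
  simp only [hj]
  have e1 : (pairs univ : Finset (Fin n × Fin n)) =
      univ.filter fun p => id p.1 < id p.2 := by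
    ext p; simp [mem_pairs]
  rw [e1, sum_filter]
  have e2 := sum_sym2_map_not_isDiag (V := Fin n) id (fun e =>
    if e.map (compRep F) = s(compRep F k, compRep F l) then edgeInner x e else 0)
  have e3 := sum_sym2_map_not_isDiag (V := Fin n) (compRep F) (fun e =>
    if e.map (compRep F) = s(compRep F k, compRep F l) then edgeInner x e else 0)
  simp only [edgeInner_mk] at e2 e3
  rw [← e2]
  have e4 : ∑ e : Sym2 (Fin n) with ¬ (e.map id).IsDiag,
      (if e.map (compRep F) = s(compRep F k, compRep F l) then edgeInner x e else 0) =
      ∑ e : Sym2 (Fin n) with ¬ (e.map (compRep F)).IsDiag,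
      (if e.map (compRep F) = s(compRep F k, compRep F l) then edgeInner x e else 0) := by
    rw [sum_filter, sum_filter]
    refine sum_congr rfl fun e _ => ?_
    by_cases he : e.map (compRep F) = s(compRep F k, compRep F l)
    · have h1 : ¬ (e.map (compRep F)).IsDiag := by rw [he]; simpa using h.ne
      have h2 : ¬ (e.map id).IsDiag := by
        intro h2
        apply h1
        rw [Sym2.map_id] at h2
        induction e with
        | _ u v =>
          simp only [id, Sym2.mk_isDiag_iff] at h2
          simp [h2]
      rw [if_pos h1, if_pos h2]
    · simp [he]
  rw [e4, e3, ← sum_filter, filter_filter]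
  unfold compSum
  rw [sum_inner]
  simp only [inner_sum]
  rw [← sum_product']
  refine sum_congr ?_ fun _ _ => rfl
  ext p
  simp only [mem_filter, mem_univ, true_and, mem_product, Sym2.map_mk, Sym2.eq_iff]
  constructor
  · rintro ⟨h1, h2 | h2⟩
    · exact h2
    · rw [h2.1, h2.2] at h1
      exact absurd h1 h.not_gt
  · intro h'
    exact ⟨by rw [h'.1, h'.2]; exact h, Or.inl h'⟩

lemma reachable_levelGraph_of_le (hFT : F ≤ T) {w : Sym2 (Fin n) → ℝ} (ha : a ≤ 1) :
    F ≤ levelGraph T (forestWeight F T w) a := by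
  intro u v huv
  refine ⟨hFT huv, ?_⟩
  have : s(u, v) ∈ F.edgeSet := huv
  simpa [forestWeight, this] using ha

/-- The new edge carries the value `a`, which exceeds every other remaining parameter. The path
between two vertices that it joins runs through it and otherwise through edges of `F` with weight
`1`, so its infimum is `a`. The path between vertices that stay separated contains an edge with a
smaller parameter, so its infimum does not notice whether the new edge weighs `a` or `1`. -/
lemma crossEnergy_update (hT : T.IsTree)
    (hFT : F ≤ T) (hkl : compRep F k < compRep F l) (hadj : T.Adj k l)
    (ha : a ≤ 1) {w : Sym2 (Fin n) → ℝ}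
    (hw : ∀ e ∈ T.edgeSet, e ∉ F.edgeSet → e ≠ s(k, l) → w e < a) :
    crossEnergy x F T (Function.update w s(k, l) a) =
      a * inner ℝ (compSum x F (compRep F k)) (compSum x F (compRep F l)) +
        crossEnergy x (F ⊔ edge k l) T w := by
  have hkl' : ¬ F.Reachable k l := fun h' => hkl.ne (compRep_eq_iff.2 h')
  have hj := sum_pairs_joined x hkl
  obtain ⟨F', hF'⟩ : ∃ F', F' = F ⊔ edge k l := ⟨_, rfl⟩
  have hj' : ∑ p ∈ pairs univ with ¬ F.Reachable p.1 p.2 ∧ F'.Reachable p.1 p.2,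
      (inner ℝ (x p.1) (x p.2) : ℝ) =
      inner ℝ (compSum x F (compRep F k)) (compSum x F (compRep F l)) := by
    rw [← hj]
    refine sum_congr ?_ fun _ _ => rfl
    ext p; simp only [mem_filter, hF']
  rw [← hF']
  have hkF : s(k, l) ∉ F.edgeSet := fun h => hkl' (SimpleGraph.Adj.reachable h)
  have hF'T : F' ≤ T := hF' ▸ sup_le hFT (by
    rw [edge_le_iff]; exact Or.inr hadj)
  have hmem : ∀ e, e ∈ F'.edgeSet ↔ e ∈ F.edgeSet ∨ e = s(k, l) := by
    intro e
    rw [hF', edgeSet_sup, edgeSet_edge_of_ne hadj.ne]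
    simp [or_comm]
  set W := forestWeight F T (Function.update w s(k, l) a)
  set W' := forestWeight F' T w
  have hWF : ∀ e : T.edgeSet, e.1 ∈ F.edgeSet → W e = 1 := fun e he => by
    simp [W, forestWeight, he]
  have hWk : ∀ e : T.edgeSet, e.1 = s(k, l) → W e = a := fun e he => by
    simp [W, forestWeight, he, hkF]
  have hWo : ∀ e : T.edgeSet, e.1 ∉ F.edgeSet → e.1 ≠ s(k, l) → W e = w e.1 := fun e he he' => by
    simp [W, forestWeight, he, he']
  have hW'F : ∀ e : T.edgeSet, e.1 ∈ F'.edgeSet → W' e = 1 := fun e he => by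
    simp [W', forestWeight, he]
  have hW'o : ∀ e : T.edgeSet, e.1 ∉ F'.edgeSet → W' e = w e.1 := fun e he => by
    simp [W', forestWeight, he]
  -- Up to level `a` the new edge is present in both weightings. Above `a`, only edges of `F`,
  -- respectively of `F'`, survive.
  have low : ∀ b ≤ a, levelGraph T W b = levelGraph T W' b := by
    intro b hb
    ext u v
    refine exists_congr fun h => ?_
    by_cases h1 : s(u, v) ∈ F.edgeSet
    · rw [hWF _ h1, hW'F _ ((hmem _).2 (Or.inl h1))]
    · by_cases h2 : s(u, v) = s(k, l)
      · rw [hWk _ h2, hW'F _ ((hmem _).2 (Or.inr h2))]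
        exact ⟨fun _ => hb.trans ha, fun _ => hb⟩
      · rw [hWo _ h1 h2, hW'o _ (fun h => by rcases (hmem _).1 h with h | h <;> tauto)]
  have high : ∀ b, a < b → levelGraph T W b ≤ F := by
    intro b hb u v ⟨h, hle⟩
    by_contra h1'
    have h1 : s(u, v) ∉ F.edgeSet := h1'
    by_cases h2 : s(u, v) = s(k, l)
    · rw [hWk _ h2] at hle; linarith
    · rw [hWo _ h1 h2] at hle
      have := hw _ h h1 h2
      simp only at hle
      linarith
  have high' : ∀ b, a < b → levelGraph T W' b ≤ F' := by
    intro b hb u v ⟨h, hle⟩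
    by_contra h1
    have h1' : s(u, v) ∉ F'.edgeSet := h1
    rw [hW'o _ h1'] at hle
    have := hw _ h (fun h' => h1' ((hmem _).2 (Or.inl h'))) (fun h' => h1' ((hmem _).2 (Or.inr h')))
    simp only at hle
    linarith
  have hF'low : ∀ b ≤ a, F' ≤ levelGraph T W b := by
    intro b hb
    rw [low b hb]
    exact reachable_levelGraph_of_le hF'T (hb.trans ha)
  unfold crossEnergy
  rw [← sum_filter_add_sum_filter_not _ (fun p => F'.Reachable p.1 p.2), filter_filter,
    filter_filter, ← hj', mul_sum]
  congr 1
  · refine sum_congr rfl fun p hp => ?_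
    obtain ⟨_, h1, h2⟩ := mem_filter.1 hp
    congr 1
    refine eq_of_forall_le_iff fun b => ?_
    by_cases hb1 : b ≤ 1
    · rw [le_pathInf_iff hT _ hb1]
      constructor
      · intro hr
        by_contra hb
        exact h1 (hr.mono (high b (not_le.1 hb)))
      · exact fun hb => h2.mono (hF'low b hb)
    · have := pathInf_le_one T W p.1 p.2
      constructor <;> intro h <;> linarith
  · refine sum_congr ?_ fun p hp => ?_
    · refine filter_congr fun p _ => ?_
      constructor
      · exact fun h => h.2
      · exact fun h => ⟨fun h' => h (h'.mono (hF' ▸ le_sup_left)), h⟩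
    · have h2 := (mem_filter.1 hp).2
      have h1 : ¬ F.Reachable p.1 p.2 := fun h' => h2 (h'.mono (hF' ▸ le_sup_left))
      congr 1
      refine pathInf_congr_of_levels hT fun b _ => ?_
      by_cases hb : b ≤ a
      · rw [low b hb]
      · constructor
        · exact fun h => absurd (h.mono (high b (not_le.1 hb))) h1
        · exact fun h => absurd (h.mono (high' b (not_le.1 hb))) h2

end ForestFlow

/-! ### The flow of the sum over trees solves the contraction equation -/

section TreeFlow

open Finset
open scoped Classical
open SimpleGraph (edge edge_adj edge_le_iff edgeSet_sup edgeSet_edge_of_ne mem_edgeSet Reachable.refl)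

variable {H : Type*} [NormedAddCommGroup H] [InnerProductSpace ℝ H] {n : ℕ} [NeZero n] (x : Fin n → H)
  {F T : SimpleGraph (Fin n)} {k l u v : Fin n}
  {s : ℝ}

lemma continuous_crossEnergy (F T : SimpleGraph (Fin n)) :
    Continuous (crossEnergy x F T) := by
  unfold crossEnergy
  refine continuous_finsetSum _ fun p _ => Continuous.mul ?_ continuous_const
  refine (continuous_pathInf T p.1 p.2).comp ?_
  refine continuous_pi fun e => ?_
  unfold forestWeight
  split_ifs
  · exact continuous_const
  · exact continuous_apply _

lemma abs_crossEnergy_le (F T : SimpleGraph (Fin n))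
    {w : Sym2 (Fin n) → ℝ} (hw : ∀ e, w e ∈ Set.Icc (0 : ℝ) 1) :
    |crossEnergy x F T w| ≤ ∑ p ∈ pairs univ, |inner ℝ (x p.1) (x p.2)| := by
  unfold crossEnergy
  refine (abs_sum_le_sum_abs _ _).trans ?_
  refine (sum_le_sum fun p _ => ?_).trans
    (sum_le_sum_of_subset_of_nonneg (filter_subset _ _) fun _ _ _ => abs_nonneg _)
  rw [abs_mul]
  refine mul_le_of_le_one_left (abs_nonneg _) ?_
  rw [abs_le]
  refine ⟨?_, pathInf_le_one _ _ _ _⟩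
  have : 0 ≤ pathInf T (forestWeight F T w) p.1 p.2 := by
    refine pathInf_nonneg T (fun e => ?_) _ _
    unfold forestWeight
    split_ifs
    · exact zero_le_one
    · exact (hw _).1
  linarith

/-- The edges of a graph that do not belong to a subgraph. -/
def remEdges (T F : SimpleGraph (Fin n)) : Finset (Sym2 (Fin n)) :=
  univ.filter fun e => e ∈ T.edgeSet ∧ e ∉ F.edgeSet

lemma mem_remEdges {e : Sym2 (Fin n)} : e ∈ remEdges T F ↔ e ∈ T.edgeSet ∧ e ∉ F.edgeSet := by
  simp [remEdges]

/-- The pairs of vertices in distinct components of a graph. -/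
def crossPairs (F : SimpleGraph (Fin n)) : Finset (Fin n × Fin n) :=
  univ.filter fun p => compRep F p.1 < compRep F p.2

/-- The Boltzmann factor of the coupling of the components of two vertices. -/
def couple (F : SimpleGraph (Fin n)) (p : Fin n × Fin n) (a : ℝ) : ℝ :=
  exp (-(a * inner ℝ (compSum x F (compRep F p.1)) (compSum x F (compRep F p.2))))

lemma not_reachable_of_mem_crossPairs {p : Fin n × Fin n} (hp : p ∈ crossPairs F) :
    ¬ F.Reachable p.1 p.2 :=
  fun h => (mem_filter.1 hp).2.ne (compRep_eq_iff.2 h)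

lemma ne_of_mem_crossPairs {p : Fin n × Fin n} (hp : p ∈ crossPairs F) : p.1 ≠ p.2 :=
  fun h => not_reachable_of_mem_crossPairs hp (h ▸ Reachable.refl _)

lemma adj_of_sup_edge_le (hkl : k ≠ l) (h : F ⊔ edge k l ≤ T) : T.Adj k l :=
  h (Or.inr ((edge_adj ..).2 ⟨Or.inl ⟨rfl, rfl⟩, hkl⟩))

/-- The integral over the parameters below a bound of the Boltzmann factor of a forest. -/
def cutIntegral (F T : SimpleGraph (Fin n)) (s : ℝ) : ℝ :=
  ∫ w, (if ∀ e ∈ remEdges T F, w e < s then exp (-crossEnergy x F T w) else 0)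
    ∂(uniformCube (Sym2 (Fin n)))

lemma intervalIntegrable_cutIntegral (F T : SimpleGraph (Fin n)) (s : ℝ) :
    IntervalIntegrable (cutIntegral x F T) volume 0 s := by
  have hmeas : Measurable fun q : ℝ × (Sym2 (Fin n) → ℝ) =>
      (if ∀ e ∈ remEdges T F, q.2 e < q.1 then exp (-crossEnergy x F T q.2) else 0) := by
    refine Measurable.ite ?_ ?_ measurable_const
    · have : {q : ℝ × (Sym2 (Fin n) → ℝ) | ∀ e ∈ remEdges T F, q.2 e < q.1} =
          ⋂ e ∈ remEdges T F, {q | q.2 e < q.1} := by ext; simp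
      rw [this]
      exact Finset.measurableSet_biInter _ fun e _ =>
        measurableSet_lt ((measurable_pi_apply e).comp measurable_snd) measurable_fst
    · exact measurable_exp.comp
        (((continuous_crossEnergy x F T).measurable.comp measurable_snd).neg)
  rw [intervalIntegrable_iff]
  refine Measure.integrableOn_of_bounded
    (M := exp (∑ p ∈ pairs univ, |inner ℝ (x p.1) (x p.2)|)) (by simp) ?_ ?_
  · exact (hmeas.stronglyMeasurable.integral_prod_right').aestronglyMeasurable
  · refine .of_forall fun a => ?_
    refine (norm_integral_le_of_norm_le_const (C :=
      exp (∑ p ∈ pairs univ, |inner ℝ (x p.1) (x p.2)|)) ?_).trans (by simp)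
    filter_upwards [ae_uniformCube_mem] with w hw
    split_ifs
    · rw [norm_eq_abs, abs_exp]
      exact exp_le_exp.2 ((neg_le_abs _).trans (abs_crossEnergy_le x F T hw))
    · rw [norm_zero]; exact (exp_pos _).le

/-- The sum over the trees that contain a forest, with the parameters of the remaining edges
below a bound. -/
def treeFlow (F : SimpleGraph (Fin n)) (s : ℝ) : ℝ :=
  ∑ T : SimpleGraph (Fin n) with T.IsTree ∧ F ≤ T,
    (∏ e ∈ remEdges T F, -edgeInner x e) * cutIntegral x F T s

lemma crossEnergy_self (hT : T.IsTree) (w : Sym2 (Fin n) → ℝ) : crossEnergy x T T w = 0 := by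
  unfold crossEnergy
  rw [filter_false_of_mem]
  · simp
  · intro p _ h
    exact h (hT.1.preconnected _ _)

lemma not_reachable_of_isTree (hT : T.IsTree) (h : F ≤ T) (hadj : T.Adj k l) (hF : ¬ F.Adj k l) : ¬ F.Reachable k l := by
  have h1 : F ⊔ edge k l ≤ T := sup_le h (by
    rw [edge_le_iff]; exact Or.inr hadj)
  have h2 := SimpleGraph.isAcyclic_sup_fromEdgeSet_iff.1 (hT.isAcyclic.anti h1)
  intro h3
  rcases h2.2 h3 with h4 | h4
  · exact hadj.ne h4
  · exact hF h4

lemma remEdges_sup_edge (hkl : k ≠ l) : remEdges T (F ⊔ edge k l) =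
      (remEdges T F).erase s(k, l) := by
  ext e
  simp only [mem_remEdges, mem_erase, edgeSet_sup,
    edgeSet_edge_of_ne hkl, Set.mem_union, Set.mem_singleton_iff, not_or]
  tauto

/-- Condition on the remaining edge with the largest parameter `a`. By `crossEnergy_update` the
Boltzmann factor splits into the coupling of the two components and the factor of the enlarged
forest, whose remaining parameters now lie below `a`. -/
lemma cutIntegral_eq_sum (hT : T.IsTree) (hFT : F ≤ T) (hne : F ≠ T) (hs0 : 0 ≤ s) (hs1 : s ≤ 1) :
    cutIntegral x F T s =
      ∑ p ∈ crossPairs F with F ⊔ edge p.1 p.2 ≤ T,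
        ∫ a in (0 : ℝ)..s, couple x F p a * cutIntegral x (F ⊔ edge p.1 p.2) T a := by
  have hE : (remEdges T F).Nonempty := by
    by_contra h
    rw [not_nonempty_iff_eq_empty] at h
    refine hne (le_antisymm hFT (SimpleGraph.edgeSet_subset_edgeSet.1 fun e he => ?_))
    by_contra h'
    have : e ∈ remEdges T F := mem_remEdges.2 ⟨he, h'⟩
    simp [h] at this
  unfold cutIntegral
  rw [integral_lt_eq_sum_argmax _ hE hs0 hs1 (fun w => exp (-crossEnergy x F T w))
    (measurable_exp.comp (continuous_crossEnergy x F T).measurable.neg)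
    (exp (∑ p ∈ pairs univ, |inner ℝ (x p.1) (x p.2)|))]
  · have hset : remEdges T F = univ.filter fun e : Sym2 (Fin n) =>
        ¬ (e.map (compRep F)).IsDiag ∧ e ∈ remEdges T F := by
      ext e
      simp only [mem_filter, mem_univ, true_and]
      refine ⟨fun h => ⟨?_, h⟩, fun h => h.2⟩
      induction e with
      | _ k l =>
        simp only [mem_remEdges, mem_edgeSet] at h
        simp only [Sym2.map_mk, Sym2.mk_isDiag_iff]
        exact fun h' => not_reachable_of_isTree hT hFT h.1 h.2 (compRep_eq_iff.1 h')
    have hsum : ∀ g : Sym2 (Fin n) → ℝ, ∑ e ∈ remEdges T F, g e =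
        ∑ p ∈ crossPairs F with s(p.1, p.2) ∈ remEdges T F, g s(p.1, p.2) := by
      intro g
      conv_lhs => rw [hset]
      rw [← filter_filter, sum_filter, sum_sym2_map_not_isDiag, ← sum_filter, crossPairs]
    have hF : ∀ p ∈ crossPairs F, s(p.1, p.2) ∈ remEdges T F ↔ F ⊔ edge p.1 p.2 ≤ T := by
      intro p hp
      simp only [mem_remEdges, mem_edgeSet, sup_le_iff, hFT, true_and, edge_le_iff]
      exact ⟨fun h => Or.inr h.1, fun h => ⟨h.resolve_left (ne_of_mem_crossPairs hp),
        fun h => not_reachable_of_mem_crossPairs hp h.reachable⟩⟩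
    rw [hsum, filter_congr hF]
    refine sum_congr rfl fun p hp => ?_
    obtain ⟨hp, hle⟩ := mem_filter.1 hp
    have hpne := ne_of_mem_crossPairs hp
    have hadj := adj_of_sup_edge_le hpne hle
    refine intervalIntegral.integral_congr fun a ha => ?_
    rw [Set.uIcc_of_le hs0] at ha
    rw [← integral_const_mul, remEdges_sup_edge hpne]
    refine integral_congr_ae (.of_forall fun w => ?_)
    simp only
    split_ifs with hw
    · rw [crossEnergy_update x hT hFT (mem_filter.1 hp).2 hadj (ha.2.trans hs1), neg_add, exp_add, couple]
      intro e heT heF hek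
      exact hw e (mem_erase.2 ⟨hek, mem_remEdges.2 ⟨by simpa using heT, by simpa using heF⟩⟩)
    · simp
  · intro w hw
    rw [abs_exp]
    exact exp_le_exp.2 ((neg_le_abs _).trans (abs_crossEnergy_le x F T hw))

/-- Exchange the sum over trees with the sum over the edge of largest parameter. The result is a
closed equation in which only larger forests appear; its constant term is the tree that has no
remaining edge. -/
lemma treeFlow_eq (F : SimpleGraph (Fin n)) (hs0 : 0 ≤ s) (hs1 : s ≤ 1) :
    treeFlow x F s = (if F.IsTree then 1 else 0) + ∫ a in (0 : ℝ)..s,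
      ∑ p ∈ crossPairs F,
        -inner ℝ (x p.1) (x p.2) * couple x F p a *
          treeFlow x (F ⊔ edge p.1 p.2) a := by
  have hint : ∀ (p : Fin n × Fin n) (T : SimpleGraph (Fin n)),
      IntervalIntegrable (fun a => couple x F p a * cutIntegral x (F ⊔ edge p.1 p.2) T a) volume 0 s := by
    intro p T
    refine (intervalIntegrable_cutIntegral x _ T s).continuousOn_mul ?_
    unfold couple
    exact Continuous.continuousOn (by fun_prop)
  have h1 : treeFlow x F s = (if F.IsTree then 1 else 0) +
      ∑ T : SimpleGraph (Fin n) with T.IsTree ∧ F ≤ T,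
        ∑ p ∈ crossPairs F with F ⊔ edge p.1 p.2 ≤ T,
        (∏ e ∈ remEdges T F, -edgeInner x e) *
        ∫ a in (0 : ℝ)..s, couple x F p a * cutIntegral x (F ⊔ edge p.1 p.2) T a := by
    have hT : ∀ T ∈ univ.filter fun T : SimpleGraph (Fin n) => T.IsTree ∧ F ≤ T,
        (∏ e ∈ remEdges T F, -edgeInner x e) *
          cutIntegral x F T s = (if F = T then 1 else 0) +
        ∑ p ∈ crossPairs F with F ⊔ edge p.1 p.2 ≤ T,
        (∏ e ∈ remEdges T F, -edgeInner x e) *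
        ∫ a in (0 : ℝ)..s, couple x F p a * cutIntegral x (F ⊔ edge p.1 p.2) T a := by
      intro T hT
      obtain ⟨_, hT, hFT⟩ := mem_filter.1 hT
      by_cases hne : F = T
      · subst hne
        rw [filter_false_of_mem]
        · simp [cutIntegral, crossEnergy_self x hT, remEdges]
        · exact fun p hp _ => not_reachable_of_mem_crossPairs hp (hT.1.preconnected _ _)
      · rw [cutIntegral_eq_sum x hT hFT hne hs0 hs1, mul_sum, if_neg hne, zero_add]
    rw [treeFlow, sum_congr rfl hT, sum_add_distrib, sum_ite_eq]
    simp
  rw [h1]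
  congr 1
  rw [intervalIntegral.integral_finsetSum]
  · rw [sum_comm' (t' := crossPairs F) (s' := fun p => univ.filter fun T =>
          T.IsTree ∧ F ⊔ edge p.1 p.2 ≤ T)]
    · refine sum_congr rfl fun p hp => ?_
      have hpne := ne_of_mem_crossPairs hp
      simp only [treeFlow, mul_sum]
      rw [intervalIntegral.integral_finsetSum]
      · refine sum_congr rfl fun T hT => ?_
        obtain ⟨_, hT, hle⟩ := mem_filter.1 hT
        have hmem : s(p.1, p.2) ∈ remEdges T F := mem_remEdges.2
          ⟨adj_of_sup_edge_le hpne hle, fun h => not_reachable_of_mem_crossPairs hp h.reachable⟩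
        rw [← mul_prod_erase _ _ hmem, ← intervalIntegral.integral_const_mul,
          ← remEdges_sup_edge hpne, edgeInner_mk]
        refine intervalIntegral.integral_congr fun a _ => ?_
        ring
      · intro T _
        have := (hint p T).const_mul (-inner ℝ (x p.1) (x p.2) *
          ∏ e ∈ remEdges T (F ⊔ edge p.1 p.2), -edgeInner x e)
        refine this.congr fun a _ => ?_
        ring
    · intro T p
      simp only [mem_filter, mem_univ, true_and, sup_le_iff]
      tauto
  · intro p _
    simp only [treeFlow, mul_sum]
    have : IntervalIntegrable (∑ T ∈ univ.filter fun T : SimpleGraph (Fin n) => T.IsTree ∧ F ⊔ edge p.1 p.2 ≤ T, fun a =>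
        (-inner ℝ (x p.1) (x p.2) * ∏ e ∈ remEdges T (F ⊔ edge p.1 p.2),
          -edgeInner x e) * (couple x F p a * cutIntegral x (F ⊔ edge p.1 p.2) T a)) volume 0 s :=
      IntervalIntegrable.sum _ fun T _ => (hint p T).const_mul _
    refine this.congr fun a _ => ?_
    simp only [Finset.sum_apply]
    refine sum_congr rfl fun T _ => ?_
    ring

lemma isTree_iff_compReps (hF : F.IsAcyclic) :
    F.IsTree ↔ compReps F = {⊥} := by
  constructor
  · intro h
    ext v
    rw [mem_singleton, mem_compReps]
    have : compRep F v = ⊥ :=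
      le_antisymm (compRep_le (h.1.preconnected _ _)) bot_le
    rw [this, eq_comm]
  · intro h
    have h' : ∀ v, compRep F v = ⊥ := fun v => by
      have : compRep F v ∈ compReps F := mem_compReps.2 (compRep_compRep F v)
      rwa [h, mem_singleton] at this
    refine ⟨⟨fun u v => compRep_eq_iff.1 ((h' u).trans (h' v).symm)⟩, hF⟩

/-- Both sides solve the same integral equation, and its right-hand side involves one component
less: induction on the number of components. -/
lemma treeFlow_eq_ursell (hF : F.IsAcyclic) (hs0 : 0 ≤ s) (hs1 : s ≤ 1) :
    treeFlow x F s = ursell s (compSum x F) (compReps F) := by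
  induction hc : (compReps F).card using Nat.strong_induction_on generalizing F s with
  | _ c ih =>
    rw [treeFlow_eq x F hs0 hs1, ursell_integral_eq _ (bot_mem_compReps F)]
    congr 1
    · simp only [isTree_iff_compReps hF]
    · refine intervalIntegral.integral_congr fun a ha => ?_
      rw [Set.uIcc_of_le hs0] at ha
      have hmaps : ∀ p ∈ crossPairs F, (compRep F p.1, compRep F p.2) ∈ pairs (compReps F) := by
        intro p hp
        exact mem_pairs.2 ⟨mem_compReps.2 (compRep_compRep F _),
          mem_compReps.2 (compRep_compRep F _), (mem_filter.1 hp).2⟩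
      -- All edges between the same two components lead to the same contracted family. Their weights
      -- add up to the inner product of the component sums, which is the factor in `pairTerm`.
      rw [← sum_fiberwise_of_maps_to hmaps]
      refine sum_congr rfl fun q hq => ?_
      obtain ⟨hq1, hq2, hlt⟩ := mem_pairs.1 hq
      have hstep : ∀ p ∈ (crossPairs F).filter fun p => (compRep F p.1, compRep F p.2) = q,
          -inner ℝ (x p.1) (x p.2) * couple x F p a *
          treeFlow x (F ⊔ edge p.1 p.2) a =
          -inner ℝ (x p.1) (x p.2) * (exp (-(a * inner ℝ (compSum x F q.1) (compSum x F q.2))) *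
          ursell a (mergePair (compSum x F) q) ((compReps F).erase q.2)) := by
        intro p hp
        obtain ⟨hp1, rfl⟩ := mem_filter.1 hp
        have hlt := (mem_filter.1 hp1).2
        have hcard : (compReps (F ⊔ edge p.1 p.2)).card < c := by
          rw [compReps_sup_edge hlt, ← hc]
          exact card_erase_lt_of_mem hq2
        rw [ih _ hcard (hF.sup_edge_of_not_reachable (not_reachable_of_mem_crossPairs hp1)) ha.1 (ha.2.trans hs1) rfl,
          compReps_sup_edge hlt, mul_assoc, couple]
        congr 2
        exact ursell_congr a fun v hv => compSum_sup_edge x hlt hv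
      rw [sum_congr rfl hstep, ← sum_mul, pairTerm, ← mul_assoc]
      congr 2
      rw [sum_neg_distrib]
      congr 1
      rw [compSum, compSum, sum_inner]
      simp only [inner_sum]
      rw [← sum_product']
      refine sum_congr ?_ fun _ _ => rfl
      ext p
      simp only [crossPairs, mem_filter, mem_univ, true_and, mem_product, Prod.ext_iff]
      constructor
      · exact fun h => h.2
      · intro h
        exact ⟨by rw [h.1, h.2]; exact hlt, h⟩

end TreeFlow

/-! ### The tree formula for the Ursell functions -/

section TreeFormula

open Finset
open scoped Classical

variable {H : Type*} [NormedAddCommGroup H] [InnerProductSpace ℝ H] {N n : ℕ}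

lemma volume_restrict_parameterCube (T : SimpleGraph (Fin n)) :
    (volume : Measure (T.edgeSet → ℝ)).restrict (parameterCube T) = uniformCube T.edgeSet := by
  have h : parameterCube T = Set.univ.pi fun _ => Set.Icc (0 : ℝ) 1 := by
    rw [parameterCube, ← Set.pi_univ_Icc]; rfl
  rw [h, volume_pi, Measure.restrict_pi_pi, uniformCube]

lemma uniformCube_map_edges (T : SimpleGraph (Fin n)) :
    (uniformCube (Sym2 (Fin n))).map (fun w (e : T.edgeSet) => w e.1) = uniformCube T.edgeSet := by
  rw [uniformCube, uniformCube, ← Measure.infinitePi_eq_pi, ← Measure.infinitePi_eq_pi]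
  exact Measure.infinitePi_map_restrict' (μ := fun _ => volume.restrict (Set.Icc (0 : ℝ) 1))
    (I := T.edgeSet)

/-- The interaction energy of replicas coupled by the interpolated covariance of a tree. -/
def treeEnergy (x : Fin n → H) (T : SimpleGraph (Fin n)) (w : T.edgeSet → ℝ) : ℝ :=
  ∑ p ∈ pairs univ, pathInf T w p.1 p.2 * inner ℝ (x p.1) (x p.2)

/-- The weight of a tree in the tree formula, up to its sign. -/
def treeWeight (x : Fin n → H) (T : SimpleGraph (Fin n)) : ℝ :=
  (∏ l : T.edgeSet, edgeInner x l) * ∫ w in parameterCube T, exp (-treeEnergy x T w)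

lemma continuous_treeEnergy (x : Fin n → H) (T : SimpleGraph (Fin n)) :
    Continuous (treeEnergy x T) :=
  continuous_finsetSum _ fun p _ => (continuous_pathInf T p.1 p.2).mul continuous_const

lemma treeFlow_bot (x : Fin (N + 1) → H) :
    treeFlow x ⊥ 1 = (-1) ^ N * ∑ T : SimpleGraph (Fin (N + 1)) with T.IsTree, treeWeight x T := by
  unfold treeFlow
  rw [mul_sum]
  have hset : (univ.filter fun T : SimpleGraph (Fin (N + 1)) => T.IsTree ∧ ⊥ ≤ T) =
      univ.filter fun T => T.IsTree := by ext; simp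
  rw [hset]
  refine sum_congr rfl fun T hT => ?_
  have hT := (mem_filter.1 hT).2
  have hmem : ∀ e, e ∈ remEdges T ⊥ ↔ e ∈ T.edgeSet := fun e => by simp [mem_remEdges]
  have hcard : Fintype.card T.edgeSet = N := by
    have := hT.card_edgeFinset
    simp only [Fintype.card_fin, SimpleGraph.edgeFinset_card] at this
    omega
  rw [prod_subtype _ hmem, prod_neg, treeWeight, ← mul_assoc]
  congr 1
  · rw [card_univ]
    congr 2
  · rw [volume_restrict_parameterCube, ← uniformCube_map_edges, integral_map, cutIntegral]
    · refine integral_congr_ae ?_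
      have hlt : ∀ᵐ w ∂(uniformCube (Sym2 (Fin (N + 1)))), ∀ e, w e < 1 := by
        rw [ae_all_iff]
        intro e
        have h1 : ∀ᵐ a ∂(volume.restrict (Set.Icc (0 : ℝ) 1)), a < 1 := by
          have h2 : ∀ᵐ a : ℝ, a ≠ 1 := by simp [ae_iff]
          filter_upwards [ae_restrict_mem measurableSet_Icc, ae_restrict_of_ae h2] with a ha h
            using lt_of_le_of_ne ha.2 h
        exact (measurePreserving_eval (fun _ : Sym2 (Fin (N + 1)) =>
          volume.restrict (Set.Icc (0 : ℝ) 1)) e).quasiMeasurePreserving.ae h1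
      filter_upwards [hlt] with w hw
      rw [if_pos fun e _ => hw e]
      congr 2
      unfold crossEnergy treeEnergy
      refine sum_congr ?_ fun p _ => ?_
      · ext p
        refine (@Finset.mem_filter _ _ (_) _ _).trans ?_
        rw [SimpleGraph.reachable_bot, and_iff_left_iff_imp]
        exact fun hp => (mem_pairs.1 hp).2.2.ne
      · congr 2
        funext e
        simp [forestWeight]
    · exact (measurable_pi_lambda _ fun e => measurable_pi_apply _).aemeasurable
    · exact (continuous_exp.comp (continuous_treeEnergy x T).neg).aestronglyMeasurable

/-- This is `treeFlow_eq_ursell` for the empty forest, whose components are the single vertices, at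
`s = 1`. When the inner products are nonnegative every summand is nonnegative, so a bound on the
Ursell function is a bound on each tree. -/
lemma sum_treeWeight (x : Fin (N + 1) → H) :
    ∑ T : SimpleGraph (Fin (N + 1)) with T.IsTree, treeWeight x T =
      (-1) ^ N * ursell 1 x univ := by
  have h := treeFlow_eq_ursell x (F := ⊥) (by simp) zero_le_one le_rfl
  have hrep : ∀ v, compRep (⊥ : SimpleGraph (Fin (N + 1))) v = v := fun v => by
    have := reachable_compRep (⊥ : SimpleGraph (Fin (N + 1))) v
    rw [SimpleGraph.reachable_bot] at this
    exact this.symm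
  have h1 : compReps (⊥ : SimpleGraph (Fin (N + 1))) = univ := by
    ext v; simp [mem_compReps, hrep]
  have h2 : compSum x ⊥ = x := by
    funext v
    simp [compSum, hrep, sum_filter]
  rw [h1, h2, treeFlow_bot] at h
  rw [← h, ← mul_assoc, ← mul_pow]
  simp

lemma treeWeight_nonneg {x : Fin n → H} (hx : ∀ i j, 0 ≤ inner ℝ (x i) (x j))
    (T : SimpleGraph (Fin n)) : 0 ≤ treeWeight x T := by
  refine mul_nonneg (prod_nonneg fun l _ => ?_) (integral_nonneg fun w => (exp_pos _).le)
  obtain ⟨l, _⟩ := l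
  induction l with
  | _ a b => exact hx a b

end TreeFormula

/-! ### Continuity and crude bounds of the Ursell functions -/

section UrsellBounds

open Finset

variable {ι H : Type*} [LinearOrder ι] [OrderBot ι] [NormedAddCommGroup H] [InnerProductSpace ℝ H]

lemma continuous_pairEnergy (A : Finset ι) : Continuous fun x : ι → H => pairEnergy x A := by
  unfold pairEnergy; fun_prop

lemma continuous_boltz (s : ℝ) (A : Finset ι) : Continuous fun x : ι → H => boltz s x A := by
  unfold boltz
  have := continuous_pairEnergy (H := H) A
  fun_prop

lemma continuous_ursell (s : ℝ) (A : Finset ι) : Continuous fun x : ι → H => ursell s x A := by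
  induction A using Finset.strongInduction with
  | H A ih =>
    have : (fun x : ι → H => ursell s x A) = fun x => boltz s x A -
        ∑ A' ∈ A.ssubsets with ⊥ ∈ A', ursell s x A' * boltz s x (A \ A') :=
      funext fun x => ursell_eq s x A
    rw [this]
    refine (continuous_boltz s A).sub (continuous_finsetSum _ fun A' hA' => ?_)
    exact (ih A' (mem_ssubsets.1 (mem_filter.1 hA').1)).mul (continuous_boltz s _)

lemma pairEnergy_nonneg {x : ι → H} (hx : ∀ i j, 0 ≤ inner ℝ (x i) (x j)) (A : Finset ι) :
    0 ≤ pairEnergy x A := by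
  rw [pairEnergy_eq_sum_pairs]
  exact sum_nonneg fun p _ => hx _ _

lemma boltz_pos (s : ℝ) (x : ι → H) (A : Finset ι) : 0 < boltz s x A := exp_pos _

lemma boltz_le_one {x : ι → H} (hx : ∀ i j, 0 ≤ inner ℝ (x i) (x j)) (A : Finset ι) :
    boltz 1 x A ≤ 1 := by
  rw [boltz, exp_le_one_iff, one_mul]
  linarith [pairEnergy_nonneg hx A]

/-- Repulsion keeps the Boltzmann factors in `(0, 1]`, so the recursion bounds the Ursell function
by a constant depending on the label set alone. The size of the constant is irrelevant: it serves
integrability at fixed order. -/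
lemma exists_abs_ursell_le (H : Type*) [NormedAddCommGroup H] [InnerProductSpace ℝ H]
    (A : Finset ι) : ∃ C : ℝ, ∀ x : ι → H,
      (∀ i j, 0 ≤ inner ℝ (x i) (x j)) → |ursell 1 x A| ≤ C := by
  induction A using Finset.strongInduction with
  | H A ih =>
    choose! C hC using ih
    refine ⟨1 + ∑ A' ∈ A.ssubsets with ⊥ ∈ A', C A', fun x hx => ?_⟩
    rw [ursell_eq]
    refine (abs_sub _ _).trans (add_le_add ?_ ((abs_sum_le_sum_abs _ _).trans
      (sum_le_sum fun A' hA' => ?_)))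
    · rw [abs_of_pos (boltz_pos _ _ _)]
      exact boltz_le_one hx A
    · rw [abs_mul, abs_of_pos (boltz_pos _ _ _)]
      exact (mul_le_of_le_one_right (abs_nonneg _) (boltz_le_one hx _)).trans
        (hC A' (mem_ssubsets.1 (mem_filter.1 hA').1) x hx)

end UrsellBounds

/-! ### Families with an additional root vector -/

section Rooted

open Finset

variable {H : Type*} [NormedAddCommGroup H] [InnerProductSpace ℝ H] {N : ℕ}

lemma inner_cons_nonneg {T : H} {x : Fin N → H} (hT : ∀ i, 0 ≤ inner ℝ T (x i))
    (hx : ∀ i j, 0 ≤ inner ℝ (x i) (x j)) (i j : Fin (N + 1)) :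
    0 ≤ (inner ℝ ((Fin.cons T x : Fin (N + 1) → H) i) ((Fin.cons T x : Fin (N + 1) → H) j) : ℝ) := by
  refine Fin.cases ?_ (fun i => ?_) i <;> refine Fin.cases ?_ (fun j => ?_) j
  · simpa using sq_nonneg ‖T‖
  · simpa using hT j
  · simpa [real_inner_comm] using hT i
  · simpa using hx i j

lemma pairEnergy_cons (T : H) (x : Fin N → H) :
    pairEnergy (Fin.cons T x : Fin (N + 1) → H) univ =
      inner ℝ T (∑ i, x i) + pairEnergy x univ := by
  unfold pairEnergy
  rw [Fin.sum_univ_succ, Fin.sum_univ_succ]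
  simp only [Fin.cons_zero, Fin.cons_succ]
  rw [norm_add_sq_real]
  ring

lemma boltz_cons_zero (x : Fin N → H) :
    boltz 1 (Fin.cons 0 x : Fin (N + 1) → H) univ = boltz 1 x univ := by
  rw [boltz, pairEnergy_cons]; simp [boltz]

lemma pairEnergy_succAbove (x : Fin (N + 1) → H) (j : Fin (N + 1)) :
    pairEnergy x univ = inner ℝ (x j) (∑ i, x (j.succAbove i)) +
      pairEnergy (fun i => x (j.succAbove i)) univ := by
  unfold pairEnergy
  rw [Fin.sum_univ_succAbove _ j, Fin.sum_univ_succAbove (fun i => ‖x i‖ ^ 2) j]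
  rw [norm_add_sq_real]
  ring

/-- Particle `j` is absorbed: its interaction with the scaled root becomes a prefactor, and the new
root `s • T + x j` interacts with the rest as both did. -/
lemma boltz_cons_smul (T : H) (x : Fin (N + 1) → H) (s : ℝ) (j : Fin (N + 1)) :
    boltz 1 (Fin.cons (s • T) x : Fin (N + 2) → H) univ =
      exp (-(s * inner ℝ T (x j))) *
        boltz 1 (Fin.cons (s • T + x j) (fun i => x (j.succAbove i)) : Fin (N + 1) → H) univ := by
  rw [boltz, boltz, pairEnergy_cons, pairEnergy_cons, pairEnergy_succAbove x j, ← exp_add,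
    Fin.sum_univ_succAbove _ j]
  congr 1
  rw [inner_add_left, inner_add_right, inner_smul_left, inner_smul_left]
  simp only [conj_trivial]
  ring

/-- The Boltzmann factor with a root decreases along the scaling of the root. -/
lemma boltz_cons_eq (T : H) (x : Fin (N + 1) → H) :
    boltz 1 (Fin.cons T x : Fin (N + 2) → H) univ =
      boltz 1 (Fin.cons 0 x : Fin (N + 2) → H) univ - ∑ j, ∫ s in (0 : ℝ)..1,
        inner ℝ T (x j) * exp (-(s * inner ℝ T (x j))) *
        boltz 1 (Fin.cons (s • T + x j) (fun i => x (j.succAbove i)) : Fin (N + 1) → H) univ := by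
  have hd : ∀ s ∈ Set.uIcc (0 : ℝ) 1, HasDerivAt
      (fun s : ℝ => boltz 1 (Fin.cons (s • T) x : Fin (N + 2) → H) univ)
      (-∑ j, inner ℝ T (x j) * (exp (-(s * inner ℝ T (x j))) *
        boltz 1 (Fin.cons (s • T + x j) (fun i => x (j.succAbove i)) : Fin (N + 1) → H) univ)) s := by
    intro s _
    have h1 : (fun s : ℝ => boltz 1 (Fin.cons (s • T) x : Fin (N + 2) → H) univ) =
        fun s => exp (-(s * inner ℝ T (∑ i, x i) + pairEnergy x univ)) := by
      funext s
      rw [boltz, pairEnergy_cons, inner_smul_left]; simp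
    have h2 : HasDerivAt (fun s : ℝ => exp (-(s * inner ℝ T (∑ i, x i) + pairEnergy x univ)))
        (exp (-(s * inner ℝ T (∑ i, x i) + pairEnergy x univ)) * (-(1 * inner ℝ T (∑ i, x i)))) s :=
      ((((hasDerivAt_id s).mul_const _).add_const _).neg).exp
    have h3 := congrFun h1 s
    rw [h1]
    convert h2 using 1
    rw [← h3]
    simp only [← boltz_cons_smul]
    rw [← sum_mul, ← inner_sum]
    ring
  have hc : ∀ j : Fin (N + 1), Continuous fun s : ℝ => inner ℝ T (x j) *
      (exp (-(s * inner ℝ T (x j))) *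
        boltz 1 (Fin.cons (s • T + x j) (fun i => x (j.succAbove i)) : Fin (N + 1) → H) univ) := by
    intro j
    have hb : Continuous fun s : ℝ =>
        boltz 1 (Fin.cons (s • T + x j) (fun i => x (j.succAbove i)) : Fin (N + 1) → H) univ := by
      refine (continuous_boltz 1 univ).comp (continuous_pi fun i => ?_)
      refine Fin.cases ?_ (fun i => ?_) i
      · simp only [Fin.cons_zero]; fun_prop
      · simp only [Fin.cons_succ]; fun_prop
    fun_prop
  have h := intervalIntegral.integral_eq_sub_of_hasDerivAt hd
    ((continuous_finsetSum _ fun j _ => hc j).neg.intervalIntegrable _ _)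
  rw [intervalIntegral.integral_neg, intervalIntegral.integral_finsetSum
    fun j _ => (hc j).intervalIntegrable _ _] at h
  simp only [one_smul, zero_smul] at h
  simp only [mul_assoc]
  linarith

/-- The increasing enumeration of a set of labels. -/
def enum (B : Finset (Fin N)) : Fin B.card → Fin N := B.orderEmbOfFin rfl

/-- This is `boltz_eq_sum` with the root at label `0`; the cluster of the root is recorded by the
set `B` of its other labels, each part renumbered increasingly so that integrals over positions
factorize. -/
lemma boltz_cons_eq_sum (T : H) (x : Fin N → H) :
    boltz 1 (Fin.cons T x : Fin (N + 1) → H) univ = ∑ B : Finset (Fin N),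
      ursell 1 (Fin.cons T (x ∘ enum B) : Fin (B.card + 1) → H) univ *
        boltz 1 (x ∘ enum Bᶜ) univ := by
  rw [boltz_eq_sum 1 _ (mem_univ _)]
  symm
  have hbot : (⊥ : Fin (N + 1)) = 0 := rfl
  refine sum_nbij' (fun B => insert 0 (B.map (Fin.succEmb N)))
    (fun A => univ.filter fun i => Fin.succ i ∈ A) ?_ ?_ ?_ ?_ ?_
  · intro B _
    simp [hbot]
  · simp
  · intro B _
    ext i
    simp
  · intro A hA
    simp only [powerset_univ, mem_filter, mem_univ, true_and, hbot] at hA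
    ext i
    refine Fin.cases ?_ (fun i => ?_) i
    · simp [hA]
    · simp
  · intro B _
    have he : Function.Injective
        (Fin.cons 0 (Fin.succ ∘ enum B) : Fin (B.card + 1) → Fin (N + 1)) := by
      refine Fin.cons_injective_iff.2 ⟨?_, (Fin.succ_injective _).comp
        (B.orderEmbOfFin rfl).injective⟩
      rintro ⟨i, hi⟩
      exact Fin.succ_ne_zero _ hi
    have hA : insert 0 (B.map (Fin.succEmb N)) = (univ : Finset (Fin (B.card + 1))).map ⟨_, he⟩ := by
      ext i
      refine Fin.cases ?_ (fun i => ?_) i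
      · simp only [mem_insert, true_or, Finset.mem_map, mem_univ, true_and, true_iff]
        exact ⟨0, by simp⟩
      · simp only [mem_insert, Finset.mem_map, mem_univ, true_and, Fin.coe_succEmb,
          Function.Embedding.coeFn_mk, Fin.succ_ne_zero, false_or, Fin.succ_inj, exists_eq_right,
          Fin.exists_fin_succ, Fin.cons_zero, Fin.cons_succ, Function.comp]
        have : i ∈ B ↔ i ∈ Set.range (B.orderEmbOfFin rfl) := by
          rw [range_orderEmbOfFin]; rfl
        rw [this, Set.mem_range]
        simp only [enum, (Fin.succ_ne_zero i).symm, false_or]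
    have hC : univ \ insert 0 (B.map (Fin.succEmb N)) =
        (univ : Finset (Fin Bᶜ.card)).map
          ((Bᶜ.orderEmbOfFin rfl).toEmbedding.trans (Fin.succEmb N)) := by
      ext i
      refine Fin.cases ?_ (fun i => ?_) i
      · simp
      · have : i ∉ B ↔ i ∈ Set.range (Bᶜ.orderEmbOfFin rfl) := by
          rw [range_orderEmbOfFin]; simp
        simp only [Finset.mem_sdiff, mem_univ, true_and, mem_insert, Fin.succ_ne_zero, false_or,
          Finset.mem_map, Fin.coe_succEmb, Fin.succ_inj, exists_eq_right,
          Function.Embedding.trans_apply]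
        rw [this, Set.mem_range]
        rfl
    rw [hC, hA, ursell_map 1 _ (by rfl), boltz_map]
    congr 2
    · funext i
      refine Fin.cases ?_ (fun i => ?_) i <;> simp

end Rooted

/-! ### Integrals over configurations split along a set of labels -/

section PiIntegrals

variable {Y 𝕜 : Type*} [MeasurableSpace Y] (ν : Measure Y) [SigmaFinite ν] [RCLike 𝕜] {N : ℕ}

lemma integral_pi_comp_enum (B : Finset (Fin N)) (f : (Fin B.card → Y) → 𝕜)
    (g : (Fin Bᶜ.card → Y) → 𝕜) :
    ∫ y : Fin N → Y, f (y ∘ enum B) * g (y ∘ enum Bᶜ) ∂(Measure.pi fun _ => ν) =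
      (∫ y, f y ∂(Measure.pi fun _ => ν)) * ∫ y, g y ∂(Measure.pi fun _ => ν) := by
  let e : Fin B.card ⊕ Fin Bᶜ.card ≃ Fin N := finSumEquivOfFinset rfl rfl
  rw [← integral_prod_mul]
  have h1 := measurePreserving_sumPiEquivProdPi (X := fun _ : Fin B.card ⊕ Fin Bᶜ.card => Y)
    (fun _ => ν)
  have h2 := measurePreserving_piCongrLeft (α := fun _ : Fin N => Y) (fun _ => ν) e
  rw [← h1.integral_comp', ← h2.integral_comp']
  refine integral_congr_ae (.of_forall fun z => ?_)
  have h3 : ∀ a, (MeasurableEquiv.piCongrLeft (fun _ : Fin N => Y) e) z (e a) = z a := fun a => by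
    rw [MeasurableEquiv.coe_piCongrLeft, Equiv.piCongrLeft_apply_apply]
  have h4 : (MeasurableEquiv.piCongrLeft (fun _ : Fin N => Y) e) z ∘ enum B = z ∘ Sum.inl := by
    funext i
    rw [Function.comp, Function.comp, ← h3]
    simp [e, enum]
  have h5 : (MeasurableEquiv.piCongrLeft (fun _ : Fin N => Y) e) z ∘ enum Bᶜ = z ∘ Sum.inr := by
    funext i
    rw [Function.comp, Function.comp, ← h3]
    simp [e, enum]
  simp only [h4, h5]
  rfl

lemma integral_pi_succAbove (j : Fin (N + 1)) (F : Y × (Fin N → Y) → 𝕜) :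
    ∫ y : Fin (N + 1) → Y, F (y j, fun i => y (j.succAbove i)) ∂(Measure.pi fun _ => ν) =
      ∫ z, F z ∂(ν.prod (Measure.pi fun _ => ν)) :=
  (measurePreserving_piFinSuccAbove (α := fun _ : Fin (N + 1) => Y) (fun _ => ν) j).integral_comp' F

end PiIntegrals

/-! ### The gas with a root particle -/

section Gas

open Finset

variable {Y 𝕜 H : Type*} [TopologicalSpace Y] [SecondCountableTopology Y] [MeasurableSpace Y]
  [BorelSpace Y] (ν : Measure Y) [SigmaFinite ν] [RCLike 𝕜] [NormedAddCommGroup H]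
  [InnerProductSpace ℝ H] {N : ℕ} (ω : Y → 𝕜) (x : Y → H)

/-- The `N`-particle term of the partition function of a gas with an additional root particle. -/
def boltzSum (N : ℕ) (T : H) : 𝕜 :=
  (N ! : 𝕜)⁻¹ * ∫ y : Fin N → Y, (∏ i, ω (y i)) *
    (boltz 1 (Fin.cons T (x ∘ y) : Fin (N + 1) → H) univ : ℝ) ∂(Measure.pi fun _ => ν)

/-- The `N`-particle term of the connected part at the root. -/
def rootedSum (N : ℕ) (T : H) : 𝕜 :=
  (N ! : 𝕜)⁻¹ * ∫ y : Fin N → Y, (∏ i, ω (y i)) *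
    (ursell 1 (Fin.cons T (x ∘ y) : Fin (N + 1) → H) univ : ℝ) ∂(Measure.pi fun _ => ν)

/-- The coefficients of the cluster expansion. -/
def clusterSum (N : ℕ) : 𝕜 :=
  ((N + 1)! : 𝕜)⁻¹ * ∫ y : Fin (N + 1) → Y, (∏ i, ω (y i)) *
    (ursell 1 (x ∘ y) univ : ℝ) ∂(Measure.pi fun _ => ν)

variable {ν ω x}

lemma integrable_config (hω : Integrable ω ν) {g : (Fin N → Y) → ℝ} (hg : Continuous g) {C : ℝ}
    (hC : ∀ y, |g y| ≤ C) :
    Integrable (fun y : Fin N → Y => (∏ i, ω (y i)) * ((g y : ℝ) : 𝕜))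
      (Measure.pi fun _ => ν) := by
  refine (Integrable.fintype_prod fun _ => hω).mul_bdd (c := C) ?_ ?_
  · exact (RCLike.continuous_ofReal.comp hg).aestronglyMeasurable
  · exact .of_forall fun y => by simpa using hC y

lemma continuous_cons_comp (hx : Continuous x) (T : H) :
    Continuous fun y : Fin N → Y => (Fin.cons T (x ∘ y) : Fin (N + 1) → H) := by
  refine continuous_pi fun i => ?_
  refine Fin.cases ?_ (fun i => ?_) i
  · simp only [Fin.cons_zero]; fun_prop
  · simp only [Fin.cons_succ, Function.comp]; fun_prop

lemma abs_boltz_le_one {ι : Type*} [LinearOrder ι] [OrderBot ι] {z : ι → H}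
    (hz : ∀ i j, 0 ≤ inner ℝ (z i) (z j)) (A : Finset ι) : |boltz 1 z A| ≤ 1 := by
  rw [abs_of_pos (boltz_pos _ _ _)]; exact boltz_le_one hz A

lemma boltzSum_zero (T : H) : boltzSum ν ω x 0 T = 1 := by
  simp [boltzSum, boltz, pairEnergy, measureReal_def]

lemma ursell_singleton {ι : Type*} [LinearOrder ι] [OrderBot ι] (z : ι → H) :
    ursell 1 z {⊥} = 1 := by
  rw [ursell_eq, sum_eq_zero]
  · simp [boltz, pairEnergy]
  · intro A hA
    obtain ⟨h1, h2⟩ := mem_filter.1 hA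
    rw [mem_ssubsets, ssubset_singleton_iff] at h1
    simp [h1] at h2

lemma rootedSum_zero (T : H) : rootedSum ν ω x 0 T = 1 := by
  have : ∀ z : Fin 1 → H, ursell 1 z univ = 1 := fun z => ursell_singleton z
  simp only [rootedSum, this]
  simp [measureReal_def]

/-- The sum over configurations splits into the cluster of the root and a free gas. -/
lemma boltzSum_eq_sum (hω : Integrable ω ν) (hx : Continuous x)
    (hxx : ∀ y y', 0 ≤ inner ℝ (x y) (x y')) {T : H} (hT : ∀ y, 0 ≤ inner ℝ T (x y)) (N : ℕ) :
    boltzSum ν ω x N T = ∑ k ∈ range (N + 1), rootedSum ν ω x k T * boltzSum ν ω x (N - k) 0 := by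
  have hI : ∀ B : Finset (Fin N), ∀ y : Fin N → Y, (∏ i, ω (y i)) *
      ((ursell 1 (Fin.cons T ((x ∘ y) ∘ enum B) : Fin (B.card + 1) → H) univ *
        boltz 1 ((x ∘ y) ∘ enum Bᶜ) univ : ℝ) : 𝕜) =
      ((∏ i, ω ((y ∘ enum B) i)) *
        (ursell 1 (Fin.cons T (x ∘ (y ∘ enum B)) : Fin (B.card + 1) → H) univ : ℝ)) *
      ((∏ i, ω ((y ∘ enum Bᶜ) i)) *
        (boltz 1 (Fin.cons 0 (x ∘ (y ∘ enum Bᶜ)) : Fin (Bᶜ.card + 1) → H) univ : ℝ)) := by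
    intro B y
    have hprod : ∏ i, ω (y i) = (∏ i, ω ((y ∘ enum B) i)) * ∏ i, ω ((y ∘ enum Bᶜ) i) := by
      rw [← (finSumEquivOfFinset (s := B) rfl rfl).prod_comp, Fintype.prod_sum_type]
      simp [enum]
    rw [boltz_cons_zero, hprod]
    push_cast
    simp only [Function.comp_assoc]
    ring
  have hint : ∀ B : Finset (Fin N), Integrable (fun y : Fin N → Y => (∏ i, ω (y i)) *
      ((ursell 1 (Fin.cons T ((x ∘ y) ∘ enum B) : Fin (B.card + 1) → H) univ *
        boltz 1 ((x ∘ y) ∘ enum Bᶜ) univ : ℝ) : 𝕜)) (Measure.pi fun _ => ν) := by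
    intro B
    obtain ⟨C, hC⟩ := exists_abs_ursell_le H (univ : Finset (Fin (B.card + 1)))
    refine integrable_config hω (C := C) ?_ ?_
    · refine Continuous.mul ?_ ?_
      · exact (continuous_ursell 1 univ).comp ((continuous_cons_comp hx T).comp
          (by fun_prop : Continuous fun y : Fin N → Y => y ∘ enum B))
      · unfold boltz pairEnergy; fun_prop
    · intro y
      rw [abs_mul]
      have hb : |boltz 1 ((x ∘ y) ∘ enum Bᶜ) univ| ≤ 1 := by
        rw [← boltz_cons_zero]
        exact abs_boltz_le_one (inner_cons_nonneg (by simp) fun i j => hxx _ _) _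
      exact (mul_le_of_le_one_right (abs_nonneg _) hb).trans
        (hC _ (inner_cons_nonneg (fun i => hT _) fun i j => hxx _ _))
  have h1 : boltzSum ν ω x N T = (N ! : 𝕜)⁻¹ * ∑ B : Finset (Fin N),
      ((B.card ! : 𝕜) * rootedSum ν ω x B.card T) *
        ((Bᶜ.card ! : 𝕜) * boltzSum ν ω x Bᶜ.card 0) := by
    rw [boltzSum]
    congr 1
    simp only [boltz_cons_eq_sum, RCLike.ofReal_sum, mul_sum]
    rw [integral_finsetSum _ fun B _ => hint B]
    refine sum_congr rfl fun B _ => ?_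
    simp only [hI]
    rw [integral_pi_comp_enum ν B (fun y => (∏ i, ω (y i)) *
        ((ursell 1 (Fin.cons T (x ∘ y) : Fin (B.card + 1) → H) univ : ℝ) : 𝕜))
        (fun y => (∏ i, ω (y i)) *
        ((boltz 1 (Fin.cons 0 (x ∘ y) : Fin (Bᶜ.card + 1) → H) univ : ℝ) : 𝕜)), rootedSum, boltzSum,
      mul_inv_cancel_left₀, mul_inv_cancel_left₀]
    · exact_mod_cast Nat.factorial_ne_zero _
    · exact_mod_cast Nat.factorial_ne_zero _
  -- The summand depends on `B` only through its cardinality, and the binomial coefficient cancels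
  -- against the factorials.
  have h2 := sum_powerset_apply_card (x := (univ : Finset (Fin N)))
    (fun k => ((k ! : 𝕜) * rootedSum ν ω x k T) * (((N - k)! : 𝕜) * boltzSum ν ω x (N - k) 0))
  simp only [powerset_univ, card_univ, Fintype.card_fin] at h2
  rw [h1]
  simp only [card_compl, Fintype.card_fin]
  rw [h2, mul_sum]
  refine sum_congr rfl fun k hk => ?_
  have hk : k ≤ N := Nat.lt_succ_iff.1 (mem_range.1 hk)
  have h3 : (N ! : 𝕜) = N.choose k * (k ! : 𝕜) * ((N - k)! : 𝕜) := by
    exact_mod_cast (Nat.choose_mul_factorial_mul_factorial hk).symm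
  have h4 : (N ! : 𝕜) ≠ 0 := by exact_mod_cast Nat.factorial_ne_zero _
  rw [nsmul_eq_mul, inv_mul_eq_iff_eq_mul₀ h4, h3]
  ring

end Gas

/-! ### The root absorbs one particle at a time -/

section RootRecursion

open Finset

variable {Y 𝕜 H : Type*} [TopologicalSpace Y] [SecondCountableTopology Y] [MeasurableSpace Y]
  [BorelSpace Y] {ν : Measure Y} [SigmaFinite ν] [RCLike 𝕜] [NormedAddCommGroup H]
  [InnerProductSpace ℝ H] {N : ℕ} {ω : Y → 𝕜} {x : Y → H}
  {T : H}

/-- The rate at which a root vector absorbs a particle. -/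
def rootRate (T v : H) (s : ℝ) : ℝ := inner ℝ T v * exp (-(s * inner ℝ T v))

lemma rootRate_nonneg {T v : H} (h : 0 ≤ inner ℝ T v) (s : ℝ) : 0 ≤ rootRate T v s :=
  mul_nonneg h (exp_pos _).le

/-- Lebesgue measure on the unit interval. -/
abbrev unitMeasure : Measure ℝ := volume.restrict (Set.Ioc (0 : ℝ) 1)

lemma integrable_inner_root (hω : Integrable ω ν) (hωx : Integrable (fun y => ‖ω y‖ * ‖x y‖) ν)
    (hx : Continuous x) (T : H) :
    Integrable (fun y => ω y * ((inner ℝ T (x y) : ℝ) : 𝕜)) ν := by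
  refine (hωx.const_mul ‖T‖).mono' ?_ (.of_forall fun y => ?_)
  · exact hω.aestronglyMeasurable.mul
      (RCLike.continuous_ofReal.comp (by fun_prop : Continuous fun y => (inner ℝ T (x y) : ℝ))).aestronglyMeasurable
  · rw [norm_mul, RCLike.norm_ofReal]
    calc ‖ω y‖ * |inner ℝ T (x y)| ≤ ‖ω y‖ * (‖T‖ * ‖x y‖) := by
          gcongr; exact abs_real_inner_le_norm _ _
      _ = ‖T‖ * (‖ω y‖ * ‖x y‖) := by ring

lemma ae_unit_prod {α : Type*} [MeasurableSpace α] (ρ : Measure α) [SFinite ρ] :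
    ∀ᵐ q ∂(unitMeasure.prod ρ), q.1 ∈ Set.Ioc (0 : ℝ) 1 := by
  have h : ∀ᵐ s ∂unitMeasure, s ∈ Set.Ioc (0 : ℝ) 1 := ae_restrict_mem measurableSet_Ioc
  exact Measure.quasiMeasurePreserving_fst.ae h

lemma integrable_rate (hω : Integrable ω ν) (hωx : Integrable (fun y => ‖ω y‖ * ‖x y‖) ν)
    (hx : Continuous x) (hT : ∀ y, 0 ≤ inner ℝ T (x y))
    {g : (ℝ × Y) × (Fin N → Y) → ℝ} (hg : Continuous g) {C : ℝ} (hC : ∀ q, 0 < q.1.1 → |g q| ≤ C) :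
    Integrable (fun q : (ℝ × Y) × (Fin N → Y) => ω q.1.2 * (rootRate T (x q.1.2) q.1.1 : ℝ) *
      ((∏ i, ω (q.2 i)) * (g q : ℝ))) ((unitMeasure.prod ν).prod (Measure.pi fun _ => ν)) := by
  have h1 : Integrable (fun z : ℝ × Y => ω z.2 * ((inner ℝ T (x z.2) : ℝ) : 𝕜))
      (unitMeasure.prod ν) := by
    have := (integrable_const (1 : 𝕜) (μ := unitMeasure)).mul_prod (integrable_inner_root hω hωx hx T)
    simpa using this
  have h2 : Integrable (fun q : (ℝ × Y) × (Fin N → Y) =>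
      (ω q.1.2 * ((inner ℝ T (x q.1.2) : ℝ) : 𝕜)) * ∏ i, ω (q.2 i))
      ((unitMeasure.prod ν).prod (Measure.pi fun _ => ν)) :=
    h1.mul_prod (Integrable.fintype_prod fun _ => hω)
  have h3 := h2.mul_bdd (c := C)
    (g := fun q => ((exp (-(q.1.1 * inner ℝ T (x q.1.2))) * g q : ℝ) : 𝕜)) ?_ ?_
  · refine h3.congr (.of_forall fun q => ?_)
    simp only [rootRate]
    push_cast
    ring
  · refine (RCLike.continuous_ofReal.comp ?_).aestronglyMeasurable
    fun_prop
  · have h4 : ∀ᵐ q ∂((unitMeasure.prod ν).prod (Measure.pi fun _ : Fin N => ν)),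
        q.1.1 ∈ Set.Ioc (0 : ℝ) 1 := Measure.quasiMeasurePreserving_fst.ae (ae_unit_prod ν)
    filter_upwards [h4] with q hq
    rw [RCLike.norm_ofReal, abs_mul, abs_exp]
    refine (mul_le_of_le_one_left (abs_nonneg _) ?_).trans (hC q hq.1)
    rw [exp_le_one_iff]
    have := mul_nonneg hq.1.le (hT q.1.2)
    linarith

lemma continuous_cons_root (hx : Continuous x) (T : H) :
    Continuous fun q : (ℝ × Y) × (Fin N → Y) =>
      (Fin.cons (q.1.1 • T + x q.1.2) (x ∘ q.2) : Fin (N + 1) → H) := by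
  refine continuous_pi fun i => ?_
  refine Fin.cases ?_ (fun i => ?_) i
  · simp only [Fin.cons_zero]; fun_prop
  · simp only [Fin.cons_succ, Function.comp]; fun_prop

lemma inner_root_nonneg (hxx : ∀ y y', 0 ≤ inner ℝ (x y) (x y'))
    (hT : ∀ y, 0 ≤ inner ℝ T (x y)) {s : ℝ} (hs : 0 ≤ s) (y y' : Y) :
    0 ≤ (inner ℝ (s • T + x y) (x y') : ℝ) := by
  rw [inner_add_left, inner_smul_left]
  exact add_nonneg (mul_nonneg hs (hT _)) (hxx _ _)

lemma integrable_rate_boltz (hω : Integrable ω ν) (hωx : Integrable (fun y => ‖ω y‖ * ‖x y‖) ν)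
    (hx : Continuous x) (hxx : ∀ y y', 0 ≤ inner ℝ (x y) (x y')) (hT : ∀ y, 0 ≤ inner ℝ T (x y)) :
    Integrable (fun q : (ℝ × Y) × (Fin N → Y) => ω q.1.2 * (rootRate T (x q.1.2) q.1.1 : ℝ) *
      ((∏ i, ω (q.2 i)) *
        (boltz 1 (Fin.cons (q.1.1 • T + x q.1.2) (x ∘ q.2) : Fin (N + 1) → H) univ : ℝ)))
      ((unitMeasure.prod ν).prod (Measure.pi fun _ => ν)) :=
  integrable_rate hω hωx hx hT
    (g := fun q => boltz 1 (Fin.cons (q.1.1 • T + x q.1.2) (x ∘ q.2) : Fin (N + 1) → H) univ)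
    ((continuous_boltz 1 univ).comp (continuous_cons_root hx T)) (C := 1)
    fun q hq => abs_boltz_le_one
      (inner_cons_nonneg (fun i => inner_root_nonneg hxx hT hq.le _ _) fun i j => hxx _ _) _

lemma integrable_rate_rootedSum (hω : Integrable ω ν) (hωx : Integrable (fun y => ‖ω y‖ * ‖x y‖) ν)
    (hx : Continuous x) (hxx : ∀ y y', 0 ≤ inner ℝ (x y) (x y'))
    (hT : ∀ y, 0 ≤ inner ℝ T (x y)) (N : ℕ) :
    Integrable (fun z : ℝ × Y => ω z.2 * (rootRate T (x z.2) z.1 : ℝ) *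
      rootedSum ν ω x N (z.1 • T + x z.2)) (unitMeasure.prod ν) := by
  obtain ⟨C, hC⟩ := exists_abs_ursell_le H (univ : Finset (Fin (N + 1)))
  have := (integrable_rate hω hωx hx hT
    (g := fun q => ursell 1 (Fin.cons (q.1.1 • T + x q.1.2) (x ∘ q.2) : Fin (N + 1) → H) univ)
    ((continuous_ursell 1 univ).comp (continuous_cons_root hx T)) (C := C)
    fun q hq => hC _ (inner_cons_nonneg (fun i => inner_root_nonneg hxx hT hq.le _ _)
      fun i j => hxx _ _)).integral_prod_left
  refine (this.const_mul (N ! : 𝕜)⁻¹).congr (.of_forall fun z => ?_)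
  simp only [rootedSum]
  rw [integral_const_mul]
  ring

/-- Integrate `boltz_cons_eq` over the positions. The `N + 1` choices of the absorbed particle
contribute equally, which turns `1 / (N + 1)!` into `1 / N!`. -/
lemma boltzSum_succ (hω : Integrable ω ν) (hωx : Integrable (fun y => ‖ω y‖ * ‖x y‖) ν)
    (hx : Continuous x) (hxx : ∀ y y', 0 ≤ inner ℝ (x y) (x y'))
    (hT : ∀ y, 0 ≤ inner ℝ T (x y)) (N : ℕ) :
    boltzSum ν ω x (N + 1) T = boltzSum ν ω x (N + 1) 0 -
      ∫ z, ω z.2 * (rootRate T (x z.2) z.1 : ℝ) * boltzSum ν ω x N (z.1 • T + x z.2)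
        ∂(unitMeasure.prod ν) := by
  set P : Measure (Fin N → Y) := Measure.pi fun _ => ν with hP
  set F : (ℝ × Y) × (Fin N → Y) → 𝕜 := fun q => ω q.1.2 * (rootRate T (x q.1.2) q.1.1 : ℝ) *
      ((∏ i, ω (q.2 i)) *
        (boltz 1 (Fin.cons (q.1.1 • T + x q.1.2) (x ∘ q.2) : Fin (N + 1) → H) univ : ℝ)) with hF
  have hFi : Integrable F ((unitMeasure.prod ν).prod P) := integrable_rate_boltz hω hωx hx hxx hT
  have hassoc := (measurePreserving_prodAssoc unitMeasure ν P).symm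
  have hFi' : Integrable (fun q : ℝ × Y × (Fin N → Y) => F ((q.1, q.2.1), q.2.2))
      (unitMeasure.prod (ν.prod P)) :=
    hassoc.integrable_comp_of_integrable hFi
  -- the contribution of a single particle
  set R : Fin (N + 1) → (Fin (N + 1) → Y) → ℝ := fun j y => ∫ s in (0 : ℝ)..1,
        inner ℝ T (x (y j)) * exp (-(s * inner ℝ T (x (y j)))) *
        boltz 1 (Fin.cons (s • T + x (y j)) (fun i => x (y (j.succAbove i))) :
          Fin (N + 1) → H) univ with hR
  have hpt : ∀ (j : Fin (N + 1)) (y : Fin (N + 1) → Y), (∏ i, ω (y i)) * ((R j y : ℝ) : 𝕜) =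
      (fun z : Y × (Fin N → Y) => ∫ s, F ((s, z.1), z.2) ∂unitMeasure)
        (y j, fun i => y (j.succAbove i)) := by
    intro j y
    simp only [hF, hR]
    rw [intervalIntegral.integral_of_le zero_le_one, ← integral_ofReal, ← integral_const_mul,
      Fin.prod_univ_succAbove _ j]
    refine integral_congr_ae (.of_forall fun s => ?_)
    simp only [rootRate, Function.comp_def]
    push_cast
    ring
  have hint : ∀ j, Integrable (fun y : Fin (N + 1) → Y => (∏ i, ω (y i)) * ((R j y : ℝ) : 𝕜))
      (Measure.pi fun _ => ν) := by
    intro j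
    simp only [hpt]
    exact (measurePreserving_piFinSuccAbove (α := fun _ : Fin (N + 1) => Y)
      (fun _ => ν) j).integrable_comp_of_integrable hFi'.integral_prod_right
  have hval : ∀ j, ∫ y : Fin (N + 1) → Y, (∏ i, ω (y i)) * ((R j y : ℝ) : 𝕜)
      ∂(Measure.pi fun _ => ν) = (N ! : 𝕜) * ∫ z, ω z.2 * (rootRate T (x z.2) z.1 : ℝ) *
        boltzSum ν ω x N (z.1 • T + x z.2) ∂(unitMeasure.prod ν) := by
    intro j
    simp only [hpt]
    rw [integral_pi_succAbove ν j (fun z => ∫ s, F ((s, z.1), z.2) ∂unitMeasure),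
      ← integral_prod_symm (fun q : ℝ × Y × (Fin N → Y) => F ((q.1, q.2.1), q.2.2)) hFi']
    have h1 : ∫ q : ℝ × Y × (Fin N → Y), F ((q.1, q.2.1), q.2.2) ∂(unitMeasure.prod (ν.prod P)) =
        ∫ q, F q ∂((unitMeasure.prod ν).prod P) := hassoc.integral_comp' F
    rw [h1, integral_prod _ hFi, ← integral_const_mul]
    refine integral_congr_ae (.of_forall fun z => ?_)
    simp only [hF, boltzSum]
    rw [integral_const_mul]
    have h4 : (N ! : 𝕜) ≠ 0 := by exact_mod_cast Nat.factorial_ne_zero _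
    rw [mul_left_comm (N ! : 𝕜), mul_inv_cancel_left₀ h4]
  have hb : ∀ S : H, (∀ y, 0 ≤ inner ℝ S (x y)) →
      Integrable (fun y : Fin (N + 1) → Y => (∏ i, ω (y i)) *
        ((boltz 1 (Fin.cons S (x ∘ y) : Fin (N + 2) → H) univ : ℝ) : 𝕜))
        (Measure.pi fun _ => ν) := fun S hS =>
    integrable_config hω (C := 1) ((continuous_boltz 1 univ).comp (continuous_cons_comp hx S))
      fun y => abs_boltz_le_one (inner_cons_nonneg (fun i => hS _) fun i j => hxx _ _) _
  have hmain : ∫ y : Fin (N + 1) → Y, (∏ i, ω (y i)) *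
        ((boltz 1 (Fin.cons T (x ∘ y) : Fin (N + 2) → H) univ : ℝ) : 𝕜) ∂(Measure.pi fun _ => ν) =
      ∫ y : Fin (N + 1) → Y, (∏ i, ω (y i)) *
        ((boltz 1 (Fin.cons 0 (x ∘ y) : Fin (N + 2) → H) univ : ℝ) : 𝕜) ∂(Measure.pi fun _ => ν) -
      ∑ j : Fin (N + 1), ∫ y : Fin (N + 1) → Y, (∏ i, ω (y i)) * ((R j y : ℝ) : 𝕜)
        ∂(Measure.pi fun _ => ν) := by
    rw [← integral_finsetSum _ fun j _ => hint j, ← integral_sub (hb 0 (by simp))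
      (integrable_finsetSum _ fun j _ => hint j)]
    refine integral_congr_ae (.of_forall fun y => ?_)
    simp only
    rw [boltz_cons_eq, RCLike.ofReal_sub, mul_sub, RCLike.ofReal_sum, mul_sum]
    rfl
  rw [boltzSum, hmain, mul_sub, boltzSum]
  congr 1
  simp only [hval, sum_const, card_univ, Fintype.card_fin, nsmul_eq_mul]
  have h4 : (N ! : 𝕜) ≠ 0 := by exact_mod_cast Nat.factorial_ne_zero _
  have h5 : ((N + 1 : ℕ) : 𝕜) ≠ 0 := Nat.cast_ne_zero.2 N.succ_ne_zero
  rw [Nat.factorial_succ, Nat.cast_mul]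
  field_simp

/-- The connected parts at a root solve an integral recursion. -/
lemma rootedSum_succ (hω : Integrable ω ν) (hωx : Integrable (fun y => ‖ω y‖ * ‖x y‖) ν)
    (hx : Continuous x) (hxx : ∀ y y', 0 ≤ inner ℝ (x y) (x y'))
    (hT : ∀ y, 0 ≤ inner ℝ T (x y)) (N : ℕ) :
    rootedSum ν ω x (N + 1) T = -∫ z, ω z.2 * (rootRate T (x z.2) z.1 : ℝ) *
      rootedSum ν ω x N (z.1 • T + x z.2) ∂(unitMeasure.prod ν) := by
  induction N using Nat.strong_induction_on with
  | _ N ih =>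
    have h1 := boltzSum_succ hω hωx hx hxx hT N
    have h2 : ∫ z, ω z.2 * (rootRate T (x z.2) z.1 : ℝ) * boltzSum ν ω x N (z.1 • T + x z.2)
        ∂(unitMeasure.prod ν) = ∑ k ∈ range (N + 1),
        (∫ z, ω z.2 * (rootRate T (x z.2) z.1 : ℝ) * rootedSum ν ω x k (z.1 • T + x z.2)
          ∂(unitMeasure.prod ν)) * boltzSum ν ω x (N - k) 0 := by
      simp only [← integral_mul_const]
      rw [← integral_finsetSum _ fun k _ =>
        (integrable_rate_rootedSum hω hωx hx hxx hT k).mul_const _]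
      refine integral_congr_ae ?_
      filter_upwards [ae_unit_prod ν] with z hz
      rw [boltzSum_eq_sum hω hx hxx (fun y => inner_root_nonneg hxx hT hz.1.le _ _), mul_sum]
      exact sum_congr rfl fun k _ => by ring
    -- Both sides are now convolutions with the free gas `boltzSum _ 0`. By induction all terms
    -- except the last agree, and the last carries the factor `boltzSum 0 0 = 1`.
    rw [h2, boltzSum_eq_sum hω hx hxx hT, sum_range_succ', rootedSum_zero, one_mul, Nat.sub_zero,
      add_comm, sub_eq_add_neg, add_right_inj, ← sum_neg_distrib, sum_range_succ, sum_range_succ] at h1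
    rw [sum_congr rfl fun k hk => ?_] at h1
    · have h3 := add_left_cancel h1
      simpa [boltzSum_zero] using h3
    · rw [ih k (mem_range.1 hk)]
      simp [Nat.succ_sub_succ]

end RootRecursion

/-! ### Supersolutions of the root recursion -/

section Supersolution

open Finset

variable {Y H : Type*} [TopologicalSpace Y] [SecondCountableTopology Y] [MeasurableSpace Y]
  [BorelSpace Y] {ν : Measure Y} [SigmaFinite ν] [NormedAddCommGroup H]
  [InnerProductSpace ℝ H] {N : ℕ} {ω : Y → ℝ} {x : Y → H}

/-- A supersolution of the root recursion bounds the connected parts. -/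
lemma sum_rootedSum_le (hω : Integrable ω ν) (hωx : Integrable (fun y => ‖ω y‖ * ‖x y‖) ν)
    (hω0 : ∀ y, 0 ≤ ω y)
    (hx : Continuous x) (hxx : ∀ y y', 0 ≤ inner ℝ (x y) (x y')) (K : H → ℝ) (C : Set H)
    (hCx : ∀ T ∈ C, ∀ y, 0 ≤ inner ℝ T (x y))
    (hC : ∀ T ∈ C, ∀ s : ℝ, 0 ≤ s → ∀ y, s • T + x y ∈ C) (hK1 : ∀ T ∈ C, 1 ≤ K T)
    (hK : ∀ T ∈ C, ∃ G : ℝ × Y → ℝ, Integrable G (unitMeasure.prod ν) ∧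
      (∀ᵐ z ∂(unitMeasure.prod ν), ω z.2 * rootRate T (x z.2) z.1 * K (z.1 • T + x z.2) ≤ G z) ∧
      ∫ z, G z ∂(unitMeasure.prod ν) ≤ K T - 1) {T : H} (hT : T ∈ C) (N : ℕ) :
    ∑ k ∈ range (N + 1), (-1) ^ k * rootedSum ν ω x k T ≤ K T := by
  induction N generalizing T with
  | zero => simpa [rootedSum_zero] using hK1 T hT
  | succ N ih =>
    obtain ⟨G, hG, hle, hGK⟩ := hK T hT
    have hint := integrable_rate_rootedSum hω hωx hx hxx (hCx T hT)
    rw [sum_range_succ', rootedSum_zero, pow_zero, one_mul]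
    -- The sign in `rootedSum_succ` is absorbed by the alternating sign. The partial sum at `T` is
    -- therefore `1` plus an integral, with nonnegative rates, of shorter partial sums at the
    -- enlarged roots, to which the induction hypothesis applies.
    have h1 : ∀ k, (-1) ^ (k + 1) * rootedSum ν ω x (k + 1) T =
        ∫ z, (-1) ^ k * (ω z.2 * rootRate T (x z.2) z.1 *
          rootedSum ν ω x k (z.1 • T + x z.2)) ∂(unitMeasure.prod ν) := by
      intro k
      rw [rootedSum_succ hω hωx hx hxx (hCx T hT), integral_const_mul, pow_succ]
      simp
    have hint' : ∀ k, Integrable (fun z => (-1) ^ k * (ω z.2 * rootRate T (x z.2) z.1 *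
        rootedSum ν ω x k (z.1 • T + x z.2))) (unitMeasure.prod ν) :=
      fun k => by simpa using (hint k).const_mul ((-1) ^ k)
    rw [sum_congr rfl fun k _ => h1 k, ← integral_finsetSum _ fun k _ => hint' k]
    have h2 : ∫ z, ∑ k ∈ range (N + 1), (-1) ^ k * (ω z.2 * rootRate T (x z.2) z.1 *
        rootedSum ν ω x k (z.1 • T + x z.2)) ∂(unitMeasure.prod ν) ≤
        ∫ z, G z ∂(unitMeasure.prod ν) := by
      refine integral_mono_ae (integrable_finsetSum _ fun k _ => hint' k) hG ?_
      filter_upwards [ae_unit_prod ν, hle] with z hz hzG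
      refine le_trans ?_ hzG
      have := mul_le_mul_of_nonneg_left (ih (hC T hT z.1 hz.1.le z.2))
        (mul_nonneg (hω0 z.2) (rootRate_nonneg (hCx T hT z.2) z.1))
      refine le_trans (le_of_eq ?_) this
      rw [mul_sum]
      exact sum_congr rfl fun k _ => by ring
    linarith

end Supersolution

/-! ### Cluster coefficients and the recursion of an exponential -/

section ClusterExpansion

open Finset

variable {Y 𝕜 H : Type*} [TopologicalSpace Y] [SecondCountableTopology Y] [MeasurableSpace Y]
  [BorelSpace Y] {ν : Measure Y} [SigmaFinite ν] [RCLike 𝕜] [NormedAddCommGroup H]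
  [InnerProductSpace ℝ H] {N : ℕ} {ω : Y → 𝕜} {x : Y → H}
  {C : ℝ}

lemma integral_root (hx : Continuous x) (hω : Integrable ω ν) {g : (Fin (N + 1) → H) → ℝ}
    (hg : Continuous g) (hC : ∀ y : Fin (N + 1) → Y, |g (x ∘ y)| ≤ C) :
    ∫ y : Fin (N + 1) → Y, (∏ i, ω (y i)) * (g (x ∘ y) : ℝ) ∂(Measure.pi fun _ => ν) =
      ∫ y, ω y * ∫ z : Fin N → Y, (∏ i, ω (z i)) * (g (Fin.cons (x y) (x ∘ z)) : ℝ)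
        ∂(Measure.pi fun _ => ν) ∂ν := by
  set F : Y × (Fin N → Y) → 𝕜 := fun q => ω q.1 * ((∏ i, ω (q.2 i)) *
    (g (Fin.cons (x q.1) (x ∘ q.2)) : ℝ)) with hF
  have h1 : ∀ y : Fin (N + 1) → Y, (∏ i, ω (y i)) * ((g (x ∘ y) : ℝ) : 𝕜) =
      F (y 0, fun i => y (Fin.succAbove 0 i)) := by
    intro y
    simp only [hF]
    rw [Fin.prod_univ_succ, mul_assoc]
    simp only [Fin.succAbove_zero]
    congr 5
    funext i
    refine Fin.cases ?_ (fun i => ?_) i <;> simp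
  have h2 : Integrable (fun y : Fin (N + 1) → Y => (∏ i, ω (y i)) * ((g (x ∘ y) : ℝ) : 𝕜))
      (Measure.pi fun _ => ν) := integrable_config hω (C := C) (hg.comp (by fun_prop)) hC
  have h3 : Integrable F (ν.prod (Measure.pi fun _ => ν)) := by
    simp only [h1] at h2
    exact ((measurePreserving_piFinSuccAbove (α := fun _ : Fin (N + 1) => Y)
      (fun _ => ν) 0).integrable_comp_emb (MeasurableEquiv.measurableEmbedding _)).1 h2
  simp only [h1]
  rw [integral_pi_succAbove ν 0 F, integral_prod _ h3]
  refine integral_congr_ae (.of_forall fun y => ?_)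
  simp only [hF]
  rw [integral_const_mul]

/-- Multiplication by the number of particles corresponds to the choice of one of them as the root.
-/
lemma succ_mul_integral_root (hx : Continuous x) (hω : Integrable ω ν) {g : (Fin (N + 1) → H) → ℝ}
    (hg : Continuous g) (hC : ∀ y : Fin (N + 1) → Y, |g (x ∘ y)| ≤ C) :
    ((N : 𝕜) + 1) * (((N + 1)! : 𝕜)⁻¹ *
        ∫ y : Fin (N + 1) → Y, (∏ i, ω (y i)) * (g (x ∘ y) : ℝ) ∂(Measure.pi fun _ => ν)) =
      ∫ y, ω y * ((N ! : 𝕜)⁻¹ * ∫ z : Fin N → Y, (∏ i, ω (z i)) *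
        (g (Fin.cons (x y) (x ∘ z)) : ℝ) ∂(Measure.pi fun _ => ν)) ∂ν := by
  have h5 : (N : 𝕜) + 1 ≠ 0 := by exact_mod_cast N.succ_ne_zero
  rw [integral_root hx hω hg hC, Nat.factorial_succ, Nat.cast_mul, Nat.cast_succ, mul_inv,
    mul_assoc, mul_inv_cancel_left₀ h5, ← integral_const_mul]
  exact integral_congr_ae (.of_forall fun y => mul_left_comm ..)

lemma succ_mul_boltzSum_succ (hω : Integrable ω ν) (hx : Continuous x)
    (hxx : ∀ y y', 0 ≤ inner ℝ (x y) (x y')) (N : ℕ) :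
    ((N : 𝕜) + 1) * boltzSum ν ω x (N + 1) 0 = ∫ y, ω y * boltzSum ν ω x N (x y) ∂ν := by
  simp only [boltzSum, boltz_cons_zero]
  exact succ_mul_integral_root hx hω (continuous_boltz 1 univ) (C := 1)
    fun y => abs_boltz_le_one (fun i j => hxx _ _) _

lemma succ_mul_clusterSum (hω : Integrable ω ν) (hx : Continuous x)
    (hxx : ∀ y y', 0 ≤ inner ℝ (x y) (x y')) (N : ℕ) :
    ((N : 𝕜) + 1) * clusterSum ν ω x N = ∫ y, ω y * rootedSum ν ω x N (x y) ∂ν := by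
  obtain ⟨C, hC⟩ := exists_abs_ursell_le H (univ : Finset (Fin (N + 1)))
  exact succ_mul_integral_root hx hω (continuous_ursell 1 univ) fun y => hC _ fun i j => hxx _ _

lemma integrable_mul_rootedSum (hω : Integrable ω ν) (hx : Continuous x)
    (hxx : ∀ y y', 0 ≤ inner ℝ (x y) (x y')) (N : ℕ) :
    Integrable (fun y => ω y * rootedSum ν ω x N (x y)) ν := by
  obtain ⟨C, hC⟩ := exists_abs_ursell_le H (univ : Finset (Fin (N + 1)))
  have h2 : Integrable (fun q : Y × (Fin N → Y) => (ω q.1 * ∏ i, ω (q.2 i)) *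
      ((ursell 1 (Fin.cons (x q.1) (x ∘ q.2) : Fin (N + 1) → H) univ : ℝ) : 𝕜))
      (ν.prod (Measure.pi fun _ => ν)) := by
    refine (hω.mul_prod (Integrable.fintype_prod fun _ => hω)).mul_bdd (c := C) ?_ ?_
    · refine (RCLike.continuous_ofReal.comp ((continuous_ursell 1 univ).comp
        (continuous_pi fun i => ?_))).aestronglyMeasurable
      refine Fin.cases ?_ (fun i => ?_) i
      · simp only [Fin.cons_zero]; fun_prop
      · simp only [Fin.cons_succ, Function.comp]; fun_prop
    · refine .of_forall fun q => ?_
      rw [RCLike.norm_ofReal]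
      exact hC _ (inner_cons_nonneg (fun i => hxx _ _) fun i j => hxx _ _)
  refine (h2.integral_prod_left.const_mul (N ! : 𝕜)⁻¹).congr (.of_forall fun z => ?_)
  simp only [rootedSum, mul_assoc]
  rw [integral_const_mul]
  ring

/-- Choose a root particle and split off its cluster by `boltzSum_eq_sum`. This is the coefficient
form of `g' = p' g`, where `p` generates the cluster coefficients; `clusterSum k` involves `k + 1`
particles, hence the shifts. -/
lemma succ_mul_boltzSum_eq_sum (hω : Integrable ω ν) (hx : Continuous x)
    (hxx : ∀ y y', 0 ≤ inner ℝ (x y) (x y')) (N : ℕ) :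
    ((N : 𝕜) + 1) * boltzSum ν ω x (N + 1) 0 = ∑ k ∈ range (N + 1),
      (((k : 𝕜) + 1) * clusterSum ν ω x k) * boltzSum ν ω x (N - k) 0 := by
  rw [succ_mul_boltzSum_succ hω hx hxx]
  simp only [succ_mul_clusterSum hω hx hxx, ← integral_mul_const]
  rw [← integral_finsetSum _ fun k _ => (integrable_mul_rootedSum hω hx hxx k).mul_const _]
  refine integral_congr_ae (.of_forall fun y => ?_)
  simp only
  rw [boltzSum_eq_sum hω hx hxx (hxx y), mul_sum]
  exact sum_congr rfl fun k _ => by ring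

end ClusterExpansion

/-! ### From the recursion of coefficients to the exponential -/

section Exponential

open Finset

/-- A sequence that satisfies the recursion of the coefficients of an exponential sums to the
exponential. -/
lemma tsum_eq_exp_of_recursion {a b : ℕ → ℂ} (ha0 : a 0 = 1)
    (h : ∀ n : ℕ, ((n : ℂ) + 1) * a (n + 1) =
      ∑ k ∈ range (n + 1), (((k : ℂ) + 1) * b k) * a (n - k))
    (hb : Summable fun k : ℕ => ((k : ℝ) + 1) * ‖b k‖) (ha : Summable fun n => ‖a n‖) :
    ∑' n, a n = Complex.exp (∑' k, b k) := by
  have hb' : Summable fun k => ‖b k‖ := by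
    refine hb.of_nonneg_of_le (fun _ => norm_nonneg _) fun k => ?_
    have : (0 : ℝ) ≤ k := k.cast_nonneg
    nlinarith [norm_nonneg (b k)]
  have hcb : Summable fun k : ℕ => ‖((k : ℂ) + 1) * b k‖ := by
    refine hb.congr fun k => ?_
    have := Complex.norm_natCast (k + 1)
    push_cast at this
    rw [norm_mul, this]
  have hca : Summable fun n : ℕ => ‖((n : ℂ) + 1) * a (n + 1)‖ := by
    simp only [h]
    exact summable_norm_sum_mul_range_of_summable_norm hcb ha
  -- the generating functions on the unit interval
  have hpow : ∀ {z : ℝ}, z ∈ Set.Icc (0 : ℝ) 1 → ∀ (c : ℂ) (n : ℕ), ‖c * (z : ℂ) ^ n‖ ≤ ‖c‖ := by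
    intro z hz c n
    rw [norm_mul, norm_pow, Complex.norm_real, norm_eq_abs, abs_of_nonneg hz.1]
    exact mul_le_of_le_one_right (norm_nonneg _) (pow_le_one₀ hz.1 hz.2)
  have hgen : ∀ (c : ℕ → ℂ), (Summable fun n => ‖c n‖) →
      (Summable fun n : ℕ => ‖((n : ℂ) + 1) * c (n + 1)‖) →
      ContinuousOn (fun z : ℝ => ∑' n, c n * (z : ℂ) ^ n) (Set.Icc 0 1) ∧
      ∀ z ∈ Set.Ioo (0 : ℝ) 1, HasDerivAt (fun z : ℝ => ∑' n, c n * (z : ℂ) ^ n)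
        (∑' n : ℕ, (((n : ℂ) + 1) * c (n + 1)) * (z : ℂ) ^ n) z := by
    intro c hc hc'
    constructor
    · exact continuousOn_tsum (fun n => by fun_prop) hc fun n z hz => hpow hz _ n
    · intro z hz
      have hs : Summable fun n : ℕ => ‖(n : ℂ) * c n‖ := by
        rw [← summable_nat_add_iff 1]
        refine hc'.congr fun n => ?_
        push_cast
        rfl
      have hd : ∀ (n : ℕ) (w : ℝ), w ∈ Set.Ioo (0 : ℝ) 1 →
          HasDerivAt (fun z : ℝ => c n * (z : ℂ) ^ n) (c n * (n * (w : ℂ) ^ (n - 1))) w :=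
        fun n w _ => ((hasDerivAt_pow n (w : ℂ)).comp_ofReal).const_mul (c n)
      have hle : ∀ w ∈ Set.Ioo (0 : ℝ) 1, ∀ n : ℕ,
          ‖c n * (n * (w : ℂ) ^ (n - 1))‖ ≤ ‖(n : ℂ) * c n‖ := fun w hw n => by
        rw [mul_left_comm, ← mul_assoc]
        exact hpow ⟨hw.1.le, hw.2.le⟩ _ _
      have := hasDerivAt_tsum_of_isPreconnected hs isOpen_Ioo isPreconnected_Ioo hd
        (fun n w hw => hle w hw n) hz ?_ hz
      · refine this.congr_deriv ?_
        rw [Summable.tsum_eq_zero_add (f := fun n : ℕ => c n * (n * (z : ℂ) ^ (n - 1)))]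
        · simp only [Nat.cast_zero, zero_mul, mul_zero, zero_add, Nat.add_sub_cancel]
          refine tsum_congr fun n => ?_
          push_cast
          ring
        · exact .of_norm_bounded hs (hle z hz)
      · exact .of_norm_bounded hc fun n => hpow ⟨hz.1.le, hz.2.le⟩ _ n
  obtain ⟨hgc, hgd⟩ := hgen a ha hca
  -- `b k` is the coefficient of `z ^ (k + 1)`, so the series is shifted and has no constant term.
  set b' : ℕ → ℂ := fun n => if n = 0 then 0 else b (n - 1) with hb'def
  have hb's : ∀ n, b' (n + 1) = b n := fun n => by simp [hb'def]
  have hsb' : Summable fun n => ‖b' n‖ := by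
    rw [← summable_nat_add_iff 1]; simpa only [hb's] using hb'
  obtain ⟨hpc, hpd⟩ := hgen b' hsb' (by simpa only [hb's] using hcb)
  set g : ℝ → ℂ := fun z => ∑' n, a n * (z : ℂ) ^ n with hg
  set p : ℝ → ℂ := fun z => ∑' n, b' n * (z : ℂ) ^ n with hp
  -- The recursion says `g' = p' g`, so `g exp(-p)` is constant inside the interval. Absolute
  -- convergence at `1` gives continuity up to both ends, where the values are compared.
  have hder : ∀ z ∈ Set.Ioo (0 : ℝ) 1, HasDerivAt (fun z => g z * Complex.exp (-p z)) 0 z := by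
    intro z hz
    have hz' : z ∈ Set.Icc (0 : ℝ) 1 := ⟨hz.1.le, hz.2.le⟩
    have h1 := (hgd z hz).mul (hpd z hz).neg.cexp
    refine h1.congr_deriv ?_
    have h2 : ∑' n : ℕ, (((n : ℂ) + 1) * a (n + 1)) * (z : ℂ) ^ n =
        (∑' n : ℕ, (((n : ℂ) + 1) * b' (n + 1)) * (z : ℂ) ^ n) * g z := by
      rw [hg]
      simp only
      rw [tsum_mul_tsum_eq_tsum_sum_range_of_summable_norm]
      · refine tsum_congr fun n => ?_
        rw [h, sum_mul]
        refine sum_congr rfl fun k hk => ?_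
        have hk : k ≤ n := Nat.lt_succ_iff.1 (mem_range.1 hk)
        rw [hb's]
        conv_lhs => rw [← Nat.add_sub_cancel' hk, pow_add, Nat.add_sub_cancel' hk]
        ring
      · simp only [hb's]
        exact hcb.of_nonneg_of_le (fun _ => norm_nonneg _) fun n => hpow hz' _ n
      · exact ha.of_nonneg_of_le (fun _ => norm_nonneg _) fun n => hpow hz' _ n
    rw [h2]
    ring
  have hcont : ContinuousOn (fun z => g z * Complex.exp (-p z)) (Set.Icc 0 1) :=
    hgc.mul hpc.neg.cexp
  have hconst : g 0 * Complex.exp (-p 0) = g 1 * Complex.exp (-p 1) := by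
    have h1 : ∀ δ ∈ Set.Ioc (0 : ℝ) 1, g δ * Complex.exp (-p δ) = g 1 * Complex.exp (-p 1) := by
      intro δ hδ
      refine (constant_of_has_deriv_right_zero (hcont.mono (Set.Icc_subset_Icc_left hδ.1.le))
        (fun z hz => (hder z ⟨hδ.1.trans_le hz.1, hz.2⟩).hasDerivWithinAt) 1 ⟨hδ.2, le_rfl⟩).symm
    have h2 : Tendsto (fun z => g z * Complex.exp (-p z)) (𝓝[>] 0)
        (𝓝 (g 0 * Complex.exp (-p 0))) :=
      ((hcont 0 ⟨le_rfl, zero_le_one⟩).mono Set.Ioc_subset_Icc_self).mono_left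
        (by rw [nhdsWithin_Ioc_eq_nhdsGT zero_lt_one])
    refine tendsto_nhds_unique h2 (tendsto_const_nhds.congr' ?_)
    filter_upwards [Ioc_mem_nhdsGT zero_lt_one] with z hz using (h1 z hz).symm
  have h0 : ∀ c : ℕ → ℂ, ∑' n, c n * ((0 : ℝ) : ℂ) ^ n = c 0 := fun c => by
    rw [tsum_eq_single 0 fun n hn => by simp [hn]]
    simp
  have h1 : g 1 = ∑' n, a n := by simp [hg]
  have h1' : p 1 = ∑' n, b n := by
    simp only [hp, Complex.ofReal_one, one_pow, mul_one]
    rw [Summable.tsum_eq_zero_add hsb'.of_norm]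
    simp only [hb's]
    simp [hb'def]
  rw [h1, h1', hg, hp] at hconst
  simp only [h0, ha0, show b' 0 = 0 from if_pos rfl] at hconst
  rw [neg_zero, Complex.exp_zero, mul_one, Complex.exp_neg] at hconst
  rw [← (eq_mul_inv_iff_mul_eq₀ (Complex.exp_ne_zero _)).1 hconst, one_mul]

end Exponential

/-! ### The exponential of an integral of characters of a Gaussian process -/

section GaussianGas

open Finset

variable {Y H Ω : Type*} [TopologicalSpace Y] [SecondCountableTopology Y] [MeasurableSpace Y]
  [BorelSpace Y] {ν : Measure Y} [SigmaFinite ν] [NormedAddCommGroup H]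
  [InnerProductSpace ℝ H] {ω ω' : Y → ℂ} {x : Y → H} [MeasurableSpace Ω] {P : Measure Ω}
  [IsProbabilityMeasure P] {X : Ω → Y → ℝ}

/-- Half the square of the total vector is the sum of the self-energies, absorbed into the weights
`ω`, and of the pair energy. -/
lemma prod_mul_exp_neg_half (hωω' : ∀ y, ω y = ω' y * (exp (-(‖x y‖ ^ 2 / 2)) : ℝ)) {n : ℕ}
    (y : Fin n → Y) :
    (∏ i, ω' (y i)) * (exp (-(‖∑ i, x (y i)‖ ^ 2 / 2)) : ℝ) =
      (∏ i, ω (y i)) * (boltz 1 (x ∘ y) univ : ℝ) := by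
  simp only [hωω']
  rw [prod_mul_distrib, mul_assoc]
  congr 1
  rw [← Complex.ofReal_prod, ← Complex.ofReal_mul]
  congr 1
  rw [boltz, ← exp_sum, ← exp_add, pairEnergy]
  congr 1
  simp only [Function.comp, sum_neg_distrib, ← sum_div]
  ring

/-- The partition function of the gas of the particles that make up the exponential of an
integral of characters of a Gaussian process. -/
lemma hasSum_boltzSum (hω' : Integrable ω' ν)
    (hωω' : ∀ y, ω y = ω' y * (exp (-(‖x y‖ ^ 2 / 2)) : ℝ))
    (hX : Measurable fun q : Ω × Y => X q.1 q.2)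
    (hchar : ∀ (n : ℕ) (y : Fin n → Y), ∫ τ, Complex.exp (Complex.I * ∑ i, (X τ (y i) : ℂ)) ∂P =
      (exp (-(‖∑ i, x (y i)‖ ^ 2 / 2)) : ℝ)) :
    (Summable fun n => ‖boltzSum ν ω x n 0‖) ∧
    HasSum (fun n => boltzSum ν ω x n 0)
      (∫ τ, Complex.exp (∫ y, ω' y * Complex.exp (Complex.I * (X τ y : ℂ)) ∂ν) ∂P) := by
  set V : Ω → ℂ := fun τ => ∫ y, ω' y * Complex.exp (Complex.I * (X τ y : ℂ)) ∂ν with hV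
  set M : ℝ := ∫ y, ‖ω' y‖ ∂ν with hM
  have hnorm : ∀ r : ℝ, ‖Complex.exp (Complex.I * (r : ℂ))‖ = 1 := fun r => by
    rw [mul_comm, Complex.norm_exp_ofReal_mul_I]
  have hVM : ∀ τ, ‖V τ‖ ≤ M := by
    intro τ
    refine (norm_integral_le_integral_norm _).trans (le_of_eq ?_)
    refine integral_congr_ae (.of_forall fun y => ?_)
    simp only [norm_mul, hnorm, mul_one]
  have hVm : AEStronglyMeasurable V P := by
    have h1 : AEStronglyMeasurable (fun q : Ω × Y => ω' q.2 * Complex.exp (Complex.I * (X q.1 q.2 : ℂ)))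
        (P.prod ν) := by
      refine (hω'.aestronglyMeasurable.comp_snd).mul ?_
      refine Measurable.aestronglyMeasurable ?_
      fun_prop
    exact h1.integral_prod_right'
  -- The `n`-th power is an integral over `n` particles; after the exchange of integrals the
  -- expectation of the product of characters is known.
  have hterm : ∀ n : ℕ, ∫ τ, V τ ^ n / (n ! : ℂ) ∂P = boltzSum ν ω x n 0 := by
    intro n
    have h1 : ∀ τ, V τ ^ n = ∫ y : Fin n → Y, (∏ i, ω' (y i)) *
        Complex.exp (Complex.I * ∑ i, (X τ (y i) : ℂ)) ∂(Measure.pi fun _ => ν) := by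
      intro τ
      have := integral_fintype_prod_eq_pow (ι := Fin n) (μ := ν)
        (fun y => ω' y * Complex.exp (Complex.I * (X τ y : ℂ)))
      rw [Fintype.card_fin] at this
      rw [hV, ← this]
      refine integral_congr_ae (.of_forall fun y => ?_)
      simp only
      rw [prod_mul_distrib, ← Complex.exp_sum, mul_sum]
    have h2 : Integrable (Function.uncurry fun (τ : Ω) (y : Fin n → Y) => (∏ i, ω' (y i)) *
        Complex.exp (Complex.I * ∑ i, (X τ (y i) : ℂ))) (P.prod (Measure.pi fun _ => ν)) := by
      have h3 : Integrable (fun q : Ω × (Fin n → Y) => ∏ i, ω' (q.2 i))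
          (P.prod (Measure.pi fun _ => ν)) := by
        have := (integrable_const (1 : ℂ) (μ := P)).mul_prod
          (Integrable.fintype_prod (ι := Fin n) fun _ => hω')
        simpa using this
      refine h3.mul_bdd (c := 1) (Measurable.aestronglyMeasurable ?_) ?_
      · refine Complex.measurable_exp.comp (measurable_const.mul ?_)
        refine Finset.measurable_sum _ fun i _ => Complex.measurable_ofReal.comp ?_
        exact hX.comp (measurable_fst.prodMk ((measurable_pi_apply i).comp measurable_snd))
      · refine .of_forall fun q => le_of_eq ?_
        rw [← Complex.ofReal_sum, hnorm]
    simp only [div_eq_inv_mul]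
    rw [integral_const_mul, boltzSum]
    congr 1
    simp only [h1]
    rw [integral_integral_swap h2]
    refine integral_congr_ae (.of_forall fun y => ?_)
    simp only
    rw [integral_const_mul, hchar, prod_mul_exp_neg_half hωω', boltz_cons_zero]
    rfl
  have hint : ∀ n : ℕ, Integrable (fun τ => V τ ^ n / (n ! : ℂ)) P := by
    intro n
    refine Integrable.of_bound
      (((continuous_pow n).div_const _).comp_aestronglyMeasurable hVm) (M ^ n / n !) (.of_forall fun τ => ?_)
    rw [norm_div, norm_pow, Complex.norm_natCast]
    gcongr
    exact hVM τ
  have hbound : ∀ n : ℕ, ∫ τ, ‖V τ ^ n / (n ! : ℂ)‖ ∂P ≤ M ^ n / n ! := by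
    intro n
    refine (integral_mono (hint n).norm (integrable_const (M ^ n / n ! : ℝ)) fun τ => ?_).trans
      (by simp)
    simp only
    rw [norm_div, norm_pow, Complex.norm_natCast]
    gcongr
    exact hVM τ
  have hsum : Summable fun n : ℕ => ∫ τ, ‖V τ ^ n / (n ! : ℂ)‖ ∂P :=
    (summable_pow_div_factorial M).of_nonneg_of_le
      (fun n => integral_nonneg fun _ => norm_nonneg _) hbound
  constructor
  · refine hsum.of_nonneg_of_le (fun _ => norm_nonneg _) fun n => ?_
    rw [← hterm]
    exact norm_integral_le_integral_norm _
  · have h := hasSum_integral_of_summable_integral_norm hint hsum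
    simp only [hterm] at h
    have hexp : ∀ τ, ∑' i : ℕ, V τ ^ i / (i ! : ℂ) = Complex.exp (V τ) := fun τ => by
      rw [Complex.exp_eq_exp_ℂ, NormedSpace.exp_eq_tsum_div]
    simpa only [hexp] using h

/-- The cluster expansion of the logarithm of the partition function. -/
lemma integral_exp_eq_exp_tsum (hω' : Integrable ω' ν) (hω : Integrable ω ν)
    (hωω' : ∀ y, ω y = ω' y * (exp (-(‖x y‖ ^ 2 / 2)) : ℝ))
    (hx : Continuous x) (hxx : ∀ y y', 0 ≤ inner ℝ (x y) (x y'))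
    (hX : Measurable fun q : Ω × Y => X q.1 q.2)
    (hchar : ∀ (n : ℕ) (y : Fin n → Y), ∫ τ, Complex.exp (Complex.I * ∑ i, (X τ (y i) : ℂ)) ∂P =
      (exp (-(‖∑ i, x (y i)‖ ^ 2 / 2)) : ℝ))
    (hsum : Summable fun k : ℕ => ((k : ℝ) + 1) * ‖clusterSum ν ω x k‖) :
    ∫ τ, Complex.exp (∫ y, ω' y * Complex.exp (Complex.I * (X τ y : ℂ)) ∂ν) ∂P =
      Complex.exp (∑' k, clusterSum ν ω x k) := by
  obtain ⟨h1, h2⟩ := hasSum_boltzSum hω' hωω' hX hchar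
  rw [← h2.tsum_eq]
  exact tsum_eq_exp_of_recursion (boltzSum_zero 0) (succ_mul_boltzSum_eq_sum hω hx hxx) hsum h1

open scoped Classical in
/-- The coefficients of the cluster expansion as sums over trees. -/
lemma clusterSum_eq_sum_trees {𝕜 : Type*} [RCLike 𝕜] {ω : Y → 𝕜} (hω : Integrable ω ν)
    (hx : Continuous x) (hxx : ∀ y y', 0 ≤ inner ℝ (x y) (x y'))
    (htree : ∀ (N : ℕ) (T : SimpleGraph (Fin (N + 1))), T.IsTree →
      Integrable (fun y : Fin (N + 1) → Y => (∏ i, ω (y i)) * (treeWeight (x ∘ y) T : ℝ))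
        (Measure.pi fun _ => ν)) (N : ℕ) :
    clusterSum ν ω x N = ((N + 1)! : 𝕜)⁻¹ * ∑ T : SimpleGraph (Fin (N + 1)) with T.IsTree,
      (-1) ^ N * ∫ y : Fin (N + 1) → Y, (∏ i, ω (y i)) * (treeWeight (x ∘ y) T : ℝ)
        ∂(Measure.pi fun _ => ν) := by
  have h := integral_finsetSum (μ := Measure.pi fun _ : Fin (N + 1) => ν)
    (univ.filter fun T : SimpleGraph (Fin (N + 1)) => T.IsTree)
    (f := fun T y => (∏ i, ω (y i)) * ((treeWeight (x ∘ y) T : ℝ) : 𝕜))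
    fun T hT => htree N T (mem_filter.1 hT).2
  rw [clusterSum, ← mul_sum, ← h]
  refine congrArg (((N + 1)! : 𝕜)⁻¹ * ·) ?_
  rw [← integral_const_mul]
  refine integral_congr_ae (.of_forall fun y => ?_)
  simp only
  rw [← mul_sum, ← RCLike.ofReal_sum, sum_treeWeight]
  push_cast
  rw [mul_left_comm, ← mul_assoc ((-1 : 𝕜) ^ N), ← mul_pow]
  simp

end GaussianGas

/-! ### Closed modes and summability of products of propagators -/

section Lattice

open Finset

/-- The closed modes are parametrized by two successive components. -/
def modeChart (i : Fin 3) : ClosedMode ≃ ℤ × ℤ where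
  toFun p := (p.1 i, p.1 (i + 1))
  invFun ab := ⟨fun j => if j = i then ab.1 else if j = i + 1 then ab.2 else -ab.1 - ab.2, by
    fin_cases i <;> simp [Fin.sum_univ_three] <;> ring⟩
  left_inv p := by
    have h := p.2
    rw [Fin.sum_univ_three] at h
    ext j
    fin_cases i <;> fin_cases j <;> simp <;> omega
  right_inv ab := by
    fin_cases i <;> simp

lemma modeChart_symm_apply (i : Fin 3) (ab : ℤ × ℤ) : ((modeChart i).symm ab).1 i = ab.1 := by
  simp [modeChart]

/-- The squared length as a quadratic form in two components. -/
def quadForm (a b : ℤ) : ℝ := (a : ℝ) ^ 2 + (b : ℝ) ^ 2 + ((a : ℝ) + b) ^ 2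

lemma sqNorm_eq_quadForm (i : Fin 3) (p : ClosedMode) :
    sqNorm p.1 = quadForm (p.1 i) (p.1 (i + 1)) := by
  have h := p.2
  rw [Fin.sum_univ_three] at h
  have h' : (p.1 0 : ℝ) + p.1 1 + p.1 2 = 0 := by exact_mod_cast h
  unfold sqNorm quadForm
  rw [Fin.sum_univ_three]
  fin_cases i
  · simp only [Fin.zero_eta, Fin.isValue, zero_add]
    rw [show (p.1 2 : ℝ) = -(p.1 0 + p.1 1) by linarith]; ring
  · simp only [Fin.mk_one, Fin.isValue, Fin.reduceAdd]
    rw [show (p.1 0 : ℝ) = -(p.1 1 + p.1 2) by linarith]; ring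
  · simp only [Fin.reduceFinMk, Fin.isValue, Fin.reduceAdd]
    rw [show (p.1 1 : ℝ) = -(p.1 2 + p.1 0) by linarith]; ring

variable {m : ℝ}
  {r : ℝ}

lemma sqNorm_nonneg (p : Mode) : 0 ≤ sqNorm p := sum_nonneg fun _ _ => sq_nonneg _

lemma sq_le_sqNorm (p : Mode) (i : Fin 3) : (p i : ℝ) ^ 2 ≤ sqNorm p :=
  single_le_sum (f := fun i => (p i : ℝ) ^ 2) (fun _ _ => sq_nonneg _) (mem_univ i)

lemma C0_pos (hm : 0 < m) (p : Mode) : 0 < C0 m p := by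
  have := sqNorm_nonneg p
  unfold C0; positivity

/-- The constant in the power bounds of the propagator. -/
def latticeConst (m : ℝ) : ℝ := min 1 (m ^ 2) / 2

lemma latticeConst_pos (hm : 0 < m) : 0 < latticeConst m := by
  unfold latticeConst; positivity

lemma latticeConst_mul_le (p : Mode) (hr0 : 0 ≤ r)
    (hr : r ^ 2 ≤ sqNorm p) : latticeConst m * (1 + r) ^ 2 ≤ sqNorm p + m ^ 2 := by
  unfold latticeConst
  have h1 : min 1 (m ^ 2) ≤ 1 := min_le_left _ _
  have h2 : min 1 (m ^ 2) ≤ m ^ 2 := min_le_right _ _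
  have h3 : 0 ≤ min 1 (m ^ 2) := by positivity
  have h4 : (1 + r) ^ 2 ≤ 2 * (1 + r ^ 2) := by nlinarith [sq_nonneg (1 - r)]
  nlinarith [sq_nonneg r]

lemma abs_le_of_sq (p : Mode) (i : Fin 3) : (|(p i : ℝ)|) ^ 2 ≤ sqNorm p := by
  rw [sq_abs]; exact sq_le_sqNorm p i

/-- A summable majorant of the square root of the propagator correlations. -/
def powerWeight (i : Fin 3) (p : ClosedMode) : ℝ :=
  (1 + |(p.1 i : ℝ)|) ^ (-(3 / 5 : ℝ)) * (1 + |(p.1 (i + 1) : ℝ)|) ^ (-(11 / 10 : ℝ))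

lemma powerWeight_nonneg (i : Fin 3) (p : ClosedMode) : 0 ≤ powerWeight i p := by
  unfold powerWeight; positivity

/-- The denominator is split with exponents 3/20 + 3/10 + 11/20 = 1 among three quadratic lower
bounds, by `r`, by `p i` and by `p (i + 1)`, which gives powers 3/10, 3/5 and 11/10. For two modes
sharing component `i`, the shared one gets 6/5 > 1 and each free one 11/10 > 1, so the pair sum
converges. The spare 3/10 becomes decay 3/5 of a variance and 6/5 > 1 of a fourth moment. -/
lemma C0_le_powerWeight (hm : 0 < m) (i : Fin 3) (p : ClosedMode) (hr0 : 0 ≤ r)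
    (hr : r ^ 2 ≤ sqNorm p.1) :
    C0 m p.1 ≤ (latticeConst m)⁻¹ * (1 + r) ^ (-(3 / 10 : ℝ)) * powerWeight i p := by
  have hc := latticeConst_pos hm
  have key : ∀ {s : ℝ}, 0 ≤ s → s ^ 2 ≤ sqNorm p.1 → ∀ {e : ℝ}, 0 < e →
      ((latticeConst m) * (1 + s) ^ (2 : ℝ)) ^ e ≤ (sqNorm p.1 + m ^ 2) ^ e := by
    intro s hs hs2 e he
    refine rpow_le_rpow (by positivity) ?_ he.le
    rw [rpow_two]
    exact latticeConst_mul_le p.1 hs hs2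
  have hD : 0 < sqNorm p.1 + m ^ 2 := by have := sqNorm_nonneg p.1; positivity
  have k1 := key hr0 hr (e := 3 / 20) (by norm_num)
  have k2 := key (abs_nonneg _) (abs_le_of_sq p.1 i) (e := 3 / 10) (by norm_num)
  have k3 := key (abs_nonneg _) (abs_le_of_sq p.1 (i + 1)) (e := 11 / 20) (by norm_num)
  have hprod := mul_le_mul (mul_le_mul k1 k2 (by positivity) (by positivity)) k3
    (by positivity) (by positivity)
  rw [← rpow_add hD, ← rpow_add hD,
    show (3 / 20 + 3 / 10 + 11 / 20 : ℝ) = 1 by norm_num, rpow_one] at hprod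
  rw [mul_rpow hc.le (by positivity), mul_rpow hc.le (by positivity),
    mul_rpow hc.le (by positivity), ← rpow_mul (by positivity),
    ← rpow_mul (by positivity), ← rpow_mul (by positivity)] at hprod
  set A := (1 + r) with hA
  set B := (1 + |(p.1 i : ℝ)|) with hB
  set E := (1 + |(p.1 (i + 1) : ℝ)|) with hE
  have hA0 : 0 < A := by positivity
  have hB0 : 0 < B := by positivity
  have hE0 : 0 < E := by positivity
  norm_num at hprod
  have hcc : latticeConst m ^ (3 / 20 : ℝ) * latticeConst m ^ (3 / 10 : ℝ) *
      latticeConst m ^ (11 / 20 : ℝ) = latticeConst m := by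
    rw [← rpow_add hc, ← rpow_add hc]; norm_num
  have hprod' : latticeConst m * (A ^ (3 / 10 : ℝ) * B ^ (3 / 5 : ℝ) * E ^ (11 / 10 : ℝ)) ≤
      sqNorm p.1 + m ^ 2 := by
    calc latticeConst m * (A ^ (3 / 10 : ℝ) * B ^ (3 / 5 : ℝ) * E ^ (11 / 10 : ℝ)) =
        (latticeConst m ^ (3 / 20 : ℝ) * latticeConst m ^ (3 / 10 : ℝ) *
          latticeConst m ^ (11 / 20 : ℝ)) *
          (A ^ (3 / 10 : ℝ) * B ^ (3 / 5 : ℝ) * E ^ (11 / 10 : ℝ)) := by rw [hcc]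
      _ ≤ _ := le_trans (le_of_eq (by ring)) hprod
  unfold C0 powerWeight
  rw [rpow_neg hA0.le, rpow_neg hB0.le, rpow_neg hE0.le, ← mul_inv, ← mul_inv, ← mul_inv, one_div]
  refine inv_anti₀ (by positivity) (le_trans (le_of_eq ?_) hprod')
  ring

lemma summable_one_add_abs_rpow {e : ℝ} (he : 1 < e) :
    Summable fun a : ℤ => (1 + |(a : ℝ)|) ^ (-e) := by
  have h := summable_abs_int_rpow he
  have h0 : Summable fun a : ℤ => (if a = 0 then 1 else 0 : ℝ) + |(a : ℝ)| ^ (-e) :=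
    (summable_of_finite_support ((Set.finite_singleton (0 : ℤ)).subset (by
      intro a ha; by_contra h; simp at h; simp [h] at ha))).add h
  refine h0.of_nonneg_of_le (fun a => by positivity) fun a => ?_
  by_cases ha : a = 0
  · subst ha
    simp only [Int.cast_zero, abs_zero, add_zero, one_rpow, if_true]
    have : (0 : ℝ) ≤ 0 ^ (-e) := by positivity
    linarith
  · rw [if_neg ha, zero_add]
    have : 0 < |(a : ℝ)| := by positivity
    exact rpow_le_rpow_of_nonpos this (by linarith) (by linarith)

/-- Pairs sharing component `i` are parametrized by that component and one further component of each
mode; the sum is then a product of three convergent ones. -/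
lemma summable_powerWeight_pairs (i : Fin 3) : Summable fun q : ClosedMode × ClosedMode =>
    if q.1.1 i = q.2.1 i then powerWeight i q.1 * powerWeight i q.2 else 0 := by
  let e : ℤ × ℤ × ℤ → ClosedMode × ClosedMode := fun t =>
    ((modeChart i).symm (t.1, t.2.1), (modeChart i).symm (t.1, t.2.2))
  have he : Function.Injective e := by
    rintro ⟨a, b, b'⟩ ⟨c, d, d'⟩ h
    simp only [e, Prod.mk.injEq, EmbeddingLike.apply_eq_iff_eq] at h
    simp [h]
  rw [← he.summable_iff]
  · have h1 := summable_one_add_abs_rpow (e := 6 / 5) (by norm_num)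
    have h2 := summable_one_add_abs_rpow (e := 11 / 10) (by norm_num)
    have h3 := h1.mul_of_nonneg (h2.mul_of_nonneg h2 (fun _ => by positivity)
      (fun _ => by positivity)) (fun _ => by positivity) (fun _ => by positivity)
    refine h3.congr fun t => ?_
    have hi : ∀ ab : ℤ × ℤ, ((modeChart i).symm ab).1 i = ab.1 := modeChart_symm_apply i
    have hi' : ∀ ab : ℤ × ℤ, ((modeChart i).symm ab).1 (i + 1) = ab.2 := by
      intro ab
      have := (modeChart i).apply_symm_apply ab
      exact congrArg Prod.snd this
    simp only [Function.comp, e, hi, powerWeight, hi', if_true]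
    have : (1 + |(t.1 : ℝ)|) ^ (-(6 / 5 : ℝ)) = (1 + |(t.1 : ℝ)|) ^ (-(3 / 5 : ℝ)) *
        (1 + |(t.1 : ℝ)|) ^ (-(3 / 5 : ℝ)) := by
      rw [← rpow_add (by positivity)]; norm_num
    rw [this]; ring
  · rintro ⟨p, r⟩ hpr
    rw [if_neg]
    intro h
    refine hpr ⟨(p.1 i, p.1 (i + 1), r.1 (i + 1)), ?_⟩
    simp only at h
    simp only [e, Prod.mk.injEq]
    refine ⟨(modeChart i).symm_apply_apply p, ?_⟩
    rw [h]
    exact (modeChart i).symm_apply_apply r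

lemma sharedModes_eq_sum (p q : Mode) :
    (sharedModes p q : ℝ) = ∑ i, if p i = q i then (1 : ℝ) else 0 := by
  simp [sharedModes]

lemma summable_shared_of_le {g : ClosedMode → ℝ} (hg0 : ∀ p, 0 ≤ g p) {C : ℝ}
    (hg : ∀ i p, g p ≤ C * powerWeight i p) :
    Summable (fun q : ClosedMode × ClosedMode => (sharedModes q.1.1 q.2.1 : ℝ) * (g q.1 * g q.2)) ∧
    ∑' q : ClosedMode × ClosedMode, (sharedModes q.1.1 q.2.1 : ℝ) * (g q.1 * g q.2) ≤
      C ^ 2 * ∑' q : ClosedMode × ClosedMode, ∑ i,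
        if q.1.1 i = q.2.1 i then powerWeight i q.1 * powerWeight i q.2 else 0 := by
  have hs : Summable fun q : ClosedMode × ClosedMode => ∑ i,
        if q.1.1 i = q.2.1 i then powerWeight i q.1 * powerWeight i q.2 else 0 :=
    summable_sum fun i _ => summable_powerWeight_pairs i
  have hle : ∀ q : ClosedMode × ClosedMode, (sharedModes q.1.1 q.2.1 : ℝ) * (g q.1 * g q.2) ≤
      C ^ 2 * ∑ i, if q.1.1 i = q.2.1 i then powerWeight i q.1 * powerWeight i q.2 else 0 := by
    intro q
    rw [sharedModes_eq_sum, sum_mul, mul_sum]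
    refine sum_le_sum fun i _ => ?_
    split_ifs
    · rw [one_mul]
      calc g q.1 * g q.2 ≤ (C * powerWeight i q.1) * (C * powerWeight i q.2) :=
            mul_le_mul (hg i _) (hg i _) (hg0 _) ((hg0 _).trans (hg i _))
        _ = _ := by ring
    · simp
  have h0 : ∀ q : ClosedMode × ClosedMode, 0 ≤ (sharedModes q.1.1 q.2.1 : ℝ) * (g q.1 * g q.2) :=
    fun q => mul_nonneg (Nat.cast_nonneg _) (mul_nonneg (hg0 _) (hg0 _))
  have h1 := (hs.mul_left (C ^ 2)).of_nonneg_of_le h0 hle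
  exact ⟨h1, (h1.tsum_le_tsum hle (hs.mul_left _)).trans (le_of_eq tsum_mul_left)⟩

lemma summable_shared_C0 (hm : 0 < m) : Summable fun q : ClosedMode × ClosedMode =>
    (sharedModes q.1.1 q.2.1 : ℝ) * (C0 m q.1.1 * C0 m q.2.1) :=
  (summable_shared_of_le (g := fun p => C0 m p.1) (fun p => (C0_pos hm _).le)
    (C := (latticeConst m)⁻¹) fun i p => by
      simpa using C0_le_powerWeight hm i p (r := 0) le_rfl (by simpa using sqNorm_nonneg _)).1

lemma summable_shared_right (hm : 0 < m) (p : ClosedMode) :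
    Summable fun r : ClosedMode => (sharedModes p.1 r.1 : ℝ) * C0 m r.1 := by
  have h := (summable_shared_C0 hm).comp_injective (i := fun r : ClosedMode => (p, r))
    (fun r r' h => (Prod.mk.inj h).2)
  refine (h.mul_left (C0 m p.1)⁻¹).congr fun r => ?_
  have := (C0_pos hm p.1).ne'
  simp only [Function.comp]
  field_simp

lemma sharedModes_self (p : Mode) : sharedModes p p = 3 := by simp [sharedModes]

lemma sharedModes_le (p q : Mode) : sharedModes p q ≤ 3 :=
  (card_filter_le _ _).trans (by simp)

lemma summable_C0_sq (hm : 0 < m) : Summable fun p : ClosedMode => C0 m p.1 ^ 2 := by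
  have h := (summable_shared_C0 hm).comp_injective (i := fun r : ClosedMode => (r, r))
    (fun r r' h => (Prod.mk.inj h).2)
  refine (h.mul_left (1 / 3)).congr fun r => ?_
  simp only [Function.comp, sharedModes_self]
  push_cast; ring

end Lattice

/-! ### Sums of the propagator over modes with a given component -/

section Fibers

open Finset

variable {m : ℝ}

/-- Half of the sum of the propagators of the nonzero modes with one vanishing component. -/
def halfAxisSum (m : ℝ) : ℝ := ∑' n : ℕ, 1 / (2 * ((n : ℝ) + 1) ^ 2 + m ^ 2)

lemma halfAxisTerm_le (m : ℝ) (n : ℕ) :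
    1 / (2 * ((n : ℝ) + 1) ^ 2 + m ^ 2) ≤ 1 / 2 * (1 / ((n + 1 : ℕ) : ℝ) ^ 2) := by
  rw [one_div_mul_one_div]
  push_cast
  gcongr
  nlinarith [sq_nonneg m]

lemma hasSum_zeta_two_succ : HasSum (fun n : ℕ => 1 / 2 * (1 / ((n + 1 : ℕ) : ℝ) ^ 2))
    (π ^ 2 / 12) := by
  have h := (hasSum_nat_add_iff' 1).2 hasSum_zeta_two
  simp only [range_one, sum_singleton, Nat.cast_zero, ne_eq, OfNat.ofNat_ne_zero,
    not_false_eq_true, zero_pow, div_zero, sub_zero] at h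
  have := h.mul_left (1 / 2)
  rwa [show π ^ 2 / 12 = 1 / 2 * (π ^ 2 / 6) by ring]

lemma summable_halfAxis (m : ℝ) : Summable fun n : ℕ => 1 / (2 * ((n : ℝ) + 1) ^ 2 + m ^ 2) :=
  hasSum_zeta_two_succ.summable.of_nonneg_of_le (fun n => by positivity) (halfAxisTerm_le m)

lemma halfAxisSum_nonneg (m : ℝ) : 0 ≤ halfAxisSum m := tsum_nonneg fun n => by positivity

lemma halfAxisSum_le (m : ℝ) : halfAxisSum m ≤ 0.8225 := by
  have h1 : halfAxisSum m ≤ π ^ 2 / 12 := by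
    rw [← hasSum_zeta_two_succ.tsum_eq]
    exact (summable_halfAxis m).tsum_le_tsum (halfAxisTerm_le m) hasSum_zeta_two_succ.summable
  have h2 := pi_lt_d4
  have h3 := pi_pos
  nlinarith

/-- The sum of the propagators with a given component. -/
def fiberSum (m : ℝ) (i : Fin 3) (a : ℤ) : ℝ := ∑' p : ClosedMode, if p.1 i = a then C0 m p.1 else 0

lemma summable_fiber (hm : 0 < m) (i : Fin 3) (a : ℤ) :
    Summable fun p : ClosedMode => if p.1 i = a then C0 m p.1 else 0 := by
  have h := summable_shared_right hm ((modeChart i).symm (a, 0))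
  refine h.of_nonneg_of_le (fun p => ?_) fun p => ?_
  · split_ifs
    exacts [(C0_pos hm _).le, le_rfl]
  · have hp := (C0_pos hm p.1).le
    split_ifs with hi
    · refine le_mul_of_one_le_left hp ?_
      have : 1 ≤ sharedModes ((modeChart i).symm (a, 0)).1 p.1 := by
        unfold sharedModes
        refine card_pos.2 ⟨i, ?_⟩
        simp [modeChart_symm_apply, hi]
      exact_mod_cast this
    · positivity

lemma C0_chart (i : Fin 3) (a b : ℤ) :
    C0 m ((modeChart i).symm (a, b)).1 = 1 / (quadForm a b + m ^ 2) := by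
  have h := (modeChart i).apply_symm_apply (a, b)
  have h1 : ((modeChart i).symm (a, b)).1 i = a := congrArg Prod.fst h
  have h2 : ((modeChart i).symm (a, b)).1 (i + 1) = b := congrArg Prod.snd h
  rw [C0, sqNorm_eq_quadForm i, h1, h2]

lemma fiberSum_eq (hm : 0 < m) (i : Fin 3) (a : ℤ) :
    HasSum (fun b : ℤ => 1 / (quadForm a b + m ^ 2)) (fiberSum m i a) := by
  have hinj : Function.Injective fun b : ℤ => (modeChart i).symm (a, b) := fun b b' h => by
    simpa using h
  have h : HasSum _ (fiberSum m i a) := (summable_fiber hm i a).hasSum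
  rw [← hinj.hasSum_iff] at h
  · simpa [Function.comp_def, modeChart_symm_apply, C0_chart] using h
  · intro p hp
    rw [if_neg]
    intro h
    refine hp ⟨p.1 (i + 1), ?_⟩
    simp only [← h]
    exact (modeChart i).symm_apply_apply p

lemma fiberSum_zero (hm : 0 < m) (i : Fin 3) :
    fiberSum m i 0 = 1 / m ^ 2 + 2 * halfAxisSum m := by
  have h1 : HasSum _ (halfAxisSum m) := (summable_halfAxis m).hasSum
  have h2 : HasSum (fun n : ℕ => 1 / (2 * (n : ℝ) ^ 2 + m ^ 2)) (halfAxisSum m + 1 / m ^ 2) := by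
    rw [← hasSum_nat_add_iff' 1]
    simpa using! h1
  have h3 := HasSum.of_nat_of_neg_add_one (f := fun b : ℤ => 1 / (quadForm 0 b + m ^ 2))
    (m := halfAxisSum m + 1 / m ^ 2) (m' := halfAxisSum m) ?_ ?_
  · rw [(fiberSum_eq hm i 0).unique h3]; ring
  · convert h2 using 3 with n
    unfold quadForm; push_cast; ring
  · convert h1 using 3 with n
    unfold quadForm; push_cast; ring

/-- The form is symmetric in `b` about `-a/2`, so each fiber is counted from there in both
directions; a nonzero `a` adds at least `2` to the minimum. -/
lemma quadForm_shift (a : ℤ) (ha : a ≠ 0) (n : ℕ) :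
    2 * (n : ℝ) ^ 2 + 2 ≤ quadForm a (n - a / 2) ∧
      2 * (n : ℝ) ^ 2 + 2 ≤ quadForm a (-(n + 1) - a / 2) := by
  have key : ∀ b : ℤ, 2 * (n : ℤ) ^ 2 + 2 ≤ a ^ 2 + b ^ 2 + (a + b) ^ 2 →
      2 * (n : ℝ) ^ 2 + 2 ≤ quadForm a b := by
    intro b h
    unfold quadForm
    exact_mod_cast h
  have hn : (0 : ℤ) ≤ n := Int.natCast_nonneg n
  obtain ⟨k, hk | hk⟩ := Int.even_or_odd' a
  · have hk0 : k ≠ 0 := by rintro rfl; exact ha (by simpa using hk)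
    have hk2 : a / 2 = k := by omega
    have hk1 : 1 ≤ k ^ 2 := by have := sq_pos_of_ne_zero hk0; omega
    constructor <;> apply key <;> rw [hk2, hk] <;> nlinarith
  · have hk2 : a / 2 = k := by omega
    have hk1 : 0 ≤ k * (k + 1) := by
      rcases le_or_gt 0 k with h | h
      · positivity
      · nlinarith
    constructor <;> apply key <;> rw [hk2, hk] <;> nlinarith

lemma fiberSum_le (hm : 0 < m) (i : Fin 3) {a : ℤ} (ha : a ≠ 0) :
    fiberSum m i a ≤ 2 / (2 + m ^ 2) + 2 * halfAxisSum m := by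
  have h := fiberSum_eq hm i a
  rw [← (Equiv.subRight (a / 2)).hasSum_iff] at h
  have hs := h.summable
  have hn : Summable fun n : ℕ => 1 / (quadForm a (n - a / 2) + m ^ 2) :=
    hs.comp_injective Nat.cast_injective
  have hn' : Summable fun n : ℕ => 1 / (quadForm a (-(n + 1) - a / 2) + m ^ 2) :=
    hs.comp_injective (i := fun n : ℕ => -((n : ℤ) + 1)) (fun x y h => by simpa using h)
  have h3 := HasSum.of_nat_of_neg_add_one
    (f := (fun b : ℤ => 1 / (quadForm a b + m ^ 2)) ∘ (Equiv.subRight (a / 2)))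
    hn.hasSum hn'.hasSum
  rw [h.unique h3]
  have h4 : HasSum (fun n : ℕ => if n = 0 then 1 / (2 + m ^ 2) else
      1 / (2 * (n : ℝ) ^ 2 + m ^ 2)) (halfAxisSum m + 1 / (2 + m ^ 2)) := by
    rw [← hasSum_nat_add_iff' 1]
    have h1 : HasSum _ (halfAxisSum m) := (summable_halfAxis m).hasSum
    simpa using! h1
  have hb : ∀ (n : ℕ) (D : ℝ), 2 * (n : ℝ) ^ 2 + 2 ≤ D → 1 / (D + m ^ 2) ≤
      if n = 0 then 1 / (2 + m ^ 2) else 1 / (2 * (n : ℝ) ^ 2 + m ^ 2) := by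
    intro n D hD
    split_ifs with h0
    · subst h0
      have : (2 : ℝ) ≤ D := by simpa using hD
      gcongr
    · have : (0 : ℝ) < 2 * (n : ℝ) ^ 2 := by positivity
      gcongr
      linarith
  have h5 := hn.tsum_le_tsum (fun n => hb n _ (quadForm_shift a ha n).1) h4.summable
  have h6 := hn'.tsum_le_tsum (fun n => hb n _ (quadForm_shift a ha n).2) h4.summable
  rw [h4.tsum_eq] at h5 h6
  have : 2 / (2 + m ^ 2) = 2 * (1 / (2 + m ^ 2)) := by ring
  linarith

lemma K2_eq (hm : 0 < m) : K2 m = 1 / m ^ 2 + 2 * halfAxisSum m := by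
  rw [← fiberSum_zero hm 0, K2, fiberSum]
  refine (tsum_subtype {p : ClosedMode | p.1 0 = 0} (fun p : ClosedMode => C0 m p.1)).trans ?_
  refine tsum_congr fun p => ?_
  simp [Set.indicator]

lemma le_K1 (hm : 0 < m) : 1 / (m ^ 2) ^ 2 ≤ K1 m := by
  have h := (summable_C0_sq hm).le_tsum ⟨0, by simp⟩ fun _ _ => sq_nonneg _
  refine le_trans (le_of_eq ?_) h
  simp [C0, sqNorm]

lemma K1_pos (hm : 0 < m) : 0 < K1 m := lt_of_lt_of_le (by positivity) (le_K1 hm)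

/-- The true value is about 12.90. The rounded bound 12.8 suffices both for the supersolution and
for the exponential moments of the quadratic part of the potential. -/
lemma le_knum_const : (12.8 : ℝ) ≤ 12 * √(π / exp 1) := by
  have h1 : (12.8 / 12 : ℝ) ≤ √(π / exp 1) := by
    refine le_sqrt_of_sq_le ?_
    rw [le_div_iff₀ (exp_pos 1)]
    have := exp_one_lt_d9
    have := pi_gt_d4
    norm_num at *
    linarith
  linarith

lemma max_K_pos (hm : 0 < m) : 0 < max (K1 m) (K2 m) := lt_max_of_lt_left (K1_pos hm)

lemma le_Knum (hm : 0 < m) : 12.8 * max (K1 m) (K2 m) ≤ Knum m :=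
  mul_le_mul_of_nonneg_right le_knum_const (max_K_pos hm).le

lemma Knum_pos (hm : 0 < m) : 0 < Knum m :=
  lt_of_lt_of_le (mul_pos (by norm_num) (max_K_pos hm)) (le_Knum hm)

/-- Used with y = m², s = 2 `halfAxisSum m` ≤ π²/6 rounded up, and M = max(K₁, K₂). For small mass
the bound 1/y² ≤ M from K₁ decides, otherwise 1/y + s ≤ M from K₂. -/
lemma zero_mode_inequality {y s M : ℝ} (hy : 0 < y) (hs0 : 0 ≤ s) (hs : s ≤ 1.645)
    (h1 : 1 / y + s ≤ M) (h2 : 1 / y ^ 2 ≤ M) :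
    2 * (1 / y) * (3.9 * s) * 9 ≤ 12.8 * M * 5 := by
  have h1' : 1 + y * s ≤ y * M := by
    have := mul_le_mul_of_nonneg_left h1 hy.le
    rw [mul_add, mul_one_div_cancel hy.ne'] at this
    exact this
  have h2' : 1 ≤ y ^ 2 * M := by
    rwa [div_le_iff₀ (by positivity), mul_comm] at h2
  have key : 70.2 * s ≤ 64 * (y * M) := by
    rcases le_or_gt y 0.55 with h | h
    · have : 1 ≤ 0.55 * (y * M) := by nlinarith
      nlinarith
    · nlinarith
  rw [show 2 * (1 / y) * (3.9 * s) * 9 = 70.2 * s / y by ring, div_le_iff₀ hy]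
  linarith

/-- The same substitution and the same alternative between K₁ and K₂, for the modes other than zero.
-/
lemma nonzero_mode_inequality {y s M : ℝ} (hy : 0 < y) (hs0 : 0 ≤ s) (hs : s ≤ 1.645)
    (h1 : 1 / y + s ≤ M) (h2 : 1 / y ^ 2 ≤ M) :
    2 * (2.25 / y + 3.9 * s + 5.55 / (2 + y)) * 13 ≤ 12.8 * M * 3 * (2 + y) := by
  rcases le_or_gt y 0.4 with h | h
  · refine le_trans ?_ (mul_le_mul_of_nonneg_right (mul_le_mul_of_nonneg_right
      (mul_le_mul_of_nonneg_left h2 (by norm_num)) (by norm_num)) (by positivity))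
    have e1 : 5.55 / (2 + y) ≤ 2.8 := by rw [div_le_iff₀ (by positivity)]; linarith
    have e2 : 2 * (2.25 / y + 3.9 * s + 5.55 / (2 + y)) * 13 ≤
      2 * (2.25 / y + 3.9 * 1.645 + 2.8) * 13 := by gcongr
    refine e2.trans ?_
    rw [show (12.8 : ℝ) * (1 / y ^ 2) * 3 * (2 + y) = 38.4 * (2 + y) / y ^ 2 by ring,
      le_div_iff₀ (by positivity)]
    have e3 : 2 * (2.25 / y + 3.9 * 1.645 + 2.8) * 13 * y ^ 2 =
      26 * (2.25 * y + 9.2155 * y ^ 2) := by field_simp; ring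
    rw [e3]
    nlinarith
  · refine le_trans ?_ (mul_le_mul_of_nonneg_right (mul_le_mul_of_nonneg_right
      (mul_le_mul_of_nonneg_left h1 (by norm_num)) (by norm_num)) (by positivity))
    rw [show (12.8 : ℝ) * (1 / y + s) * 3 * (2 + y) = 76.8 / y + 38.4 + 76.8 * s + 38.4 * y * s by
      field_simp; ring]
    have e1 : 144.3 / (2 + y) ≤ 38.4 + 18.3 / y + (38.4 * y - 24.6) * s := by
      rw [div_le_iff₀ (by positivity)]
      rcases le_or_gt y 0.65 with h' | h'
      · have hb : (38.4 * y - 24.6) * 1.645 - 0.6 ≤ (38.4 * y - 24.6) * s := by nlinarith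
        rcases le_or_gt y 0.45 with h'' | h''
        · have hc : 40.6 ≤ 18.3 / y := by rw [le_div_iff₀ hy]; linarith
          nlinarith
        · rcases le_or_gt y 0.55 with h3 | h3
          · have hc : 33.2 ≤ 18.3 / y := by rw [le_div_iff₀ hy]; linarith
            nlinarith
          · have hc : 28.1 ≤ 18.3 / y := by rw [le_div_iff₀ hy]; linarith
            nlinarith
      · have hb : 0 ≤ (38.4 * y - 24.6) * s := mul_nonneg (by linarith) hs0
        have hc : 18.3 / y * (2 + y) = 36.6 / y + 18.3 := by field_simp; ring
        have hd : 0 < 36.6 / y := by positivity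
        have he : 36.6 / y * y = 36.6 := by field_simp
        have hf : 70 ≤ 36.6 / y + 38.4 * y := by
          rw [← sub_nonneg, show 36.6 / y + 38.4 * y - 70 = (36.6 + 38.4 * y ^ 2 - 70 * y) / y by
            field_simp]
          refine div_nonneg ?_ hy.le
          nlinarith [sq_nonneg (y - 0.95)]
        nlinarith
    have e2 : 2 * (2.25 / y + 3.9 * s + 5.55 / (2 + y)) * 13 =
      58.5 / y + 101.4 * s + 144.3 / (2 + y) := by ring
    have e3 : 76.8 / y = 58.5 / y + 18.3 / y := by ring
    rw [e2, e3]
    linarith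

end Fibers

/-! ### The rates of the supersolution -/

section FugacityWeights

open Finset

variable {m : ℝ}
  {κ : ℝ} {p : ClosedMode}

/-- The rates of the supersolution, in units of the propagator. -/
def rateWeight (m κ : ℝ) (p : ClosedMode) : ℝ :=
  (if p.1 = 0 then 9 / 4 else 13 / 10) * C0 m p.1 / κ

/-- The total rate that the other modes exert on a mode. -/
def neighbourRate (m κ : ℝ) (p : ClosedMode) : ℝ :=
  ∑' r : ClosedMode, if r = p then 0 else 2 * (sharedModes p.1 r.1 : ℝ) * rateWeight m κ r

lemma rateWeight_pos (hm : 0 < m) (hκ : 0 < κ) (p : ClosedMode) :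
    0 < rateWeight m κ p := by
  have := C0_pos hm p.1
  unfold rateWeight
  split_ifs <;> positivity

lemma rateWeight_le (hm : 0 < m) (hκ : 0 < κ) (p : ClosedMode) :
    rateWeight m κ p ≤ 9 / 4 / κ * C0 m p.1 := by
  have := C0_pos hm p.1
  unfold rateWeight
  rw [mul_div_assoc, div_mul_eq_mul_div, mul_div_assoc]
  gcongr
  split_ifs <;> norm_num

lemma summable_shared_rateWeight (hm : 0 < m) (hκ : 0 < κ) (p : ClosedMode) :
    Summable fun r : ClosedMode => 2 * (sharedModes p.1 r.1 : ℝ) * rateWeight m κ r := by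
  refine ((summable_shared_right hm p).mul_left (2 * (9 / 4 / κ))).of_nonneg_of_le (fun r => ?_)
    fun r => ?_
  · have := (rateWeight_pos hm hκ r).le
    positivity
  · calc 2 * (sharedModes p.1 r.1 : ℝ) * rateWeight m κ r
        ≤ 2 * (sharedModes p.1 r.1 : ℝ) * (9 / 4 / κ * C0 m r.1) := by
          gcongr; exact rateWeight_le hm hκ r
      _ = _ := by ring

lemma summable_neighbourRate (hm : 0 < m) (hκ : 0 < κ) (p : ClosedMode) :
    Summable fun r : ClosedMode =>
      if r = p then 0 else 2 * (sharedModes p.1 r.1 : ℝ) * rateWeight m κ r := by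
  refine (summable_shared_rateWeight hm hκ p).of_nonneg_of_le (fun r => ?_) fun r => ?_
  all_goals
    have := (rateWeight_pos hm hκ r).le
    split_ifs <;> first | positivity | exact le_rfl

lemma neighbourRate_nonneg (hm : 0 < m) (hκ : 0 < κ) (p : ClosedMode) :
    0 ≤ neighbourRate m κ p := by
  refine tsum_nonneg fun r => ?_
  have := (rateWeight_pos hm hκ r).le
  split_ifs <;> positivity

/-- The contribution of a mode to the rate that the others exert on `p` through one component. -/
def neighbourTerm (m : ℝ) (i : Fin 3) (p r : ClosedMode) : ℝ :=
  if r = p then 0 else if p.1 i = r.1 i then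
    (if r.1 = 0 then 9 / 4 else 13 / 10) * C0 m r.1 else 0

/-- Up to the zero mode this is 13/10 times a fiber sum. The three cases are: the zero mode is `p`
itself and drops out, it is a neighbour through component `i` with the larger coefficient 9/4, or it
is absent. -/
lemma neighbour_fiber_le (hm : 0 < m) (i : Fin 3) (p : ClosedMode) :
    Summable (neighbourTerm m i p) ∧ ∑' r, neighbourTerm m i p r ≤
      if p.1 = 0 then 2.6 * halfAxisSum m else if p.1 i = 0 then
        2.25 / m ^ 2 + 2.6 * halfAxisSum m else 2.6 / (2 + m ^ 2) + 2.6 * halfAxisSum m := by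
  set z : ClosedMode := ⟨0, by simp⟩ with hz
  have hz0 : ∀ r : ClosedMode, r = z ↔ r.1 = 0 := fun r => by rw [hz, Subtype.ext_iff]
  have hC0 : C0 m z.1 = 1 / m ^ 2 := by simp [hz, C0, sqNorm]
  have hF := (summable_fiber hm i (p.1 i)).hasSum
  -- The correction at the zero mode to 13/10 times the fiber sum.
  set d : ℝ := if p.1 = 0 then -(13 / 10) * (1 / m ^ 2) else if p.1 i = 0 then
    (9 / 4 - 13 / 10) * (1 / m ^ 2) else 0 with hd
  have hsum := (hF.mul_left (13 / 10)).add (hasSum_ite_eq z d)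
  have hle : ∀ r, neighbourTerm m i p r ≤
      13 / 10 * (if r.1 i = p.1 i then C0 m r.1 else 0) + (if r = z then d else 0) := by
    intro r
    rw [neighbourTerm, hd]
    have hr := C0_pos hm r.1
    by_cases hrz : r = z
    · have hr0 := (hz0 r).1 hrz
      have hC : C0 m r.1 = 1 / m ^ 2 := by rw [hrz, hC0]
      have hri : r.1 i = 0 := by rw [hr0]; rfl
      rw [if_pos hrz, if_pos hr0]
      by_cases hp : p.1 = 0
      · have hrp : r = p := Subtype.ext (hr0.trans hp.symm)
        rw [if_pos hrp, if_pos hp, if_pos (by rw [hrp]), hC]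
        linarith
      · have hrp : r ≠ p := fun h => hp (h ▸ hr0)
        rw [if_neg hrp, if_neg hp]
        by_cases hpi : p.1 i = 0
        · rw [if_pos (hpi.trans hri.symm), if_pos (hri.trans hpi.symm), if_pos hpi, hC]
          linarith
        · rw [if_neg (fun h => hpi (h.trans hri)), if_neg (fun h => hpi (h.symm.trans hri)),
            if_neg hpi]
          simp
    · have hr0 : r.1 ≠ 0 := fun h => hrz ((hz0 r).2 h)
      simp only [hrz, hr0, if_false, add_zero]
      by_cases hrp : r = p
      · simp only [hrp, if_true]
        have := C0_pos hm p.1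
        positivity
      · simp only [hrp, if_false, eq_comm]
        split_ifs <;> simp
  have hs := hsum.summable.of_nonneg_of_le (fun r => ?_) hle
  swap
  · have := C0_pos hm r.1
    unfold neighbourTerm
    split_ifs <;> positivity
  refine ⟨hs, (hs.tsum_le_tsum hle hsum.summable).trans ?_⟩
  rw [hsum.tsum_eq]
  change 13 / 10 * fiberSum m i (p.1 i) + d ≤ _
  rw [hd]
  split_ifs with h1 h2
  · rw [h1, Pi.zero_apply, fiberSum_zero hm i]; linarith
  · rw [h2, fiberSum_zero hm i]
    have : 2.25 / m ^ 2 = 2.25 * (1 / m ^ 2) := by ring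
    linarith
  · have h3 := fiberSum_le hm i h2
    have : 2.6 / (2 + m ^ 2) = 13 / 10 * (2 / (2 + m ^ 2)) := by ring
    linarith

lemma neighbourRate_eq (hm : 0 < m) (p : ClosedMode) :
    neighbourRate m κ p = 2 / κ * ∑ i, ∑' r, neighbourTerm m i p r := by
  rw [neighbourRate, ← Summable.tsum_finsetSum fun i _ => (neighbour_fiber_le hm i p).1,
    ← tsum_mul_left]
  refine tsum_congr fun r => ?_
  by_cases h : r = p
  · simp [h, neighbourTerm]
  · simp only [h, if_false, neighbourTerm]
    rw [sharedModes_eq_sum, rateWeight, mul_sum, sum_mul, mul_sum]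
    refine sum_congr rfl fun i _ => ?_
    split_ifs <;> ring

lemma two_zero_components (hp : p.1 ≠ 0) {i j : Fin 3} (hij : i ≠ j)
    (hi : p.1 i = 0) : p.1 j ≠ 0 := by
  intro hj
  have h := p.2
  rw [Fin.sum_univ_three] at h
  refine hp (funext fun k => ?_)
  fin_cases i <;> fin_cases j <;> fin_cases k <;> simp_all

lemma two_le_sqNorm (hp : p.1 ≠ 0) : 2 ≤ sqNorm p.1 := by
  have one_le : ∀ i, p.1 i ≠ 0 → (1 : ℤ) ≤ p.1 i ^ 2 := fun i h => by
    have := sq_pos_of_ne_zero h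
    omega
  have key : (2 : ℤ) ≤ p.1 0 ^ 2 + p.1 1 ^ 2 + p.1 2 ^ 2 := by
    by_cases h0 : p.1 0 = 0
    · have h1 := one_le 1 (two_zero_components hp (by decide) h0)
      have h2 := one_le 2 (two_zero_components hp (by decide) h0)
      linarith [sq_nonneg (p.1 0)]
    · have h0 := one_le 0 h0
      by_cases h1 : p.1 1 = 0
      · linarith [one_le 2 (two_zero_components hp (by decide) h1), sq_nonneg (p.1 1)]
      · linarith [one_le 1 h1, sq_nonneg (p.1 2)]
  unfold sqNorm
  rw [Fin.sum_univ_three]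
  exact_mod_cast key

/-- The mass and the smallest rate that the expansion admits. -/
structure Critical (m κ : ℝ) : Prop where
  mass_pos : 0 < m
  rate_pos : 0 < κ
  rate_sq : κ ^ 2 = Knum m

/-- The smallness condition on the coupling that makes the supersolution work. -/
lemma one_le_rateWeight_mul (hA : Critical m κ) (p : ClosedMode) :
    1 ≤ rateWeight m κ p * (κ / C0 m p.1 - neighbourRate m κ p) := by
  obtain ⟨hm, hκ, hκm⟩ := hA
  set M := max (K1 m) (K2 m) with hM
  have hy : 0 < m ^ 2 := by positivity
  have hs0 := halfAxisSum_nonneg m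
  have hs := halfAxisSum_le m
  have hM1 : 1 / m ^ 2 + 2 * halfAxisSum m ≤ M := by
    rw [← K2_eq hm]; exact le_max_right _ _
  have hM2 : 1 / (m ^ 2) ^ 2 ≤ M := (le_K1 hm).trans (le_max_left _ _)
  have hκM : 12.8 * M ≤ κ ^ 2 := hκm ▸ le_Knum hm
  have hMpos : 0 < M := max_K_pos hm
  have hC := C0_pos hm p.1
  set S := ∑ i, ∑' r, neighbourTerm m i p r with hS
  have hn : neighbourRate m κ p = 2 / κ * S := neighbourRate_eq hm p
  have hform : rateWeight m κ p * (κ / C0 m p.1 - neighbourRate m κ p) =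
      (if p.1 = 0 then 9 / 4 else 13 / 10) * (1 - 2 * C0 m p.1 * S / κ ^ 2) := by
    rw [hn, rateWeight]
    field_simp
  rw [hform]
  by_cases hp : p.1 = 0
  · rw [if_pos hp]
    have hS' : S ≤ 3.9 * (2 * halfAxisSum m) := by
      rw [hS, Fin.sum_univ_three]
      have := fun i => (neighbour_fiber_le hm i p).2
      simp only [hp, if_true] at this ⊢
      linarith [this 0, this 1, this 2]
    have hC0 : C0 m p.1 = 1 / m ^ 2 := by rw [hp]; simp [C0, sqNorm]
    have hz := zero_mode_inequality hy (s := 2 * halfAxisSum m) (by linarith) (by linarith) hM1 hM2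
    -- 5/9 is the threshold because 9/4 · (1 - 5/9) = 1; for the other modes it is 3/13, from 13/10
    -- · (1 - 3/13) = 1.
    have : 2 * C0 m p.1 * S / κ ^ 2 ≤ 5 / 9 := by
      rw [div_le_div_iff₀ (by positivity) (by norm_num), hC0]
      have h1 : 2 * (1 / m ^ 2) * S ≤ 2 * (1 / m ^ 2) * (3.9 * (2 * halfAxisSum m)) := by gcongr
      linarith
    linarith
  · rw [if_neg hp]
    have hbound := fun i => (neighbour_fiber_le hm i p).2
    simp only [if_neg hp] at hbound
    have hle : 2.25 / (2 + m ^ 2) ≤ 2.25 / m ^ 2 := by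
      gcongr
      linarith
    have hpos : 0 < 1 / (2 + m ^ 2) := by positivity
    have e225 : 2.25 / (2 + m ^ 2) = 2.25 * (1 / (2 + m ^ 2)) := by ring
    have e26 : 2.6 / (2 + m ^ 2) = 2.6 * (1 / (2 + m ^ 2)) := by ring
    have e555 : 5.55 / (2 + m ^ 2) = 5.55 * (1 / (2 + m ^ 2)) := by ring
    -- A nonzero closed mode has at most one vanishing component. With none, the first terms sum to
    -- 7.8/(2 + m²), which is 2.25 + 5.55 over 2 + m²; with one, 5.2 < 5.55 is left beside 2.25/m².
    -- One bound covers both.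
    have hS' : S ≤ 2.25 / m ^ 2 + 3.9 * (2 * halfAxisSum m) + 5.55 / (2 + m ^ 2) := by
      rw [hS, Fin.sum_univ_three]
      have h0 := hbound 0
      have h1 := hbound 1
      have h2 := hbound 2
      by_cases c0 : p.1 0 = 0
      · have c1 := two_zero_components hp (j := 1) (by decide) c0
        have c2 := two_zero_components hp (j := 2) (by decide) c0
        rw [if_pos c0] at h0; rw [if_neg c1] at h1; rw [if_neg c2] at h2
        linarith
      · rw [if_neg c0] at h0
        by_cases c1 : p.1 1 = 0
        · have c2 := two_zero_components hp (j := 2) (by decide) c1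
          rw [if_pos c1] at h1; rw [if_neg c2] at h2
          linarith
        · rw [if_neg c1] at h1
          split_ifs at h2 <;> linarith
    have hCle : C0 m p.1 ≤ 1 / (2 + m ^ 2) := by
      unfold C0
      have := two_le_sqNorm hp
      gcongr
    have hz := nonzero_mode_inequality hy (s := 2 * halfAxisSum m) (by linarith) (by linarith)
      hM1 hM2
    have : 2 * C0 m p.1 * S / κ ^ 2 ≤ 3 / 13 := by
      rw [div_le_div_iff₀ (by positivity) (by norm_num)]
      set B := 2.25 / m ^ 2 + 3.9 * (2 * halfAxisSum m) + 5.55 / (2 + m ^ 2) with hB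
      have hB0 : 0 ≤ B := by positivity
      have h1 : 2 * C0 m p.1 * S ≤ 2 * (1 / (2 + m ^ 2)) * B := by
        calc 2 * C0 m p.1 * S ≤ 2 * C0 m p.1 * B := by gcongr
          _ ≤ _ := by gcongr
      have h2 : 2 * (1 / (2 + m ^ 2)) * B * 13 ≤ 12.8 * M * 3 := by
        rw [show 2 * (1 / (2 + m ^ 2)) * B * 13 = 2 * B * 13 / (2 + m ^ 2) by ring,
          div_le_iff₀ (by positivity)]
        exact hz
      linarith
    linarith

/-- The bound of the cluster coefficients. -/
def rateSum (m κ : ℝ) : ℝ :=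
  ∑' p : ClosedMode, (neighbourRate m κ p + 6 * rateWeight m κ p) * rateWeight m κ p

/-- The term `6 * rateWeight` is the diagonal of the double sum over pairs of modes, as a mode
shares all three components with itself. -/
lemma summable_rate_product (hm : 0 < m) (hκ : 0 < κ) : Summable fun p : ClosedMode =>
    (neighbourRate m κ p + 6 * rateWeight m κ p) * rateWeight m κ p := by
  have h := summable_shared_C0 hm
  set c := 9 / 4 / κ with hc
  have h2 : Summable fun q : ClosedMode × ClosedMode =>
      2 * (sharedModes q.1.1 q.2.1 : ℝ) * rateWeight m κ q.2 * rateWeight m κ q.1 := by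
    refine (h.mul_left (2 * c ^ 2)).of_nonneg_of_le (fun q => ?_) fun q => ?_
    · have := (rateWeight_pos hm hκ q.1).le
      have := (rateWeight_pos hm hκ q.2).le
      positivity
    · have h1 := rateWeight_le hm hκ q.1
      have h2 := rateWeight_le hm hκ q.2
      have h3 := (rateWeight_pos hm hκ q.1).le
      have h4 := (rateWeight_pos hm hκ q.2).le
      have h5 := C0_pos hm q.2.1
      calc 2 * (sharedModes q.1.1 q.2.1 : ℝ) * rateWeight m κ q.2 * rateWeight m κ q.1 ≤
          2 * (sharedModes q.1.1 q.2.1 : ℝ) * (c * C0 m q.2.1) * (c * C0 m q.1.1) := by gcongr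
        _ = _ := by ring
  have h3 : Summable fun p : ClosedMode => ∑' r : ClosedMode,
      2 * (sharedModes p.1 r.1 : ℝ) * rateWeight m κ r * rateWeight m κ p := h2.prod
  refine h3.congr fun p => ?_
  rw [tsum_mul_right]
  congr 1
  have h4 := (summable_shared_rateWeight hm hκ p).tsum_eq_add_tsum_ite p
  rw [h4, neighbourRate, sharedModes_self]
  push_cast
  ring

end FugacityWeights

/-! ### Particles: modes with proper times, their vectors and weights -/

section Particles

open Finset

variable {m : ℝ}
  {y : Particle} {κ : ℝ} {ε : ℝ} {μ : ℂ}

/-- A particle of the gas: a mode and a proper time. -/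
abbrev Particle := ClosedMode × ℝ

/-- Counting measure on the modes times Lebesgue measure on the positive proper times. -/
def particleMeasure : Measure Particle :=
  (Measure.count : Measure ClosedMode).prod (volume.restrict (Set.Ioi 0))

instance : SigmaFinite particleMeasure := by unfold particleMeasure; infer_instance

/-- The Hilbert space of the vectors that the particles carry. -/
abbrev ChargeSpace := lp (fun _ : Fin 3 × ℤ => ℝ) 2

/-- The indicator of the components of a mode. -/
def modeVec (p : ClosedMode) : ChargeSpace := ∑ i, lp.single 2 (i, p.1 i) (1 : ℝ)

lemma inner_modeVec (p r : ClosedMode) :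
    (inner ℝ (modeVec p) (modeVec r) : ℝ) = sharedModes p.1 r.1 := by
  have h : ∀ i : Fin 3, (modeVec r : ChargeSpace) (i, p.1 i) = if p.1 i = r.1 i then 1 else 0 := by
    intro i
    simp only [modeVec, lp.coeFn_sum, Finset.sum_apply, lp.coeFn_single, Pi.single_apply,
      Prod.mk.injEq]
    rw [Finset.sum_eq_single i]
    · simp
    · intro j _ hj; rw [if_neg fun h => hj h.1.symm]
    · simp
  rw [modeVec, sum_inner]
  simp only [lp.inner_single_left, h]
  simp [sharedModes_eq_sum]

/-- The vector of a particle. -/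
def particleVec (y : Particle) : ChargeSpace := (√2 * |y.2|) • modeVec y.1

lemma continuous_particleVec : Continuous particleVec := by
  have : Continuous modeVec := continuous_of_discreteTopology
  unfold particleVec
  fun_prop

/-- The factor `2` is that of `√(2 lam)`. The absolute value of the proper time makes the
interaction repulsive for all particles, also outside the support of `particleMeasure`. -/
lemma inner_particleVec (y z : Particle) : (inner ℝ (particleVec y) (particleVec z) : ℝ) =
    2 * |y.2| * |z.2| * sharedModes y.1.1 z.1.1 := by
  rw [particleVec, particleVec, real_inner_smul_left, real_inner_smul_right, inner_modeVec]
  have := mul_self_sqrt (zero_le_two (α := ℝ))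
  linear_combination (|y.2| * |z.2| * sharedModes y.1.1 z.1.1) * this

lemma inner_particleVec_nonneg (y z : Particle) :
    0 ≤ (inner ℝ (particleVec y) (particleVec z) : ℝ) := by
  rw [inner_particleVec]; positivity

lemma norm_particleVec_sq (y : Particle) : ‖particleVec y‖ ^ 2 = 6 * y.2 ^ 2 := by
  rw [← real_inner_self_eq_norm_sq, inner_particleVec, sharedModes_self]
  push_cast
  rw [← sq_abs y.2]
  ring

/-- The weight of a particle before the self-energy is taken into account. -/
def bareWeight (m : ℝ) (μ : ℂ) (y : Particle) : ℂ :=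
  Complex.exp (-(y.2 * (μ / C0 m y.1.1))) / y.2

/-- The weight of a particle. -/
def gasWeight (m : ℝ) (μ : ℂ) (y : Particle) : ℂ :=
  bareWeight m μ y * (exp (-(3 * y.2 ^ 2)) : ℝ)

/-- The weight of a particle for a real parameter. -/
def realWeight (m κ : ℝ) (y : Particle) : ℝ :=
  exp (-(y.2 * (κ / C0 m y.1.1)) - 3 * y.2 ^ 2) / y.2

/-- The particles with mode in `Λ` and proper time at least `ε`. -/
def cut (Λ : Finset ClosedMode) (ε : ℝ) : Set Particle := {y | y.1 ∈ Λ ∧ ε < y.2}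

lemma measurableSet_cut (Λ : Finset ClosedMode) (ε : ℝ) : MeasurableSet (cut Λ ε) := by
  have h1 : MeasurableSet {y : Particle | y.1 ∈ Λ} :=
    measurable_fst (Set.Finite.measurableSet (Finset.finite_toSet Λ))
  have h2 : MeasurableSet {y : Particle | ε < y.2} := measurableSet_lt measurable_const measurable_snd
  exact h1.inter h2

lemma ae_particle_pos : ∀ᵐ y ∂particleMeasure, 0 < y.2 := by
  have h : ∀ᵐ t ∂(volume.restrict (Set.Ioi (0 : ℝ))), 0 < t := ae_restrict_mem measurableSet_Ioi
  exact Measure.quasiMeasurePreserving_snd.ae h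

lemma norm_gasWeight (hm : 0 < m) (μ : ℂ) (hy : 0 < y.2) :
    ‖gasWeight m μ y‖ = realWeight m μ.re y := by
  have hC := C0_pos hm y.1.1
  rw [gasWeight, bareWeight, norm_mul, norm_div, Complex.norm_exp, Complex.norm_real,
    Complex.norm_real, norm_eq_abs, norm_eq_abs, abs_of_pos hy, abs_exp, realWeight,
    sub_eq_add_neg, exp_add]
  have : (-((y.2 : ℂ) * (μ / (C0 m y.1.1 : ℂ)))).re = -(y.2 * (μ.re / C0 m y.1.1)) := by
    rw [Complex.neg_re, Complex.re_ofReal_mul, Complex.div_ofReal_re]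
  rw [this]
  ring

lemma gasWeight_ofReal (κ : ℝ) (y : Particle) : gasWeight m κ y = (realWeight m κ y : ℝ) := by
  rw [gasWeight, bareWeight, realWeight, sub_eq_add_neg, exp_add]
  push_cast
  ring

lemma realWeight_pos (κ : ℝ) (hy : 0 < y.2) : 0 < realWeight m κ y :=
  div_pos (exp_pos _) hy

/-- With `norm_gasWeight` this lets the weights at a single real parameter dominate those of a whole
half plane. -/
lemma realWeight_anti (hm : 0 < m) {κ κ' : ℝ} (h : κ ≤ κ') (hy : 0 < y.2) :
    realWeight m κ' y ≤ realWeight m κ y := by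
  have hC := C0_pos hm y.1.1
  unfold realWeight
  gcongr

lemma measurable_C0 : Measurable fun y : Particle => C0 m y.1.1 :=
  (measurable_of_countable fun p : ClosedMode => C0 m p.1).comp measurable_fst

lemma measurable_bareWeight (μ : ℂ) : Measurable (bareWeight m μ) := by
  have := measurable_C0 (m := m)
  unfold bareWeight
  fun_prop

lemma measurable_gasWeight (μ : ℂ) : Measurable (gasWeight m μ) := by
  have := measurable_bareWeight (m := m) μ
  unfold gasWeight
  fun_prop

lemma measurable_realWeight (κ : ℝ) : Measurable (realWeight m κ) := by
  have := measurable_C0 (m := m)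
  unfold realWeight
  fun_prop

lemma lintegral_particle {f : Particle → ENNReal} (hf : Measurable f) :
    ∫⁻ y, f y ∂particleMeasure = ∑' p : ClosedMode, ∫⁻ t in Set.Ioi 0, f (p, t) := by
  rw [particleMeasure, lintegral_prod _ hf.aemeasurable, lintegral_count]

/-- Below the cutoffs the weights are integrable, also against powers of the proper time. -/
lemma integrable_cut (hm : 0 < m) (hκ : 0 < κ) (Λ : Finset ClosedMode) (hε : 0 < ε)
    (j : ℕ) : Integrable ((cut Λ ε).indicator fun y : Particle =>
      y.2 ^ j * (exp (-(y.2 * (κ / C0 m y.1.1))) / y.2)) particleMeasure := by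
  have hmeas : Measurable ((cut Λ ε).indicator fun y : Particle =>
      y.2 ^ j * (exp (-(y.2 * (κ / C0 m y.1.1))) / y.2)) := by
    have := measurable_C0 (m := m)
    exact Measurable.indicator (by fun_prop) (measurableSet_cut Λ ε)
  refine ⟨hmeas.aestronglyMeasurable, ?_⟩
  rw [hasFiniteIntegral_iff_enorm, lintegral_particle hmeas.enorm, tsum_eq_sum (s := Λ)]
  · refine ENNReal.sum_lt_top.2 fun p _ => ?_
    have hb : 0 < κ / C0 m p.1 := div_pos hκ (C0_pos hm p.1)
    have h1 : IntegrableOn (fun t : ℝ => ε⁻¹ * (t ^ (j : ℝ) * exp (-(κ / C0 m p.1) * t)))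
        (Set.Ioi 0) := by
      have := integrableOn_rpow_mul_exp_neg_mul_rpow (p := 1) (s := (j : ℝ)) (b := κ / C0 m p.1)
        (by have : (0 : ℝ) ≤ j := j.cast_nonneg
            linarith) zero_lt_one hb
      simp only [rpow_one] at this
      exact this.const_mul _
    refine lt_of_le_of_lt ?_ (hasFiniteIntegral_iff_enorm.1 h1.2)
    refine setLIntegral_mono' measurableSet_Ioi fun t ht => ?_
    rw [Set.mem_Ioi] at ht
    by_cases hc : (p, t) ∈ cut Λ ε
    · rw [Set.indicator_of_mem hc]
      rw [enorm_le_iff_norm_le, norm_eq_abs, norm_eq_abs, abs_of_pos (by positivity),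
        abs_of_pos (by positivity), rpow_natCast, div_eq_inv_mul,
        show -(t * (κ / C0 m p.1)) = -(κ / C0 m p.1) * t by ring, mul_left_comm]
      gcongr
      exact hc.2.le
    · rw [Set.indicator_of_notMem hc]; simp
  · intro p hp
    have : ∀ t, (p, t) ∉ cut Λ ε := fun t h => hp h.1
    simp [Set.indicator_of_notMem (this _)]

lemma integrable_cut_bareWeight (hm : 0 < m) (hμ : 0 < μ.re) (Λ : Finset ClosedMode)
    (hε : 0 < ε) : Integrable ((cut Λ ε).indicator (bareWeight m μ)) particleMeasure := by
  refine (integrable_cut hm hμ Λ hε 0).mono'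
    ((measurable_bareWeight μ).indicator (measurableSet_cut Λ ε)).aestronglyMeasurable ?_
  refine .of_forall fun y => ?_
  by_cases hc : y ∈ cut Λ ε
  · have hy : 0 < y.2 := hε.trans hc.2
    rw [Set.indicator_of_mem hc, Set.indicator_of_mem hc, bareWeight, norm_div, Complex.norm_exp,
      Complex.norm_real, norm_eq_abs, abs_of_pos hy, Complex.neg_re, Complex.re_ofReal_mul,
      Complex.div_ofReal_re]
    simp
  · rw [Set.indicator_of_notMem hc, Set.indicator_of_notMem hc]; simp

lemma indicator_gasWeight (μ : ℂ) (S : Set Particle) (y : Particle) :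
    S.indicator (gasWeight m μ) y = S.indicator (bareWeight m μ) y *
      (exp (-(‖particleVec y‖ ^ 2 / 2)) : ℝ) := by
  rw [norm_particleVec_sq, show -(6 * y.2 ^ 2 / 2) = -(3 * y.2 ^ 2) by ring]
  by_cases hc : y ∈ S
  · rw [Set.indicator_of_mem hc, Set.indicator_of_mem hc, gasWeight]
  · rw [Set.indicator_of_notMem hc, Set.indicator_of_notMem hc]; simp

lemma integrable_cut_gasWeight (hm : 0 < m) (hμ : 0 < μ.re) (Λ : Finset ClosedMode)
    (hε : 0 < ε) : Integrable ((cut Λ ε).indicator (gasWeight m μ)) particleMeasure := by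
  refine (integrable_cut_bareWeight hm hμ Λ hε).mono
    ((measurable_gasWeight μ).indicator (measurableSet_cut Λ ε)).aestronglyMeasurable ?_
  refine .of_forall fun y => ?_
  rw [indicator_gasWeight, norm_mul, Complex.norm_real, norm_eq_abs, abs_exp]
  refine mul_le_of_le_one_right (norm_nonneg _) (exp_le_one_iff.2 ?_)
  have : 0 ≤ ‖particleVec y‖ ^ 2 / 2 := by positivity
  linarith

lemma integrable_cut_realWeight (hm : 0 < m) (hκ : 0 < κ) (Λ : Finset ClosedMode)
    (hε : 0 < ε) : Integrable ((cut Λ ε).indicator (realWeight m κ)) particleMeasure := by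
  have := integrable_cut_gasWeight hm (μ := κ) (by simpa using hκ) Λ hε
  refine this.norm.congr (.of_forall fun y => ?_)
  by_cases hc : y ∈ cut Λ ε
  · have hy : 0 < y.2 := hε.trans hc.2
    simp only [Set.indicator_of_mem hc]
    rw [norm_gasWeight hm _ hy, Complex.ofReal_re]
  · simp only [Set.indicator_of_notMem hc, norm_zero]

lemma norm_particleVec (y : Particle) : ‖particleVec y‖ = √6 * |y.2| := by
  rw [← sqrt_sq (norm_nonneg (particleVec y)), norm_particleVec_sq,
    sqrt_mul (by norm_num), sqrt_sq_eq_abs]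

lemma integrable_cut_realWeight_mul (hm : 0 < m) (hκ : 0 < κ) (Λ : Finset ClosedMode)
    (hε : 0 < ε) : Integrable (fun y => ‖(cut Λ ε).indicator (realWeight m κ) y‖ *
      ‖particleVec y‖) particleMeasure := by
  refine ((integrable_cut hm hκ Λ hε 1).const_mul (√6)).mono' ?_ ?_
  · exact (((measurable_realWeight κ).indicator (measurableSet_cut Λ ε)).norm.aestronglyMeasurable).mul
      continuous_particleVec.norm.aestronglyMeasurable
  · refine .of_forall fun y => ?_
    rw [norm_mul, norm_norm, norm_norm, norm_particleVec]
    by_cases hc : y ∈ cut Λ ε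
    · have hy : 0 < y.2 := hε.trans hc.2
      rw [Set.indicator_of_mem hc, Set.indicator_of_mem hc, norm_eq_abs,
        abs_of_pos (realWeight_pos κ hy), abs_of_pos hy, realWeight, pow_one, mul_comm, mul_assoc]
      gcongr
      have : 0 ≤ 3 * y.2 ^ 2 := by positivity
      linarith
    · rw [Set.indicator_of_notMem hc, Set.indicator_of_notMem hc]; simp

end Particles

/-! ### The product supersolution and the two integrals that close it -/

section ModelSupersolution

open Finset

variable {m κ : ℝ}
  {T : ChargeSpace} {Λ : Finset ClosedMode}

/-- The rate of a mode in the presence of a root vector. -/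
def modeRate (m κ : ℝ) (T : ChargeSpace) (p : ClosedMode) : ℝ :=
  √2 * rateWeight m κ p * inner ℝ (modeVec p) T

/-- The supersolution of the root recursion. -/
def modeProduct (m κ : ℝ) (Λ : Finset ClosedMode) (T : ChargeSpace) : ℝ :=
  ∏ p ∈ Λ, (1 + modeRate m κ T p)

/-- The vectors that have nonnegative inner products with all mode vectors. -/
def modeCone : Set ChargeSpace := {T | ∀ p, 0 ≤ inner ℝ (modeVec p) T}

lemma modeRate_nonneg (hm : 0 < m) (hκ : 0 < κ) (hT : T ∈ modeCone)
    (p : ClosedMode) : 0 ≤ modeRate m κ T p :=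
  mul_nonneg (mul_nonneg (sqrt_nonneg 2) (rateWeight_pos hm hκ p).le) (hT p)

lemma inner_particleVec_of_modeCone (y : Particle) :
    (inner ℝ T (particleVec y) : ℝ) = √2 * |y.2| * inner ℝ (modeVec y.1) T := by
  rw [particleVec, real_inner_smul_right, real_inner_comm]

lemma modeRate_smul_add (T : ChargeSpace) (s : ℝ) (y : Particle) (r : ClosedMode) :
    modeRate m κ (s • T + particleVec y) r = s * modeRate m κ T r +
      2 * |y.2| * sharedModes r.1 y.1.1 * rateWeight m κ r := by
  rw [modeRate, modeRate, inner_add_right, real_inner_smul_right, particleVec,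
    real_inner_smul_right, inner_modeVec]
  linear_combination (|y.2| * sharedModes r.1 y.1.1 * rateWeight m κ r) *
    mul_self_sqrt (zero_le_two (α := ℝ))

/-- The effect of absorbing a particle on the supersolution. -/
lemma modeProduct_absorb_le (hm : 0 < m) (hκ : 0 < κ) (hT : T ∈ modeCone)
    {s : ℝ} (hs : 0 ≤ s) {y : Particle} (hp : y.1 ∈ Λ) (ht : 0 ≤ y.2) :
    modeProduct m κ Λ (s • T + particleVec y) ≤
      (∏ r ∈ Λ.erase y.1, (1 + s * modeRate m κ T r)) * exp (neighbourRate m κ y.1 * y.2) *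
        (1 + s * modeRate m κ T y.1 + 6 * rateWeight m κ y.1 * y.2) := by
  obtain ⟨p, t⟩ := y
  simp only at hp ht ⊢
  have hA := modeRate_nonneg hm hκ hT
  have hf := fun r => (rateWeight_pos hm hκ r).le
  rw [modeProduct, ← mul_prod_erase Λ _ hp]
  simp only [modeRate_smul_add, abs_of_nonneg ht, sharedModes_self]
  -- Factor by factor, 1 + a + b ≤ (1 + a) e^b for a, b ≥ 0; the exponents add up to at most the
  -- neighbour rate times `t`.
  have h1 : ∏ r ∈ Λ.erase p, (1 + (s * modeRate m κ T r +
      2 * t * (sharedModes r.1 p.1) * rateWeight m κ r)) ≤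
      (∏ r ∈ Λ.erase p, (1 + s * modeRate m κ T r)) * exp (neighbourRate m κ p * t) := by
    have h2 : exp (∑ r ∈ Λ.erase p, 2 * t * (sharedModes r.1 p.1) * rateWeight m κ r) ≤
        exp (neighbourRate m κ p * t) := by
      refine exp_le_exp.2 ?_
      have h3 := (summable_neighbourRate hm hκ p).sum_le_tsum (Λ.erase p) fun r _ => by
        have := hf r
        split_ifs
        · exact le_rfl
        · positivity
      have h4 : ∑ r ∈ Λ.erase p, 2 * t * (sharedModes r.1 p.1) * rateWeight m κ r =
          (∑ r ∈ Λ.erase p, if r = p then 0 else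
            2 * (sharedModes p.1 r.1 : ℝ) * rateWeight m κ r) * t := by
        rw [sum_mul]
        refine sum_congr rfl fun r hr => ?_
        rw [if_neg (ne_of_mem_erase hr), sharedModes_comm]
        ring
      rw [h4]
      exact mul_le_mul_of_nonneg_right h3 ht
    refine le_trans ?_ (mul_le_mul_of_nonneg_left h2 (prod_nonneg fun r _ => by
      have := hA r; positivity))
    rw [exp_sum, ← prod_mul_distrib]
    refine prod_le_prod (fun r _ => ?_) fun r _ => ?_
    · have := hA r; have := hf r; positivity
    · have h3 : 0 ≤ s * modeRate m κ T r := mul_nonneg hs (hA r)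
      have h4 : 0 ≤ 2 * t * (sharedModes r.1 p.1) * rateWeight m κ r := by
        have := hf r; positivity
      have h5 := add_one_le_exp (2 * t * (sharedModes r.1 p.1) * rateWeight m κ r)
      nlinarith
  have h6 : 0 ≤ s * modeRate m κ T p := mul_nonneg hs (hA p)
  rw [mul_comm]
  refine (mul_le_mul_of_nonneg_right h1 ?_).trans (le_of_eq ?_)
  · have := hf p; positivity
  · push_cast; ring

/-- The Gamma-like integral that closes the recursion. -/
lemma lintegral_rate_exp {β : ℝ} (hβ : 0 < β) :
    ∫⁻ t in Set.Ioi (0 : ℝ), ENNReal.ofReal ((β + 6 * t) * exp (-(β * t) - 3 * t ^ 2)) = 1 := by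
  have hd : ∀ t ∈ Set.Ici (0 : ℝ), HasDerivAt (fun t => -exp (-(β * t) - 3 * t ^ 2))
      ((β + 6 * t) * exp (-(β * t) - 3 * t ^ 2)) t := by
    intro t _
    have h1 : HasDerivAt (fun t : ℝ => -(β * t) - 3 * t ^ 2) (-(β * 1) - 3 * (2 * t)) t := by
      have := (((hasDerivAt_id t).const_mul β).neg).sub ((hasDerivAt_pow 2 t).const_mul 3)
      exact this.congr_deriv (by simp)
    exact h1.exp.neg.congr_deriv (by ring)
  have hpos : ∀ t ∈ Set.Ioi (0 : ℝ), 0 ≤ (β + 6 * t) * exp (-(β * t) - 3 * t ^ 2) := by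
    intro t ht
    rw [Set.mem_Ioi] at ht
    positivity
  have hlim : Tendsto (fun t => -exp (-(β * t) - 3 * t ^ 2)) atTop (𝓝 0) := by
    rw [← neg_zero]
    refine (tendsto_exp_atBot.comp ?_).neg
    refine tendsto_atBot_mono (fun t => ?_) (tendsto_neg_atTop_atBot.comp
      (tendsto_id.const_mul_atTop hβ))
    simp only [Function.comp, id]
    nlinarith [sq_nonneg t]
  rw [← ofReal_integral_eq_lintegral_ofReal (integrableOn_Ioi_deriv_of_nonneg' hd hpos hlim)
    ((ae_restrict_mem measurableSet_Ioi).mono hpos), integral_Ioi_of_hasDerivAt_of_nonneg' hd hpos hlim]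
  simp

/-- The integral over the interpolation parameter of the derivative of the supersolution. -/
lemma lintegral_deriv_prod {A : ClosedMode → ℝ} (hA : ∀ p, 0 ≤ A p) :
    ∫⁻ s in Set.Ioc (0 : ℝ) 1, ENNReal.ofReal (∑ p ∈ Λ, A p * ∏ r ∈ Λ.erase p, (1 + s * A r)) =
      ENNReal.ofReal (∏ p ∈ Λ, (1 + A p) - 1) := by
  have hd : ∀ s : ℝ, HasDerivAt (fun s => ∏ p ∈ Λ, (1 + s * A p))
      (∑ p ∈ Λ, A p * ∏ r ∈ Λ.erase p, (1 + s * A r)) s := by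
    intro s
    have h := HasDerivAt.fun_finsetProd (u := Λ) (f := fun p s => 1 + s * A p) (f' := A) (x := s)
      fun p _ => by simpa using ((hasDerivAt_id s).mul_const (A p)).const_add 1
    exact h.congr_deriv (sum_congr rfl fun p _ => by rw [smul_eq_mul, mul_comm])
  have hc : Continuous fun s : ℝ => ∑ p ∈ Λ, A p * ∏ r ∈ Λ.erase p, (1 + s * A r) := by fun_prop
  have hI := hc.intervalIntegrable (μ := volume) 0 1
  rw [← ofReal_integral_eq_lintegral_ofReal ((intervalIntegrable_iff_integrableOn_Ioc_of_le
    zero_le_one).1 hI), ← intervalIntegral.integral_of_le zero_le_one,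
    intervalIntegral.integral_eq_sub_of_hasDerivAt (fun s _ => hd s) hI]
  · simp
  · filter_upwards [ae_restrict_mem measurableSet_Ioc] with s hs
    exact sum_nonneg fun p _ => mul_nonneg (hA p) (prod_nonneg fun r _ => by
      have := mul_nonneg hs.1.le (hA r); linarith)

end ModelSupersolution

/-! ### The supersolution inequality and the bound on cluster coefficients -/

section ModelSupersolution

open Finset

variable {m κ : ℝ}
  {T : ChargeSpace} {z : ℝ × Particle} {ε : ℝ}

/-- The density that dominates the root recursion of the supersolution. -/
def absorbDensity (m κ : ℝ) (Λ : Finset ClosedMode) (T : ChargeSpace) (z : ℝ × Particle) : ℝ :=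
  if z.2.1 ∈ Λ then
    (modeRate m κ T z.2.1 * ∏ r ∈ Λ.erase z.2.1, (1 + z.1 * modeRate m κ T r)) *
    ((κ / C0 m z.2.1.1 - neighbourRate m κ z.2.1 + z.1 * modeRate m κ T z.2.1 /
        rateWeight m κ z.2.1 + 6 * z.2.2) *
      exp (-((κ / C0 m z.2.1.1 - neighbourRate m κ z.2.1 + z.1 * modeRate m κ T z.2.1 /
        rateWeight m κ z.2.1) * z.2.2) - 3 * z.2.2 ^ 2))
  else 0

lemma measurable_absorbDensity (Λ : Finset ClosedMode) (T : ChargeSpace) :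
    Measurable (absorbDensity m κ Λ T) := by
  have h : Measurable fun q : (ℝ × ℝ) × ClosedMode => absorbDensity m κ Λ T (q.1.1, q.2, q.1.2) := by
    refine measurable_from_prod_countable_left fun p => ?_
    simp only [absorbDensity]
    split_ifs
    · fun_prop
    · exact measurable_const
  exact h.comp ((measurable_fst.prodMk (measurable_snd.comp measurable_snd)).prodMk
    (measurable_fst.comp measurable_snd))

lemma rate_gap_pos (hA : Critical m κ) (p : ClosedMode) :
    (rateWeight m κ p)⁻¹ ≤ κ / C0 m p.1 - neighbourRate m κ p := by
  have h := one_le_rateWeight_mul hA p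
  have hf := rateWeight_pos hA.1 hA.2 p
  rw [inv_eq_one_div, div_le_iff₀ hf]
  linarith

lemma absorbDensity_nonneg (hA : Critical m κ)
    (hT : T ∈ modeCone) (Λ : Finset ClosedMode) (hs : 0 ≤ z.1)
    (ht : 0 ≤ z.2.2) : 0 ≤ absorbDensity m κ Λ T z := by
  have hR := modeRate_nonneg hA.1 hA.2 hT
  have hf := rateWeight_pos hA.1 hA.2
  have hgap := (inv_nonneg.2 (hf z.2.1).le).trans (rate_gap_pos hA z.2.1)
  unfold absorbDensity
  split_ifs
  · refine mul_nonneg (mul_nonneg (hR _) (prod_nonneg fun r _ => ?_)) (mul_nonneg ?_ (exp_pos _).le)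
    · have := mul_nonneg hs (hR r); linarith
    · have := div_nonneg (mul_nonneg hs (hR z.2.1)) (hf z.2.1).le
      linarith
  · exact le_rfl

/-- For each mode the integral over proper time is exactly `1` by `lintegral_rate_exp`. The
remaining integrand is the derivative in `s` of the product, so the total is its increment from `s =
0` to `s = 1`. -/
lemma lintegral_absorbDensity (hA : Critical m κ) (hT : T ∈ modeCone) (Λ : Finset ClosedMode) :
    ∫⁻ z, ENNReal.ofReal (absorbDensity m κ Λ T z) ∂(unitMeasure.prod particleMeasure) =
      ENNReal.ofReal (modeProduct m κ Λ T - 1) := by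
  have hR := modeRate_nonneg hA.1 hA.2 hT
  have hf := rateWeight_pos hA.1 hA.2
  rw [lintegral_prod _ (measurable_absorbDensity Λ T).ennreal_ofReal.aemeasurable, modeProduct,
    ← lintegral_deriv_prod hR]
  refine setLIntegral_congr_fun measurableSet_Ioc fun s hs => ?_
  have hP : ∀ p, 0 ≤ modeRate m κ T p * ∏ r ∈ Λ.erase p, (1 + s * modeRate m κ T r) := fun p =>
    mul_nonneg (hR p) (prod_nonneg fun r _ => by have := mul_nonneg hs.1.le (hR r); linarith)
  have hms : Measurable fun y : Particle => ENNReal.ofReal (absorbDensity m κ Λ T (s, y)) :=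
    ((measurable_absorbDensity Λ T).comp measurable_prodMk_left).ennreal_ofReal
  rw [lintegral_particle hms, tsum_eq_sum (s := Λ)]
  · rw [ENNReal.ofReal_sum_of_nonneg]
    · refine sum_congr rfl fun p hp => ?_
      have hβ : 0 < κ / C0 m p.1 - neighbourRate m κ p + s * modeRate m κ T p / rateWeight m κ p := by
        have := div_nonneg (mul_nonneg hs.1.le (hR p)) (hf p).le
        have := (inv_pos.2 (hf p)).trans_le (rate_gap_pos hA p)
        linarith
      simp only [absorbDensity, if_pos hp, ENNReal.ofReal_mul (hP p)]
      rw [lintegral_const_mul, lintegral_rate_exp hβ, mul_one]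
      exact Measurable.ennreal_ofReal (by fun_prop)
    · exact fun p _ => hP p
  · intro p hp
    simp [absorbDensity, hp]

lemma one_le_modeProduct (hm : 0 < m) (hκ : 0 < κ) (hT : T ∈ modeCone)
    (Λ : Finset ClosedMode) : 1 ≤ modeProduct m κ Λ T := by
  unfold modeProduct
  refine prod_induction _ (1 ≤ ·) (fun a b => one_le_mul_of_one_le_of_one_le) le_rfl fun p _ => ?_
  linarith [modeRate_nonneg hm hκ hT p]

lemma mem_modeCone_absorb (hT : T ∈ modeCone) {s : ℝ} (hs : 0 ≤ s) (y : Particle) :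
    s • T + particleVec y ∈ modeCone := by
  intro p
  rw [inner_add_right, real_inner_smul_right, particleVec, real_inner_smul_right, inner_modeVec]
  have := hT p
  positivity

lemma particleVec_mem_modeCone (y : Particle) : particleVec y ∈ modeCone := by
  intro p
  rw [particleVec, real_inner_smul_right, inner_modeVec]
  positivity

/-- After the absorption estimate the density has the form of `absorbDensity`, except that the
inverse rate stands where the gap κ/C₀ - u is needed to complete an exact derivative. `rate_gap_pos`
says that the gap is at least the inverse rate; this is where the smallness of the coupling enters.
-/
lemma rate_mul_modeProduct_le (hA : Critical m κ)
    (hT : T ∈ modeCone) (Λ : Finset ClosedMode) (hε : 0 < ε)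
    (hs : 0 ≤ z.1) (hz : 0 < z.2.2) : (cut Λ ε).indicator (realWeight m κ) z.2 *
      rootRate T (particleVec z.2) z.1 * modeProduct m κ Λ (z.1 • T + particleVec z.2) ≤
        absorbDensity m κ Λ T z := by
  obtain ⟨s, y⟩ := z
  simp only at hs hz ⊢
  by_cases hc : y ∈ cut Λ ε
  · have hR := modeRate_nonneg hA.1 hA.2 hT
    have hf := rateWeight_pos hA.1 hA.2 y.1
    have hgap := rate_gap_pos hA y.1
    have hK := modeProduct_absorb_le hA.1 hA.2 hT hs hc.1 hz.le
    have hin : (inner ℝ T (particleVec y) : ℝ) = y.2 * (modeRate m κ T y.1 / rateWeight m κ y.1) := by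
      rw [inner_particleVec_of_modeCone, modeRate, abs_of_pos hz]
      field_simp
    rw [Set.indicator_of_mem hc, absorbDensity, if_pos hc.1]
    set f := rateWeight m κ y.1
    set u := neighbourRate m κ y.1
    set A := modeRate m κ T y.1
    set b := κ / C0 m y.1.1 with hb
    set P := ∏ r ∈ Λ.erase y.1, (1 + s * modeRate m κ T r) with hP
    have hA0 : 0 ≤ A := hR _
    have hP0 : 0 ≤ P := prod_nonneg fun r _ => by have := mul_nonneg hs (hR r); linarith
    have hw : realWeight m κ y * rootRate T (particleVec y) s =
        A / f * exp (-(b * y.2) - 3 * y.2 ^ 2 - s * A / f * y.2) := by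
      rw [realWeight, rootRate, hin, ← hb, show -(b * y.2) - 3 * y.2 ^ 2 - s * A / f * y.2 =
        (-(y.2 * b) - 3 * y.2 ^ 2) + -(s * (y.2 * (A / f))) by ring, exp_add]
      field_simp
    rw [hw]
    have h0 : 0 ≤ A / f * exp (-(b * y.2) - 3 * y.2 ^ 2 - s * A / f * y.2) := by positivity
    refine (mul_le_mul_of_nonneg_left hK h0).trans ?_
    have h1 : A / f * exp (-(b * y.2) - 3 * y.2 ^ 2 - s * A / f * y.2) *
        (P * exp (u * y.2) * (1 + s * A + 6 * f * y.2)) =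
        (A * P) * ((f⁻¹ + s * A / f + 6 * y.2) *
          exp (-((b - u + s * A / f) * y.2) - 3 * y.2 ^ 2)) := by
      rw [show -((b - u + s * A / f) * y.2) - 3 * y.2 ^ 2 =
        (-(b * y.2) - 3 * y.2 ^ 2 - s * A / f * y.2) + u * y.2 by ring, exp_add]
      field_simp
    rw [h1]
    gcongr
  · rw [Set.indicator_of_notMem hc, zero_mul, zero_mul]
    exact absorbDensity_nonneg hA hT Λ hs hz.le

/-- The connected parts of the cut-off gas are bounded by the supersolution. -/
lemma sum_rootedSum_le_modeProduct (hA : Critical m κ)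
    (hT : T ∈ modeCone) (Λ : Finset ClosedMode) (hε : 0 < ε) (N : ℕ) :
    ∑ k ∈ range (N + 1), (-1) ^ k *
      rootedSum particleMeasure ((cut Λ ε).indicator (realWeight m κ)) particleVec k T ≤
        modeProduct m κ Λ T := by
  refine sum_rootedSum_le (integrable_cut_realWeight hA.1 hA.2 Λ hε)
    (integrable_cut_realWeight_mul hA.1 hA.2 Λ hε) ?_ continuous_particleVec inner_particleVec_nonneg
    (modeProduct m κ Λ) modeCone ?_ ?_ ?_ ?_ hT N
  · intro y
    refine Set.indicator_nonneg (fun y hy => (realWeight_pos κ (hε.trans hy.2)).le) y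
  · intro T hT y
    rw [inner_particleVec_of_modeCone]
    have := hT y.1
    positivity
  · exact fun T hT s hs y => mem_modeCone_absorb hT hs y
  · exact fun T hT => one_le_modeProduct hA.1 hA.2 hT Λ
  · intro T hT
    have hpos : ∀ᵐ z ∂(unitMeasure.prod particleMeasure), 0 < z.2.2 :=
      Measure.quasiMeasurePreserving_snd.ae ae_particle_pos
    have h0 : ∀ᵐ z ∂(unitMeasure.prod particleMeasure), 0 ≤ absorbDensity m κ Λ T z := by
      filter_upwards [ae_unit_prod particleMeasure, hpos] with z hz hz'
      exact absorbDensity_nonneg hA hT Λ hz.1.le hz'.le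
    have hl := lintegral_absorbDensity hA hT Λ
    have hms := (measurable_absorbDensity (m := m) (κ := κ) Λ T).aestronglyMeasurable
      (μ := unitMeasure.prod particleMeasure)
    refine ⟨absorbDensity m κ Λ T, ⟨hms, ?_⟩, ?_, ?_⟩
    · rw [hasFiniteIntegral_iff_ofReal h0, hl]
      exact ENNReal.ofReal_lt_top
    · filter_upwards [ae_unit_prod particleMeasure, hpos] with z hz hz'
      exact rate_mul_modeProduct_le hA hT Λ hε hz.1.le hz'
    · rw [integral_eq_lintegral_of_nonneg_ae h0 hms, hl, ENNReal.toReal_ofReal]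
      linarith [one_le_modeProduct hA.1 hA.2 hT Λ]

/-- The absorption estimate for the root `0`, combined with e^a - 1 ≤ a e^a. The difference is of
first order in the proper time, which compensates the `1/t` of the weight. -/
lemma modeProduct_particleVec_le (hm : 0 < m) (hκ : 0 < κ) {Λ : Finset ClosedMode} {y : Particle}
    (hp : y.1 ∈ Λ) (ht : 0 ≤ y.2) : modeProduct m κ Λ (particleVec y) - 1 ≤
      (neighbourRate m κ y.1 + 6 * rateWeight m κ y.1) * y.2 *
        exp (neighbourRate m κ y.1 * y.2) := by
  have h := modeProduct_absorb_le hm hκ (T := 0) (fun p => by simp) zero_le_one hp ht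
  have h0 : ∀ r, modeRate m κ 0 r = 0 := fun r => by simp [modeRate]
  simp only [h0, smul_zero, zero_add, mul_zero, add_zero, prod_const_one, one_mul] at h
  set a := neighbourRate m κ y.1 * y.2 with ha
  have h1 := one_sub_le_exp_neg a
  have h2 : exp a * exp (-a) = 1 := by rw [← exp_add]; simp
  have h3 : exp a - 1 ≤ a * exp a := by nlinarith [exp_pos a]
  have h4 : (neighbourRate m κ y.1 + 6 * rateWeight m κ y.1) * y.2 = a + 6 * rateWeight m κ y.1 * y.2 := by
    rw [ha]; ring
  rw [h4]
  linarith

/-- The cluster coefficients of the cut-off gas are bounded uniformly in the cutoffs. -/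
lemma sum_clusterSum_le (hA : Critical m κ) (Λ : Finset ClosedMode) (hε : 0 < ε) (N : ℕ) :
    ∑ k ∈ range N, ((k : ℝ) + 2) * ((-1) ^ (k + 1) *
      clusterSum particleMeasure ((cut Λ ε).indicator (realWeight m κ)) particleVec (k + 1)) ≤ rateSum m κ := by
  set ω := (cut Λ ε).indicator (realWeight m κ) with hω
  have hc0 : ∀ p, 0 ≤ neighbourRate m κ p + 6 * rateWeight m κ p := fun p => by
    have h1 := neighbourRate_nonneg hA.1 hA.2 p
    have h2 := rateWeight_pos hA.1 hA.2 p
    positivity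
  have hI := integrable_cut_realWeight hA.1 hA.2 Λ hε
  have hω0 : ∀ y, 0 ≤ ω y :=
    Set.indicator_nonneg (fun y hy => (realWeight_pos κ (hε.trans hy.2)).le)
  have hR := fun k => integrable_mul_rootedSum hI continuous_particleVec inner_particleVec_nonneg k
  have h1 : ∀ k : ℕ, ((k : ℝ) + 2) * ((-1) ^ (k + 1) * clusterSum particleMeasure ω particleVec (k + 1)) =
      ∫ y, (-1) ^ (k + 1) * (ω y * rootedSum particleMeasure ω particleVec (k + 1) (particleVec y))
        ∂particleMeasure := by
    intro k
    rw [integral_const_mul]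
    have := succ_mul_clusterSum hI continuous_particleVec inner_particleVec_nonneg (k + 1)
    simp only [← hω] at this
    rw [← this]
    push_cast
    ring
  simp only [h1]
  rw [← integral_finsetSum _ fun k _ => (hR (k + 1)).const_mul _]
  have hle : ∀ y, ∑ k ∈ range N, (-1) ^ (k + 1) *
      (ω y * rootedSum particleMeasure ω particleVec (k + 1) (particleVec y)) ≤
      ω y * (modeProduct m κ Λ (particleVec y) - 1) := by
    intro y
    have h := sum_rootedSum_le_modeProduct hA (particleVec_mem_modeCone y) Λ hε N
    rw [← hω, sum_range_succ', rootedSum_zero, pow_zero, one_mul] at h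
    calc _ = ω y * ∑ k ∈ range N, (-1) ^ (k + 1) *
          rootedSum particleMeasure ω particleVec (k + 1) (particleVec y) := by
          rw [mul_sum]; exact sum_congr rfl fun k _ => by ring
      _ ≤ _ := mul_le_mul_of_nonneg_left (by linarith) (hω0 y)
  -- By `rate_gap_pos` the net exponential decay in proper time is at least the inverse rate. The
  -- time integral of this majorant is then the rate itself, and the sum over modes is `rateSum`.
  set g : Particle → ℝ := fun y => (neighbourRate m κ y.1 + 6 * rateWeight m κ y.1) *
    exp (-(rateWeight m κ y.1)⁻¹ * y.2) with hg
  have hg0 : ∀ y, 0 ≤ g y := fun y => mul_nonneg (hc0 y.1) (exp_pos _).le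
  have hle2 : ∀ y, ω y * (modeProduct m κ Λ (particleVec y) - 1) ≤ g y := by
    intro y
    by_cases hc : y ∈ cut Λ ε
    · have hy : 0 < y.2 := hε.trans hc.2
      have h1 := modeProduct_particleVec_le hA.1 hA.2 hc.1 hy.le
      have hgap := rate_gap_pos hA y.1
      rw [hω, Set.indicator_of_mem hc]
      refine (mul_le_mul_of_nonneg_left h1 (realWeight_pos κ hy).le).trans ?_
      have h2 : realWeight m κ y * ((neighbourRate m κ y.1 + 6 * rateWeight m κ y.1) * y.2 *
          exp (neighbourRate m κ y.1 * y.2)) =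
          (neighbourRate m κ y.1 + 6 * rateWeight m κ y.1) * exp (-(y.2 * (κ / C0 m y.1.1)) -
            3 * y.2 ^ 2 + neighbourRate m κ y.1 * y.2) := by
        rw [realWeight, exp_add]
        field_simp
      rw [h2]
      refine mul_le_mul_of_nonneg_left (exp_le_exp.2 ?_) (hc0 _)
      nlinarith [sq_nonneg y.2, mul_le_mul_of_nonneg_right hgap hy.le]
    · rw [hω, Set.indicator_of_notMem hc, zero_mul]
      exact hg0 y
  have hgm : Measurable g := measurable_from_prod_countable_right fun p => by
    simp only [hg]
    fun_prop
  have hgl : ∫⁻ y, ENNReal.ofReal (g y) ∂particleMeasure = ENNReal.ofReal (rateSum m κ) := by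
    rw [rateSum, lintegral_particle hgm.ennreal_ofReal, ENNReal.ofReal_tsum_of_nonneg (fun p =>
      mul_nonneg (hc0 p) (rateWeight_pos hA.1 hA.2 p).le) (summable_rate_product hA.1 hA.2)]
    refine tsum_congr fun p => ?_
    have hf := rateWeight_pos hA.1 hA.2 p
    simp only [hg, ENNReal.ofReal_mul (hc0 p)]
    rw [lintegral_const_mul _ (Measurable.ennreal_ofReal (by fun_prop))]
    congr 1
    rw [← ofReal_integral_eq_lintegral_ofReal]
    · rw [integral_exp_mul_Ioi (by simpa using hf) 0]
      simp
    · exact integrableOn_exp_mul_Ioi (by simpa using hf) 0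
    · exact .of_forall fun t => (exp_pos _).le
  have hgI : Integrable g particleMeasure := by
    refine ⟨hgm.aestronglyMeasurable, ?_⟩
    rw [hasFiniteIntegral_iff_ofReal (.of_forall hg0), hgl]
    exact ENNReal.ofReal_lt_top
  refine (integral_mono (integrable_finsetSum _ fun k _ => (hR (k + 1)).const_mul _) hgI fun y =>
    (hle y).trans (hle2 y)).trans (le_of_eq ?_)
  rw [integral_eq_lintegral_of_nonneg_ae (.of_forall hg0) hgm.aestronglyMeasurable, hgl,
    ENNReal.toReal_ofReal]
  exact tsum_nonneg fun p => mul_nonneg (hc0 p) (rateWeight_pos hA.1 hA.2 p).le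

end ModelSupersolution

/-! ### Absolute summability of the tree sum for real weights -/

section TreeMass

open Finset
open scoped Classical

variable {m κ : ℝ} {n : ℕ}
  {N : ℕ}

lemma treeWeight_le_ursell {H : Type*} [NormedAddCommGroup H] [InnerProductSpace ℝ H]
    {x : Fin (N + 1) → H} (hx : ∀ i j, 0 ≤ inner ℝ (x i) (x j))
    {T : SimpleGraph (Fin (N + 1))} (hT : T.IsTree) : treeWeight x T ≤ |ursell 1 x univ| := by
  have h := single_le_sum (f := fun T => treeWeight x T) (fun T _ => treeWeight_nonneg hx T)
    (mem_filter.2 ⟨mem_univ T, hT⟩ : T ∈ univ.filter fun T : SimpleGraph (Fin (N + 1)) => T.IsTree)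
  rw [sum_treeWeight] at h
  refine h.trans ((le_abs_self _).trans (le_of_eq ?_))
  rw [abs_mul, abs_pow]
  simp

lemma continuous_treeWeight_particleVec (T : SimpleGraph (Fin n)) :
    Continuous fun y : Fin n → Particle => treeWeight (particleVec ∘ y) T := by
  have hv := continuous_particleVec
  have hE : Continuous fun q : (Fin n → Particle) × (T.edgeSet → ℝ) =>
      treeEnergy (particleVec ∘ q.1) T q.2 := by
    unfold treeEnergy
    have := fun i j => (continuous_pathInf T i j).comp
      (continuous_snd (X := Fin n → Particle) (Y := T.edgeSet → ℝ))
    refine continuous_finsetSum _ fun p _ => (this p.1 p.2).mul ?_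
    simp only [Function.comp]
    fun_prop
  have hI : Continuous fun y : Fin n → Particle =>
      ∫ w in parameterCube T, exp (-treeEnergy (particleVec ∘ y) T w) :=
    continuous_parametric_integral_of_continuous
      (f := fun (y : Fin n → Particle) w => exp (-treeEnergy (particleVec ∘ y) T w))
      (continuous_exp.comp hE.neg) isCompact_Icc
  unfold treeWeight
  refine (continuous_finsetProd _ fun l _ => ?_).mul hI
  obtain ⟨l, _⟩ := l
  induction l with
  | _ a b =>
    simp only [edgeInner, Sym2.lift_mk, Function.comp]
    fun_prop

lemma treeWeight_particleVec_nonneg (y : Fin n → Particle) (T : SimpleGraph (Fin n)) :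
    0 ≤ treeWeight (particleVec ∘ y) T :=
  treeWeight_nonneg (fun _ _ => inner_particleVec_nonneg _ _) T

lemma ae_particles_pos : ∀ᵐ y ∂(Measure.pi fun _ : Fin n => particleMeasure), ∀ i, 0 < (y i).2 :=
  ae_all_iff.2 fun i => (Measure.quasiMeasurePreserving_eval
    (fun _ : Fin n => particleMeasure) i).ae ae_particle_pos

/-- The integral of the weight of a tree over the particles in `S`. -/
def treeMass (m κ : ℝ) (S : Set Particle) (T : SimpleGraph (Fin n)) : ENNReal :=
  ∫⁻ y : Fin n → Particle, ENNReal.ofReal ((∏ i, S.indicator (realWeight m κ) (y i)) *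
    treeWeight (particleVec ∘ y) T) ∂(Measure.pi fun _ => particleMeasure)

lemma integrable_cut_tree {𝕜 : Type*} [RCLike 𝕜] {ω : Particle → 𝕜}
    (hω : Integrable ω particleMeasure) {T : SimpleGraph (Fin (N + 1))} (hT : T.IsTree) :
    Integrable (fun y : Fin (N + 1) → Particle => (∏ i, ω (y i)) *
      ((treeWeight (particleVec ∘ y) T : ℝ) : 𝕜)) (Measure.pi fun _ => particleMeasure) := by
  obtain ⟨C, hC⟩ := exists_abs_ursell_le ChargeSpace (univ : Finset (Fin (N + 1)))
  refine integrable_config hω (continuous_treeWeight_particleVec T) (C := C) fun y => ?_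
  rw [abs_of_nonneg (treeWeight_particleVec_nonneg y T)]
  exact (treeWeight_le_ursell (fun _ _ => inner_particleVec_nonneg _ _) hT).trans
    (hC _ fun _ _ => inner_particleVec_nonneg _ _)

/-- With nonnegative weights the signed cluster coefficients are sums of nonnegative tree integrals,
so the bound on their partial sums is already a bound on the trees. -/
lemma sum_treeMass_cut_le (hA : Critical m κ) (Λ : Finset ClosedMode) {ε : ℝ} (hε : 0 < ε) (N : ℕ) :
    ∑ k ∈ range N, ENNReal.ofReal (((k : ℝ) + 2) / (k + 2)!) *
      ∑ T : SimpleGraph (Fin (k + 2)) with T.IsTree, treeMass m κ (cut Λ ε) T ≤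
      ENNReal.ofReal (rateSum m κ) := by
  refine le_trans (le_of_eq ?_) (ENNReal.ofReal_le_ofReal (sum_clusterSum_le hA Λ hε N))
  have hI := integrable_cut_realWeight hA.1 hA.2 Λ hε
  have hω0 : ∀ y, 0 ≤ (cut Λ ε).indicator (realWeight m κ) y :=
    Set.indicator_nonneg (fun y hy => (realWeight_pos κ (hε.trans hy.2)).le)
  have h0 : ∀ {k : ℕ} (T : SimpleGraph (Fin k)), 0 ≤ fun y : Fin k → Particle =>
      (∏ i, (cut Λ ε).indicator (realWeight m κ) (y i)) * treeWeight (particleVec ∘ y) T :=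
    fun T y => mul_nonneg (prod_nonneg fun i _ => hω0 _) (treeWeight_particleVec_nonneg y T)
  have h1 : ∀ (k : ℕ) (T : SimpleGraph (Fin (k + 2))), T.IsTree → treeMass m κ (cut Λ ε) T =
      ENNReal.ofReal (∫ y : Fin (k + 2) → Particle,
        (∏ i, (cut Λ ε).indicator (realWeight m κ) (y i)) * treeWeight (particleVec ∘ y) T
          ∂(Measure.pi fun _ => particleMeasure)) := by
    intro k T hT
    rw [treeMass, ofReal_integral_eq_lintegral_ofReal]
    · simpa using integrable_cut_tree hI hT
    · exact .of_forall (h0 T)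
  have h2 : ∀ k : ℕ, (-1) ^ (k + 1) * clusterSum particleMeasure
      ((cut Λ ε).indicator (realWeight m κ)) particleVec (k + 1) = ((k + 2)! : ℝ)⁻¹ *
      ∑ T : SimpleGraph (Fin (k + 2)) with T.IsTree, ∫ y : Fin (k + 2) → Particle,
        (∏ i, (cut Λ ε).indicator (realWeight m κ) (y i)) * treeWeight (particleVec ∘ y) T
          ∂(Measure.pi fun _ => particleMeasure) := by
    intro k
    rw [clusterSum_eq_sum_trees hI continuous_particleVec inner_particleVec_nonneg
      fun N T hT => integrable_cut_tree hI hT, ← mul_sum, mul_left_comm, ← mul_assoc ((-1 : ℝ) ^ (k + 1)),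
      ← mul_pow]
    simp
  rw [ENNReal.ofReal_sum_of_nonneg]
  · refine sum_congr rfl fun k _ => ?_
    rw [h2, ← mul_assoc, ← div_eq_mul_inv, ENNReal.ofReal_mul (by positivity),
      ENNReal.ofReal_sum_of_nonneg fun T _ => integral_nonneg (h0 T)]
    congr 1
    exact sum_congr rfl fun T hT => h1 k T (mem_filter.1 hT).2
  · intro k _
    rw [h2]
    exact mul_nonneg (by positivity) (mul_nonneg (by positivity)
      (sum_nonneg fun T _ => integral_nonneg (h0 T)))

/-- Cutoffs `S j` that exhaust the particles in `S`. -/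
def Exhausts (S : ℕ → Set Particle) (S' : Set Particle) : Prop :=
  ∀ y : Particle, 0 < y.2 → ∀ᶠ j in atTop, y ∈ S j ↔ y ∈ S'

lemma Exhausts.indicator {S : ℕ → Set Particle} {S' : Set Particle} (h : Exhausts S S')
    {E : Type*} [AddZeroClass E] (f : Particle → E) {y : Particle} (hy : 0 < y.2) :
    ∀ᶠ j in atTop, (S j).indicator f y = S'.indicator f y := by
  filter_upwards [h y hy] with j hj
  by_cases hc : y ∈ S'
  · rw [Set.indicator_of_mem hc, Set.indicator_of_mem (hj.2 hc)]
  · rw [Set.indicator_of_notMem hc, Set.indicator_of_notMem fun h => hc (hj.1 h)]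

/-- The closed modes with all components between `-N` and `N`. -/
def closedBox (N : ℕ) : Finset ClosedMode := (modeBox N).subtype fun p => ∑ i, p i = 0

lemma mem_closedBox {p : ClosedMode} : p ∈ closedBox N ↔ ∀ i, |p.1 i| ≤ N := by
  rw [closedBox, Finset.mem_subtype, modeBox, Finset.mem_filter, Finset.mem_Icc, and_iff_left p.2,
    Pi.le_def, Pi.le_def, ← forall_and]
  simp only [abs_le]

lemma closedBox_mono {N N' : ℕ} (h : N ≤ N') : closedBox N ⊆ closedBox N' := fun p hp =>
  mem_closedBox.2 fun i => (mem_closedBox.1 hp i).trans (by exact_mod_cast h)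

lemma eventually_mem_closedBox (p : ClosedMode) : ∀ᶠ N in atTop, p ∈ closedBox N := by
  filter_upwards [eventually_ge_atTop (∑ i, (p.1 i).natAbs)] with N hN
  refine mem_closedBox.2 fun i => ?_
  have := single_le_sum (f := fun i => (p.1 i).natAbs) (fun _ _ => Nat.zero_le _) (mem_univ i)
  have h2 : (p.1 i).natAbs ≤ ∑ i, (p.1 i).natAbs := this
  rw [Int.abs_eq_natAbs]
  exact_mod_cast h2.trans hN

lemma exhausts_boxes : Exhausts (fun j => cut (closedBox j) (1 / ((j : ℝ) + 1))) Set.univ := by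
  intro y hy
  filter_upwards [eventually_mem_closedBox y.1,
    tendsto_one_div_add_atTop_nhds_zero_nat.eventually_lt_const hy] with j hj hj'
  simp only [Set.mem_univ, iff_true]
  exact ⟨hj, hj'⟩

lemma exhausts_cut (Λ : Finset ClosedMode) :
    Exhausts (fun j => cut Λ (1 / ((j : ℝ) + 1))) (cut Λ 0) := by
  intro y hy
  filter_upwards [tendsto_one_div_add_atTop_nhds_zero_nat.eventually_lt_const hy] with j hj'
  exact ⟨fun h => ⟨h.1, hy⟩, fun h => ⟨h.1, hj'⟩⟩

lemma exhausts_closedBox : Exhausts (fun j => cut (closedBox j) 0) Set.univ := by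
  intro y hy
  filter_upwards [eventually_mem_closedBox y.1] with j hj
  simp only [Set.mem_univ, iff_true]
  exact ⟨hj, hy⟩

lemma measurable_prod_indicator {𝕜 : Type*} [RCLike 𝕜] {f : Particle → 𝕜}
    (hf : Measurable f) {S : Set Particle} (hS : MeasurableSet S) :
    Measurable fun y : Fin n → Particle => ∏ i, S.indicator f (y i) :=
  Finset.measurable_prod _ fun i _ => (hf.indicator hS).comp (measurable_pi_apply i)

/-- Monotone convergence: the cutoffs increase and the integrands are nonnegative. The bound,
uniform in the cutoffs, therefore survives their removal. -/
lemma tendsto_treeMass (T : SimpleGraph (Fin n)) :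
    Tendsto (fun j : ℕ => treeMass m κ (cut (closedBox j) (1 / ((j : ℝ) + 1))) T) atTop
      (𝓝 (treeMass m κ Set.univ T)) := by
  refine lintegral_tendsto_of_tendsto_of_monotone (fun j => ?_) ?_ ?_
  · exact ((measurable_prod_indicator (measurable_realWeight κ) (measurableSet_cut _ _)).mul
      (continuous_treeWeight_particleVec T).measurable).ennreal_ofReal.aemeasurable
  · filter_upwards [ae_particles_pos] with y hy i j hij
    refine ENNReal.ofReal_le_ofReal (mul_le_mul_of_nonneg_right ?_ (treeWeight_particleVec_nonneg y T))
    refine prod_le_prod (fun k _ => ?_) fun k _ => ?_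
    · exact Set.indicator_apply_nonneg fun _ => (realWeight_pos κ (hy k)).le
    · by_cases hz : y k ∈ cut (closedBox i) (1 / ((i : ℝ) + 1))
      · have hz' : y k ∈ cut (closedBox j) (1 / ((j : ℝ) + 1)) := ⟨closedBox_mono hij hz.1,
          lt_of_le_of_lt (one_div_le_one_div_of_le (by positivity) (by gcongr)) hz.2⟩
        rw [Set.indicator_of_mem hz', Set.indicator_of_mem hz]
      · rw [Set.indicator_of_notMem hz]
        exact Set.indicator_apply_nonneg fun _ => (realWeight_pos κ (hy k)).le
  · filter_upwards [ae_particles_pos] with y hy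
    refine tendsto_const_nhds.congr' ?_
    filter_upwards [eventually_all.2 fun i => exhausts_boxes.indicator (realWeight m κ) (hy i)] with j hj
    simp only [hj]

lemma sum_treeMass_le (hA : Critical m κ) (N : ℕ) :
    ∑ k ∈ range N, ENNReal.ofReal (((k : ℝ) + 2) / (k + 2)!) *
      ∑ T : SimpleGraph (Fin (k + 2)) with T.IsTree, treeMass m κ Set.univ T ≤
      ENNReal.ofReal (rateSum m κ) := by
  refine le_of_tendsto' (x := atTop) (f := fun j : ℕ => ∑ k ∈ range N,
    ENNReal.ofReal (((k : ℝ) + 2) / (k + 2)!) * ∑ T : SimpleGraph (Fin (k + 2)) with T.IsTree,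
      treeMass m κ (cut (closedBox j) (1 / ((j : ℝ) + 1))) T) ?_ fun j =>
    sum_treeMass_cut_le hA _ (by positivity) N
  refine tendsto_finsetSum _ fun k _ => ENNReal.Tendsto.const_mul
    (tendsto_finsetSum _ fun T _ => tendsto_treeMass T) (Or.inr ENNReal.ofReal_ne_top)

/-- The numbers `n ≥ 2`, enumerated. -/
def vertexCount : ℕ ≃ {n : ℕ // 2 ≤ n} where
  toFun k := ⟨k + 2, by omega⟩
  invFun n := n.1 - 2
  left_inv k := by simp
  right_inv n := Subtype.ext (by have := n.2; simp; omega)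

/-- The extra factor `n`, gained from the choice of a root, supplies the convergence of `∑ (k + 1)
‖clusterSum k‖` that the exponential recursion needs. -/
lemma tsum_treeMass_lt_top (hA : Critical m κ) :
    ∑' T : LabelledTree, ENNReal.ofReal (T.1.1 / (T.1.1)!) * treeMass m κ Set.univ T.2.1 < ⊤ := by
  refine lt_of_le_of_lt ?_ (ENNReal.ofReal_lt_top (r := rateSum m κ))
  rw [ENNReal.tsum_sigma', ← vertexCount.tsum_eq]
  refine ENNReal.tsum_le_of_sum_range_le fun N => le_trans (le_of_eq ?_)
    (sum_treeMass_le hA N)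
  refine sum_congr rfl fun k _ => ?_
  rw [tsum_fintype]
  change ∑ T : {T : SimpleGraph (Fin (k + 2)) // T.IsTree},
    ENNReal.ofReal (((k + 2 : ℕ) : ℝ) / (k + 2)!) * treeMass m κ Set.univ T.1 = _
  rw [← mul_sum]
  congr 1
  · push_cast; rfl
  · exact (sum_subtype (univ.filter fun T : SimpleGraph (Fin (k + 2)) => T.IsTree)
      (fun T => by simp) fun T => treeMass m κ Set.univ T).symm

end TreeMass

/-! ### The tree sum of the gas at complex parameters -/

section GasTerm

open Finset
open scoped Classical

variable {m κ : ℝ} {n : ℕ}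
  {μ : ℂ} {ε : ℝ}

/-- The contribution of a tree to the cluster expansion of the gas of the particles in `S`. -/
def gasTerm (m : ℝ) (μ : ℂ) (S : Set Particle) (T : SimpleGraph (Fin n)) : ℂ :=
  (-1) ^ (n - 1) / (n ! : ℂ) * ∫ y : Fin n → Particle, (∏ i, S.indicator (gasWeight m μ) (y i)) *
    ((treeWeight (particleVec ∘ y) T : ℝ) : ℂ) ∂(Measure.pi fun _ => particleMeasure)

lemma treeMass_ne_top (hA : Critical m κ) (T : LabelledTree) :
    treeMass m κ Set.univ T.2.1 ≠ ⊤ := by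
  have h := (ENNReal.ne_top_of_tsum_ne_top (tsum_treeMass_lt_top hA).ne) T
  intro hT
  rw [hT, ENNReal.mul_top] at h
  · exact h rfl
  · have : 0 < T.1.1 := by have := T.1.2; omega
    exact (ENNReal.ofReal_pos.2 (by positivity)).ne'

lemma summable_treeMass (hA : Critical m κ) :
    Summable fun T : LabelledTree => (T.1.1 / (T.1.1)! : ℝ) * (treeMass m κ Set.univ T.2.1).toReal := by
  refine (ENNReal.summable_toReal (tsum_treeMass_lt_top hA).ne).congr fun T => ?_
  rw [ENNReal.toReal_mul, ENNReal.toReal_ofReal (by positivity)]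

/-- The product of the weights of the particles of a tree and of the weight of the tree. -/
def treeDensity (m κ : ℝ) (T : SimpleGraph (Fin n)) (y : Fin n → Particle) : ℝ :=
  (∏ i, realWeight m κ (y i)) * treeWeight (particleVec ∘ y) T

lemma measurable_treeDensity (T : SimpleGraph (Fin n)) : Measurable (treeDensity m κ T) :=
  (Finset.measurable_prod _ fun i _ => (measurable_realWeight κ).comp (measurable_pi_apply i)).mul
    (continuous_treeWeight_particleVec T).measurable

lemma treeDensity_nonneg : ∀ᵐ y ∂(Measure.pi fun _ : Fin n => particleMeasure),
    ∀ T : SimpleGraph (Fin n), 0 ≤ treeDensity m κ T y := by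
  filter_upwards [ae_particles_pos] with y hy T
  exact mul_nonneg (prod_nonneg fun i _ => (realWeight_pos κ (hy i)).le)
    (treeWeight_particleVec_nonneg y T)

lemma integrable_treeDensity (hA : Critical m κ) (T : LabelledTree) :
    Integrable (treeDensity m κ T.2.1) (Measure.pi fun _ => particleMeasure) := by
  refine ⟨(measurable_treeDensity _).aestronglyMeasurable, ?_⟩
  rw [hasFiniteIntegral_iff_ofReal (treeDensity_nonneg.mono fun y hy => hy _)]
  have := treeMass_ne_top hA T
  simp only [treeMass, Set.indicator_univ] at this
  exact this.lt_top

lemma integral_treeDensity (T : SimpleGraph (Fin n)) :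
    ∫ y, treeDensity m κ T y ∂(Measure.pi fun _ => particleMeasure) =
      (treeMass m κ Set.univ T).toReal := by
  rw [integral_eq_lintegral_of_nonneg_ae (treeDensity_nonneg.mono fun y hy => hy _)
    (measurable_treeDensity _).aestronglyMeasurable]
  simp only [treeMass, Set.indicator_univ, treeDensity]

/-- The parameter enters the modulus only through its real part, and the weights decrease in it. One
integrable majorant serves all `μ` in the half plane and all cutoffs. -/
lemma norm_gas_integrand_le (hm : 0 < m) (hμ : κ ≤ μ.re) (S : Set Particle)
    (T : SimpleGraph (Fin n)) {y : Fin n → Particle} (hy : ∀ i, 0 < (y i).2) :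
    ‖(∏ i, S.indicator (gasWeight m μ) (y i)) * ((treeWeight (particleVec ∘ y) T : ℝ) : ℂ)‖ ≤
      treeDensity m κ T y := by
  have h0 := treeWeight_particleVec_nonneg y T
  rw [norm_mul, norm_prod, Complex.norm_real, norm_eq_abs, abs_of_nonneg h0, treeDensity]
  refine mul_le_mul_of_nonneg_right (prod_le_prod (fun _ _ => norm_nonneg _) fun i _ => ?_) h0
  refine (norm_indicator_le_norm_self _ _).trans ?_
  rw [norm_gasWeight hm μ (hy i)]
  exact realWeight_anti hm hμ (hy i)

lemma measurable_gas_integrand (μ : ℂ) {S : Set Particle} (hS : MeasurableSet S)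
    (T : SimpleGraph (Fin n)) : Measurable fun y : Fin n → Particle =>
    (∏ i, S.indicator (gasWeight m μ) (y i)) * ((treeWeight (particleVec ∘ y) T : ℝ) : ℂ) :=
  (measurable_prod_indicator (measurable_gasWeight μ) hS).mul
    (Complex.measurable_ofReal.comp (continuous_treeWeight_particleVec T).measurable)

lemma norm_gasTerm_le (hA : Critical m κ) (hμ : κ ≤ μ.re)
    (S : Set Particle) (T : LabelledTree) : ‖gasTerm m μ S T.2.1‖ ≤
      ((T.1.1)! : ℝ)⁻¹ * (treeMass m κ Set.univ T.2.1).toReal := by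
  rw [gasTerm, norm_mul, norm_div, norm_pow, norm_neg, norm_one, one_pow, Complex.norm_natCast,
    one_div, ← integral_treeDensity]
  refine mul_le_mul_of_nonneg_left ?_ (by positivity)
  refine norm_integral_le_of_norm_le (integrable_treeDensity hA T) ?_
  filter_upwards [ae_particles_pos] with y hy
  exact norm_gas_integrand_le hA.1 hμ S T.2.1 hy

lemma summable_treeBound (hA : Critical m κ) :
    Summable fun T : LabelledTree => ((T.1.1)! : ℝ)⁻¹ * (treeMass m κ Set.univ T.2.1).toReal := by
  refine (summable_treeMass hA).of_nonneg_of_le (fun T => by positivity) fun T => ?_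
  refine mul_le_mul_of_nonneg_right ?_ ENNReal.toReal_nonneg
  rw [inv_eq_one_div]
  gcongr
  have : 1 ≤ T.1.1 := by have := T.1.2; omega
  exact_mod_cast this

lemma summable_gasTerm (hA : Critical m κ) (hμ : κ ≤ μ.re)
    (S : Set Particle) : Summable fun T : LabelledTree => ‖gasTerm m μ S T.2.1‖ :=
  (summable_treeBound hA).of_nonneg_of_le (fun _ => norm_nonneg _)
    (norm_gasTerm_le hA hμ S)

/-- The tree expansion of the gas is continuous in the cutoffs. -/
lemma tendsto_tsum_gasTerm (hA : Critical m κ) (hμ : κ ≤ μ.re)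
    {S : ℕ → Set Particle} {S' : Set Particle} (hS : ∀ j, MeasurableSet (S j))
    (h : Exhausts S S') : Tendsto (fun j => ∑' T : LabelledTree, gasTerm m μ (S j) T.2.1) atTop
      (𝓝 (∑' T : LabelledTree, gasTerm m μ S' T.2.1)) := by
  refine tendsto_tsum_of_dominated_convergence (summable_treeBound hA) (fun T => ?_)
    (.of_forall fun j T => norm_gasTerm_le hA hμ _ T)
  refine Tendsto.const_mul _ (tendsto_integral_of_dominated_convergence _ (fun j =>
    (measurable_gas_integrand μ (hS j) T.2.1).aestronglyMeasurable)
    (integrable_treeDensity hA T) (fun j => ?_) ?_)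
  · filter_upwards [ae_particles_pos] with y hy
    exact norm_gas_integrand_le hA.1 hμ _ T.2.1 hy
  · filter_upwards [ae_particles_pos] with y hy
    refine tendsto_const_nhds.congr' ?_
    filter_upwards [eventually_all.2 fun i => h.indicator (gasWeight m μ) (hy i)] with j hj
    simp only [hj]

lemma clusterSum_succ_eq (hm : 0 < m) (hκ : 0 < κ) (hμ : κ ≤ μ.re)
    (Λ : Finset ClosedMode) (hε : 0 < ε) (k : ℕ) :
    clusterSum particleMeasure ((cut Λ ε).indicator (gasWeight m μ)) particleVec (k + 1) =
      ∑' T : {T : SimpleGraph (Fin (k + 2)) // T.IsTree}, gasTerm m μ (cut Λ ε) T.1 := by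
  have hI := integrable_cut_gasWeight hm (hκ.trans_le hμ) Λ hε
  rw [clusterSum_eq_sum_trees hI continuous_particleVec inner_particleVec_nonneg
      fun N T hT => integrable_cut_tree hI hT, tsum_fintype, mul_sum]
  rw [← sum_subtype (univ.filter fun T : SimpleGraph (Fin (k + 2)) => T.IsTree)
      (fun T => by simp) fun T => gasTerm m μ (cut Λ ε) T]
  refine sum_congr rfl fun T _ => ?_
  rw [gasTerm, ← mul_assoc, div_eq_inv_mul]
  rfl

/-- The coefficient with one particle is the plain integral of the weight, since a single vertex has
no interaction; the others are regrouped by the tree formula. -/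
lemma hasSum_clusterSum (hA : Critical m κ) (hμ : κ ≤ μ.re) (Λ : Finset ClosedMode) (hε : 0 < ε) :
    (Summable fun k : ℕ => ((k : ℝ) + 1) *
      ‖clusterSum particleMeasure ((cut Λ ε).indicator (gasWeight m μ)) particleVec k‖) ∧
    ∑' k, clusterSum particleMeasure ((cut Λ ε).indicator (gasWeight m μ)) particleVec k =
      (∫ y, (cut Λ ε).indicator (gasWeight m μ) y ∂particleMeasure) +
        ∑' T : LabelledTree, gasTerm m μ (cut Λ ε) T.2.1 := by
  set c := clusterSum particleMeasure ((cut Λ ε).indicator (gasWeight m μ)) particleVec with hc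
  have h1 : Summable fun k : ℕ => ((k : ℝ) + 1) * ‖c k‖ := by
    rw [← summable_nat_add_iff 1]
    have h2 : Summable fun T : LabelledTree => (T.1.1 : ℝ) * ‖gasTerm m μ (cut Λ ε) T.2.1‖ := by
      refine (summable_treeMass hA).of_nonneg_of_le (fun T => by positivity) fun T => ?_
      rw [div_eq_mul_inv, mul_assoc]
      exact mul_le_mul_of_nonneg_left (norm_gasTerm_le hA hμ _ T) (by positivity)
    have h3 := vertexCount.summable_iff.2 h2.sigma
    refine h3.of_nonneg_of_le (fun k => by positivity) fun k => ?_
    rw [hc, clusterSum_succ_eq hA.1 hA.2 hμ Λ hε k, tsum_fintype]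
    change _ ≤ ∑' T : {T : SimpleGraph (Fin (k + 2)) // T.IsTree},
      ((k + 2 : ℕ) : ℝ) * ‖gasTerm m μ (cut Λ ε) T.1‖
    rw [tsum_fintype, ← mul_sum]
    have := norm_sum_le univ fun T : {T : SimpleGraph (Fin (k + 2)) // T.IsTree} =>
      gasTerm m μ (cut Λ ε) T.1
    push_cast
    rw [add_assoc, one_add_one_eq_two]
    gcongr
  refine ⟨h1, ?_⟩
  have h4 : Summable c := by
    refine Summable.of_norm (h1.of_nonneg_of_le (fun _ => norm_nonneg _) fun k => ?_)
    have : (0 : ℝ) ≤ k := k.cast_nonneg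
    nlinarith [norm_nonneg (c k)]
  rw [h4.tsum_eq_zero_add, (summable_gasTerm hA hμ _).of_norm.tsum_sigma, ← vertexCount.tsum_eq]
  congr 1
  · have hu : ∀ z : Fin 1 → ChargeSpace, ursell 1 z univ = 1 := fun z => ursell_singleton z
    simp only [hc, clusterSum, zero_add, hu]
    have := integral_fintype_prod_eq_pow (ι := Fin 1) (μ := particleMeasure)
      ((cut Λ ε).indicator (gasWeight m μ))
    simpa using this
  · refine tsum_congr fun k => ?_
    rw [hc, clusterSum_succ_eq hA.1 hA.2 hμ Λ hε k]
    rfl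

end GasTerm

/-! ### Expectations of characters of the intermediate field -/

section Characters

open Finset

/-- The expectation of a finite product of functions of independent variables. -/
lemma integral_prod_infinitePi {ι E : Type*} [MeasurableSpace E] (ρ : ι → Measure E)
    [∀ i, IsProbabilityMeasure (ρ i)] (s : Finset ι) (f : ι → E → ℂ) (hf : ∀ i, Measurable (f i)) :
    ∫ τ, ∏ i ∈ s, f i (τ i) ∂(Measure.infinitePi ρ) = ∏ i ∈ s, ∫ z, f i z ∂(ρ i) := by
  have h : ∀ τ : ι → E, ∏ i ∈ s, f i (τ i) =
      (fun z : s → E => ∏ i : s, f i (z i)) (s.restrict τ) := fun τ => by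
    rw [← prod_coe_sort]; rfl
  simp only [h]
  rw [integral_restrict_infinitePi (μ := ρ) (f := fun z : s → E => ∏ i : s, f i (z i))]
  · rw [integral_fintype_prod_eq_prod (fun i : s => f i), prod_coe_sort s fun i => ∫ z, f i z ∂(ρ i)]
  · exact (Finset.measurable_prod univ fun (i : s) _ =>
      (hf i).comp (measurable_pi_apply (X := fun _ : s => E) i)).aestronglyMeasurable

lemma integral_exp_vectorGaussian (s : Finset (Fin 3 × ℤ)) (c : Fin 3 × ℤ → ℝ) :
    ∫ τ, Complex.exp (Complex.I * ∑ j ∈ s, (c j * τ j : ℝ)) ∂vectorGaussian =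
      (exp (-((∑ j ∈ s, c j ^ 2) / 2)) : ℝ) := by
  have h := integral_prod_infinitePi (fun _ : Fin 3 × ℤ => gaussianReal 0 1) s
    (fun j x => Complex.exp (c j * x * Complex.I)) (fun j => by fun_prop)
  have h1 : ∀ j, ∫ x, Complex.exp (c j * x * Complex.I) ∂(gaussianReal 0 1) =
      Complex.exp (-(c j ^ 2 / 2)) := by
    intro j
    have := charFun_gaussianReal (μ := 0) (v := 1) (c j)
    rw [charFun_apply_real] at this
    rw [this]
    congr 1
    push_cast
    ring
  simp only [h1, ← Complex.exp_sum] at h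
  rw [vectorGaussian]
  refine (integral_congr_ae (.of_forall fun τ => ?_)).trans (h.trans ?_)
  · push_cast
    rw [mul_sum]
    congr 1
    exact sum_congr rfl fun j _ => by ring
  · push_cast
    rw [sum_neg_distrib, ← sum_div]

/-- The components of a family of modes. -/
def modeSupport {ι : Type*} [Fintype ι] (p : ι → ClosedMode) : Finset (Fin 3 × ℤ) :=
  univ.image fun q : ι × Fin 3 => (q.2, (p q.1).1 q.2)

lemma modeVec_apply (p : ClosedMode) (j : Fin 3 × ℤ) :
    (modeVec p : ChargeSpace) j = if p.1 j.1 = j.2 then 1 else 0 := by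
  obtain ⟨i, q⟩ := j
  simp only [modeVec, lp.coeFn_sum, Finset.sum_apply, lp.coeFn_single, Pi.single_apply,
      Prod.mk.injEq]
  rw [Finset.sum_eq_single i]
  · simp [eq_comm]
  · intro j _ hj; rw [if_neg fun h => hj h.1.symm]
  · simp

/-- `Γ(p)` is the pairing of the field with `modeVec p`. For finitely many modes only the
coordinates in `modeSupport` matter, so expectations are finite products. -/
lemma sum_modeVec_mul {ι : Type*} [Fintype ι] (p : ι → ClosedMode) (k : ι) (τ : Fin 3 × ℤ → ℝ) :
    ∑ j ∈ modeSupport p, (modeVec (p k) : ChargeSpace) j * τ j = Gam τ (p k).1 := by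
  have h1 : (univ.image fun i : Fin 3 => (i, (p k).1 i)) ⊆ modeSupport p := by
    intro j hj
    obtain ⟨i, _, rfl⟩ := mem_image.1 hj
    exact mem_image.2 ⟨(k, i), mem_univ _, rfl⟩
  rw [← sum_subset h1]
  · rw [sum_image fun i _ i' _ h => congrArg Prod.fst h, Gam]
    simp [modeVec_apply]
  · intro j _ hj
    rw [modeVec_apply, if_neg, zero_mul]
    exact fun h => hj (mem_image.2 ⟨j.1, mem_univ _, by rw [h]⟩)

lemma sum_particleVec_mul {ι : Type*} [Fintype ι] (y : ι → Particle) (k : ι) (τ : Fin 3 × ℤ → ℝ) :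
    ∑ j ∈ modeSupport (fun i => (y i).1), (particleVec (y k) : ChargeSpace) j * τ j =
      √2 * |(y k).2| * Gam τ (y k).1.1 := by
  rw [← sum_modeVec_mul (fun i => (y i).1) k, mul_sum]
  refine sum_congr rfl fun j _ => ?_
  simp only [particleVec, lp.coeFn_smul, Pi.smul_apply, smul_eq_mul]
  ring

lemma sum_particleVec_mul_particleVec {ι : Type*} [Fintype ι] (y : ι → Particle) (k l : ι) :
    ∑ j ∈ modeSupport (fun i => (y i).1), (particleVec (y k) : ChargeSpace) j *
      (particleVec (y l) : ChargeSpace) j = inner ℝ (particleVec (y k)) (particleVec (y l)) := by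
  rw [sum_particleVec_mul, inner_particleVec]
  have : Gam (particleVec (y l) : ChargeSpace) (y k).1.1 =
      √2 * |(y l).2| * sharedModes (y k).1.1 (y l).1.1 := by
    simp only [Gam, particleVec, lp.coeFn_smul, Pi.smul_apply, smul_eq_mul, modeVec_apply]
    rw [← mul_sum, sharedModes_eq_sum]
    simp only [eq_comm]
  rw [this]
  linear_combination (|(y k).2| * |(y l).2| * sharedModes (y k).1.1 (y l).1.1) *
    mul_self_sqrt (zero_le_two (α := ℝ))

lemma integral_exp_Gam {n : ℕ} (y : Fin n → Particle) :
    ∫ τ, Complex.exp (Complex.I * ∑ i, ((√2 * |(y i).2| * Gam τ (y i).1.1 : ℝ) : ℂ))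
      ∂vectorGaussian = (exp (-(‖∑ i, particleVec (y i)‖ ^ 2 / 2)) : ℝ) := by
  have h := integral_exp_vectorGaussian (modeSupport fun i => (y i).1)
    fun j => ∑ i, (particleVec (y i) : ChargeSpace) j
  have h1 : ∑ j ∈ modeSupport (fun i => (y i).1), (∑ i, (particleVec (y i) : ChargeSpace) j) ^ 2 =
      ‖∑ i, particleVec (y i)‖ ^ 2 := by
    rw [← real_inner_self_eq_norm_sq, sum_inner]
    simp only [inner_sum, ← sum_particleVec_mul_particleVec, sq, sum_mul_sum]
    rw [sum_comm]
    exact sum_congr rfl fun i _ => sum_comm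
  rw [h1] at h
  rw [← h]
  refine integral_congr_ae (.of_forall fun τ => ?_)
  simp only [← sum_particleVec_mul, ← Complex.ofReal_sum]
  rw [sum_comm]
  simp only [sum_mul]

lemma measurable_Gam (p : Mode) : Measurable fun τ : VectorFields => Gam τ p := by
  unfold Gam
  fun_prop

/-- The partition function of the cut-off gas. -/
lemma integral_exp_cut {m κ : ℝ} (hA : Critical m κ) {μ : ℂ}
    (hμ : κ ≤ μ.re) (Λ : Finset ClosedMode) {ε : ℝ} (hε : 0 < ε) :
    ∫ τ, Complex.exp (∫ y, (cut Λ ε).indicator (bareWeight m μ) y *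
      Complex.exp (Complex.I * (√2 * |y.2| * Gam τ y.1.1 : ℝ)) ∂particleMeasure)
        ∂vectorGaussian =
      Complex.exp ((∫ y, (cut Λ ε).indicator (gasWeight m μ) y ∂particleMeasure) +
        ∑' T : LabelledTree, gasTerm m μ (cut Λ ε) T.2.1) := by
  have : IsProbabilityMeasure vectorGaussian := by unfold vectorGaussian; infer_instance
  obtain ⟨h1, h2⟩ := hasSum_clusterSum hA hμ Λ hε
  rw [← h2]
  have hG : Measurable fun q : VectorFields × ClosedMode => Gam q.1 q.2.1 :=
    measurable_from_prod_countable_left fun p => measurable_Gam p.1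
  have hG' : Measurable fun q : VectorFields × Particle => Gam q.1 q.2.1.1 :=
    hG.comp (measurable_fst.prodMk (measurable_fst.comp measurable_snd))
  have hX : Measurable fun q : VectorFields × Particle => √2 * |q.2.2| * Gam q.1 q.2.1.1 :=
    (measurable_const.mul (measurable_abs.comp (measurable_snd.comp measurable_snd))).mul hG'
  have hb := integrable_cut_bareWeight hA.1 (hA.2.trans_le hμ) Λ hε
  have hg := integrable_cut_gasWeight hA.1 (hA.2.trans_le hμ) Λ hε
  have hbg := indicator_gasWeight (m := m) μ (cut Λ ε)
  generalize (cut Λ ε).indicator (bareWeight m μ) = ω' at *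
  generalize (cut Λ ε).indicator (gasWeight m μ) = ω at *
  exact integral_exp_eq_exp_tsum hb hg hbg
    continuous_particleVec inner_particleVec_nonneg hX (fun _ y => integral_exp_Gam y) h1

end Characters

end

section

open Complex

/-! ### The logarithm of a mode as an integral over proper time -/

section LoopIntegral

variable {b : ℂ}

/-- If the number were real and nonpositive, its product with `b` would have nonpositive real part;
but that product is `b - I * x`, with real part `b.re`. -/
lemma one_sub_mem_slitPlane (hb : 0 < b.re) (x : ℝ) :
    1 - I * x / b ∈ slitPlane := by
  have hb0 : b ≠ 0 := fun h => by simp [h] at hb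
  rw [mem_slitPlane_iff_not_le_zero]
  intro h
  obtain ⟨h1, h2⟩ := le_def.1 h
  set z := 1 - I * x / b with hz
  have h3 : b * z = b - I * x := by rw [hz]; field_simp
  have h4 := congrArg re h3
  simp only [zero_re, zero_im] at h1 h2
  rw [mul_re, h2] at h4
  simp at h4
  nlinarith

lemma hasDerivAt_log_vertex (hb : 0 < b.re) (x : ℝ) :
    HasDerivAt (fun x : ℝ => -log (1 - I * x / b)) (I / (b - I * x)) x := by
  have hb0 : b ≠ 0 := fun h => by simp [h] at hb
  have hs := one_sub_mem_slitPlane hb x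
  have h1 : HasDerivAt (fun x : ℝ => 1 - I * (x : ℂ) / b) (-(I / b)) x := by
    have := (((ofRealCLM.hasDerivAt (x := x)).const_mul I).div_const b).const_sub 1
    simpa using! this
  refine (h1.clog_real hs).neg.congr_deriv ?_
  have h2 : b - I * x = b * (1 - I * x / b) := by field_simp
  rw [h2]
  field_simp [slitPlane_ne_zero hs]

lemma re_le_norm_sub (x : ℝ) : b.re ≤ ‖b - I * x‖ := by
  refine le_trans (le_of_eq ?_) (re_le_norm _)
  simp

/-- The quadratic remainder of the potential of a mode. -/
lemma norm_log_vertex_le (hb : 0 < b.re) (x : ℝ) :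
    ‖-log (1 - I * x / b) - I * x / b‖ ≤ x ^ 2 / (2 * b.re ^ 2) := by
  have hb0 : b ≠ 0 := fun h => by simp [h] at hb
  -- The remainder is followed along `s ↦ s * x`. Its derivative is at most s x² / (Re b)² in
  -- modulus, because both `b` and `b - I * (s * x)` have modulus at least Re b.
  have hd : ∀ s : ℝ, HasDerivAt (fun s : ℝ => -log (1 - I * (s * x : ℝ) / b) -
      I * (s * x : ℝ) / b) (x * (I / (b - I * (s * x : ℝ)) - I / b)) s := by
    intro s
    have h1 : HasDerivAt (fun s : ℝ => s * x) x s := by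
      simpa using (hasDerivAt_id s).mul_const x
    have h2 := (hasDerivAt_log_vertex hb (s * x)).scomp s h1
    have h3 : HasDerivAt (fun s : ℝ => I * (s * x : ℝ) / b) (I * x / b) s := by
      have := ((h1.ofReal_comp).const_mul I).div_const b
      simpa using! this
    refine (h2.sub h3).congr_deriv ?_
    rw [real_smul]
    ring
  have hB : ∀ s : ℝ, HasDerivAt (fun s : ℝ => s ^ 2 * (x ^ 2 / (2 * b.re ^ 2)))
      (s * (x ^ 2 / b.re ^ 2)) s := by
    intro s
    refine ((hasDerivAt_pow 2 s).mul_const _).congr_deriv ?_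
    simp
    ring
  have h := image_norm_le_of_norm_deriv_right_le_deriv_boundary
    (fun s _ => (hd s).continuousAt.continuousWithinAt) (fun s _ => (hd s).hasDerivWithinAt)
    (a := 0) (b := 1) (B := fun s : ℝ => s ^ 2 * (x ^ 2 / (2 * b.re ^ 2)))
    (by simp) hB (fun s hs => ?_) (x := 1) ⟨zero_le_one, le_rfl⟩
  · simpa using h
  · have hne : b - I * (s * x : ℝ) ≠ 0 := by
      intro h0
      have := re_le_norm_sub (b := b) (s * x)
      rw [h0, norm_zero] at this
      linarith
    have h1 : (x : ℂ) * (I / (b - I * (s * x : ℝ)) - I / b) =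
        -(s * x ^ 2 : ℝ) / (b * (b - I * (s * x : ℝ))) := by
      field_simp
      push_cast
      ring_nf
      simp
    rw [h1, norm_div, norm_neg, norm_mul, norm_real, Real.norm_eq_abs,
      abs_of_nonneg (mul_nonneg hs.1 (sq_nonneg x)), ← mul_div_assoc]
    have h2 := re_le_norm_sub (b := b) (s * x)
    have h3 := re_le_norm b
    have h4 := mul_nonneg hs.1 (sq_nonneg x)
    rw [sq b.re]
    gcongr

lemma norm_exp_neg_mul (b : ℂ) (t : ℝ) : ‖exp (-(t * b))‖ = Real.exp (-b.re * t) := by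
  rw [norm_exp, neg_re, re_ofReal_mul]
  congr 1
  ring

lemma norm_vertex_integrand_le (x : ℝ) {t : ℝ} (ht : 0 < t) :
    ‖exp (-(t * b)) / t * (exp (I * (t * x : ℝ)) - 1)‖ ≤
      |x| * Real.exp (-b.re * t) := by
  have h := Real.norm_exp_I_mul_ofReal_sub_one_le (x := t * x)
  rw [norm_mul, norm_div, norm_exp_neg_mul, norm_real, Real.norm_eq_abs, abs_of_pos ht]
  rw [Real.norm_eq_abs, abs_mul, abs_of_pos ht] at h
  refine (mul_le_mul_of_nonneg_left h (by positivity)).trans (le_of_eq ?_)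
  field_simp

lemma integrable_vertex_integrand (hb : 0 < b.re) (x : ℝ) :
    IntegrableOn (fun t : ℝ => exp (-(t * b)) / t * (exp (I * (t * x : ℝ)) - 1)) (Set.Ioi 0) := by
  refine ((integrableOn_exp_mul_Ioi (a := -b.re) (by simpa using hb) 0).const_mul |x|).mono'
    (Measurable.aestronglyMeasurable (by fun_prop)) ?_
  filter_upwards [ae_restrict_mem measurableSet_Ioi] with t ht
  exact norm_vertex_integrand_le x ht

/-- The proper time representation of the potential of a mode. -/
lemma integral_vertex (hb : 0 < b.re) (x : ℝ) :
    ∫ t in Set.Ioi (0 : ℝ), exp (-(t * b)) / t *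
      (exp (I * (t * x : ℝ)) - 1) = -log (1 - I * x / b) := by
  have hd : ∀ x : ℝ, HasDerivAt (fun x : ℝ => ∫ t in Set.Ioi (0 : ℝ), exp (-(t * b)) / t *
      (exp (I * (t * x : ℝ)) - 1)) (I / (b - I * x)) x := by
    intro x
    have h := hasDerivAt_integral_of_dominated_loc_of_deriv_le (μ := volume.restrict (Set.Ioi (0 : ℝ)))
      (F := fun (x t : ℝ) => exp (-(t * b)) / t * (exp (I * (t * x : ℝ)) - 1))
      (F' := fun x t => I * exp (-(b - I * x) * t)) (x₀ := x)
      (bound := fun t => Real.exp (-b.re * t)) univ_mem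
      (.of_forall fun x => Measurable.aestronglyMeasurable (by fun_prop))
      (integrable_vertex_integrand hb x) (Measurable.aestronglyMeasurable (by fun_prop)) ?_
      (integrableOn_exp_mul_Ioi (a := -b.re) (by simpa using hb) 0) ?_
    · refine h.2.congr_deriv ?_
      have hre : (-(b - I * x)).re < 0 := by simpa using hb
      rw [integral_const_mul, integral_exp_mul_complex_Ioi hre 0]
      rw [ofReal_zero, mul_zero, exp_zero, neg_div_neg_eq, mul_one_div]
    · refine .of_forall fun t x _ => le_of_eq ?_
      rw [norm_mul, norm_I, one_mul, norm_exp]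
      simp
    · filter_upwards [ae_restrict_mem measurableSet_Ioi] with t ht x _
      have ht0 : (t : ℂ) ≠ 0 := ofReal_ne_zero.2 (ne_of_gt ht)
      have h1 : HasDerivAt (fun x : ℝ => I * (t * x : ℝ)) (I * t) x := by
        have := (((hasDerivAt_id x).const_mul t).ofReal_comp).const_mul I
        simpa using! this
      refine ((h1.cexp.sub_const 1).const_mul (exp (-(t * b)) / t)).congr_deriv ?_
      rw [show -(b - I * x) * t = -(t * b) + I * (t * x : ℝ) by push_cast; ring,
        exp_add]
      field_simp
  -- Both sides have derivative `I / (b - I * x)` and vanish at `x = 0`.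
  have hconst := is_const_of_deriv_eq_zero (f := fun x : ℝ => (∫ t in Set.Ioi (0 : ℝ),
      exp (-(t * b)) / t * (exp (I * (t * x : ℝ)) - 1)) -
      -log (1 - I * x / b))
    (fun x => ((hd x).sub (hasDerivAt_log_vertex hb x)).differentiableAt)
    (fun x => ((hd x).fun_sub (hasDerivAt_log_vertex hb x)).deriv.trans (sub_self _)) x 0
  simp only [mul_zero, ofReal_zero, exp_zero, sub_self, integral_zero, zero_div,
    sub_zero, log_one, neg_zero] at hconst
  exact sub_eq_zero.1 hconst

end LoopIntegral

/-! ### The cut-off potential as an integral over particles -/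

section ParticleIntegrals

variable {m κ : ℝ}
  {S : Set Particle} {μ : ℂ} {ε : ℝ}

lemma integrable_particle {E : Type*} [NormedAddCommGroup E] [NormedSpace ℝ E] {f : Particle → E}
    (hf : AEStronglyMeasurable f particleMeasure)
    (h : ∀ p, IntegrableOn (fun t => f (p, t)) (Set.Ioi 0))
    (hs : Summable fun p : ClosedMode => ∫ t in Set.Ioi 0, ‖f (p, t)‖) :
    Integrable f particleMeasure := by
  rw [particleMeasure] at hf ⊢
  rw [integrable_prod_iff hf]
  refine ⟨.of_forall h, integrable_count_iff.2 ?_⟩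
  refine hs.congr fun p => ?_
  rw [Real.norm_of_nonneg (integral_nonneg fun _ => norm_nonneg _)]

lemma integral_particle {E : Type*} [NormedAddCommGroup E] [NormedSpace ℝ E] [CompleteSpace E]
    {f : Particle → E} (hf : Integrable f particleMeasure) :
    ∫ y, f y ∂particleMeasure = ∑' p : ClosedMode, ∫ t in Set.Ioi 0, f (p, t) := by
  have hf' := hf
  rw [particleMeasure] at hf' ⊢
  rw [integral_prod _ hf', integral_countable hf'.integral_prod_left]
  refine tsum_congr fun p => ?_
  simp [measureReal_def]

/-- The factor of the proper time `t` in the potential of a mode. -/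
def vertexIntegrand (m : ℝ) (μ : ℂ) (τ : VectorFields) (y : Particle) : ℂ :=
  bareWeight m μ y * (exp (I * (y.2 * (√2 * Gam τ y.1.1) : ℝ)) - 1)

lemma re_div_C0 (μ : ℂ) (p : Mode) : (μ / C0 m p).re = μ.re / C0 m p := div_ofReal_re _ _

lemma norm_vertexIntegrand_le (μ : ℂ) (τ : VectorFields) {y : Particle} (hy : 0 < y.2) :
    ‖vertexIntegrand m μ τ y‖ ≤
      |√2 * Gam τ y.1.1| * Real.exp (-(μ.re / C0 m y.1.1) * y.2) := by
  rw [← re_div_C0]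
  exact norm_vertex_integrand_le _ hy

lemma measurable_indicator_vertexIntegrand (μ : ℂ) (hS : MeasurableSet S) :
    Measurable fun q : VectorFields × Particle => S.indicator (vertexIntegrand m μ q.1) q.2 := by
  have hG : Measurable fun q : VectorFields × ClosedMode => Gam q.1 q.2.1 :=
    measurable_from_prod_countable_left fun p => measurable_Gam p.1
  have hG' : Measurable fun q : VectorFields × Particle => Gam q.1 q.2.1.1 :=
    hG.comp (measurable_fst.prodMk (measurable_fst.comp measurable_snd))
  have h2 := measurable_bareWeight (m := m) μ
  have h : Measurable fun q : VectorFields × Particle => vertexIntegrand m μ q.1 q.2 := by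
    unfold vertexIntegrand
    fun_prop
  exact h.indicator (measurable_snd hS : MeasurableSet ((Prod.snd : VectorFields × Particle → _) ⁻¹' S))

lemma measurable_indicator_vertexIntegrand_right (μ : ℂ) (hS : MeasurableSet S)
    (τ : VectorFields) : Measurable (S.indicator (vertexIntegrand m μ τ)) :=
  (measurable_indicator_vertexIntegrand μ hS).comp measurable_prodMk_left

/-- The bound on the potential of the modes in `Λ` and its integrand. -/
def vertexBound (m κ : ℝ) (Λ : Finset ClosedMode) (τ : VectorFields) (y : Particle) : ℝ :=
  (cut Λ 0).indicator (fun y => |√2 * Gam τ y.1.1| * Real.exp (-(κ / C0 m y.1.1) * y.2)) y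

lemma integrable_vertexBound (hm : 0 < m) (hκ : 0 < κ) (Λ : Finset ClosedMode) (τ : VectorFields) :
    Integrable (vertexBound m κ Λ τ) particleMeasure ∧
    ∫ y, vertexBound m κ Λ τ y ∂particleMeasure =
      ∑ p ∈ Λ, |√2 * Gam τ p.1| * (C0 m p.1 / κ) := by
  have hb : ∀ p : ClosedMode, -(κ / C0 m p.1) < 0 := fun p => by
    have := div_pos hκ (C0_pos hm p.1); linarith
  have hcut : ∀ (p : ClosedMode), p ∉ Λ → ∀ t, vertexBound m κ Λ τ (p, t) = 0 :=
    fun p hp t => Set.indicator_of_notMem (fun h => hp h.1) _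
  have hcut' : ∀ (p : ClosedMode), p ∈ Λ → ∀ t ∈ Set.Ioi (0 : ℝ), vertexBound m κ Λ τ (p, t) =
      |√2 * Gam τ p.1| * Real.exp (-(κ / C0 m p.1) * t) :=
    fun p hp t ht => Set.indicator_of_mem (s := cut Λ 0) (a := (p, t)) ⟨hp, ht⟩ _
  have hmeas : Measurable (vertexBound m κ Λ τ) := by
    have h1 : Measurable fun y : Particle => Gam τ y.1.1 :=
      (measurable_of_countable fun p : ClosedMode => Gam τ p.1).comp measurable_fst
    have h2 := measurable_C0 (m := m)
    exact Measurable.indicator (by fun_prop) (measurableSet_cut Λ 0)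
  have hI : Integrable (vertexBound m κ Λ τ) particleMeasure := by
    refine integrable_particle hmeas.aestronglyMeasurable (fun p => ?_) ?_
    · by_cases hp : p ∈ Λ
      · exact IntegrableOn.congr_fun ((integrableOn_exp_mul_Ioi (hb p) 0).const_mul _)
          (fun t ht => (hcut' p hp t ht).symm) measurableSet_Ioi
      · simp [hcut p hp, integrableOn_zero]
    · refine summable_of_hasFiniteSupport ((Finset.finite_toSet Λ).subset fun p hp => ?_)
      by_contra h
      exact hp (by simp [hcut p h])
  refine ⟨hI, ?_⟩
  rw [integral_particle hI, tsum_eq_sum (s := Λ)]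
  · refine Finset.sum_congr rfl fun p hp => ?_
    rw [setIntegral_congr_fun measurableSet_Ioi (hcut' p hp), integral_const_mul,
      integral_exp_mul_Ioi (hb p)]
    simp [neg_div_neg_eq]
  · intro p hp; simp [hcut p hp]

/-- The difference of the character and `1` cancels the singularity `1/t`, so the bound is uniform
down to `ε = 0`. -/
lemma norm_indicator_vertexIntegrand_le (hm : 0 < m) (hμ : κ ≤ μ.re) (Λ : Finset ClosedMode)
    (hε : 0 ≤ ε) (τ : VectorFields) (y : Particle) :
    ‖(cut Λ ε).indicator (vertexIntegrand m μ τ) y‖ ≤ vertexBound m κ Λ τ y := by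
  by_cases hc : y ∈ cut Λ ε
  · have hy : 0 < y.2 := hε.trans_lt hc.2
    have hC := C0_pos hm y.1.1
    have h0 : y ∈ cut Λ 0 := ⟨hc.1, hy⟩
    rw [Set.indicator_of_mem hc, vertexBound, Set.indicator_of_mem h0]
    refine (norm_vertexIntegrand_le μ τ hy).trans ?_
    gcongr
  · rw [Set.indicator_of_notMem hc, norm_zero]
    exact Set.indicator_apply_nonneg fun _ => by positivity

lemma integrable_indicator_vertexIntegrand (hm : 0 < m) (hμ : 0 < μ.re) (Λ : Finset ClosedMode)
    (hε : 0 ≤ ε) (τ : VectorFields) :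
    Integrable ((cut Λ ε).indicator (vertexIntegrand m μ τ)) particleMeasure :=
  (integrable_vertexBound hm hμ Λ τ).1.mono'
    (measurable_indicator_vertexIntegrand_right μ (measurableSet_cut Λ ε) τ).aestronglyMeasurable
    (.of_forall fun y => norm_indicator_vertexIntegrand_le hm le_rfl Λ hε τ y)

/-- The cut-off potential in the proper time representation. -/
lemma integral_vertexIntegrand (hm : 0 < m) (hμ : 0 < μ.re) (Λ : Finset ClosedMode)
    (τ : VectorFields) : ∫ y, (cut Λ 0).indicator (vertexIntegrand m μ τ) y ∂particleMeasure =
      -∑ p ∈ Λ, log (1 - I * (√2 * Gam τ p.1 : ℝ) / (μ / C0 m p.1)) := by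
  have hI := integrable_indicator_vertexIntegrand hm hμ Λ le_rfl τ
  rw [integral_particle hI, tsum_eq_sum (s := Λ), ← Finset.sum_neg_distrib]
  · refine Finset.sum_congr rfl fun p hp => ?_
    have hb : 0 < (μ / C0 m p.1).re := by
      rw [re_div_C0]; exact div_pos hμ (C0_pos hm p.1)
    rw [← integral_vertex hb]
    refine setIntegral_congr_fun measurableSet_Ioi fun t ht => ?_
    exact Set.indicator_of_mem (s := cut Λ 0) (a := (p, t)) ⟨hp, ht⟩ _
  · intro p hp
    have : ∀ t, (cut Λ 0).indicator (vertexIntegrand m μ τ) (p, t) = 0 :=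
      fun t => Set.indicator_of_notMem (fun h => hp h.1) _
    simp [this]

end ParticleIntegrals

/-! ### Laws of linear combinations of the fields Γ -/

section GaussianLaws

open Finset

instance : IsProbabilityMeasure vectorGaussian := by unfold vectorGaussian; infer_instance

/-- The variance of a linear combination of the fields `Γ`. -/
def gamVariance (Λ : Finset ClosedMode) (a : ClosedMode → ℝ) : ℝ :=
  ∑ p ∈ Λ, ∑ q ∈ Λ, a p * a q * sharedModes p.1 q.1

lemma gamVariance_eq (Λ : Finset ClosedMode) (a : ClosedMode → ℝ) :
    gamVariance Λ a = ∑ j ∈ modeSupport (Subtype.val : Λ → ClosedMode),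
      (∑ p ∈ Λ, a p * (modeVec p : ChargeSpace) j) ^ 2 := by
  simp only [← sum_coe_sort Λ, gamVariance, sq, sum_mul_sum]
  rw [sum_comm]
  refine Eq.trans (sum_congr rfl fun p _ => ?_) sum_comm.symm
  rw [sum_comm]
  refine sum_congr rfl fun q _ => ?_
  have h := sum_modeVec_mul (Subtype.val : Λ → ClosedMode) p (modeVec q.1 : ChargeSpace)
  have h2 : Gam (modeVec q.1 : ChargeSpace) p.1.1 = sharedModes p.1.1 q.1.1 := by
    simp only [Gam, modeVec_apply, sharedModes_eq_sum, eq_comm]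
  rw [sharedModes_comm, ← h2, ← h, mul_sum]
  exact sum_congr rfl fun j _ => by ring

lemma gamVariance_nonneg (Λ : Finset ClosedMode) (a : ClosedMode → ℝ) : 0 ≤ gamVariance Λ a := by
  rw [gamVariance_eq]; positivity

lemma sum_mul_Gam_eq (Λ : Finset ClosedMode) (a : ClosedMode → ℝ) (τ : VectorFields) :
    ∑ p ∈ Λ, a p * Gam τ p.1 = ∑ j ∈ modeSupport (Subtype.val : Λ → ClosedMode),
      (∑ p ∈ Λ, a p * (modeVec p : ChargeSpace) j) * τ j := by
  simp only [← sum_coe_sort Λ, sum_mul]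
  rw [sum_comm]
  refine sum_congr rfl fun p _ => ?_
  rw [← sum_modeVec_mul (Subtype.val : Λ → ClosedMode) p τ, mul_sum]
  exact sum_congr rfl fun j _ => by ring

lemma measurable_sum_Gam (Λ : Finset ClosedMode) (a : ClosedMode → ℝ) :
    Measurable fun τ : VectorFields => ∑ p ∈ Λ, a p * Gam τ p.1 :=
  Finset.measurable_sum _ fun p _ => (measurable_Gam p.1).const_mul _

lemma map_sum_Gam (Λ : Finset ClosedMode) (a : ClosedMode → ℝ) :
    vectorGaussian.map (fun τ => ∑ p ∈ Λ, a p * Gam τ p.1) =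
      gaussianReal 0 (gamVariance Λ a).toNNReal := by
  have hm := measurable_sum_Gam Λ a
  have : IsProbabilityMeasure (vectorGaussian.map fun τ => ∑ p ∈ Λ, a p * Gam τ p.1) :=
    Measure.isProbabilityMeasure_map hm.aemeasurable
  refine Measure.ext_of_charFun (funext fun t => ?_)
  rw [charFun_gaussianReal, charFun_apply_real, integral_map hm.aemeasurable
    (Measurable.aestronglyMeasurable (by fun_prop))]
  have h := integral_exp_vectorGaussian (modeSupport (Subtype.val : Λ → ClosedMode))
    fun j => t * ∑ p ∈ Λ, a p * (modeVec p : ChargeSpace) j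
  simp only [mul_assoc, ← mul_sum, ← sum_mul_Gam_eq, mul_pow, ← gamVariance_eq] at h
  rw [ofReal_exp] at h
  refine Eq.trans ?_ (h.trans ?_)
  · refine integral_congr_ae (.of_forall fun τ => ?_)
    simp only
    congr 1
    rw [ofReal_mul]
    ring
  · congr 1
    rw [Real.coe_toNNReal _ (gamVariance_nonneg Λ a)]
    push_cast
    ring

lemma map_Gam (p : ClosedMode) :
    vectorGaussian.map (fun τ => Gam τ p.1) = gaussianReal 0 3 := by
  have h := map_sum_Gam {p} fun _ => 1
  simp only [sum_singleton, one_mul] at h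
  rw [h, gamVariance]
  simp [sharedModes_self]

lemma integrable_comp_Gam {f : ℝ → ℝ} (hf : Measurable f) (p : ClosedMode)
    (h : Integrable f (gaussianReal 0 3)) : Integrable (fun τ => f (Gam τ p.1)) vectorGaussian := by
  rw [← map_Gam p] at h
  exact (integrable_map_measure hf.aestronglyMeasurable (measurable_Gam p.1).aemeasurable).1 h

lemma exp_mul_abs_le (c x : ℝ) : Real.exp (c * |x|) ≤ Real.exp (c * x) + Real.exp (-c * x) := by
  rcases abs_cases x with ⟨h, _⟩ | ⟨h, _⟩ <;> rw [h]
  · linarith [Real.exp_pos (-c * x)]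
  · rw [show c * -x = -c * x by ring]
    linarith [Real.exp_pos (c * x)]

lemma integrable_exp_abs_gaussianReal (v : NNReal) (c : ℝ) :
    Integrable (fun x => Real.exp (c * |x|)) (gaussianReal 0 v) := by
  refine ((integrable_exp_mul_gaussianReal c).add (integrable_exp_mul_gaussianReal (-c))).mono'
    (Measurable.aestronglyMeasurable (by fun_prop)) (.of_forall fun x => ?_)
  rw [Real.norm_eq_abs, Real.abs_exp]
  exact exp_mul_abs_le c x

/-- The sum is at most the number of terms times the largest; the `1` covers the empty sum.
Independence of the summands is not needed. -/
lemma exp_sum_le {ι : Type*} (s : Finset ι) (a : ι → ℝ) :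
    Real.exp (∑ i ∈ s, a i) ≤ 1 + ∑ i ∈ s, Real.exp (s.card * a i) := by
  rcases s.eq_empty_or_nonempty with rfl | hs
  · simp
  · obtain ⟨i, hi, hmax⟩ := exists_max_image s a hs
    have h1 : ∑ j ∈ s, a j ≤ s.card * a i := by
      rw [← nsmul_eq_mul]; exact sum_le_card_nsmul _ _ _ hmax
    have h2 := single_le_sum (f := fun i => Real.exp (s.card * a i))
      (fun _ _ => (Real.exp_pos _).le) hi
    have h3 := Real.exp_le_exp.2 h1
    linarith [show Real.exp (s.card * a i) ≤ ∑ i ∈ s, Real.exp (s.card * a i) from h2]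

lemma integrable_exp_sum_abs_Gam (Λ : Finset ClosedMode) (c : ClosedMode → ℝ) :
    Integrable (fun τ => Real.exp (∑ p ∈ Λ, c p * |Gam τ p.1|)) vectorGaussian := by
  have h : Integrable (fun τ => 1 + ∑ p ∈ Λ, Real.exp (Λ.card * c p * |Gam τ p.1|)) vectorGaussian :=
    (integrable_const 1).add (integrable_finsetSum _ fun p _ => integrable_comp_Gam
      (f := fun x => Real.exp (Λ.card * c p * |x|)) (by fun_prop) p
      (integrable_exp_abs_gaussianReal 3 _))
  refine h.mono' (Measurable.aestronglyMeasurable ?_) (.of_forall fun τ => ?_)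
  · exact Real.measurable_exp.comp (Finset.measurable_sum _ fun p _ =>
      (measurable_Gam p.1).abs.const_mul _)
  · rw [Real.norm_eq_abs, Real.abs_exp]
    simpa only [mul_assoc] using exp_sum_le Λ fun p => c p * |Gam τ p.1|

end GaussianLaws

/-! ### The one-particle term -/

section SelfEnergy

variable {m κ : ℝ}
  {μ : ℂ}

/-- The integrand of the contribution of a single particle. -/
def selfIntegrand (m : ℝ) (μ : ℂ) (y : Particle) : ℂ := gasWeight m μ y - bareWeight m μ y

/-- The contribution of a single particle. -/
def selfEnergy (m : ℝ) (μ : ℂ) (S : Set Particle) : ℂ :=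
  ∫ y, S.indicator (selfIntegrand m μ) y ∂particleMeasure

/-- The bound on the contribution of a single particle. -/
def selfBound (m κ : ℝ) (y : Particle) : ℝ := 3 * (y.2 * Real.exp (-(κ / C0 m y.1.1 * y.2)))

/-- The difference e^(-3t²) - 1 gains t² against the singular factor 1/t. The time integral is then
of order C₀², which is summable over the modes. -/
lemma norm_selfIntegrand_le (hm : 0 < m) (hμ : κ ≤ μ.re) {y : Particle} (hy : 0 < y.2) :
    ‖selfIntegrand m μ y‖ ≤ selfBound m κ y := by
  have hC := C0_pos hm y.1.1
  have h1 : selfIntegrand m μ y = bareWeight m μ y * ((Real.exp (-(3 * y.2 ^ 2)) - 1 : ℝ) : ℂ) := by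
    rw [selfIntegrand, gasWeight]; push_cast; ring
  have h2 : |Real.exp (-(3 * y.2 ^ 2)) - 1| ≤ 3 * y.2 ^ 2 := by
    rw [abs_le]
    constructor
    · linarith [Real.add_one_le_exp (-(3 * y.2 ^ 2))]
    · have : Real.exp (-(3 * y.2 ^ 2)) ≤ 1 := Real.exp_le_one_iff.2 (by nlinarith [sq_nonneg y.2])
      nlinarith [sq_nonneg y.2]
  rw [h1, norm_mul, norm_real, Real.norm_eq_abs, bareWeight, norm_div, norm_exp_neg_mul,
    norm_real, Real.norm_eq_abs, abs_of_pos hy, re_div_C0]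
  calc _ ≤ Real.exp (-(μ.re / C0 m y.1.1) * y.2) / y.2 * (3 * y.2 ^ 2) := by gcongr
    _ = 3 * (y.2 * Real.exp (-(μ.re / C0 m y.1.1) * y.2)) := by field_simp
    _ ≤ _ := by
      rw [selfBound, neg_mul]
      gcongr

lemma integrable_selfBound (hm : 0 < m) (hκ : 0 < κ) : Integrable (selfBound m κ) particleMeasure := by
  have hmeas : Measurable (selfBound m κ) := by
    have h2 := measurable_C0 (m := m)
    unfold selfBound
    fun_prop
  have hb : ∀ p : ClosedMode, 0 < κ / C0 m p.1 := fun p => div_pos hκ (C0_pos hm p.1)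
  have h1 : ∀ p : ClosedMode, ∀ t : ℝ, selfBound m κ (p, t) =
      3 * (t ^ ((2 : ℝ) - 1) * Real.exp (-(κ / C0 m p.1 * t))) := by
    intro p t
    norm_num [selfBound]
  have h2 : ∀ p : ClosedMode, IntegrableOn (fun t => selfBound m κ (p, t)) (Set.Ioi 0) := by
    intro p
    simp only [h1]
    have h := integrableOn_rpow_mul_exp_neg_mul_rpow (p := 1) (s := 1) (b := κ / C0 m p.1)
      (by norm_num) zero_lt_one (hb p)
    refine (h.const_mul 3).congr (.of_forall fun t => ?_)
    norm_num
  refine integrable_particle hmeas.aestronglyMeasurable h2 ?_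
  refine ((summable_C0_sq hm).mul_left (3 / κ ^ 2)).congr fun p => ?_
  have h3 : ∀ t ∈ Set.Ioi (0 : ℝ), ‖selfBound m κ (p, t)‖ =
      3 * (t ^ ((2 : ℝ) - 1) * Real.exp (-(κ / C0 m p.1 * t))) := by
    intro t ht
    rw [Real.norm_of_nonneg, h1]
    rw [selfBound]
    have : 0 < t := ht
    positivity
  have hC := C0_pos hm p.1
  rw [setIntegral_congr_fun measurableSet_Ioi h3, integral_const_mul,
    Real.integral_rpow_mul_exp_neg_mul_Ioi two_pos (hb p), Real.Gamma_two]
  norm_num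
  field_simp

lemma measurable_selfIntegrand (μ : ℂ) : Measurable (selfIntegrand m μ) :=
  (measurable_gasWeight μ).sub (measurable_bareWeight μ)

lemma tendsto_selfEnergy (hm : 0 < m) (hκ : 0 < κ) (hμ : κ ≤ μ.re)
    {S : ℕ → Set Particle} {S' : Set Particle} (hS : ∀ j, MeasurableSet (S j))
    (h : Exhausts S S') : Tendsto (fun j => selfEnergy m μ (S j)) atTop (𝓝 (selfEnergy m μ S')) := by
  refine tendsto_integral_of_dominated_convergence _
    (fun j => ((measurable_selfIntegrand μ).indicator (hS j)).aestronglyMeasurable)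
    (integrable_selfBound hm hκ) (fun j => ?_) ?_
  · filter_upwards [ae_particle_pos] with y hy
    exact (norm_indicator_le_norm_self _ _).trans (norm_selfIntegrand_le hm hμ hy)
  · filter_upwards [ae_particle_pos] with y hy
    refine tendsto_const_nhds.congr' ?_
    filter_upwards [h.indicator (selfIntegrand m μ) hy] with j hj using hj.symm

end SelfEnergy

/-! ### Removal of the cutoff on proper times -/

section FiniteModes

variable {m κ : ℝ}
  {μ : ℂ}

/-- The vertex integral is that of the characters minus the field-independent integral of the bare
weight. Dividing `integral_exp_cut` by the exponential of this constant turns the integral of the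
gas weight into the self-energy, which stays finite as ε → 0. -/
lemma integral_exp_vertexIntegrand (hA : Critical m κ)
    (hμ : κ ≤ μ.re) (Λ : Finset ClosedMode) {ε : ℝ} (hε : 0 < ε) :
    ∫ τ, exp (∫ y, (cut Λ ε).indicator (vertexIntegrand m μ τ) y ∂particleMeasure)
        ∂vectorGaussian =
      exp (selfEnergy m μ (cut Λ ε) + ∑' T : LabelledTree, gasTerm m μ (cut Λ ε) T.2.1) := by
  have hb := integrable_cut_bareWeight hA.1 (hA.2.trans_le hμ) Λ hε
  have hg := integrable_cut_gasWeight hA.1 (hA.2.trans_le hμ) Λ hε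
  have h := integral_exp_cut hA hμ Λ hε
  have h1 : ∀ τ y, (cut Λ ε).indicator (bareWeight m μ) y *
      exp (I * (√2 * |y.2| * Gam τ y.1.1 : ℝ)) =
      (cut Λ ε).indicator (vertexIntegrand m μ τ) y + (cut Λ ε).indicator (bareWeight m μ) y := by
    intro τ y
    by_cases hc : y ∈ cut Λ ε
    · simp only [Set.indicator_of_mem hc]
      rw [vertexIntegrand, abs_of_pos (hε.trans hc.2),
        show √2 * y.2 * Gam τ y.1.1 = y.2 * (√2 * Gam τ y.1.1) by ring]
      ring
    · simp only [Set.indicator_of_notMem hc]; simp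
  have hI := integrable_indicator_vertexIntegrand hA.1 (hA.2.trans_le hμ) Λ hε.le
  have h2 : selfEnergy m μ (cut Λ ε) = (∫ y, (cut Λ ε).indicator (gasWeight m μ) y ∂particleMeasure) -
      ∫ y, (cut Λ ε).indicator (bareWeight m μ) y ∂particleMeasure := by
    rw [selfEnergy, ← integral_sub hg hb]
    refine integral_congr_ae (.of_forall fun y => ?_)
    exact congrFun (Set.indicator_sub (cut Λ ε) (gasWeight m μ) (bareWeight m μ)) y
  simp only [h1] at h
  simp only [integral_add (hI _) hb, exp_add] at h
  rw [integral_mul_const] at h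
  rw [h2, exp_add, exp_sub, div_mul_eq_mul_div, eq_div_iff (exp_ne_zero _)]
  exact h

/-- The tree expansion with finitely many modes. -/
lemma integral_exp_modes (hA : Critical m κ) (hμ : κ ≤ μ.re) (Λ : Finset ClosedMode) :
    ∫ τ, exp (-∑ p ∈ Λ, log (1 - I * (√2 * Gam τ p.1 : ℝ) / (μ / C0 m p.1))) ∂vectorGaussian =
      exp (selfEnergy m μ (cut Λ 0) + ∑' T : LabelledTree, gasTerm m μ (cut Λ 0) T.2.1) := by
  have hpos : ∀ j : ℕ, (0 : ℝ) < 1 / ((j : ℝ) + 1) := fun j => by positivity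
  have hmono : ∀ (j : ℕ) τ y, ‖(cut Λ (1 / ((j : ℝ) + 1))).indicator (vertexIntegrand m μ τ) y‖ ≤
      vertexBound m κ Λ τ y := fun j τ y =>
    norm_indicator_vertexIntegrand_le hA.1 hμ Λ (hpos j).le τ y
  -- Both sides of the identity with cutoff ε = 1/(j + 1) are followed as j → ∞.
  refine tendsto_nhds_unique (f := fun j : ℕ => ∫ τ, exp (∫ y,
    (cut Λ (1 / ((j : ℝ) + 1))).indicator (vertexIntegrand m μ τ) y ∂particleMeasure)
      ∂vectorGaussian) (l := atTop) ?_ ?_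
  · refine tendsto_integral_of_dominated_convergence
      (fun τ => Real.exp (∑ p ∈ Λ, √2 * (C0 m p.1 / κ) * |Gam τ p.1|)) (fun j => ?_)
      (integrable_exp_sum_abs_Gam Λ fun p => √2 * (C0 m p.1 / κ)) (fun j => ?_) ?_
    · refine continuous_exp.comp_aestronglyMeasurable ?_
      exact ((measurable_indicator_vertexIntegrand μ (measurableSet_cut Λ _)).aestronglyMeasurable
        (μ := vectorGaussian.prod particleMeasure)).integral_prod_right'
    · refine .of_forall fun τ => ?_
      rw [norm_exp]
      refine Real.exp_le_exp.2 ((re_le_norm _).trans ?_)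
      refine (norm_integral_le_of_norm_le (integrable_vertexBound hA.1 hA.2 Λ τ).1
        (.of_forall (hmono j τ))).trans (le_of_eq ?_)
      rw [(integrable_vertexBound hA.1 hA.2 Λ τ).2]
      refine Finset.sum_congr rfl fun p _ => ?_
      rw [abs_mul, abs_of_nonneg (Real.sqrt_nonneg 2)]
      ring
    · refine .of_forall fun τ => ?_
      rw [← integral_vertexIntegrand hA.1 (hA.2.trans_le hμ)]
      refine (continuous_exp.tendsto _).comp ?_
      refine tendsto_integral_of_dominated_convergence _ (fun j =>
        (measurable_indicator_vertexIntegrand_right μ (measurableSet_cut Λ _) τ).aestronglyMeasurable)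
        (integrable_vertexBound hA.1 hA.2 Λ τ).1 (fun j => .of_forall (hmono j τ)) ?_
      filter_upwards [ae_particle_pos] with y hy
      refine tendsto_const_nhds.congr' ?_
      filter_upwards [(exhausts_cut Λ).indicator (vertexIntegrand m μ τ) hy] with j hj using hj.symm
  · simp only [integral_exp_vertexIntegrand hA hμ Λ (hpos _)]
    refine (continuous_exp.tendsto _).comp ?_
    exact (tendsto_selfEnergy hA.1 hA.2 hμ (fun j => measurableSet_cut _ _) (exhausts_cut Λ)).add
      (tendsto_tsum_gasTerm hA hμ (fun j => measurableSet_cut _ _) (exhausts_cut Λ))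

end FiniteModes

/-! ### Almost sure convergence and convergence of expectations -/

section Convergence

variable {Ω : Type*} [MeasurableSpace Ω] {P : Measure Ω}

lemma eLpNorm_four_pow (f : Ω → ℝ) : eLpNorm f 4 P ^ 4 = ∫⁻ ω, ‖f ω‖ₑ ^ 4 ∂P := by
  have h := eLpNorm_nnreal_pow_eq_lintegral (f := f) (μ := P) (p := 4) (by norm_num)
  rw [show ((4 : NNReal) : ℝ) = ((4 : ℕ) : ℝ) by norm_num, ENNReal.rpow_natCast] at h
  simp only [ENNReal.rpow_natCast] at h
  exact_mod_cast h

/-- A sequence whose fourth moments of differences are summable converges almost surely. -/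
lemma ae_tendsto_of_fourth_moment {X : ℕ → Ω → ℝ} (hX : ∀ n, Measurable (X n))
    (hX4 : ∀ n, ∫⁻ ω, ‖X n ω‖ₑ ^ 4 ∂P ≠ ⊤) {B : ℕ → ENNReal} (hB : ∑' n, B n ≠ ⊤)
    (h : ∀ M N, M ≤ N → ∫⁻ ω, ‖X N ω - X M ω‖ₑ ^ 4 ∂P ≤ B M) :
    ∀ᵐ ω ∂P, ∃ l, Tendsto (fun n => X n ω) atTop (𝓝 l) := by
  have hB0 : Tendsto B atTop (𝓝 0) := by
    have := ENNReal.tendsto_cofinite_zero_of_tsum_ne_top hB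
    rwa [Nat.cofinite_eq_atTop] at this
  have hlt : ∀ k : ℕ, ∀ᶠ n in atTop, B n < ((2 : ENNReal)⁻¹ ^ k) ^ 4 := fun k =>
    hB0.eventually_lt_const (by simp [ENNReal.pow_pos])
  -- A subsequence with geometrically small differences provides a limit in L⁴.
  obtain ⟨n, hn, hnB⟩ := extraction_forall_of_eventually' fun k => eventually_atTop.1 (hlt k)
  have hdiff : ∀ M N, M ≤ N → eLpNorm (X N - X M) 4 P ^ 4 ≤ B M := fun M N hMN => by
    rw [eLpNorm_four_pow]; exact h M N hMN
  have hlp : ∀ k, MemLp (X k) 4 P := fun k => by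
    refine ⟨(hX k).aestronglyMeasurable, ?_⟩
    have h4 := hX4 k
    rw [← eLpNorm_four_pow] at h4
    exact lt_top_iff_ne_top.2 fun h => h4 (by rw [h]; simp)
  obtain ⟨Y, hY, hlim⟩ := Lp.cauchy_complete_eLpNorm (p := 4) (μ := P) (by norm_num)
    (f := fun k => X (n k)) (fun k => hlp _) (B := fun k => (2 : ENNReal)⁻¹ ^ k)
    (by rw [ENNReal.tsum_geometric]; simp [ENNReal.inv_eq_top, tsub_eq_zero_iff_le]) (fun K a b ha hb => by
      wlog hab : b ≤ a generalizing a b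
      · rw [eLpNorm_sub_comm]; exact this b a hb ha (le_of_not_ge hab)
      have h1 := (hdiff (n b) (n a) (hn.monotone hab)).trans_lt (hnB b)
      have h2 : eLpNorm (X (n a) - X (n b)) 4 P < (2 : ENNReal)⁻¹ ^ b :=
        lt_of_not_ge fun hge => absurd h1 (not_lt.2 (pow_le_pow_left₀ zero_le hge 4))
      refine h2.trans_le (pow_le_pow_of_le_one zero_le ?_ hb)
      simp)
  -- The distance to the limit inherits the bound. Its summability makes the sum over all `M` of the
  -- fourth powers almost surely finite, so the whole sequence converges, not only the subsequence.
  have hfin : ∀ M, ∫⁻ ω, ‖X M ω - Y ω‖ₑ ^ 4 ∂P ≤ B M := by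
    intro M
    have h1 : ∀ᶠ k in atTop, eLpNorm (X M - Y) 4 P ≤
        (B M) ^ (1 / 4 : ℝ) + eLpNorm (X (n k) - Y) 4 P := by
      filter_upwards [hn.tendsto_atTop.eventually_ge_atTop M] with k hk
      have h2 : X M - Y = (X M - X (n k)) + (X (n k) - Y) := by abel
      rw [h2]
      refine (eLpNorm_add_le ((hX M).sub (hX _)).aestronglyMeasurable
        ((hX _).aestronglyMeasurable.sub hY.1) (by norm_num)).trans (add_le_add_left ?_ _)
      rw [eLpNorm_sub_comm]
      have h3 := ENNReal.rpow_le_rpow (hdiff M (n k) hk) (by norm_num : (0 : ℝ) ≤ 1 / 4)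
      rwa [← ENNReal.rpow_natCast, ← ENNReal.rpow_mul, show ((4 : ℕ) : ℝ) * (1 / 4) = 1 by norm_num,
        ENNReal.rpow_one] at h3
    have h4 := ge_of_tendsto (tendsto_const_nhds.add hlim) h1
    rw [add_zero] at h4
    have h5 := pow_le_pow_left₀ zero_le h4 4
    rw [eLpNorm_four_pow, ← ENNReal.rpow_natCast, ← ENNReal.rpow_mul,
      show 1 / 4 * ((4 : ℕ) : ℝ) = 1 by norm_num, ENNReal.rpow_one] at h5
    exact h5
  have hsum : ∫⁻ ω, ∑' M, ‖X M ω - Y ω‖ₑ ^ 4 ∂P ≠ ⊤ := by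
    rw [lintegral_tsum (f := fun M ω => ‖X M ω - Y ω‖ₑ ^ 4)
      fun M => (((hX M).aestronglyMeasurable.sub hY.1).enorm.pow_const 4)]
    exact ne_top_of_le_ne_top hB (ENNReal.tsum_le_tsum hfin)
  have hae := ae_lt_top' (AEMeasurable.ennreal_tsum fun M =>
    (((hX M).aestronglyMeasurable.sub hY.1).enorm.pow_const 4)) hsum
  filter_upwards [hae] with ω hω
  refine ⟨Y ω, ?_⟩
  have h1 := ENNReal.tendsto_cofinite_zero_of_tsum_ne_top hω.ne
  rw [Nat.cofinite_eq_atTop] at h1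
  have h2 := h1.ennrpow_const (1 / 4)
  simp only [← ENNReal.rpow_natCast, ← ENNReal.rpow_mul] at h2
  norm_num at h2
  rw [tendsto_iff_edist_tendsto_0]
  simpa only [edist_eq_enorm_sub] using h2

/-- Almost surely convergent sequences with bounded second moments converge in mean. -/
lemma tendsto_integral_of_sq_bound [IsProbabilityMeasure P] {f : ℕ → Ω → ℂ} {g : Ω → ℂ}
    (hf : ∀ n, AEStronglyMeasurable (f n) P) {B : NNReal} (hB : ∀ n, ∫⁻ ω, ‖f n ω‖ₑ ^ 2 ∂P ≤ B)
    (hfg : ∀ᵐ ω ∂P, Tendsto (fun n => f n ω) atTop (𝓝 (g ω))) :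
    Integrable g P ∧ Tendsto (fun n => ∫ ω, f n ω ∂P) atTop (𝓝 (∫ ω, g ω ∂P)) := by
  have hle : ∀ z : ℂ, ‖z‖ₑ ≤ 1 + ‖z‖ₑ ^ 2 := fun z => by
    rcases le_total ‖z‖ₑ 1 with h | h
    · exact h.trans le_self_add
    · exact (le_self_pow₀ h two_ne_zero).trans le_add_self
  have hf1 : ∀ n, ∫⁻ ω, ‖f n ω‖ₑ ∂P ≤ 1 + B := fun n => by
    refine (lintegral_mono fun ω => hle _).trans ?_
    rw [lintegral_add_left measurable_const]
    simpa using add_le_add_right (hB n) 1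
  have hgm : AEStronglyMeasurable g P := aestronglyMeasurable_of_tendsto_ae atTop hf hfg
  have hg : Integrable g P := by
    refine ⟨hgm, ?_⟩
    have h1 : ∫⁻ ω, ‖g ω‖ₑ ∂P ≤ liminf (fun n => ∫⁻ ω, ‖f n ω‖ₑ ∂P) atTop := by
      refine le_trans (lintegral_mono_ae ?_) (lintegral_liminf_le' fun n => (hf n).enorm)
      filter_upwards [hfg] with ω hω
      exact le_of_eq hω.enorm.liminf_eq.symm
    refine lt_of_le_of_lt (h1.trans (liminf_le_of_le (a := 1 + (B : ENNReal)) (by isBoundedDefault) fun b hb => ?_))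
      (ENNReal.add_lt_top.2 ⟨ENNReal.one_lt_top, ENNReal.coe_lt_top⟩)
    obtain ⟨n, hn⟩ := hb.exists
    exact hn.trans (hf1 n)
  have hfi : ∀ n, Integrable (f n) P := fun n => ⟨hf n, (hf1 n).trans_lt
    (ENNReal.add_lt_top.2 ⟨ENNReal.one_lt_top, ENNReal.coe_lt_top⟩)⟩
  refine ⟨hg, tendsto_integral_of_L1 g hgm (.of_forall hfi) ?_⟩
  have hui : UnifIntegrable f 1 P := by
    refine unifIntegrable_of le_rfl ENNReal.one_ne_top hf fun ε hε => ?_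
    -- Where the modulus is at least M, it is at most its square divided by M; so the tail is at
    -- most B/M ≤ ε.
    refine ⟨⟨(B + 1) / ε, by positivity⟩, fun n => ?_⟩
    set M : NNReal := ⟨(B + 1) / ε, by positivity⟩ with hM
    have hMpos : 0 < M := by
      rw [← NNReal.coe_pos]; change 0 < ((B : ℝ) + 1) / ε; positivity
    rw [eLpNorm_one_eq_lintegral_enorm]
    have h1 : ∀ ω, ‖({x | M ≤ ‖f n x‖₊}.indicator (f n)) ω‖ₑ ≤ (M : ENNReal)⁻¹ * ‖f n ω‖ₑ ^ 2 := by
      intro ω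
      by_cases hc : ω ∈ {x | M ≤ ‖f n x‖₊}
      · rw [Set.indicator_of_mem hc, sq, ← mul_assoc]
        refine le_mul_of_one_le_left zero_le ?_
        rw [← ENNReal.inv_mul_cancel (a := M) (by simpa using hMpos.ne') ENNReal.coe_ne_top]
        gcongr
        exact ENNReal.coe_le_coe.2 hc
      · rw [Set.indicator_of_notMem hc]; simp
    refine (lintegral_mono h1).trans ?_
    rw [lintegral_const_mul' _ _ (by simpa using hMpos.ne')]
    refine (mul_le_mul_right (hB n) _).trans ?_
    rw [← ENNReal.coe_inv hMpos.ne', ← ENNReal.coe_mul, ENNReal.ofReal, ENNReal.coe_le_coe]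
    rw [← NNReal.coe_le_coe, NNReal.coe_mul, NNReal.coe_inv, Real.coe_toNNReal _ hε.le]
    change (((B : ℝ) + 1) / ε)⁻¹ * B ≤ ε
    rw [inv_div, div_mul_eq_mul_div, div_le_iff₀ (by positivity)]
    nlinarith [B.2]
  have h := tendsto_Lp_finite_of_tendsto_ae le_rfl ENNReal.one_ne_top hf
    (memLp_one_iff_integrable.2 hg) hui hfg
  simpa only [eLpNorm_one_eq_lintegral_enorm, Pi.sub_apply] using h

end Convergence

/-! ### Gaussian moments and exponential bounds -/

section GaussianMoments

lemma integral_exp_mul_gaussianReal (v : NNReal) (c : ℝ) :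
    ∫ x, Real.exp (c * x) ∂(gaussianReal 0 v) = Real.exp (v * c ^ 2 / 2) := by
  have h := congrFun (mgf_id_gaussianReal (μ := 0) (v := v)) c
  simpa [mgf] using h

lemma lintegral_exp_abs_gaussianReal (v : NNReal) (c : ℝ) :
    ∫⁻ x, ENNReal.ofReal (Real.exp (c * |x|)) ∂(gaussianReal 0 v) ≤
      ENNReal.ofReal (2 * Real.exp (v * c ^ 2 / 2)) := by
  have hI := (integrable_exp_mul_gaussianReal (μ := 0) (v := v) c).add
    (integrable_exp_mul_gaussianReal (-c))
  refine (lintegral_mono fun x => ENNReal.ofReal_le_ofReal (exp_mul_abs_le c x)).trans ?_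
  have h := ofReal_integral_eq_lintegral_ofReal hI (.of_forall fun x => by
    simp only [Pi.zero_apply, Pi.add_apply]; positivity)
  simp only [Pi.add_apply] at h
  rw [← h, integral_add (integrable_exp_mul_gaussianReal c) (integrable_exp_mul_gaussianReal (-c)),
    integral_exp_mul_gaussianReal, integral_exp_mul_gaussianReal, neg_sq, two_mul]

/-- The bound x⁴ ≤ 24 V² exp(|x|/√V) is combined with an expectation of the exponential that is at
most 2 e^(1/2) ≤ 4; hence the constant 96 = 24 · 4. It need not be sharp. -/
lemma lintegral_pow_four_gaussianReal {v : NNReal} {V : ℝ} (hV : 0 < V) (hv : v ≤ V) :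
    ∫⁻ x, ‖x‖ₑ ^ 4 ∂(gaussianReal 0 v) ≤ ENNReal.ofReal (96 * V ^ 2) := by
  set c := (√V)⁻¹ with hc
  have hc2 : c ^ 2 * V = 1 := by
    rw [hc, inv_pow, Real.sq_sqrt hV.le, inv_mul_cancel₀ hV.ne']
  have hc0 : 0 < c := inv_pos.2 (Real.sqrt_pos.2 hV)
  have h1 : ∀ x : ℝ, ‖x‖ₑ ^ 4 ≤ ENNReal.ofReal (24 * V ^ 2) * ENNReal.ofReal (Real.exp (c * |x|)) := by
    intro x
    rw [← ENNReal.ofReal_mul (by positivity), ← ofReal_norm_eq_enorm, Real.norm_eq_abs,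
      ← ENNReal.ofReal_pow (abs_nonneg x)]
    refine ENNReal.ofReal_le_ofReal ?_
    have h2 := Real.pow_div_factorial_le_exp (c * |x|) (by positivity) 4
    have h3 : |x| ^ 4 = 24 * V ^ 2 * ((c * |x|) ^ 4 / (4 ! : ℕ)) := by
      have h4 : (c ^ 2 * V) ^ 2 = 1 := by rw [hc2, one_pow]
      norm_num [Nat.factorial]
      linear_combination (-|x| ^ 4) * h4
    rw [h3]
    gcongr
  refine (lintegral_mono h1).trans ?_
  rw [lintegral_const_mul _ (Measurable.ennreal_ofReal (by fun_prop))]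
  refine (mul_le_mul_right (lintegral_exp_abs_gaussianReal v c) _).trans ?_
  rw [← ENNReal.ofReal_mul (by positivity)]
  refine ENNReal.ofReal_le_ofReal ?_
  have h5 : Real.exp (v * c ^ 2 / 2) ≤ 2 := by
    have h6 : v * c ^ 2 / 2 ≤ 1 / 2 := by nlinarith [sq_nonneg c]
    have h7 : Real.exp (1 / 2) ^ 2 ≤ 2 ^ 2 := by
      rw [← Real.exp_nat_mul]
      norm_num
      linarith [Real.exp_one_lt_d9]
    exact (Real.exp_le_exp.2 h6).trans (le_of_sq_le_sq' h7)
  nlinarith [sq_nonneg V]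
where
  le_of_sq_le_sq' {a : ℝ} (h : a ^ 2 ≤ 2 ^ 2) : a ≤ 2 := by nlinarith

/-- Gaussian integrability of the exponential of a small multiple of the square. -/
lemma integrable_exp_sq_gaussianReal {θ : ℝ} (hθ : θ < 1 / 6) :
    Integrable (fun x => Real.exp (θ * x ^ 2)) (gaussianReal 0 3) := by
  rw [gaussianReal_of_var_ne_zero 0 (by norm_num : (3 : NNReal) ≠ 0),
    integrable_withDensity_iff (measurable_gaussianPDF _ _)
      (.of_forall fun x => gaussianPDF_lt_top)]
  have h := (integrable_exp_neg_mul_sq (b := 1 / 6 - θ) (by linarith)).const_mul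
    (√(2 * Real.pi * 3))⁻¹
  refine h.congr (.of_forall fun x => ?_)
  simp only [toReal_gaussianPDF, gaussianPDFReal]
  rw [mul_left_comm, ← Real.exp_add]
  push_cast
  congr 2
  ring

/-- Jensen's inequality for the exponential and a subprobability. -/
lemma exp_sum_mul_le {ι : Type*} (s : Finset ι) (w a : ι → ℝ) (hw : ∀ i ∈ s, 0 ≤ w i)
    (hw1 : ∑ i ∈ s, w i ≤ 1) :
    Real.exp (∑ i ∈ s, w i * a i) ≤ 1 + ∑ i ∈ s, w i * Real.exp (a i) := by
  set S := ∑ i ∈ s, w i * a i with hS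
  set W := ∑ i ∈ s, w i with hW
  have hW0 : 0 ≤ W := Finset.sum_nonneg hw
  have h1 : ∀ x, Real.exp S * (1 + x - S) ≤ Real.exp x := fun x => by
    have := mul_le_mul_of_nonneg_left (Real.add_one_le_exp (x - S)) (Real.exp_pos S).le
    rw [← Real.exp_add, add_sub_cancel] at this
    linarith
  have h2 : ∑ i ∈ s, w i * (Real.exp S * (1 + a i - S)) ≤ ∑ i ∈ s, w i * Real.exp (a i) :=
    Finset.sum_le_sum fun i hi => mul_le_mul_of_nonneg_left (h1 _) (hw i hi)
  have h3 : ∑ i ∈ s, w i * (Real.exp S * (1 + a i - S)) = Real.exp S * (W + S - W * S) := by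
    have : ∀ i, w i * (Real.exp S * (1 + a i - S)) = Real.exp S * (w i + w i * a i - w i * S) :=
      fun i => by ring
    simp only [this]
    rw [← Finset.mul_sum, Finset.sum_sub_distrib, Finset.sum_add_distrib, ← Finset.sum_mul]
  have h4 := h1 0
  rw [Real.exp_zero] at h4
  have h5 := mul_le_mul_of_nonneg_left h4 (sub_nonneg.2 hw1)
  nlinarith

end GaussianMoments

/-! ### The linear and quadratic parts of the potential -/

section LinearPart

open Finset

variable {m κ : ℝ}

/-- The divergent linear part of the potential, with cut-off modes. -/
def linearSum (m : ℝ) (N : ℕ) (τ : VectorFields) : ℝ := ∑ p ∈ closedBox N, C0 m p.1 * Gam τ p.1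

/-- The quadratic part of the potential, with cut-off modes. -/
def squareSum (m : ℝ) (N : ℕ) (τ : VectorFields) : ℝ :=
  ∑ p ∈ closedBox N, C0 m p.1 ^ 2 * Gam τ p.1 ^ 2

lemma gamVariance_le {g : ClosedMode → ℝ} (hg : ∀ p, 0 ≤ g p) {Λ : Finset ClosedMode}
    {a : ClosedMode → ℝ} (ha : ∀ p ∈ Λ, a p = g p)
    (hs : Summable fun q : ClosedMode × ClosedMode => (sharedModes q.1.1 q.2.1 : ℝ) * (g q.1 * g q.2)) :
    gamVariance Λ a ≤
      ∑' q : ClosedMode × ClosedMode, (sharedModes q.1.1 q.2.1 : ℝ) * (g q.1 * g q.2) := by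
  refine le_trans (le_of_eq ?_) (hs.sum_le_tsum (Λ ×ˢ Λ) fun q _ => mul_nonneg (Nat.cast_nonneg _)
    (mul_nonneg (hg _) (hg _)))
  rw [sum_product, gamVariance]
  refine sum_congr rfl fun p hp => sum_congr rfl fun q hq => ?_
  rw [ha p hp, ha q hq]
  ring

lemma sq_le_sqNorm_of_notMem {N : ℕ} {p : ClosedMode} (hp : p ∉ closedBox N) :
    (N : ℝ) ^ 2 ≤ sqNorm p.1 := by
  rw [mem_closedBox] at hp
  push Not at hp
  obtain ⟨i, hi⟩ := hp
  have h1 : (N : ℝ) ≤ |(p.1 i : ℝ)| := by exact_mod_cast hi.le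
  refine (pow_le_pow_left₀ (Nat.cast_nonneg N) h1 2).trans ?_
  rw [sq_abs]
  exact sq_le_sqNorm _ _

/-- The variance of the modes outside of a box decays. -/
lemma exists_gamVariance_le (hm : 0 < m) : ∃ D : ℝ, 0 < D ∧ ∀ M N : ℕ,
    gamVariance (closedBox N \ closedBox M) (fun p => C0 m p.1) ≤
      D * (1 + (M : ℝ)) ^ (-(3 / 5) : ℝ) := by
  set S : ℝ := ∑' q : ClosedMode × ClosedMode, ∑ i,
    if q.1.1 i = q.2.1 i then powerWeight i q.1 * powerWeight i q.2 else 0 with hS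
  have hl := latticeConst_pos hm
  have hS0 : 0 ≤ S := tsum_nonneg fun q => sum_nonneg fun i _ => by
    split_ifs
    · exact mul_nonneg (powerWeight_nonneg _ _) (powerWeight_nonneg _ _)
    · exact le_rfl
  refine ⟨((latticeConst m)⁻¹) ^ 2 * (S + 1), by positivity, fun M N => ?_⟩
  -- Outside of the box `sqNorm` is at least M², so `C0_le_powerWeight` applies with `r = M`; the
  -- factor (1 + M)^(-3/10) is squared in the pair sum.
  set g : ClosedMode → ℝ := fun p => if p ∈ closedBox M then 0 else C0 m p.1 with hg
  have hg0 : ∀ p, 0 ≤ g p := fun p => by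
    simp only [hg]; split_ifs
    · exact le_rfl
    · exact (C0_pos hm _).le
  have hM : (0 : ℝ) < 1 + M := by positivity
  have h := summable_shared_of_le hg0 (C := (latticeConst m)⁻¹ * (1 + (M : ℝ)) ^ (-(3 / 10) : ℝ))
    fun i p => by
      simp only [hg]; split_ifs with hp
      · have := powerWeight_nonneg i p; positivity
      · exact C0_le_powerWeight hm i p (Nat.cast_nonneg M) (sq_le_sqNorm_of_notMem hp)
  refine (gamVariance_le hg0 (fun p hp => ?_) h.1).trans (h.2.trans ?_)
  · rw [hg]; simp only; rw [if_neg (Finset.mem_sdiff.1 hp).2]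
  · rw [← hS, mul_pow, ← Real.rpow_natCast ((1 + (M : ℝ)) ^ (-(3 / 10) : ℝ)) 2, ← Real.rpow_mul hM.le,
      show (-(3 / 10) : ℝ) * (2 : ℕ) = -(3 / 5) by norm_num, mul_right_comm]
    gcongr
    linarith

lemma linearSum_sub {M N : ℕ} (h : M ≤ N) (τ : VectorFields) :
    linearSum m N τ - linearSum m M τ = ∑ p ∈ closedBox N \ closedBox M, C0 m p.1 * Gam τ p.1 := by
  rw [linearSum, linearSum, ← sum_sdiff (closedBox_mono h), add_sub_cancel_right]

lemma lintegral_comp_sum_Gam (Λ : Finset ClosedMode) (a : ClosedMode → ℝ) {f : ℝ → ENNReal}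
    (hf : Measurable f) : ∫⁻ τ, f (∑ p ∈ Λ, a p * Gam τ p.1) ∂vectorGaussian =
      ∫⁻ x, f x ∂(gaussianReal 0 (gamVariance Λ a).toNNReal) := by
  rw [← map_sum_Gam, lintegral_map hf (measurable_sum_Gam Λ a)]

lemma lintegral_comp_Gam (p : ClosedMode) {f : ℝ → ENNReal}
    (hf : Measurable f) : ∫⁻ τ, f (Gam τ p.1) ∂vectorGaussian = ∫⁻ x, f x ∂(gaussianReal 0 3) := by
  rw [← map_Gam p, lintegral_map hf (measurable_Gam p.1)]

/-- The linear part converges almost surely. -/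
lemma ae_tendsto_linearSum (hm : 0 < m) :
    ∀ᵐ τ ∂vectorGaussian, ∃ l, Tendsto (fun N => linearSum m N τ) atTop (𝓝 l) := by
  obtain ⟨D, hD, hvar⟩ := exists_gamVariance_le hm
  have hfour : Measurable fun x : ℝ => ‖x‖ₑ ^ 4 := by fun_prop
  set V : ℕ → ℝ := fun M => D * (1 + (M : ℝ)) ^ (-(3 / 5) : ℝ) with hV
  have hV0 : ∀ M, 0 < V M := fun M => by
    have : (0 : ℝ) < 1 + M := by positivity
    positivity
  refine ae_tendsto_of_fourth_moment (fun N => measurable_sum_Gam _ _) (fun N => ?_)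
    (B := fun M => ENNReal.ofReal (96 * V M ^ 2)) ?_ fun M N hMN => ?_
  · have h := lintegral_comp_sum_Gam (closedBox N) (fun p => C0 m p.1) hfour
    simp only [linearSum]
    rw [h]
    refine ne_top_of_le_ne_top ENNReal.ofReal_ne_top (lintegral_pow_four_gaussianReal
      (V := gamVariance (closedBox N) (fun p => C0 m p.1) + 1) ?_ ?_)
    · linarith [gamVariance_nonneg (closedBox N) fun p => C0 m p.1]
    · rw [Real.coe_toNNReal _ (gamVariance_nonneg _ _)]; linarith
  · have h2 : Summable fun M : ℕ => 96 * V M ^ 2 := by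
      have h3 : Summable fun M : ℕ => ((M + 1 : ℕ) : ℝ) ^ (-(6 / 5) : ℝ) :=
        (summable_nat_add_iff 1).2 (Real.summable_nat_rpow.2 (by norm_num))
      refine (h3.mul_left (96 * D ^ 2)).congr fun M => ?_
      have hM : (0 : ℝ) ≤ 1 + M := by positivity
      rw [hV]
      simp only
      rw [mul_pow, ← Real.rpow_natCast ((1 + (M : ℝ)) ^ (-(3 / 5) : ℝ)) 2, ← Real.rpow_mul hM,
        show (-(3 / 5) : ℝ) * (2 : ℕ) = -(6 / 5) by norm_num]
      push_cast
      rw [add_comm (1 : ℝ), mul_assoc]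
    rw [← ENNReal.ofReal_tsum_of_nonneg (fun M => by positivity) h2]
    exact ENNReal.ofReal_ne_top
  · simp only [linearSum_sub hMN]
    rw [lintegral_comp_sum_Gam _ (fun p => C0 m p.1) hfour]
    refine lintegral_pow_four_gaussianReal (hV0 M) ?_
    rw [Real.coe_toNNReal _ (gamVariance_nonneg _ _)]
    exact hvar M N

/-- The quadratic part converges almost surely. -/
lemma ae_summable_square (hm : 0 < m) :
    ∀ᵐ τ ∂vectorGaussian, Summable fun p : ClosedMode => C0 m p.1 ^ 2 * Gam τ p.1 ^ 2 := by
  have hsq : Measurable fun x : ℝ => ENNReal.ofReal (x ^ 2) := by fun_prop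
  set G := ∫⁻ x, ENNReal.ofReal (x ^ 2) ∂(gaussianReal 0 3) with hG
  have hGt : G ≠ ⊤ := by
    have h1 : ∀ x : ℝ, ENNReal.ofReal (x ^ 2) ≤ ENNReal.ofReal 2 * ENNReal.ofReal (Real.exp (1 * |x|)) := by
      intro x
      rw [← ENNReal.ofReal_mul (by norm_num)]
      refine ENNReal.ofReal_le_ofReal ?_
      have := Real.pow_div_factorial_le_exp |x| (abs_nonneg x) 2
      norm_num at this ⊢
      linarith
    refine ne_top_of_le_ne_top ?_ (lintegral_mono h1)
    rw [lintegral_const_mul _ (Measurable.ennreal_ofReal (by fun_prop))]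
    exact ENNReal.mul_ne_top ENNReal.ofReal_ne_top (ne_top_of_le_ne_top ENNReal.ofReal_ne_top
      (lintegral_exp_abs_gaussianReal 3 1))
  have hmeas : ∀ p : ClosedMode, Measurable fun τ : VectorFields =>
      ENNReal.ofReal (C0 m p.1 ^ 2 * Gam τ p.1 ^ 2) := fun p =>
    (((measurable_Gam p.1).pow_const 2).const_mul _).ennreal_ofReal
  have h : ∫⁻ τ, ∑' p : ClosedMode, ENNReal.ofReal (C0 m p.1 ^ 2 * Gam τ p.1 ^ 2) ∂vectorGaussian ≠ ⊤ := by
    rw [lintegral_tsum fun p => (hmeas p).aemeasurable]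
    have h2 : ∀ p : ClosedMode, ∫⁻ τ, ENNReal.ofReal (C0 m p.1 ^ 2 * Gam τ p.1 ^ 2) ∂vectorGaussian =
        ENNReal.ofReal (C0 m p.1 ^ 2) * G := by
      intro p
      simp only [ENNReal.ofReal_mul (sq_nonneg (C0 m p.1))]
      rw [lintegral_const_mul _ (((measurable_Gam p.1).pow_const 2).ennreal_ofReal),
        lintegral_comp_Gam p hsq]
    simp only [h2]
    rw [ENNReal.tsum_mul_right, ← ENNReal.ofReal_tsum_of_nonneg (fun p => sq_nonneg _)
      (summable_C0_sq hm)]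
    exact ENNReal.mul_ne_top ENNReal.ofReal_ne_top hGt
  filter_upwards [ae_lt_top (Measurable.ennreal_tsum hmeas) h] with τ hτ
  refine (ENNReal.summable_toReal hτ.ne).congr fun p => ENNReal.toReal_ofReal (by positivity)

end LinearPart

/-! ### The limit of growing boxes -/

section PotentialLimit

open Finset

variable {m κ : ℝ} {μ : ℂ}

/-- The potential of the modes in a box, in terms of `μ = lam ^ (-1 / 2)`. -/
def boxPotential (m : ℝ) (μ : ℂ) (N : ℕ) (τ : VectorFields) : ℂ :=
  ∑ p ∈ closedBox N, log (1 - I * (√2 * Gam τ p.1 : ℝ) / (μ / C0 m p.1))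

/-- The remainder of the potential of a mode beyond its linear part. -/
def modeRemainder (m : ℝ) (μ : ℂ) (τ : VectorFields) (p : ClosedMode) : ℂ :=
  -log (1 - I * (√2 * Gam τ p.1 : ℝ) / (μ / C0 m p.1)) -
    I * (√2 * Gam τ p.1 : ℝ) / (μ / C0 m p.1)

lemma norm_modeRemainder_le (hm : 0 < m) (hκ : 0 < κ) (hμ : κ ≤ μ.re) (τ : VectorFields)
    (p : ClosedMode) : ‖modeRemainder m μ τ p‖ ≤ (C0 m p.1 ^ 2 * Gam τ p.1 ^ 2) / κ ^ 2 := by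
  have hC := C0_pos hm p.1
  have hμ0 := hκ.trans_le hμ
  have hb : 0 < (μ / C0 m p.1).re := by rw [re_div_C0]; positivity
  refine (norm_log_vertex_le hb _).trans ?_
  rw [re_div_C0, mul_pow, Real.sq_sqrt zero_le_two, div_pow]
  have : 2 * Gam τ p.1 ^ 2 / (2 * (μ.re ^ 2 / C0 m p.1 ^ 2)) =
    C0 m p.1 ^ 2 * Gam τ p.1 ^ 2 / μ.re ^ 2 := by field_simp
  rw [this]
  gcongr

lemma neg_boxPotential_eq (hm : 0 < m) (N : ℕ) (τ : VectorFields) :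
    -boxPotential m μ N τ = I * √2 / μ * (linearSum m N τ : ℝ) +
      ∑ p ∈ closedBox N, modeRemainder m μ τ p := by
  rw [linearSum, ofReal_sum, mul_sum, ← sum_add_distrib, boxPotential, ← sum_neg_distrib]
  refine sum_congr rfl fun p _ => ?_
  have hC : (C0 m p.1 : ℂ) ≠ 0 := ofReal_ne_zero.2 (C0_pos hm p.1).ne'
  rw [modeRemainder]
  push_cast
  rw [div_div_eq_mul_div]
  ring

lemma norm_boxPotential_le (hm : 0 < m) (hκ : 0 < κ) (hμ : κ ≤ μ.re) (N : ℕ) (τ : VectorFields) :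
    ‖boxPotential m μ N τ‖ ≤ √2 / κ * |linearSum m N τ| + squareSum m N τ / κ ^ 2 := by
  rw [← norm_neg, neg_boxPotential_eq hm]
  refine (norm_add_le _ _).trans (add_le_add ?_ ?_)
  · rw [norm_mul, norm_div, norm_mul, norm_I, one_mul, norm_real, norm_real,
      Real.norm_eq_abs, Real.norm_eq_abs, abs_of_nonneg (Real.sqrt_nonneg 2)]
    gcongr
    exact hμ.trans (re_le_norm μ)
  · rw [squareSum, sum_div]
    exact norm_sum_le_of_le _ fun p _ => norm_modeRemainder_le hm hκ hμ τ p

/-- The linear part converges along the boxes by `ae_tendsto_linearSum`; the remainders are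
dominated by the summable squares and converge absolutely. -/
lemma ae_exists_tendsto_boxPotential (hm : 0 < m) (hκ : 0 < κ) (hμ : κ ≤ μ.re) :
    ∀ᵐ τ ∂vectorGaussian, ∃ l, Tendsto (fun N => boxPotential m μ N τ) atTop (𝓝 l) := by
  filter_upwards [ae_tendsto_linearSum hm, ae_summable_square hm] with τ ⟨l, hl⟩ hs
  have h1 : Summable (modeRemainder m μ τ) :=
    Summable.of_norm_bounded (hs.div_const _) (norm_modeRemainder_le hm hκ hμ τ)
  have h2 := h1.hasSum.comp (tendsto_atTop_finset_of_monotone (fun _ _ => closedBox_mono)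
    fun p => (eventually_mem_closedBox p).exists)
  have h3 := (((continuous_ofReal.tendsto l).comp hl).const_mul (I * √2 / μ)).add h2
  refine ⟨_, h3.neg.congr fun N => ?_⟩
  have := neg_boxPotential_eq (μ := μ) hm N τ
  simp only [Function.comp]
  rw [← this, neg_neg]

/-- Since 2/42 + 2/2.1 = 1, the exponent on the left is a convex combination of those on the right.
The linear part has all exponential moments and can take the factor 42; the quadratic part has
little room beyond 2. -/
lemma exp_two_mul_add_le {r q : ℝ} :
    Real.exp (2 * (r + q)) ≤ Real.exp (42 * r) + Real.exp (2.1 * q) := by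
  rcases le_total (2.1 * q) (42 * r) with h | h
  · exact (Real.exp_le_exp.2 (by linarith)).trans (le_add_of_nonneg_right (Real.exp_pos _).le)
  · exact (Real.exp_le_exp.2 (by linarith)).trans (le_add_of_nonneg_left (Real.exp_pos _).le)

lemma measurable_linearSum (N : ℕ) : Measurable (linearSum m N) := measurable_sum_Gam _ _

lemma exists_lintegral_exp_linearSum_le (hm : 0 < m) (c : ℝ) : ∃ B : ℝ, ∀ N,
    ∫⁻ τ, ENNReal.ofReal (Real.exp (c * |linearSum m N τ|)) ∂vectorGaussian ≤ ENNReal.ofReal B := by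
  set V := ∑' q : ClosedMode × ClosedMode, (sharedModes q.1.1 q.2.1 : ℝ) * (C0 m q.1.1 * C0 m q.2.1)
  refine ⟨2 * Real.exp (V * c ^ 2 / 2), fun N => ?_⟩
  have hf : Measurable fun x : ℝ => ENNReal.ofReal (Real.exp (c * |x|)) :=
    Measurable.ennreal_ofReal (by fun_prop)
  refine (lintegral_comp_sum_Gam (closedBox N) (fun p => C0 m p.1) hf).le.trans
    ((lintegral_exp_abs_gaussianReal _ c).trans (ENNReal.ofReal_le_ofReal ?_))
  rw [Real.coe_toNNReal _ (gamVariance_nonneg _ _)]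
  have := gamVariance_le (fun p => (C0_pos hm p.1).le) (Λ := closedBox N) (fun _ _ => rfl)
    (summable_shared_C0 hm)
  gcongr

/-- Jensen's inequality with the weights C₀(p)²/K₁ reduces the uniform bound to one Gaussian
variable of variance 3, so the dependence between modes plays no role. -/
lemma exists_lintegral_exp_squareSum_le (hA : Critical m κ) :
    ∃ B : ℝ, ∀ N, ∫⁻ τ, ENNReal.ofReal (Real.exp (2.1 * (squareSum m N τ / κ ^ 2)))
      ∂vectorGaussian ≤ ENNReal.ofReal B := by
  have hK1 := K1_pos hA.1
  set θ := 2.1 * K1 m / κ ^ 2 with hθ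
  -- The exponent must stay below the 1/6 of a Gaussian density of variance 3. This holds because κ²
  -- ≥ 12.8 K₁ and 6 · 2.1 = 12.6 < 12.8.
  have hθ6 : θ < 1 / 6 := by
    rw [hθ, div_lt_iff₀ (pow_pos hA.2 2), hA.3]
    have h1 := le_Knum hA.1
    have h2 := le_max_left (K1 m) (K2 m)
    nlinarith
  set G := ∫ x, Real.exp (θ * x ^ 2) ∂(gaussianReal 0 3) with hG
  have hG0 : 0 ≤ G := integral_nonneg fun x => (Real.exp_pos _).le
  have hGl : ∫⁻ x, ENNReal.ofReal (Real.exp (θ * x ^ 2)) ∂(gaussianReal 0 3) = ENNReal.ofReal G :=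
    (ofReal_integral_eq_lintegral_ofReal (integrable_exp_sq_gaussianReal hθ6)
      (.of_forall fun x => (Real.exp_pos _).le)).symm
  have hmeas : Measurable fun x : ℝ => ENNReal.ofReal (Real.exp (θ * x ^ 2)) :=
    Measurable.ennreal_ofReal (by fun_prop)
  refine ⟨1 + G, fun N => ?_⟩
  have hw1 : ∑ p ∈ closedBox N, C0 m p.1 ^ 2 / K1 m ≤ 1 := by
    rw [← sum_div, div_le_one hK1]
    exact (summable_C0_sq hA.1).sum_le_tsum _ fun p _ => sq_nonneg _
  have hw0 : ∀ p : ClosedMode, 0 ≤ C0 m p.1 ^ 2 / K1 m := fun p => by positivity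
  have h1 : ∀ τ, ENNReal.ofReal (Real.exp (2.1 * (squareSum m N τ / κ ^ 2))) ≤
      1 + ∑ p ∈ closedBox N, ENNReal.ofReal (C0 m p.1 ^ 2 / K1 m) *
        ENNReal.ofReal (Real.exp (θ * Gam τ p.1 ^ 2)) := by
    intro τ
    have h2 := exp_sum_mul_le (closedBox N) (fun p => C0 m p.1 ^ 2 / K1 m)
      (fun p => θ * Gam τ p.1 ^ 2) (fun p _ => hw0 p) hw1
    have h3 : ∑ p ∈ closedBox N, C0 m p.1 ^ 2 / K1 m * (θ * Gam τ p.1 ^ 2) =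
        2.1 * (squareSum m N τ / κ ^ 2) := by
      rw [squareSum, sum_div, mul_sum]
      refine sum_congr rfl fun p _ => ?_
      rw [hθ]
      field_simp
    rw [h3] at h2
    refine (ENNReal.ofReal_le_ofReal h2).trans (le_of_eq ?_)
    rw [ENNReal.ofReal_add zero_le_one (sum_nonneg fun p _ => mul_nonneg (hw0 p) (Real.exp_pos _).le),
      ENNReal.ofReal_one, ENNReal.ofReal_sum_of_nonneg fun p _ =>
        mul_nonneg (hw0 p) (Real.exp_pos _).le]
    simp only [ENNReal.ofReal_mul (hw0 _)]
  refine (lintegral_mono h1).trans ?_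
  have hm2 : ∀ p : ClosedMode, Measurable fun τ : VectorFields =>
      ENNReal.ofReal (Real.exp (θ * Gam τ p.1 ^ 2)) := fun p => hmeas.comp (measurable_Gam p.1)
  rw [lintegral_add_left measurable_const, lintegral_const, measure_univ, mul_one,
    lintegral_finsetSum _ fun p _ => (hm2 p).const_mul _, ENNReal.ofReal_add zero_le_one hG0,
    ENNReal.ofReal_one]
  refine add_le_add le_rfl ?_
  have h4 : ∀ p : ClosedMode, ∫⁻ τ, ENNReal.ofReal (C0 m p.1 ^ 2 / K1 m) *
      ENNReal.ofReal (Real.exp (θ * Gam τ p.1 ^ 2)) ∂vectorGaussian =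
      ENNReal.ofReal (C0 m p.1 ^ 2 / K1 m) * ENNReal.ofReal G := fun p => by
    rw [lintegral_const_mul _ (hm2 p), ← hGl, ← lintegral_comp_Gam p hmeas]
  simp only [h4]
  rw [← sum_mul, ← ENNReal.ofReal_sum_of_nonneg fun p _ => hw0 p]
  exact (mul_le_mul_left (ENNReal.ofReal_le_one.2 hw1) _).trans (one_mul _).le

/-- Functions bounded by the exponential of the size of the potential are bounded in mean square. -/
lemma exists_lintegral_sq_le (hA : Critical m κ) (hμ : κ ≤ μ.re) :
    ∃ B : NNReal, ∀ (N : ℕ) (f : VectorFields → ℂ),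
      (∀ τ, ‖f τ‖ ≤ Real.exp ‖boxPotential m μ N τ‖) → ∫⁻ τ, ‖f τ‖ₑ ^ 2 ∂vectorGaussian ≤ B := by
  obtain ⟨B1, h1⟩ := exists_lintegral_exp_linearSum_le hA.1 (42 * (√2 / κ))
  obtain ⟨B2, h2⟩ := exists_lintegral_exp_squareSum_le hA
  refine ⟨B1.toNNReal + B2.toNNReal, fun N f hf => ?_⟩
  have h3 : ∀ τ, ‖f τ‖ₑ ^ 2 ≤ ENNReal.ofReal (Real.exp (42 * (√2 / κ) * |linearSum m N τ|)) +
      ENNReal.ofReal (Real.exp (2.1 * (squareSum m N τ / κ ^ 2))) := by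
    intro τ
    rw [← ofReal_norm_eq_enorm, ← ENNReal.ofReal_pow (norm_nonneg _),
      ← ENNReal.ofReal_add (Real.exp_pos _).le (Real.exp_pos _).le, mul_assoc]
    refine ENNReal.ofReal_le_ofReal (le_trans ?_ exp_two_mul_add_le)
    refine (pow_le_pow_left₀ (norm_nonneg _) ((hf τ).trans
      (Real.exp_le_exp.2 (norm_boxPotential_le hA.1 hA.2 hμ N τ))) 2).trans (le_of_eq ?_)
    rw [← Real.exp_nat_mul, Nat.cast_two]
  refine (lintegral_mono h3).trans ?_
  rw [lintegral_add_left (Measurable.ennreal_ofReal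
    (by have := measurable_linearSum (m := m) N; fun_prop))]
  exact add_le_add (h1 N) (h2 N)

lemma measurable_boxPotential (N : ℕ) : Measurable (boxPotential m μ N) :=
  Finset.measurable_sum _ fun p _ => by
    have := measurable_Gam p.1
    fun_prop

/-- The expectation of the potential of finitely many modes. -/
lemma integral_boxPotential (hm : 0 < m) (hμ : 0 < μ.re) (N : ℕ) :
    ∫ τ, -boxPotential m μ N τ ∂vectorGaussian = selfEnergy m μ (cut (closedBox N) 0) := by
  have h1 : ∀ τ, -boxPotential m μ N τ =
      ∫ y, (cut (closedBox N) 0).indicator (vertexIntegrand m μ τ) y ∂particleMeasure := fun τ =>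
    (integral_vertexIntegrand hm hμ _ τ).symm
  simp only [h1]
  have hmeas := measurable_indicator_vertexIntegrand (m := m) μ (measurableSet_cut (closedBox N) 0)
  have hle := fun τ y => norm_indicator_vertexIntegrand_le (m := m) (μ := μ) hm le_rfl (closedBox N)
    le_rfl τ y
  have hint : Integrable (fun q : VectorFields × Particle =>
      (cut (closedBox N) 0).indicator (vertexIntegrand m μ q.1) q.2)
      (vectorGaussian.prod particleMeasure) := by
    rw [integrable_prod_iff hmeas.aestronglyMeasurable]
    have hI := integrable_indicator_vertexIntegrand hm hμ (closedBox N) le_rfl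
    refine ⟨.of_forall hI, ?_⟩
    have hs : Integrable (fun τ : VectorFields => ∑ p ∈ closedBox N,
        |√2 * Gam τ p.1| * (C0 m p.1 / μ.re)) vectorGaussian := by
      refine integrable_finsetSum _ fun p _ => Integrable.mul_const ?_ _
      have h := integrable_exp_sum_abs_Gam {p} fun _ => √2
      refine h.mono' (((measurable_Gam p.1).const_mul _).abs.aestronglyMeasurable)
        (.of_forall fun τ => ?_)
      rw [Real.norm_eq_abs, abs_abs, sum_singleton, abs_mul, abs_of_nonneg (Real.sqrt_nonneg 2)]
      linarith [Real.add_one_le_exp (√2 * |Gam τ p.1|)]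
    refine hs.mono' hmeas.norm.aestronglyMeasurable.integral_prod_right' (.of_forall fun τ => ?_)
    rw [Real.norm_of_nonneg (integral_nonneg fun y => norm_nonneg _),
      ← (integrable_vertexBound hm hμ (closedBox N) τ).2]
    exact integral_mono (hI τ).norm (integrable_vertexBound hm hμ (closedBox N) τ).1 (hle τ)
  rw [integral_integral_swap hint, selfEnergy]
  refine integral_congr_ae (.of_forall fun y => ?_)
  simp only
  by_cases hc : y ∈ cut (closedBox N) 0
  · simp only [Set.indicator_of_mem hc, vertexIntegrand]
    have hG := measurable_Gam y.1.1
    -- `Γ(p)` has variance 3, so averaging the character produces the self-energy factor of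
    -- `gasWeight`.
    have h3 : ∫ τ, exp (I * (y.2 * (√2 * Gam τ y.1.1) : ℝ)) ∂vectorGaussian =
        exp (-(3 * y.2 ^ 2)) := by
      have h4 := charFun_gaussianReal (μ := 0) (v := 3) (y.2 * √2)
      rw [charFun_apply_real, ← map_Gam y.1, integral_map hG.aemeasurable (by fun_prop)] at h4
      convert h4 using 1
      · refine integral_congr_ae (.of_forall fun τ => ?_)
        simp only
        congr 1
        push_cast
        ring
      · congr 1
        have : (√2 : ℂ) ^ 2 = 2 := by
          rw [← ofReal_pow, Real.sq_sqrt zero_le_two]; norm_num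
        push_cast
        linear_combination (3 / 2 * (y.2 : ℂ) ^ 2) * this
    have h5 : Integrable (fun τ : VectorFields =>
        exp (I * (y.2 * (√2 * Gam τ y.1.1) : ℝ))) vectorGaussian :=
      Integrable.of_bound (C := 1) (Measurable.aestronglyMeasurable (by fun_prop))
        (.of_forall fun τ => by rw [mul_comm, norm_exp_ofReal_mul_I])
    rw [integral_const_mul, integral_sub h5 (integrable_const _), h3, integral_const, selfIntegrand,
      gasWeight]
    simp [mul_sub]
  · simp only [Set.indicator_of_notMem hc, integral_zero]

/-- The free energy as a function of the parameter of the gas. -/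
def freeEnergy (m : ℝ) (μ : ℂ) : ℂ :=
  selfEnergy m μ Set.univ + ∑' T : LabelledTree, gasTerm m μ Set.univ T.2.1

lemma tendsto_integral_exp_boxPotential (hA : Critical m κ) (hμ : κ ≤ μ.re) :
    Tendsto (fun N => ∫ τ, exp (-boxPotential m μ N τ) ∂vectorGaussian) atTop
      (𝓝 (exp (freeEnergy m μ))) := by
  refine ((continuous_exp.tendsto _).comp ((tendsto_selfEnergy hA.1 hA.2 hμ
    (fun j => measurableSet_cut (closedBox j) 0) exhausts_closedBox).add (tendsto_tsum_gasTerm hA hμ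
      (fun j => measurableSet_cut (closedBox j) 0) exhausts_closedBox))).congr fun N => ?_
  exact (integral_exp_modes hA hμ (closedBox N)).symm

/-- The limit of the potential is integrable together with its exponential, and their expectations
are given by the gas of particles. -/
lemma potential_limit (hA : Critical m κ) (hμ : κ ≤ μ.re) {W : VectorFields → ℂ}
    (hW : ∀ᵐ τ ∂vectorGaussian, Tendsto (fun N => boxPotential m μ N τ) atTop (𝓝 (W τ))) :
    Integrable W vectorGaussian ∧ Integrable (fun τ => exp (-W τ)) vectorGaussian ∧
    ∫ τ, -W τ ∂vectorGaussian = selfEnergy m μ Set.univ ∧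
    ∫ τ, exp (-W τ) ∂vectorGaussian =
      exp (freeEnergy m μ) := by
  obtain ⟨B, hB⟩ := exists_lintegral_sq_le hA hμ
  have hμ0 := hA.2.trans_le hμ
  have h1 := tendsto_integral_of_sq_bound (f := fun N τ => -boxPotential m μ N τ)
    (g := fun τ => -W τ) (fun N => (measurable_boxPotential N).neg.aestronglyMeasurable)
    (fun N => hB N _ fun τ => by
      rw [norm_neg]; linarith [Real.add_one_le_exp ‖boxPotential m μ N τ‖])
    (hW.mono fun τ h => h.neg)
  have h2 := tendsto_integral_of_sq_bound (f := fun N τ => exp (-boxPotential m μ N τ))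
    (g := fun τ => exp (-W τ))
    (fun N => ((measurable_boxPotential N).neg.cexp).aestronglyMeasurable)
    (fun N => hB N _ fun τ => by
      rw [norm_exp, ← norm_neg]; exact Real.exp_le_exp.2 (re_le_norm _))
    (hW.mono fun τ h => (continuous_exp.tendsto _).comp h.neg)
  have h3 := tendsto_selfEnergy hA.1 hA.2 hμ (fun j => measurableSet_cut (closedBox j) 0) exhausts_closedBox
  refine ⟨by simpa using! h1.1.neg, h2.1, tendsto_nhds_unique h1.2 ?_,
    tendsto_nhds_unique h2.2 (tendsto_integral_exp_boxPotential hA hμ)⟩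
  simpa only [integral_boxPotential hA.1 hμ0] using h3

end PotentialLimit

/-! ### The coupling, the parameter of the gas and the domain -/

section Coupling

variable {m κ : ℝ}
  {lam : ℂ}

/-- The parameter `lam ^ (-1 / 2)` of the gas. -/
def gasParameter (lam : ℂ) : ℂ := lam ^ (-(1 / 2) : ℂ)

lemma gasParameter_sq (h : lam ≠ 0) : lam * gasParameter lam ^ 2 = 1 := by
  rw [gasParameter, ← cpow_nat_mul]
  norm_num [cpow_neg_one, h]

lemma gasParameter_ne_zero (h : lam ≠ 0) : gasParameter lam ≠ 0 := by
  intro h0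
  have := gasParameter_sq h
  simp [h0] at this

/-- The principal logarithms of `2` and of `lam` add without a branch correction because `2` is
positive. -/
lemma sqrtTwo_eq (h : lam ≠ 0) : sqrtTwo lam = √2 / gasParameter lam := by
  have h2 : ((√2 : ℝ) : ℂ) = exp (Real.log 2 * (1 / 2)) := by
    rw [Real.sqrt_eq_rpow, Real.rpow_def_of_pos two_pos]
    push_cast
    norm_num
  rw [sqrtTwo, gasParameter, cpow_neg, div_inv_eq_mul, h2,
    cpow_def_of_ne_zero (by simpa using h), cpow_def_of_ne_zero h, ← exp_add,
    ← add_mul, ← log_ofReal_mul two_pos h, ofReal_ofNat]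

/-- This formula is the origin of the cardioid: squared, the condition Re μ > √`Knum` reads ρ <
cos²(θ/2)/`Knum`. -/
lemma gasParameter_re (h : lam ≠ 0) :
    (gasParameter lam).re = Real.cos (lam.arg / 2) / √‖lam‖ := by
  have hn : 0 < ‖lam‖ := norm_pos_iff.2 h
  rw [gasParameter, cpow_def_of_ne_zero h, exp_re]
  have h1 : (log lam * -(1 / 2)).re = -(Real.log ‖lam‖ / 2) := by
    simp [mul_re, log_re]; ring
  have h2 : (log lam * -(1 / 2)).im = -(lam.arg / 2) := by
    simp [mul_im, log_im]; ring
  rw [h1, h2, Real.cos_neg, Real.exp_neg, ← Real.log_sqrt hn.le, Real.exp_log (Real.sqrt_pos.2 hn)]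
  ring

lemma norm_polar {ρ : ℝ} (hρ : 0 ≤ ρ) (θ : ℝ) : ‖(ρ : ℂ) * exp (I * θ)‖ = ρ := by
  rw [mul_comm I, norm_mul, norm_exp_ofReal_mul_I, mul_one, norm_real, Real.norm_of_nonneg hρ]

lemma re_polar (ρ θ : ℝ) : ((ρ : ℂ) * exp (I * θ)).re = ρ * Real.cos θ := by
  rw [mul_comm I, re_ofReal_mul, exp_ofReal_mul_I_re]

lemma cos_half_sq (θ : ℝ) : Real.cos (θ / 2) ^ 2 = (1 + Real.cos θ) / 2 := by
  rw [Real.cos_sq, mul_div_cancel₀ _ two_ne_zero]; ring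

/-- The equation of the domain in Cartesian coordinates. -/
lemma mem_domain_iff_norm (hm : 0 < m) :
    lam ∈ domain m ↔ 2 * Knum m * ‖lam‖ ^ 2 < ‖lam‖ + lam.re := by
  have hK := Knum_pos hm
  have hiff : ∀ ρ θ : ℝ, 0 < ρ → (ρ < 1 / K m θ ↔ 2 * Knum m * ρ ^ 2 < ρ + ρ * Real.cos θ) := by
    intro ρ θ hρ
    rw [K, one_div_div, lt_div_iff₀ hK, cos_half_sq, lt_div_iff₀ two_pos,
      ← mul_lt_mul_iff_right₀ hρ]
    ring_nf
  constructor
  · rintro ⟨ρ, θ, hρ, -, -, rfl, h⟩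
    rw [norm_polar hρ.le] at h ⊢
    rw [re_polar]
    exact (hiff ρ θ hρ).1 h
  · intro h
    have hρ : 0 < ‖lam‖ := by
      rw [norm_pos_iff]
      rintro rfl
      simp at h
    have ha : lam.arg ≠ Real.pi := by
      intro ha
      have h1 := norm_mul_cos_arg lam
      rw [ha, Real.cos_pi] at h1
      rw [← h1] at h
      have : 0 < 2 * Knum m * ‖lam‖ ^ 2 := by positivity
      linarith
    refine ⟨‖lam‖, lam.arg, hρ, neg_pi_lt_arg lam, lt_of_le_of_ne (arg_le_pi lam) ha, ?_,
      (hiff _ _ hρ).2 ?_⟩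
    · rw [mul_comm I, norm_mul_exp_arg_mul_I]
    · rwa [norm_mul_cos_arg]

/-- The domain is the image of a half plane. -/
lemma mem_domain_iff (hm : 0 < m) :
    lam ∈ domain m ↔ √(Knum m) < (gasParameter lam).re := by
  rcases eq_or_ne lam 0 with rfl | hz
  · simp [mem_domain_iff_norm hm, gasParameter, Real.sqrt_nonneg]
  have hn : 0 < ‖lam‖ := norm_pos_iff.2 hz
  have h0 : 0 ≤ (gasParameter lam).re := by
    rw [gasParameter_re hz]
    exact div_nonneg (Real.cos_nonneg_of_mem_Icc ⟨by linarith [neg_pi_lt_arg lam],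
      by linarith [arg_le_pi lam]⟩) (Real.sqrt_nonneg _)
  rw [Real.sqrt_lt (Knum_pos hm).le h0, gasParameter_re hz, div_pow, Real.sq_sqrt hn.le, cos_half_sq,
    lt_div_iff₀ hn, lt_div_iff₀ two_pos, mem_domain_iff_norm hm, ← norm_mul_cos_arg lam]
  refine Iff.trans ?_ (mul_lt_mul_iff_right₀ hn)
  ring_nf

lemma ne_zero_of_mem_domain (h : lam ∈ domain m) : lam ≠ 0 := by
  obtain ⟨ρ, θ, hρ, -, -, rfl, -⟩ := h
  exact mul_ne_zero (by exact_mod_cast hρ.ne') (exp_ne_zero _)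

lemma denom_eq (h : lam ≠ 0) (hm : 0 < m) (τ : VectorFields) (p : Mode) :
    denom m lam τ p =
      1 - I * (√2 * Gam τ p : ℝ) / (gasParameter lam / C0 m p) := by
  have hC : (C0 m p : ℂ) ≠ 0 := ofReal_ne_zero.2 (C0_pos hm p).ne'
  rw [denom, sqrtTwo_eq h, div_div_eq_mul_div]
  push_cast
  ring

lemma cutPotential_eq (h : lam ≠ 0) (hm : 0 < m) (N : ℕ) (τ : VectorFields) :
    cutPotential m lam N τ = boxPotential m (gasParameter lam) N τ := by
  simp only [cutPotential, denom_eq h hm]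
  exact (Finset.sum_subtype_of_mem _ fun p hp => (Finset.mem_filter.1 hp).2).symm

/-- The partition function is the exponential of the free energy of the gas. -/
theorem potentialWellDefined_of_mem_domain (hm : 0 < m) (h : lam ∈ domain m) :
    PotentialWellDefined m lam ∧ oneVertexTerm m lam = selfEnergy m (gasParameter lam) Set.univ ∧
      partitionFunction m lam = exp (freeEnergy m (gasParameter lam)) := by
  have hK := Knum_pos hm
  have h0 := ne_zero_of_mem_domain h
  have hκ := Real.sqrt_pos.2 hK
  have hμ := ((mem_domain_iff hm).1 h).le
  have hlim : ∀ᵐ τ ∂vectorGaussian, Tendsto (fun N : ℕ => cutPotential m lam N τ) atTop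
      (𝓝 (potential m lam τ)) := by
    filter_upwards [ae_exists_tendsto_boxPotential (m := m) hm hκ hμ] with τ ⟨l, hl⟩
    exact tendsto_nhds_limUnder ⟨l, by simpa only [cutPotential_eq h0 hm] using hl⟩
  obtain ⟨h1, h2, h3, h4⟩ := potential_limit ⟨hm, hκ, Real.sq_sqrt hK.le⟩ hμ
    (by simpa only [cutPotential_eq h0 hm] using hlim)
  exact ⟨⟨hlim, h1, h2⟩, h3, h4⟩

end Coupling

/-! ### Particle integrals as sums over modes of time integrals -/

section ParticleFubini

open Finset

variable {n : ℕ} {e : (Fin n → ClosedMode) → ℂ} {g : Fin n → Particle → ℂ}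

lemma pi_count : Measure.pi (fun _ : Fin n => (Measure.count : Measure ClosedMode)) = Measure.count := by
  refine Measure.ext_of_singleton fun p => ?_
  rw [← Set.univ_pi_singleton, Measure.pi_pi]
  simp [Set.univ_pi_singleton]

/-- The measure on configurations as a product of a sum over modes and an integral. -/
lemma measurePreserving_particles : MeasurePreserving
    (MeasurableEquiv.arrowProdEquivProdArrow ClosedMode ℝ (Fin n))
    (Measure.pi fun _ => particleMeasure) ((Measure.count : Measure (Fin n → ClosedMode)).prod
      (Measure.pi fun _ => volume.restrict (Set.Ioi 0))) := by
  have h := measurePreserving_arrowProdEquivProdArrow ClosedMode ℝ (Fin n) (fun _ => Measure.count)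
    fun _ => volume.restrict (Set.Ioi 0)
  rw [pi_count] at h
  exact h

lemma integrable_particles_iff (hg : ∀ k, Measurable (g k))
    (hI : ∀ k p, IntegrableOn (fun t => g k (p, t)) (Set.Ioi 0)) :
    Integrable (fun y : Fin n → Particle => e (fun i => (y i).1) * ∏ k, g k (y k))
      (Measure.pi fun _ => particleMeasure) ↔
    Summable fun p : Fin n → ClosedMode => ‖e p‖ * ∏ k, ∫ t in Set.Ioi 0, ‖g k (p k, t)‖ := by
  have hmeas : Measurable fun q : (Fin n → ClosedMode) × (Fin n → ℝ) =>
      e q.1 * ∏ k, g k (q.1 k, q.2 k) := by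
    refine Measurable.mul ((measurable_of_countable e).comp measurable_fst)
      (Finset.measurable_prod _ fun k _ => (hg k).comp ?_)
    exact ((measurable_pi_apply k).comp measurable_fst).prodMk ((measurable_pi_apply k).comp measurable_snd)
  have h := (measurePreserving_particles (n := n)).integrable_comp_emb
    (MeasurableEquiv.measurableEmbedding _) (g := fun q => e q.1 * ∏ k, g k (q.1 k, q.2 k))
  refine h.trans ?_
  rw [integrable_prod_iff hmeas.aestronglyMeasurable, integrable_count_iff]
  refine (and_iff_right (Eventually.of_forall fun p => ?_)).trans (summable_congr fun p => ?_)
  · exact (Integrable.fintype_prod_dep (f := fun k t => g k (p k, t)) fun k => hI k (p k)).const_mul (e p)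
  · simp only [norm_mul, norm_prod]
    rw [integral_const_mul, integral_fintype_prod_eq_prod fun k t => ‖g k (p k, t)‖, Real.norm_of_nonneg]
    exact mul_nonneg (norm_nonneg _) (prod_nonneg fun k _ => integral_nonneg fun t => norm_nonneg _)

lemma integral_particles (h : Integrable (fun y : Fin n → Particle => e (fun i => (y i).1) *
      ∏ k, g k (y k)) (Measure.pi fun _ => particleMeasure)) :
    ∫ y : Fin n → Particle, e (fun i => (y i).1) * ∏ k, g k (y k) ∂(Measure.pi fun _ => particleMeasure) =
      ∑' p : Fin n → ClosedMode, e p * ∏ k, ∫ t in Set.Ioi 0, g k (p k, t) := by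
  have h1 := (measurePreserving_particles (n := n)).integral_comp
    (MeasurableEquiv.measurableEmbedding _) fun q => e q.1 * ∏ k, g k (q.1 k, q.2 k)
  have h2 := ((measurePreserving_particles (n := n)).integrable_comp_emb
    (MeasurableEquiv.measurableEmbedding _) (g := fun q => e q.1 * ∏ k, g k (q.1 k, q.2 k))).1 h
  refine h1.trans ?_
  rw [integral_prod _ h2, integral_countable h2.integral_prod_left]
  refine tsum_congr fun p => ?_
  simp only [measureReal_def, Measure.count_singleton, ENNReal.toReal_one, one_smul]
  rw [integral_const_mul, integral_fintype_prod_eq_prod fun k t => g k (p k, t)]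

end ParticleFubini

/-! ### Gamma integrals with complex rate -/

section GammaIntegral

lemma integrableOn_pow_mul_exp {a : ℝ} (ha : 0 < a) (k : ℕ) :
    IntegrableOn (fun t : ℝ => t ^ k * Real.exp (-(t * a))) (Set.Ioi 0) := by
  have h := integrableOn_rpow_mul_exp_neg_mul_rpow (p := 1) (s := k) (b := a)
    (by have := Nat.cast_nonneg (α := ℝ) k; linarith) zero_lt_one ha
  refine IntegrableOn.congr_fun h (fun t _ => ?_) measurableSet_Ioi
  simp only [Real.rpow_natCast, Real.rpow_one]
  ring_nf

lemma norm_pow_mul_cexp (z : ℂ) (k : ℕ) {t : ℝ} (ht : 0 < t) :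
    ‖(t : ℂ) ^ k * exp (-(t * z))‖ = t ^ k * Real.exp (-(t * z.re)) := by
  rw [norm_mul, norm_pow, norm_real, Real.norm_of_nonneg ht.le, norm_exp_neg_mul]
  ring_nf

lemma integrableOn_pow_mul_cexp {z : ℂ} (hz : 0 < z.re) (k : ℕ) :
    IntegrableOn (fun t : ℝ => (t : ℂ) ^ k * exp (-(t * z))) (Set.Ioi 0) := by
  refine (integrableOn_pow_mul_exp hz k).mono' (Measurable.aestronglyMeasurable (by fun_prop)) ?_
  filter_upwards [ae_restrict_mem measurableSet_Ioi] with t ht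
  rw [norm_pow_mul_cexp z k ht]

lemma integral_pow_mul_cexp {z : ℂ} (hz : 0 < z.re) (k : ℕ) :
    ∫ t in Set.Ioi (0 : ℝ), (t : ℂ) ^ k * exp (-(t * z)) = k ! / z ^ (k + 1) := by
  have hz0 : z ≠ 0 := fun h => by simp [h] at hz
  have hd : ∀ (j : ℕ) (t : ℝ), HasDerivAt (fun t : ℝ => (t : ℂ) ^ j * exp (-(t * z)))
      (j * (t : ℂ) ^ (j - 1) * exp (-(t * z)) - z * ((t : ℂ) ^ j * exp (-(t * z)))) t := by
    intro j t
    have h1 : HasDerivAt (fun s : ℂ => s ^ j * exp (-(s * z)))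
        (j * (t : ℂ) ^ (j - 1) * exp (-(t * z)) -
        z * ((t : ℂ) ^ j * exp (-(t * z)))) t :=
      ((hasDerivAt_pow j (t : ℂ)).fun_mul ((hasDerivAt_id' (t : ℂ)).mul_const z).fun_neg.cexp).congr_deriv
        (by ring)
    exact h1.comp_ofReal
  have hlim : ∀ j : ℕ, Tendsto (fun t : ℝ => (t : ℂ) ^ j * exp (-(t * z))) atTop (𝓝 0) := by
    intro j
    rw [tendsto_zero_iff_norm_tendsto_zero]
    have h := tendsto_rpow_mul_exp_neg_mul_atTop_nhds_zero (j : ℝ) z.re hz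
    refine h.congr' ?_
    filter_upwards [eventually_gt_atTop 0] with t ht
    rw [norm_pow_mul_cexp z j ht, Real.rpow_natCast]
    ring_nf
  have hInt := integrableOn_pow_mul_cexp hz
  have hval : ∀ j : ℕ, IntegrableOn (fun t : ℝ => j * (t : ℂ) ^ (j - 1) * exp (-(t * z)))
      (Set.Ioi 0) := fun j => by
    simp only [mul_assoc]; exact (hInt (j - 1)).const_mul _
  have hftc : ∀ j : ℕ, (∫ t in Set.Ioi (0 : ℝ), (j * (t : ℂ) ^ (j - 1) * exp (-(t * z)))) -
      z * (∫ t in Set.Ioi (0 : ℝ), (t : ℂ) ^ j * exp (-(t * z))) = -(0 : ℂ) ^ j := by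
    intro j
    have h := integral_Ioi_of_hasDerivAt_of_tendsto' (fun t _ => hd j t)
      ((hval j).sub ((hInt j).const_mul z)) (hlim j)
    rw [integral_sub (hval j) ((hInt j).const_mul z), integral_const_mul] at h
    simpa using h
  induction k with
  | zero =>
    have h := hftc 0
    simp only [Nat.cast_zero, zero_mul, integral_zero, zero_sub, pow_zero, one_mul, neg_inj] at h ⊢
    rw [Nat.factorial_zero, Nat.cast_one, zero_add, pow_one, eq_div_iff hz0, mul_comm]
    exact h
  | succ k ih =>
    have h := hftc (k + 1)
    rw [Nat.add_sub_cancel] at h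
    simp only [mul_assoc] at h
    rw [integral_const_mul, ih, zero_pow (Nat.succ_ne_zero k), neg_zero, sub_eq_zero] at h
    rw [eq_div_iff (pow_ne_zero _ hz0), pow_succ, ← mul_assoc, mul_right_comm,
      mul_comm _ z, ← h, Nat.factorial_succ]
    field_simp
    push_cast
    ring

end GammaIntegral

/-! ### Products over the edges of a tree -/

section TreeProducts

open Finset
open scoped Classical

variable {n : ℕ} {T : SimpleGraph (Fin n)}

/-- The number of edges of a tree at each vertex, in products over the edges. -/
lemma prod_edges_eq {R : Type*} [CommMonoid R] (T : SimpleGraph (Fin n)) (f : Fin n → R)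
    (E : Sym2 (Fin n) → R) (hE : ∀ a b, a ≠ b → E s(a, b) = f a * f b) :
    ∏ l : T.edgeSet, E l = ∏ k, f k ^ T.degree k := by
  have h1 : ∀ l : T.edgeSet, E l = ∏ k, if k ∈ l.1 then f k else 1 := by
    rintro ⟨l, hl⟩
    induction l using Sym2.ind with
    | _ a b =>
      have hab : a ≠ b := SimpleGraph.Adj.ne hl
      rw [hE a b hab, ← prod_filter]
      have : univ.filter (fun k => k ∈ s(a, b)) = {a, b} := by ext; simp
      rw [this, prod_pair hab]
  simp only [h1]
  rw [Finset.prod_comm]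
  refine prod_congr rfl fun k _ => ?_
  rw [← SimpleGraph.card_incidenceFinset_eq_degree, SimpleGraph.incidenceFinset_eq_filter,
    ← prod_const, prod_filter]
  exact (prod_subtype T.edgeFinset (fun l => SimpleGraph.mem_edgeFinset)
    fun l => if k ∈ l then f k else 1).symm

lemma sum_degree (hT : T.IsTree) : ∑ k, T.degree k = 2 * (n - 1) := by
  rw [SimpleGraph.sum_degrees_eq_twice_card_edges]
  have := hT.card_edgeFinset
  rw [Fintype.card_fin] at this
  omega

/-- Each incident edge gives a vertex one power of its proper time. Together with the `1/t` of the
particle weight this is the power `degree - 1` of a Gamma integral. -/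
lemma prod_edgeInner_particleVec (hT : T.IsTree) (y : Fin n → Particle) :
    ∏ l : T.edgeSet, edgeInner (particleVec ∘ y) l =
      2 ^ (n - 1) * ((∏ l : T.edgeSet, (edgeFactor (fun i => (y i).1) l : ℝ)) *
        ∏ k, |(y k).2| ^ T.degree k) := by
  have h1 : ∀ l : Sym2 (Fin n), edgeInner (particleVec ∘ y) l = 2 *
      (edgeFactor (fun i => (y i).1) l * Sym2.lift ⟨fun a b => |(y a).2| * |(y b).2|,
        fun _ _ => mul_comm _ _⟩ l) := by
    intro l
    induction l using Sym2.ind with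
    | _ a b =>
      rw [edgeInner_mk, Function.comp, Function.comp, inner_particleVec]
      simp only [edgeFactor, Sym2.lift_mk]
      ring
  have hcard : Fintype.card T.edgeSet = n - 1 := by
    have := hT.card_edgeFinset
    simp only [Fintype.card_fin, SimpleGraph.edgeFinset_card] at this
    omega
  simp only [h1]
  rw [prod_mul_distrib, prod_const, card_univ, hcard, prod_mul_distrib,
    prod_edges_eq T (fun k => |(y k).2|) _ fun a b _ => by simp only [Sym2.lift_mk]]

end TreeProducts

/-! ### Absolute convergence of the sums over modes -/

section TreeSums

open Finset
open scoped Classical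

variable {m κ : ℝ} {n : ℕ} {T : SimpleGraph (Fin n)}

lemma degree_pos_of_isTree (hn : 2 ≤ n) (hT : T.IsTree) (k : Fin n) : 0 < T.degree k := by
  have : Nontrivial (Fin n) := Fin.nontrivial_iff_two_le.2 hn
  exact hT.connected.preconnected.degree_pos_of_nontrivial k

lemma treeEnergy_le {M : ℝ} {y : Fin n → Particle} (hy : ∀ k, 0 < (y k).2) (hM : ∀ k, (y k).2 ≤ M)
    (w : T.edgeSet → ℝ) :
    treeEnergy (particleVec ∘ y) T w ≤ (pairs (univ : Finset (Fin n))).card * (6 * M ^ 2) := by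
  rw [← nsmul_eq_mul, treeEnergy]
  refine sum_le_card_nsmul _ _ _ fun p _ => ?_
  have h0 := inner_particleVec_nonneg (y p.1) (y p.2)
  refine (mul_le_of_le_one_left h0 (pathInf_le_one _ _ _ _)).trans ?_
  rw [inner_particleVec, abs_of_pos (hy _), abs_of_pos (hy _)]
  have h1 : (sharedModes (y p.1).1.1 (y p.2).1.1 : ℝ) ≤ 3 := by exact_mod_cast sharedModes_le _ _
  have hM0 : 0 ≤ M := (hy p.1).le.trans (hM _)
  calc _ ≤ 2 * M * M * 3 := by
        gcongr
        · exact (hy p.2).le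
        · exact hM _
        · exact hM _
    _ = _ := by ring

lemma continuous_exp_treeEnergy {H : Type*} [NormedAddCommGroup H] [InnerProductSpace ℝ H]
    (x : Fin n → H) : Continuous fun w => Real.exp (-treeEnergy x T w) :=
  Real.continuous_exp.comp (continuous_treeEnergy x T).neg

/-- The sum over the modes of a tree converges. -/
lemma summable_tree_modes (hA : Critical m κ) (hn : 2 ≤ n)
    (hT : T.IsTree) : Summable fun p : Fin n → ClosedMode =>
      (∏ l : T.edgeSet, (edgeFactor p l : ℝ)) * ∏ k, C0 m (p k).1 ^ T.degree k := by
  set M := 1 / m ^ 2 with hM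
  have hCM : ∀ p : Mode, C0 m p ≤ M := fun p => by
    rw [C0, hM]
    have := sqNorm_nonneg p
    have := hA.1
    gcongr
    linarith
  set B := (pairs (univ : Finset (Fin n))).card * (6 * M ^ 2) with hB
  set δ := Real.exp (-(κ + 3 * M ^ 2)) ^ n * Real.exp (-B) with hδ
  have hδ0 : 0 < δ := by positivity
  -- For proper times at most C₀ the exponential factors of weights and energy are bounded below, so
  -- `treeDensity` is at least `δ` times the power integrand. The finite tree mass thus controls the
  -- sum over modes, and no combinatorial summation along the tree is needed.
  set S : Set Particle := {y | y.2 ≤ C0 m y.1.1} with hS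
  have hSm : MeasurableSet S := measurableSet_le measurable_snd measurable_C0
  set g : Fin n → Particle → ℂ := fun k => S.indicator fun y => (y.2 : ℂ) ^ (T.degree k - 1) with hg
  set e : (Fin n → ClosedMode) → ℂ := fun p => ((∏ l : T.edgeSet, (edgeFactor p l : ℝ) : ℝ) : ℂ) with he
  have he0 : ∀ p, ‖e p‖ = ∏ l : T.edgeSet, (edgeFactor p l : ℝ) := fun p => by
    rw [he, norm_real, Real.norm_of_nonneg (prod_nonneg fun l _ => Nat.cast_nonneg _)]
  have hgm : ∀ k, Measurable (g k) := fun k => Measurable.indicator (by fun_prop) hSm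
  have hnorm : ∀ k y, 0 < y.2 → ‖g k y‖ = S.indicator (fun y => y.2 ^ (T.degree k - 1)) y := by
    intro k y hy
    rw [hg, norm_indicator_eq_indicator_norm]
    simp only [norm_pow, norm_real, Set.indicator, Real.norm_of_nonneg hy.le]
  have hset : ∀ p : ClosedMode, ∀ k : ℕ, (fun t : ℝ => S.indicator (fun y : Particle => y.2 ^ k) (p, t)) =
      (Set.Iic (C0 m p.1)).indicator fun t => t ^ k := fun p k => rfl
  have hIoc : ∀ p : ClosedMode, Set.Ioi 0 ∩ Set.Iic (C0 m p.1) = Set.Ioc 0 (C0 m p.1) := fun p => rfl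
  have hI : ∀ k p, IntegrableOn (fun t => g k (p, t)) (Set.Ioi 0) := by
    intro k p
    have h1 : IntegrableOn (fun t : ℝ => S.indicator (fun y : Particle => y.2 ^ (T.degree k - 1)) (p, t))
        (Set.Ioi 0) := by
      rw [hset, integrableOn_indicator_iff measurableSet_Iic, Set.inter_comm, hIoc]
      exact ((continuous_pow _).integrableOn_Icc).mono_set Set.Ioc_subset_Icc_self
    refine h1.mono' (((hgm k).comp (by fun_prop)).aestronglyMeasurable) ?_
    filter_upwards [ae_restrict_mem measurableSet_Ioi] with t ht
    rw [hnorm k (p, t) ht]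
  have hint : Integrable (fun y : Fin n → Particle => e (fun i => (y i).1) * ∏ k, g k (y k))
      (Measure.pi fun _ => particleMeasure) := by
    refine ((integrable_treeDensity hA ⟨⟨n, hn⟩, T, hT⟩).const_mul δ⁻¹).mono' ?_ ?_
    · refine Measurable.aestronglyMeasurable (Measurable.mul ?_
        (Finset.measurable_prod _ fun k _ => (hgm k).comp (measurable_pi_apply k)))
      exact (measurable_of_countable e).comp (measurable_pi_lambda _ fun i =>
        measurable_fst.comp (measurable_pi_apply i))
    · filter_upwards [ae_particles_pos, treeDensity_nonneg (m := m) (κ := κ)] with y hy hd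
      by_cases hc : ∀ k, y k ∈ S
      · rw [le_inv_mul_iff₀ hδ0, norm_mul, norm_prod, he0]
        simp only [hnorm _ _ (hy _), Set.indicator_of_mem (hc _)]
        have h1 : ∀ k, Real.exp (-(κ + 3 * M ^ 2)) * (y k).2⁻¹ ≤ realWeight m κ (y k) := by
          intro k
          have hC := C0_pos hA.1 (y k).1.1
          rw [realWeight, div_eq_mul_inv]
          have h2 : (y k).2 * (κ / C0 m (y k).1.1) ≤ κ := by
            rw [← mul_div_assoc, div_le_iff₀ hC, mul_comm]
            exact mul_le_mul_of_nonneg_left (hc k) hA.2.le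
          have h3 : (y k).2 ^ 2 ≤ M ^ 2 := pow_le_pow_left₀ (hy k).le ((hc k).trans (hCM _)) 2
          have := (hy k).le
          gcongr
          linarith
        have h4 : Real.exp (-B) ≤ ∫ w in parameterCube T, Real.exp (-treeEnergy (particleVec ∘ y) T w) := by
          have h5 := integral_mono (μ := (volume : Measure (T.edgeSet → ℝ)).restrict (parameterCube T))
            (f := fun _ => Real.exp (-B)) (by rw [volume_restrict_parameterCube]; exact integrable_const _)
            (Continuous.integrableOn_Icc (continuous_exp_treeEnergy _))
            (fun w => Real.exp_le_exp.2 (neg_le_neg (treeEnergy_le hy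
              (fun k => (hc k).trans (hCM _)) w)))
          rw [volume_restrict_parameterCube] at h5 ⊢
          simpa using h5
        have h6 : ∀ k, (y k).2 ^ (T.degree k - 1) = (y k).2⁻¹ * |(y k).2| ^ T.degree k := fun k => by
          rw [abs_of_pos (hy k), ← mul_pow_sub_one (degree_pos_of_isTree hn hT k).ne', ← mul_assoc,
            inv_mul_cancel₀ (hy k).ne', one_mul]
        set P := ∏ l : T.edgeSet, (edgeFactor (fun i => (y i).1) l : ℝ) with hP
        have hP0 : 0 ≤ P := prod_nonneg fun l _ => Nat.cast_nonneg _
        have h7 : (∏ k, Real.exp (-(κ + 3 * M ^ 2)) * (y k).2⁻¹) ≤ ∏ k, realWeight m κ (y k) :=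
          prod_le_prod (fun k _ => by have := hy k; positivity) fun k _ => h1 k
        rw [prod_mul_distrib, prod_const, card_univ, Fintype.card_fin] at h7
        simp only [treeDensity, treeWeight, h6, prod_mul_distrib]
        rw [prod_edgeInner_particleVec hT]
        have hW0 : 0 ≤ ∏ k, realWeight m κ (y k) := prod_nonneg fun k _ => (realWeight_pos κ (hy k)).le
        have hQ0 : 0 ≤ ∏ k, |(y k).2| ^ T.degree k := by positivity
        have h8 : (1 : ℝ) ≤ 2 ^ (n - 1) := one_le_pow₀ one_le_two
        have hR0 : 0 ≤ ∏ k, (y k).2⁻¹ := prod_nonneg fun k _ => (inv_pos.2 (hy k)).le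
        calc _ = (Real.exp (-(κ + 3 * M ^ 2)) ^ n * ∏ k, (y k).2⁻¹) *
              ((1 * (P * ∏ k, |(y k).2| ^ T.degree k)) * Real.exp (-B)) := by rw [hδ]; ring
          _ ≤ _ := by gcongr
      · push Not at hc
        obtain ⟨k, hk⟩ := hc
        rw [prod_eq_zero (mem_univ k) (by rw [hg]; exact Set.indicator_of_notMem hk _), mul_zero,
          norm_zero]
        exact mul_nonneg (inv_nonneg.2 hδ0.le) (hd T)
  -- For a vertex of degree c, the integral of t^(c-1) over (0, C₀] is C₀^c / c; integrability over
  -- particles becomes the asserted summability up to the factors c.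
  have hsum := (integrable_particles_iff hgm hI).1 hint
  refine (hsum.mul_right (∏ k, (T.degree k : ℝ))).congr fun p => ?_
  rw [he0, mul_assoc, ← prod_mul_distrib]
  congr 1
  refine prod_congr rfl fun k _ => ?_
  have hC := C0_pos hA.1 (p k).1
  have hd := degree_pos_of_isTree hn hT k
  rw [setIntegral_congr_fun measurableSet_Ioi fun t ht => hnorm k (p k, t) ht, hset,
    setIntegral_indicator measurableSet_Iic, hIoc, ← intervalIntegral.integral_of_le hC.le, integral_pow,
    Nat.sub_add_cancel hd, zero_pow hd.ne', sub_zero]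
  have : ((T.degree k - 1 : ℕ) : ℝ) + 1 = T.degree k := by
    rw [Nat.cast_sub hd]; simp
  rw [this, div_mul_cancel₀]
  exact_mod_cast hd.ne'

/-- The integrand of a tree in terms of the rates of its vertices. -/
def vertexProduct (T : SimpleGraph (Fin n)) (b : Fin n → ClosedMode → ℂ) (y : Fin n → Particle) : ℂ :=
  (∏ l : T.edgeSet, (edgeFactor (fun i => (y i).1) l : ℂ)) *
    ∏ k, (((y k).2 : ℂ) ^ (T.degree k - 1) * exp (-((y k).2 * b k (y k).1)))

/-- The time integral at a vertex is a Gamma integral, the source of the factor (c - 1)!. The real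
parts of the rates are at least κ/C₀, so the mode sum is dominated by `summable_tree_modes`. -/
lemma vertexProduct_facts (hA : Critical m κ) (hn : 2 ≤ n)
    (hT : T.IsTree) {b : Fin n → ClosedMode → ℂ} (hb : ∀ k p, κ / C0 m p.1 ≤ (b k p).re) :
    Integrable (vertexProduct T b) (Measure.pi fun _ => particleMeasure) ∧
    (Summable fun p : Fin n → ClosedMode => ‖(∏ l : T.edgeSet, (edgeFactor p l : ℂ)) *
      ∏ k, ((T.degree k - 1)! / b k (p k) ^ T.degree k)‖) ∧
    ∫ y, vertexProduct T b y ∂(Measure.pi fun _ => particleMeasure) =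
      ∑' p : Fin n → ClosedMode, (∏ l : T.edgeSet, (edgeFactor p l : ℂ)) *
        ∏ k, ((T.degree k - 1)! / b k (p k) ^ T.degree k) := by
  have hb0 : ∀ k p, 0 < (b k p).re := fun k p =>
    (div_pos hA.2 (C0_pos hA.1 p.1)).trans_le (hb k p)
  have hd := degree_pos_of_isTree hn hT
  set e : (Fin n → ClosedMode) → ℂ := fun p => ∏ l : T.edgeSet, (edgeFactor p l : ℂ) with he
  set g : Fin n → Particle → ℂ := fun k y =>
    (y.2 : ℂ) ^ (T.degree k - 1) * exp (-(y.2 * b k y.1)) with hg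
  have hgm : ∀ k, Measurable (g k) := fun k => by
    have : Measurable fun y : Particle => b k y.1 := (measurable_of_countable (b k)).comp measurable_fst
    fun_prop
  have hI : ∀ k p, IntegrableOn (fun t => g k (p, t)) (Set.Ioi 0) := fun k p =>
    integrableOn_pow_mul_cexp (hb0 k p) _
  have hval : ∀ k p, ∫ t in Set.Ioi 0, g k (p, t) = (T.degree k - 1)! / b k p ^ T.degree k := by
    intro k p
    have := integral_pow_mul_cexp (hb0 k p) (T.degree k - 1)
    rwa [Nat.sub_add_cancel (hd k)] at this
  have hnorm : ∀ k p, ∫ t in Set.Ioi 0, ‖g k (p, t)‖ = (T.degree k - 1)! / (b k p).re ^ T.degree k := by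
    intro k p
    have h := integral_pow_mul_cexp (z := (b k p).re) (by simpa using hb0 k p) (T.degree k - 1)
    rw [Nat.sub_add_cancel (hd k)] at h
    rw [← ofReal_inj, ← integral_complex_ofReal]
    push_cast
    rw [← h]
    refine setIntegral_congr_fun measurableSet_Ioi fun t ht => ?_
    simp only [hg]
    rw [norm_pow_mul_cexp _ _ ht]
    push_cast
    rfl
  have he0 : ∀ p, ‖e p‖ = ∏ l : T.edgeSet, (edgeFactor p l : ℝ) := fun p => by
    rw [he, norm_prod]; simp
  have hle : ∀ k p, (T.degree k - 1)! / (b k p).re ^ T.degree k ≤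
      ((T.degree k - 1)! / κ ^ T.degree k) * C0 m p.1 ^ T.degree k := by
    intro k p
    have hC := C0_pos hA.1 p.1
    have := hA.2
    rw [div_mul_eq_mul_div, div_le_div_iff₀ (pow_pos (hb0 k p) _) (pow_pos hA.2 _), mul_assoc, ← mul_pow]
    gcongr
    have := (div_le_iff₀ hC).1 (hb k p)
    linarith
  have hsum : Summable fun p : Fin n → ClosedMode =>
      ‖e p‖ * ∏ k, ((T.degree k - 1)! / (b k (p k)).re ^ T.degree k) := by
    refine ((summable_tree_modes hA hn hT).mul_left
      (∏ k, ((T.degree k - 1)! / κ ^ T.degree k))).of_nonneg_of_le (fun p => ?_) fun p => ?_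
    · exact mul_nonneg (norm_nonneg _) (prod_nonneg fun k _ =>
        div_nonneg (Nat.cast_nonneg _) (pow_nonneg (hb0 k (p k)).le _))
    · rw [he0, mul_left_comm, ← prod_mul_distrib]
      refine mul_le_mul_of_nonneg_left (prod_le_prod (fun k _ => ?_) fun k _ => hle k (p k))
        (prod_nonneg fun l _ => Nat.cast_nonneg _)
      exact div_nonneg (Nat.cast_nonneg _) (pow_nonneg (hb0 k (p k)).le _)
  have hint := (integrable_particles_iff (e := e) hgm hI).2 (by simpa only [hnorm] using hsum)
  refine ⟨hint, hsum.of_nonneg_of_le (fun _ => norm_nonneg _) fun p => ?_, ?_⟩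
  · rw [norm_mul]
    refine mul_le_mul_of_nonneg_left ?_ (norm_nonneg _)
    rw [norm_prod]
    refine Finset.prod_le_prod (fun _ _ => norm_nonneg _) fun k _ => ?_
    rw [norm_div, norm_pow, Complex.norm_natCast]
    have := hb0 k (p k)
    gcongr
    exact re_le_norm _
  · refine (integral_particles hint).trans ?_
    simp only [hval]
    rfl

end TreeSums

/-! ### Characters under the interpolated replica measure -/

section ReplicaExpectation

open Finset
open scoped Classical

variable {n : ℕ} {T : SimpleGraph (Fin n)}

instance (X : Matrix (Fin n) (Fin n) ℝ) : IsProbabilityMeasure (replicaGaussian X) := by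
  unfold replicaGaussian; infer_instance

lemma measurable_Gam_replica (k : Fin n) (p : Mode) :
    Measurable fun τ : ReplicaFields n => Gam (replica τ k) p := by
  unfold Gam replica
  fun_prop

/-- The characteristic function of the interpolated Gaussian measure. -/
lemma integral_exp_replicaGaussian (hT : T.IsTree) {w : T.edgeSet → ℝ} (hw : w ∈ parameterCube T)
    (y : Fin n → Particle) :
    ∫ τ, exp (I * ∑ k, (√2 * |(y k).2| * Gam (replica τ k) (y k).1.1 : ℝ))
      ∂(replicaGaussian (interpolation T w)) =
      exp (-(∑ k, 3 * ((y k).2 : ℂ) ^ 2) - (treeEnergy (particleVec ∘ y) T w : ℝ)) := by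
  set s := modeSupport fun i => (y i).1 with hs
  set v : Fin n → Fin 3 × ℤ → ℝ := fun k j => (particleVec (y k) : ChargeSpace) j with hv
  set x : Fin 3 × ℤ → EuclideanSpace ℝ (Fin n) := fun j => WithLp.toLp 2 fun k => v k j with hx
  have h1 : ∀ τ : ReplicaFields n, exp (I *
      ∑ k, (√2 * |(y k).2| * Gam (replica τ k) (y k).1.1 : ℝ)) =
      ∏ j ∈ s, exp ((inner ℝ (τ j) (x j) : ℝ) * I) := by
    intro τ
    rw [← exp_sum]
    congr 1
    rw [← sum_mul, mul_comm, ← ofReal_sum]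
    congr 2
    simp only [← sum_particleVec_mul]
    rw [Finset.sum_comm]
    refine sum_congr rfl fun j _ => ?_
    simp only [PiLp.inner_apply, hx, hv, replica]
    refine sum_congr rfl fun k _ => ?_
    simp
  simp only [h1]
  rw [replicaGaussian, integral_prod_infinitePi (fun _ => multivariateGaussian 0 (interpolation T w)) s
    (fun j z => exp ((inner ℝ z (x j) : ℝ) * I)) (fun j => by fun_prop)]
  have h2 : ∀ j, ∫ z, exp ((inner ℝ z (x j) : ℝ) * I)
      ∂(multivariateGaussian 0 (interpolation T w)) =
      exp ((-((∑ k, ∑ l, pathInf T w k l * (v k j * v l j)) / 2) : ℝ)) := by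
    intro j
    have h := charFun_multivariateGaussian (μ := 0) (posSemidef_interpolation hT hw) (x j)
    rw [charFun_apply] at h
    rw [h]
    congr 1
    simp only [inner_zero_right, ofReal_zero, zero_mul, zero_sub]
    push_cast
    congr 2
    rw [dotProduct]
    push_cast
    refine sum_congr rfl fun k _ => ?_
    rw [Matrix.mulVec, dotProduct]
    push_cast
    rw [mul_sum]
    refine sum_congr rfl fun l _ => ?_
    simp only [interpolation, Matrix.of_apply, hx]
    ring
  simp only [h2]
  rw [← exp_sum, ← ofReal_sum]
  congr 1
  have h3 : ∑ j ∈ s, -((∑ k, ∑ l, pathInf T w k l * (v k j * v l j)) / 2) =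
      -((∑ q ∈ (univ : Finset (Fin n)) ×ˢ univ, pathInf T w q.1 q.2 *
        inner ℝ (particleVec (y q.1)) (particleVec (y q.2))) / 2) := by
    rw [sum_neg_distrib, ← sum_div, sum_product, Finset.sum_comm]
    congr 2
    refine sum_congr rfl fun k _ => ?_
    rw [Finset.sum_comm]
    refine sum_congr rfl fun l _ => ?_
    rw [← sum_particleVec_mul_particleVec, mul_sum]
  rw [h3, sum_product_eq_sum_pairs (f := fun k l => pathInf T w k l *
    inner ℝ (particleVec (y k)) (particleVec (y l))) fun a b => by
      rw [pathInf_symm hT, real_inner_comm], treeEnergy]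
  simp only [pathInf_self hT, one_mul, real_inner_self_eq_norm_sq, norm_particleVec_sq, Function.comp]
  push_cast
  rw [← mul_sum, ← mul_sum]
  ring

end ReplicaExpectation

/-! ### Amplitudes are the tree terms of the gas -/

section Amplitude

open Finset
open scoped Classical

variable {m κ : ℝ} {μ : ℂ} {n : ℕ} {T : SimpleGraph (Fin n)}

/-- The rate of the proper time of a vertex in given vector fields. -/
def vertexRate (m : ℝ) (μ : ℂ) (τ : ReplicaFields n) (k : Fin n) (p : ClosedMode) : ℂ :=
  μ / C0 m p.1 - I * (√2 * Gam (replica τ k) p.1 : ℝ)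

lemma vertexRate_re (τ : ReplicaFields n) (k : Fin n) (p : ClosedMode) :
    (vertexRate m μ τ k p).re = μ.re / C0 m p.1 := by
  rw [vertexRate, sub_re, re_div_C0, re_mul_ofReal, I_re, zero_mul, sub_zero]

/-- Each resolvent is μ divided by the rate of its vertex, and the degrees of a tree add up to 2(n -
1); the resulting power of μ compensates the power of the coupling in the amplitude. -/
lemma treeTerm_eq (hm : 0 < m) {lam : ℂ} (hl : lam ≠ 0) (hT : T.IsTree) (τ : ReplicaFields n)
    (p : Fin n → ClosedMode) : treeTerm m lam T τ p = gasParameter lam ^ (2 * (n - 1)) *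
      ((∏ l : T.edgeSet, (edgeFactor p l : ℂ)) *
        ∏ k, ((T.degree k - 1)! / vertexRate m (gasParameter lam) τ k (p k) ^ T.degree k)) := by
  have hμ := gasParameter_ne_zero hl
  have h1 : ∀ k, resolvent m lam (replica τ k) (p k) =
      gasParameter lam * (vertexRate m (gasParameter lam) τ k (p k))⁻¹ := by
    intro k
    have hC : (C0 m (p k).1 : ℂ) ≠ 0 := ofReal_ne_zero.2 (C0_pos hm _).ne'
    rw [resolvent, denom_eq hl hm, vertexRate, div_div_eq_mul_div, one_sub_div hμ, div_div_eq_mul_div,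
      mul_comm, ← div_eq_mul_inv, div_sub' hC, div_div_eq_mul_div]
    congr 1
    ring
  rw [treeTerm, ← sum_degree hT, ← prod_pow_eq_pow_sum]
  simp only [h1, mul_pow]
  rw [← mul_assoc, mul_comm (∏ k, _) (∏ l : T.edgeSet, _), mul_right_comm _ (∏ l : T.edgeSet, _), mul_comm]
  congr 1
  rw [← prod_mul_distrib]
  refine prod_congr rfl fun k _ => ?_
  rw [inv_pow, div_eq_mul_inv]
  ring

/-- The product of the weights of the vertices and of the edges of a tree. -/
def gasIntegrand (m : ℝ) (μ : ℂ) (T : SimpleGraph (Fin n)) (w : T.edgeSet → ℝ) (y : Fin n → Particle) : ℂ :=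
  (∏ k, gasWeight m μ (y k)) * ((∏ l : T.edgeSet, edgeInner (particleVec ∘ y) l : ℝ) : ℂ) *
    (Real.exp (-treeEnergy (particleVec ∘ y) T w) : ℝ)

/-- The average of the integrand of a tree over the vector fields. -/
lemma integral_vertexProduct (hn : 2 ≤ n) (hT : T.IsTree) {w : T.edgeSet → ℝ} (hw : w ∈ parameterCube T)
    {y : Fin n → Particle} (hy : ∀ k, 0 < (y k).2) :
    ∫ τ, vertexProduct T (vertexRate m μ τ) y ∂(replicaGaussian (interpolation T w)) =
      (2 ^ (n - 1))⁻¹ * gasIntegrand m μ T w y := by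
  have h1 : ∀ τ, vertexProduct T (vertexRate m μ τ) y =
      ((∏ l : T.edgeSet, (edgeFactor (fun i => (y i).1) l : ℂ)) *
        ∏ k, (((y k).2 : ℂ) ^ (T.degree k - 1) * exp (-((y k).2 * (μ / C0 m (y k).1.1))))) *
      exp (I * ∑ k, (√2 * |(y k).2| * Gam (replica τ k) (y k).1.1 : ℝ)) := by
    intro τ
    rw [vertexProduct, mul_assoc, ofReal_sum, mul_sum, exp_sum, ← prod_mul_distrib]
    congr 1
    refine prod_congr rfl fun k _ => ?_
    rw [mul_assoc, ← exp_add, vertexRate, abs_of_pos (hy k)]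
    congr 2
    push_cast
    ring
  simp only [h1]
  rw [integral_const_mul, integral_exp_replicaGaussian hT hw, gasIntegrand, prod_edgeInner_particleVec hT,
    sub_eq_add_neg, exp_add, ofReal_exp, ofReal_neg, ← mul_assoc, ← mul_assoc]
  congr 1
  rw [← sum_neg_distrib, exp_sum, mul_assoc, ← prod_mul_distrib]
  push_cast
  have h2 : (2 : ℂ) ^ (n - 1) ≠ 0 := pow_ne_zero _ two_ne_zero
  rw [mul_left_comm (∏ k, gasWeight m μ (y k)), inv_mul_cancel_left₀ h2, mul_left_comm, ← prod_mul_distrib]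
  congr 1
  refine prod_congr rfl fun k _ => ?_
  have hk : ((y k).2 : ℂ) ≠ 0 := ofReal_ne_zero.2 (hy k).ne'
  rw [gasWeight, bareWeight, abs_of_pos (hy k),
    ← mul_pow_sub_one (degree_pos_of_isTree hn hT k).ne' ((y k).2 : ℂ)]
  push_cast
  field_simp

lemma measurable_particle_fst : Measurable fun y : Fin n → Particle => fun i => (y i).1 :=
  measurable_pi_lambda _ fun i => measurable_fst.comp (measurable_pi_apply i)

lemma measurable_vertexRate_particle (k : Fin n) : Measurable fun q : ReplicaFields n × (Fin n → Particle) =>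
    vertexRate m μ q.1 k (q.2 k).1 := by
  have h3 : Measurable fun q : ReplicaFields n × ClosedMode => Gam (replica q.1 k) q.2.1 :=
      measurable_from_prod_countable_left fun p => measurable_Gam_replica k p.1
  have h5 : Measurable fun q : ReplicaFields n × (Fin n → Particle) => (Gam (replica q.1 k) (q.2 k).1.1) :=
    h3.comp (measurable_fst.prodMk (((measurable_pi_apply k).comp measurable_snd).fst))
  have h6 : Measurable fun q : ReplicaFields n × (Fin n → Particle) => C0 m (q.2 k).1.1 :=
    measurable_C0.comp ((measurable_pi_apply k).comp measurable_snd)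
  exact (h6.complex_ofReal.const_div μ).sub ((h5.const_mul _).complex_ofReal.const_mul _)

lemma measurable_vertexProduct : Measurable fun q : ReplicaFields n × (Fin n → Particle) =>
    vertexProduct T (vertexRate m μ q.1) q.2 := by
  have h1 : Measurable fun q : ReplicaFields n × (Fin n → Particle) =>
      ∏ l : T.edgeSet, (edgeFactor (fun i => (q.2 i).1) l : ℂ) :=
    (measurable_of_countable fun p : Fin n → ClosedMode => ∏ l : T.edgeSet, (edgeFactor p l : ℂ)).comp
      (measurable_particle_fst.comp measurable_snd)
  refine h1.mul (Finset.measurable_prod _ fun k _ => ?_)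
  have h2 : Measurable fun q : ReplicaFields n × (Fin n → Particle) => ((q.2 k).2 : ℂ) :=
    ((measurable_pi_apply k).comp measurable_snd).snd.complex_ofReal
  exact (h2.pow_const _).mul (h2.mul (measurable_vertexRate_particle k)).neg.cexp

variable {lam : ℂ}

/-- The expectation of a tree as an integral over particles. -/
lemma treeExpectation_eq (hA : Critical m κ) (hl : lam ≠ 0)
    (hμ : κ ≤ (gasParameter lam).re) (hn : 2 ≤ n) (hT : T.IsTree) {w : T.edgeSet → ℝ}
    (hw : w ∈ parameterCube T) :
    Integrable (fun τ => ∑' p : Fin n → ClosedMode, treeTerm m lam T τ p)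
      (replicaGaussian (interpolation T w)) ∧
    treeExpectation m lam T w = gasParameter lam ^ (2 * (n - 1)) * ((2 ^ (n - 1))⁻¹ *
      ∫ y, gasIntegrand m (gasParameter lam) T w y ∂(Measure.pi fun _ => particleMeasure)) := by
  set μ := gasParameter lam with hμdef
  have hb : ∀ τ : ReplicaFields n, ∀ k p, κ / C0 m p.1 ≤ (vertexRate m μ τ k p).re := fun τ k p => by
    rw [vertexRate_re]
    have := C0_pos hA.1 p.1
    gcongr
  have hsum : ∀ τ : ReplicaFields n, ∑' p : Fin n → ClosedMode, treeTerm m lam T τ p =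
      μ ^ (2 * (n - 1)) *
        ∫ y, vertexProduct T (vertexRate m μ τ) y ∂(Measure.pi fun _ => particleMeasure) := by
    intro τ
    simp only [treeTerm_eq hA.1 hl hT]
    rw [tsum_mul_left, (vertexProduct_facts hA hn hT (hb τ)).2.2]
  have hint : Integrable (fun q : ReplicaFields n × (Fin n → Particle) =>
      vertexProduct T (vertexRate m μ q.1) q.2)
      ((replicaGaussian (interpolation T w)).prod (Measure.pi fun _ => particleMeasure)) := by
    rw [integrable_prod_iff measurable_vertexProduct.aestronglyMeasurable]
    refine ⟨.of_forall fun τ => (vertexProduct_facts hA hn hT (hb τ)).1, ?_⟩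
    -- The fields enter only the imaginary parts of the rates, hence only phases. The particle
    -- integral of the norm is independent of τ and may be evaluated at τ = 0.
    refine (integrable_const (∫ y, ‖vertexProduct T (vertexRate m μ (0 : ReplicaFields n)) y‖
      ∂(Measure.pi fun _ => particleMeasure))).congr (.of_forall fun τ => ?_)
    refine integral_congr_ae ?_
    filter_upwards [ae_particles_pos] with y hy
    simp only [vertexProduct, norm_mul, norm_prod]
    congr 1
    refine prod_congr rfl fun k _ => ?_
    rw [← norm_mul, ← norm_mul, norm_pow_mul_cexp _ _ (hy k), norm_pow_mul_cexp _ _ (hy k),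
      vertexRate_re, vertexRate_re]
  refine ⟨?_, ?_⟩
  · simp only [hsum]
    exact hint.integral_prod_left.const_mul _
  · rw [treeExpectation]
    simp only [hsum]
    rw [integral_const_mul, integral_integral_swap hint, ← integral_const_mul ((2 ^ (n - 1))⁻¹ : ℂ)]
    congr 1
    refine integral_congr_ae ?_
    filter_upwards [ae_particles_pos] with y hy
    exact integral_vertexProduct hn hT hw hy

/-- Integrated over the parameters first, the norm reproduces the tree weight, and `treeDensity`
dominates it. -/
lemma integrable_gasIntegrand (hA : Critical m κ) (hμ : κ ≤ μ.re) (hn : 2 ≤ n) (hT : T.IsTree) :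
    Integrable (fun q : (T.edgeSet → ℝ) × (Fin n → Particle) => gasIntegrand m μ T q.1 q.2)
      ((volume.restrict (parameterCube T)).prod (Measure.pi fun _ => particleMeasure)) := by
  have hE : Continuous fun q : (T.edgeSet → ℝ) × (Fin n → Particle) =>
      treeEnergy (particleVec ∘ q.2) T q.1 := by
    have hv := continuous_particleVec
    unfold treeEnergy
    have := fun i j => (continuous_pathInf T i j).comp
      (continuous_fst (X := T.edgeSet → ℝ) (Y := Fin n → Particle))
    refine continuous_finsetSum _ fun p _ => (this p.1 p.2).mul ?_
    simp only [Function.comp]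
    fun_prop
  have hI : Continuous fun y : Fin n → Particle => ∏ l : T.edgeSet, edgeInner (particleVec ∘ y) l := by
    refine continuous_finsetProd _ fun l _ => ?_
    obtain ⟨l, hl⟩ := l
    induction l using Sym2.ind with
    | _ a b =>
      have hv := continuous_particleVec
      simp only [edgeInner_mk, Function.comp]
      fun_prop
  have hmeas : Measurable fun q : (T.edgeSet → ℝ) × (Fin n → Particle) => gasIntegrand m μ T q.1 q.2 := by
    have h1 : Measurable fun q : (T.edgeSet → ℝ) × (Fin n → Particle) => ∏ k, gasWeight m μ (q.2 k) :=
      Finset.measurable_prod _ fun k _ => (measurable_gasWeight μ).comp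
        ((measurable_pi_apply k).comp measurable_snd)
    have h2 := hE.measurable
    have h3 : Measurable fun q : (T.edgeSet → ℝ) × (Fin n → Particle) =>
      ∏ l : T.edgeSet, edgeInner (particleVec ∘ q.2) l := hI.measurable.comp measurable_snd
    unfold gasIntegrand
    exact (h1.mul h3.complex_ofReal).mul (h2.neg.exp.complex_ofReal)
  rw [integrable_prod_iff' hmeas.aestronglyMeasurable]
  constructor
  · refine .of_forall fun y => ?_
    simp only [gasIntegrand]
    refine Integrable.const_mul ?_ _
    exact (Continuous.integrableOn_Icc (continuous_exp_treeEnergy (particleVec ∘ y))).ofReal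
  · refine (integrable_treeDensity hA ⟨⟨n, hn⟩, T, hT⟩).mono'
      (hmeas.norm.aestronglyMeasurable.prod_swap.integral_prod_right') ?_
    filter_upwards [ae_particles_pos] with y hy
    have h4 : ∀ w, ‖gasIntegrand m μ T w y‖ = ‖∏ k, gasWeight m μ (y k)‖ *
        ((∏ l : T.edgeSet, edgeInner (particleVec ∘ y) l) *
          Real.exp (-treeEnergy (particleVec ∘ y) T w)) := by
      intro w
      rw [gasIntegrand, norm_mul, norm_mul, norm_real, norm_real, Real.norm_of_nonneg,
        Real.norm_of_nonneg (Real.exp_pos _).le, mul_assoc]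
      rw [prod_edgeInner_particleVec hT]
      positivity
    have h5 := norm_gas_integrand_le (m := m) hA.1 hμ Set.univ T hy
    simp only [Set.indicator_univ] at h5
    rw [norm_mul, norm_real, Real.norm_of_nonneg (treeWeight_particleVec_nonneg y T)] at h5
    rw [Real.norm_of_nonneg (integral_nonneg fun _ => norm_nonneg _)]
    simp only [h4]
    rw [integral_const_mul, integral_const_mul]
    exact h5

/-- The amplitude of a tree is its contribution to the free energy of the gas. -/
theorem treeAmplitude_eq (hA : Critical m κ) (hl : lam ≠ 0)
    (hμ : κ ≤ (gasParameter lam).re) (hn : 2 ≤ n) (hT : T.IsTree) :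
    AmplitudeWellDefined m lam T ∧
      treeAmplitude m lam T = gasTerm m (gasParameter lam) Set.univ T := by
  set μ := gasParameter lam with hμdef
  have hcube : MeasurableSet (parameterCube T) := measurableSet_Icc
  have hint := integrable_gasIntegrand hA hμ hn hT
  refine ⟨⟨fun w hw => posSemidef_interpolation hT hw, fun τ => ?_, fun w hw =>
    (treeExpectation_eq hA hl hμ hn hT hw).1, ?_⟩, ?_⟩
  · have h := (vertexProduct_facts (b := vertexRate m μ τ) hA hn hT fun k p => by
      rw [vertexRate_re]
      have := C0_pos hA.1 p.1
      gcongr).2.1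
    simp only [treeTerm_eq hA.1 hl hT]
    exact (h.mul_left ‖μ ^ (2 * (n - 1))‖).congr fun p => (norm_mul _ _).symm
  · refine IntegrableOn.congr_fun (((hint.integral_prod_left).const_mul
      ((2 ^ (n - 1))⁻¹ : ℂ)).const_mul (μ ^ (2 * (n - 1)))) (fun w hw => ?_) hcube
    exact (treeExpectation_eq hA hl hμ hn hT hw).2.symm
  · rw [treeAmplitude, setIntegral_congr_fun hcube fun w hw =>
      (treeExpectation_eq hA hl hμ hn hT hw).2, integral_const_mul, integral_const_mul,
      integral_integral_swap hint, gasTerm]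
    -- Since λ μ² = 1, the powers of the coupling and of `2` cancel and only the sign of the cluster
    -- expansion remains.
    have h1 : (-2 * lam) ^ (n - 1) / (n ! : ℂ) * (μ ^ (2 * (n - 1)) * (2 ^ (n - 1))⁻¹) =
        (-1) ^ (n - 1) / (n ! : ℂ) := by
      rw [pow_mul, div_mul_eq_mul_div, ← inv_pow, ← mul_pow, ← mul_pow]
      congr 2
      have := gasParameter_sq hl
      rw [← hμdef] at this
      linear_combination (-1) * this
    rw [← mul_assoc (μ ^ (2 * (n - 1))), ← mul_assoc, h1]
    congr 1
    refine integral_congr_ae (.of_forall fun y => ?_)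
    simp only [Set.indicator_univ, gasIntegrand, treeWeight]
    rw [integral_const_mul, integral_complex_ofReal]
    push_cast
    ring

end Amplitude

/-! ### Analyticity of the free energy -/

section Analyticity

open Finset

/-- Laplace transforms are analytic. -/
lemma differentiableOn_laplace {α : Type*} [MeasurableSpace α] {ν : Measure α} {A : α → ℂ} {h : α → ℝ}
    {κ : ℝ} (hA : Measurable A) (hh : Measurable h) (h0 : ∀ᵐ y ∂ν, 0 ≤ h y)
    (hI : Integrable (fun y => ‖A y‖ * Real.exp (-(κ * h y))) ν) :
    DifferentiableOn ℂ (fun μ : ℂ => ∫ y, A y * exp (-(μ * h y)) ∂ν) {μ | κ < μ.re} := by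
  intro μ hμ
  have hμ' : κ < μ.re := hμ
  -- Half of the distance to the boundary: on the ball of radius δ the spare decay e^(-δh) absorbs
  -- the factor h of the derivative at the cost of 1/δ.
  set δ := (μ.re - κ) / 2 with hδ
  have hδ0 : 0 < δ := by rw [hδ]; linarith
  have hnorm : ∀ (z : ℂ) y, ‖A y * exp (-(z * h y))‖ = ‖A y‖ * Real.exp (-(z.re * h y)) := by
    intro z y
    rw [norm_mul, norm_exp, neg_re, re_mul_ofReal]
  have hmeas : ∀ z : ℂ, Measurable fun y => A y * exp (-(z * h y)) := fun z => by fun_prop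
  have key := hasDerivAt_integral_of_dominated_loc_of_deriv_le (μ := ν)
    (F := fun (μ : ℂ) y => A y * exp (-(μ * h y)))
    (F' := fun (μ : ℂ) y => A y * (exp (-(μ * h y)) * -(h y : ℂ)))
    (x₀ := μ) (s := Metric.ball μ δ) (bound := fun y => δ⁻¹ * (‖A y‖ * Real.exp (-(κ * h y))))
    (Metric.ball_mem_nhds μ hδ0) (.of_forall fun z => (hmeas z).aestronglyMeasurable)
    (hI.mono' (hmeas μ).aestronglyMeasurable ?_) (Measurable.aestronglyMeasurable (by fun_prop)) ?_
    (hI.const_mul _) ?_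
  · exact (key.2.differentiableAt).differentiableWithinAt
  · filter_upwards [h0] with y hy
    rw [hnorm]
    gcongr
  · filter_upwards [h0] with y hy z hz
    have h1 : κ + δ ≤ z.re := by
      have h2 := abs_re_le_norm (z - μ)
      rw [Metric.mem_ball, dist_eq_norm] at hz
      rw [sub_re] at h2
      have := abs_le.1 (h2.trans hz.le)
      rw [hδ] at this ⊢
      linarith
    rw [← mul_assoc (A y), norm_mul (A y * _), hnorm, norm_neg, norm_real,
      Real.norm_of_nonneg hy, mul_assoc, mul_left_comm δ⁻¹]
    refine mul_le_mul_of_nonneg_left ?_ (norm_nonneg _)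
    rw [inv_mul_eq_div, le_div_iff₀ hδ0, mul_comm (Real.exp _) (h y)]
    have h3 := Real.add_one_le_exp (δ * h y)
    calc h y * Real.exp (-(z.re * h y)) * δ ≤ Real.exp (δ * h y) * Real.exp (-(z.re * h y)) := by
          rw [mul_right_comm]
          gcongr
          linarith
      _ = Real.exp (δ * h y - z.re * h y) := by rw [← Real.exp_add]; rfl
      _ ≤ _ := Real.exp_le_exp.2 (by nlinarith)
  · refine .of_forall fun y z _ => ?_
    have h4 := (((hasDerivAt_id' z).mul_const (h y : ℂ)).fun_neg.cexp).const_mul (A y)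
    simpa only [one_mul] using h4

variable {m κ : ℝ} {n : ℕ}
  {lam : ℂ}

lemma differentiableOn_gasTerm (hA : Critical m κ) (T : LabelledTree) :
    DifferentiableOn ℂ (fun μ => gasTerm m μ Set.univ T.2.1) {μ | κ < μ.re} := by
  set A : (Fin T.1.1 → Particle) → ℂ := fun y => (∏ i, ((Real.exp (-(3 * (y i).2 ^ 2)) / (y i).2 : ℝ) : ℂ)) *
    ((treeWeight (particleVec ∘ y) T.2.1 : ℝ) : ℂ) with hA'
  set h : (Fin T.1.1 → Particle) → ℝ := fun y => ∑ i, (y i).2 / C0 m (y i).1.1 with hh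
  have hC : ∀ i, Measurable fun y : Fin T.1.1 → Particle => C0 m (y i).1.1 := fun i =>
    measurable_C0.comp (measurable_pi_apply i)
  have hexp : ∀ (μ : ℂ) y, (∏ i, Set.univ.indicator (gasWeight m μ) (y i)) *
      ((treeWeight (particleVec ∘ y) T.2.1 : ℝ) : ℂ) = A y * exp (-(μ * h y)) := by
    intro μ y
    simp only [Set.indicator_univ]
    rw [hA', mul_right_comm]
    congr 1
    have h1 : exp (-(μ * h y)) = ∏ i, exp (-((y i).2 * (μ / C0 m (y i).1.1))) := by
      rw [← exp_sum, hh, ofReal_sum, mul_sum, ← sum_neg_distrib]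
      congr 1
      refine sum_congr rfl fun i _ => ?_
      push_cast
      ring
    rw [h1, ← prod_mul_distrib]
    refine prod_congr rfl fun i _ => ?_
    rw [gasWeight, bareWeight]
    push_cast
    ring
  have key := differentiableOn_laplace (ν := Measure.pi fun _ : Fin T.1.1 => particleMeasure)
    (A := A) (h := h) (κ := κ) ?_ ?_ ?_ ?_
  · simp only [gasTerm, hexp]
    exact key.const_mul _
  · have h2 := (continuous_treeWeight_particleVec T.2.1).measurable
    refine Measurable.mul (Finset.measurable_prod _ fun i _ => ?_) h2.complex_ofReal
    fun_prop
  · have := hC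
    fun_prop
  · filter_upwards [ae_particles_pos] with y hy
    exact sum_nonneg fun i _ => div_nonneg (hy i).le (C0_pos hA.1 _).le
  · refine (integrable_treeDensity hA T).congr ?_
    filter_upwards [ae_particles_pos] with y hy
    have h3 := hexp (κ : ℂ) y
    simp only [Set.indicator_univ, gasWeight_ofReal] at h3
    rw [treeDensity, ← Real.norm_of_nonneg (mul_nonneg (prod_nonneg fun i _ =>
      (realWeight_pos (m := m) κ (hy i)).le) (treeWeight_particleVec_nonneg y T.2.1)),
      ← norm_real, ofReal_mul, ofReal_prod, h3, norm_mul, norm_exp,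
      neg_re, re_mul_ofReal, ofReal_re]

lemma differentiableOn_selfEnergy (hm : 0 < m) (hκ : 0 < κ) :
    DifferentiableOn ℂ (fun μ => selfEnergy m μ Set.univ) {μ | κ < μ.re} := by
  set A : Particle → ℂ := fun y => (((Real.exp (-(3 * y.2 ^ 2)) - 1) / y.2 : ℝ) : ℂ) with hA
  set h : Particle → ℝ := fun y => y.2 / C0 m y.1.1 with hh
  have hC := measurable_C0 (m := m)
  have hexp : ∀ (μ : ℂ) y, selfIntegrand m μ y = A y * exp (-(μ * h y)) := by
    intro μ y
    rw [selfIntegrand, gasWeight, bareWeight, hA, hh]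
    have : μ * ((y.2 / C0 m y.1.1 : ℝ) : ℂ) = y.2 * (μ / C0 m y.1.1) := by push_cast; ring
    rw [this]
    push_cast
    ring
  have key := differentiableOn_laplace (ν := particleMeasure) (A := A) (h := h) (κ := κ)
    (by fun_prop) (by fun_prop) ?_ ?_
  · simp only [selfEnergy, Set.indicator_univ, hexp]
    exact key
  · filter_upwards [ae_particle_pos] with y hy
    exact div_nonneg hy.le (C0_pos hm _).le
  · refine (integrable_selfBound hm hκ).mono' (Measurable.aestronglyMeasurable (by fun_prop)) ?_
    filter_upwards [ae_particle_pos] with y hy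
    have h1 := norm_selfIntegrand_le hm (μ := κ) (κ := κ) (by simp) hy
    rw [hexp, norm_mul, norm_exp, neg_re, re_mul_ofReal, ofReal_re] at h1
    rwa [Real.norm_of_nonneg (by positivity)]

lemma differentiableOn_freeEnergy (hA : Critical m κ) :
    DifferentiableOn ℂ (freeEnergy m) {μ | κ < μ.re} := by
  refine (differentiableOn_selfEnergy hA.1 hA.2).add (differentiableOn_tsum_of_summable_norm
    (summable_treeBound hA) (differentiableOn_gasTerm hA)
    (isOpen_lt continuous_const continuous_re) fun T μ hμ => ?_)
  exact norm_gasTerm_le hA (le_of_lt hμ) _ T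

lemma freeEnergy_ofReal (x : ℝ) : ∃ r : ℝ, freeEnergy m x = r := by
  have h1 : ∃ r : ℝ, selfEnergy m x Set.univ = r := by
    refine ⟨∫ y, (realWeight m x y - Real.exp (-(y.2 * (x / C0 m y.1.1))) / y.2) ∂particleMeasure, ?_⟩
    rw [← integral_complex_ofReal, selfEnergy]
    refine integral_congr_ae (.of_forall fun y => ?_)
    simp only [Set.indicator_univ, selfIntegrand, gasWeight_ofReal, bareWeight]
    push_cast
    rfl
  have h2 : ∀ T : LabelledTree, ∃ r : ℝ, gasTerm m x Set.univ T.2.1 = r := fun T => by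
    refine ⟨(-1) ^ (T.1.1 - 1) / (T.1.1)! * ∫ y, treeDensity m x T.2.1 y
      ∂(Measure.pi fun _ => particleMeasure), ?_⟩
    rw [gasTerm, ofReal_mul, ← integral_complex_ofReal]
    simp only [Set.indicator_univ, gasWeight_ofReal, treeDensity]
    push_cast
    rfl
  obtain ⟨r, hr⟩ := h1
  choose f hf using h2
  exact ⟨r + ∑' T, f T, by rw [freeEnergy, hr, ofReal_add, ofReal_tsum]; simp only [hf]⟩

lemma mem_slitPlane_of_mem_domain (hm : 0 < m) (h : lam ∈ domain m) : lam ∈ slitPlane := by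
  rw [mem_domain_iff_norm hm] at h
  by_contra hs
  rw [mem_slitPlane_iff, not_or, not_lt, not_not] at hs
  rw [← abs_re_eq_norm.2 hs.2, abs_of_nonpos hs.1] at h
  nlinarith [mul_nonneg (Knum_pos hm).le (sq_nonneg lam.re)]

lemma differentiableAt_gasParameter (h : lam ∈ slitPlane) :
    DifferentiableAt ℂ gasParameter lam := differentiableAt_id.cpow_const h

lemma isOpen_domain (hm : 0 < m) : IsOpen (domain m) := by
  have h : domain m = {z | 2 * Knum m * ‖z‖ ^ 2 < ‖z‖ + z.re} := Set.ext fun _ => mem_domain_iff_norm hm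
  rw [h]
  exact isOpen_lt (by fun_prop) (continuous_norm.add continuous_re)

lemma analyticOnNhd_freeEnergy (hm : 0 < m) :
    AnalyticOnNhd ℂ (fun lam => freeEnergy m (gasParameter lam)) (domain m) := by
  have hK := Knum_pos hm
  refine DifferentiableOn.analyticOnNhd ?_ (isOpen_domain hm)
  refine (differentiableOn_freeEnergy ⟨hm, Real.sqrt_pos.2 hK, Real.sq_sqrt hK.le⟩).comp
    (fun lam h => (differentiableAt_gasParameter (mem_slitPlane_of_mem_domain hm h)).differentiableWithinAt)
    fun lam h => (mem_domain_iff hm).1 h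

lemma freeEnergy_real (hm : 0 < m) {x : ℝ} (hx : 0 < x) (h : (x : ℂ) ∈ domain m) :
    freeEnergy m (gasParameter x) = log (partitionFunction m x) ∧
      (freeEnergy m (gasParameter x)).im = 0 := by
  have h1 : gasParameter x = ((x ^ (-(1 / 2) : ℝ) : ℝ) : ℂ) := by
    rw [gasParameter, ofReal_cpow hx.le]
    norm_num
  obtain ⟨r, hr⟩ := freeEnergy_ofReal (m := m) (x ^ (-(1 / 2) : ℝ))
  rw [(potentialWellDefined_of_mem_domain hm h).2.2, h1, hr]
  refine ⟨(log_exp ?_ ?_).symm, ofReal_im r⟩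
  · rw [ofReal_im]; linarith [Real.pi_pos]
  · rw [ofReal_im]; exact Real.pi_pos.le

end Analyticity

/-! ### The geometry of the domain -/

section Cardioid

variable {m : ℝ}

/-- Both are square roots of the same number, and the principal branch is the one with nonnegative
real part. -/
lemma gasParameter_inv_sq {μ : ℂ} (hμ : 0 < μ.re) : gasParameter (μ ^ 2)⁻¹ = μ := by
  have h0 : μ ≠ 0 := fun h => by simp [h] at hμ
  have hz : (μ ^ 2)⁻¹ ≠ 0 := inv_ne_zero (pow_ne_zero 2 h0)
  have h1 := gasParameter_sq hz
  rw [inv_mul_eq_one₀ (pow_ne_zero 2 h0), eq_comm, sq_eq_sq_iff_eq_or_eq_neg] at h1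
  rcases h1 with h1 | h1
  · exact h1
  · exfalso
    have h2 : 0 ≤ (gasParameter (μ ^ 2)⁻¹).re := by
      rw [gasParameter_re hz]
      refine div_nonneg (Real.cos_nonneg_of_mem_Icc ⟨?_, ?_⟩) (Real.sqrt_nonneg _)
      · linarith [neg_pi_lt_arg (μ ^ 2)⁻¹]
      · linarith [arg_le_pi (μ ^ 2)⁻¹]
    rw [h1, neg_re] at h2
    linarith

lemma image_halfPlane {S : Set ℂ} (hS : S ⊆ {μ | 0 < μ.re}) :
    (fun μ : ℂ => (μ ^ 2)⁻¹) '' S = {lam | lam ≠ 0 ∧ gasParameter lam ∈ S} := by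
  ext lam
  constructor
  · rintro ⟨μ, hμ, rfl⟩
    have h0 : μ ≠ 0 := fun h => by have := hS hμ; simp [h] at this
    refine ⟨inv_ne_zero (pow_ne_zero 2 h0), ?_⟩
    simp only
    rwa [gasParameter_inv_sq (hS hμ)]
  · rintro ⟨h0, h⟩
    refine ⟨_, h, ?_⟩
    simp only
    rw [inv_eq_of_mul_eq_one_left (gasParameter_sq h0)]

/-- The set is the continuous image of a convex set under μ ↦ μ^(-2). It serves for the domain, a
half plane in μ, and for its part in the right half plane. -/
lemma isConnected_inv_sq {S : Set ℂ} (hS : S ⊆ {μ | 0 < μ.re}) (hc : Convex ℝ S) (hn : S.Nonempty) :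
    IsConnected {lam | lam ≠ 0 ∧ gasParameter lam ∈ S} := by
  rw [← image_halfPlane hS]
  refine (hc.isPreconnected.image _ ?_ |> fun h => ⟨hn.image _, h⟩)
  refine ContinuousOn.inv₀ (by fun_prop) fun μ hμ => pow_ne_zero 2 fun h => ?_
  have := hS hμ
  simp [h] at this

lemma isConnected_domain (hm : 0 < m) : IsConnected (domain m) := by
  have hκ := Real.sqrt_pos.2 (Knum_pos hm)
  have h := isConnected_inv_sq (S := {μ | √(Knum m) < μ.re}) (fun μ hμ => hκ.trans hμ)
    (convex_halfSpace_re_gt _) ⟨((√(Knum m) + 1 : ℝ) : ℂ), by simp⟩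
  convert h using 1
  ext lam
  exact ⟨fun h => ⟨ne_zero_of_mem_domain h, (mem_domain_iff hm).1 h⟩, fun h => (mem_domain_iff hm).2 h.2⟩

lemma isBounded_domain (hm : 0 < m) : Bornology.IsBounded (domain m) := by
  refine (Metric.isBounded_closedBall (x := (0 : ℂ)) (r := 1 / Knum m)).subset fun lam h => ?_
  have hK := Knum_pos hm
  have h0 := norm_pos_iff.2 (ne_zero_of_mem_domain h)
  rw [mem_domain_iff_norm hm] at h
  rw [mem_closedBall_zero_iff, le_div_iff₀ hK]
  have := re_le_norm lam
  by_contra hc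
  push Not at hc
  nlinarith

lemma polar_mem_domain (hm : 0 < m) {θ t : ℝ} (hθ : Real.cos (θ / 2) ≠ 0) (ht0 : 0 < t) (ht1 : t < 1) :
    (t : ℂ) * (((Real.cos (θ / 2) ^ 2 / Knum m : ℝ) : ℂ) * exp (I * θ)) ∈ domain m := by
  have hK := Knum_pos hm
  have hc : 0 < Real.cos (θ / 2) ^ 2 := by positivity
  rw [← mul_assoc, ← ofReal_mul, mem_domain_iff_norm hm, norm_polar (by positivity), re_polar]
  have h1 := cos_half_sq θ
  set c := Real.cos (θ / 2) ^ 2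
  have h2 : Real.cos θ = 2 * c - 1 := by linarith
  have h3 : 2 * Knum m * (t * (c / Knum m)) ^ 2 = t * (2 * t * c ^ 2 / Knum m) := by field_simp
  have h4 : t * (c / Knum m) + t * (c / Knum m) * Real.cos θ = t * (2 * c ^ 2 / Knum m) := by
    rw [h2]; field_simp; ring
  rw [h3, h4]
  have : 0 < 2 * c ^ 2 := by positivity
  gcongr
  nlinarith

lemma frontier_domain (hm : 0 < m) : frontier (domain m) = cardioid m := by
  have hK := Knum_pos hm
  -- The open radial segment from the origin to a point of the curve lies in the domain, so both of
  -- its ends lie in the closure.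
  have hlim : ∀ θ : ℝ, Real.cos (θ / 2) ≠ 0 → ∀ a ∈ Set.Icc (0 : ℝ) 1,
      (a : ℂ) * (((Real.cos (θ / 2) ^ 2 / Knum m : ℝ) : ℂ) * exp (I * θ)) ∈
        closure (domain m) := by
    intro θ hθ a ha
    have : (𝓝[Set.Ioo 0 1] a).NeBot :=
      mem_closure_iff_nhdsWithin_neBot.1 (by rwa [closure_Ioo zero_ne_one])
    have h : Tendsto (fun t : ℝ => (t : ℂ) * (((Real.cos (θ / 2) ^ 2 / Knum m : ℝ) : ℂ) *
        exp (I * θ))) (𝓝 a) (𝓝 _) :=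
      (continuous_ofReal.mul continuous_const).tendsto a
    refine mem_closure_of_tendsto (h.mono_left (nhdsWithin_le_nhds (s := Set.Ioo 0 1))) ?_
    filter_upwards [self_mem_nhdsWithin] with t ht
    exact polar_mem_domain hm hθ ht.1 ht.2
  have hzero : (0 : ℂ) ∈ closure (domain m) := by
    simpa using hlim 0 (by simp) 0 (by simp)
  rw [(isOpen_domain hm).frontier_eq]
  ext lam
  constructor
  · rintro ⟨h1, h2⟩
    have h3 : 2 * Knum m * ‖lam‖ ^ 2 ≤ ‖lam‖ + lam.re := by
      have hcl : IsClosed {z : ℂ | 2 * Knum m * ‖z‖ ^ 2 ≤ ‖z‖ + z.re} :=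
        isClosed_le (by fun_prop) (continuous_norm.add continuous_re)
      exact closure_minimal (fun z hz => ((mem_domain_iff_norm hm).1 hz).le) hcl h1
    rw [mem_domain_iff_norm hm, not_lt] at h2
    rcases eq_or_ne lam 0 with rfl | h0
    -- The cusp at the origin, where the cosine vanishes.
    · exact ⟨Real.pi, by simp⟩
    · refine ⟨lam.arg, ?_⟩
      have hρ := norm_pos_iff.2 h0
      have h4 : Real.cos (lam.arg / 2) ^ 2 / Knum m = ‖lam‖ := by
        rw [cos_half_sq, div_eq_iff hK.ne']
        have h5 := norm_mul_cos_arg lam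
        have h6 : ‖lam‖ * ((1 + Real.cos lam.arg) / 2) = ‖lam‖ * (‖lam‖ * Knum m) := by
          linarith [le_antisymm h3 h2]
        exact mul_left_cancel₀ hρ.ne' h6
      simp only
      rw [h4, mul_comm I, norm_mul_exp_arg_mul_I]
  · rintro ⟨θ, rfl⟩
    simp only
    by_cases hc : Real.cos (θ / 2) = 0
    · rw [hc]
      simp only [ne_eq, OfNat.ofNat_ne_zero, not_false_eq_true, zero_pow, zero_div, ofReal_zero,
        zero_mul]
      exact ⟨hzero, fun h => ne_zero_of_mem_domain h rfl⟩
    · constructor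
      · simpa only [ofReal_one, one_mul] using hlim θ hc 1 (by simp)
      · rw [mem_domain_iff_norm hm, norm_polar (by positivity), re_polar, not_lt]
        have h1 := cos_half_sq θ
        set c := Real.cos (θ / 2) ^ 2
        have h2 : Real.cos θ = 2 * c - 1 := by linarith
        rw [h2]
        refine le_of_eq ?_
        field_simp
        ring

end Cardioid

/-! ### The quartic invariant of the tensor field -/

section QuarticInvariant

open Finset

/-- The squared modulus of a closed mode of the field. -/
def modeSq (T : Mode → ℂ) (p : ClosedMode) : ℝ := ‖T p.1‖ ^ 2

lemma modeSq_nonneg (T : Mode → ℂ) (p : ClosedMode) : 0 ≤ modeSq T p := sq_nonneg _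

-- The closure constraint makes the colour matrices diagonal: two closed modes that agree in two
-- components agree in the third.
open Classical in
lemma colourMatrix_eq {T : Mode → ℂ} (hT : ∀ p, ∑ i, p i ≠ 0 → T p = 0) (i : Fin 3) (a b : ℤ) :
    colourMatrix i T a b =
      if a = b then ((∑' p : ClosedMode, if p.1 i = a then modeSq T p else 0 : ℝ) : ℂ) else 0 := by
  have hinj : Function.Injective fun p : ClosedMode => (p.1, p.1) := fun p q h =>
    Subtype.ext (Prod.mk.inj h).1
  rw [colourMatrix, ← hinj.tsum_eq]
  · split_ifs with hab
    · subst hab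
      rw [ofReal_tsum]
      refine tsum_congr fun p => ?_
      by_cases h : p.1 i = a
      · simp [h, modeSq, mul_conj, normSq_eq_norm_sq]
      · simp [h]
    · convert tsum_zero with p
      exact if_neg fun h => hab (h.2.1.symm.trans h.1)
  · intro pq hpq
    rw [Function.mem_support] at hpq
    obtain ⟨⟨h1, h2, h3⟩, h4⟩ := ite_ne_right_iff.1 hpq
    have hp : ∑ j, pq.1 j = 0 := by_contra fun h => h4 (by rw [hT _ h, zero_mul])
    have hq : ∑ j, pq.2 j = 0 := by_contra fun h => h4 (by rw [hT _ h, map_zero, mul_zero])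
    have h5 : ∑ j ∈ univ.erase i, pq.1 j = ∑ j ∈ univ.erase i, pq.2 j :=
      sum_congr rfl fun j hj => h3 j (ne_of_mem_erase hj)
    have h6 : pq.1 i = pq.2 i := by
      rw [← add_sum_erase _ _ (mem_univ i)] at hp hq
      rw [h5] at hp
      exact add_right_cancel (hp.trans hq.symm)
    refine ⟨⟨pq.1, hp⟩, Prod.ext rfl (funext fun j => ?_)⟩
    by_cases hj : j = i
    · rw [hj]; exact h6
    · exact h3 j hj

/-- The quartic interaction in terms of the squared moduli of the closed modes. -/
def quarticSum (u : ClosedMode → ℝ) : ENNReal :=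
  ∑' q : ClosedMode × ClosedMode, ENNReal.ofReal ((sharedModes q.1.1 q.2.1 : ℝ) * (u q.1 * u q.2))

open Classical in
lemma quarticSum_eq {u : ClosedMode → ℝ} (hu : ∀ p, 0 ≤ u p) : quarticSum u =
    ∑ i : Fin 3, ∑' a : ℤ, (∑' p : ClosedMode, ENNReal.ofReal (if p.1 i = a then u p else 0)) ^ 2 := by
  have h1 : ∀ q : ClosedMode × ClosedMode,
      ENNReal.ofReal ((sharedModes q.1.1 q.2.1 : ℝ) * (u q.1 * u q.2)) = ∑ i : Fin 3, ∑' a : ℤ,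
        ENNReal.ofReal (if q.1.1 i = a then u q.1 else 0) *
          ENNReal.ofReal (if q.2.1 i = a then u q.2 else 0) := by
    intro q
    rw [sharedModes_eq_sum, sum_mul, ENNReal.ofReal_sum_of_nonneg fun i _ =>
      mul_nonneg (by split_ifs <;> norm_num) (mul_nonneg (hu _) (hu _))]
    refine sum_congr rfl fun i _ => ?_
    rw [tsum_eq_single (q.1.1 i) fun a ha => by rw [if_neg ha.symm, ENNReal.ofReal_zero, zero_mul],
      if_pos rfl, ← ENNReal.ofReal_mul (hu _)]
    congr 1
    by_cases h : q.1.1 i = q.2.1 i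
    · rw [if_pos h, if_pos h.symm, one_mul]
    · rw [if_neg h, if_neg (Ne.symm h), zero_mul, mul_zero]
  rw [quarticSum]
  simp only [h1]
  rw [Summable.tsum_finsetSum fun i _ => ENNReal.summable]
  refine sum_congr rfl fun i _ => ?_
  rw [ENNReal.tsum_comm]
  refine tsum_congr fun a => ?_
  rw [ENNReal.tsum_prod (f := fun p q : ClosedMode => ENNReal.ofReal (if p.1 i = a then u p else 0) *
    ENNReal.ofReal (if q.1 i = a then u q else 0)), sq, ← ENNReal.tsum_mul_right]
  simp only [ENNReal.tsum_mul_left]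

open Classical in
lemma quarticInvariant_eq {T : Mode → ℂ} (hT : ∀ p, ∑ i, p i ≠ 0 → T p = 0)
    (hfin : quarticSum (modeSq T) ≠ ⊤) :
    quarticInvariant T = ((quarticSum (modeSq T)).toReal : ℂ) := by
  have hq := quarticSum_eq (modeSq_nonneg T)
  set A : Fin 3 → ℤ → ENNReal := fun i a =>
    ∑' p : ClosedMode, ENNReal.ofReal (if p.1 i = a then modeSq T p else 0) with hA
  have hi : ∀ i, ∑' a, A i a ^ 2 ≠ ⊤ := fun i =>
    ne_top_of_le_ne_top hfin (hq ▸ single_le_sum (f := fun i => ∑' a, A i a ^ 2)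
      (fun _ _ => zero_le) (mem_univ i))
  have ha : ∀ i a, A i a ^ 2 ≠ ⊤ := fun i a => ENNReal.ne_top_of_tsum_ne_top (hi i) a
  have hAr : ∀ i a, (∑' p : ClosedMode, if p.1 i = a then modeSq T p else 0 : ℝ) = (A i a).toReal := by
    intro i a
    rw [hA, ENNReal.tsum_toReal_eq fun _ => ENNReal.ofReal_ne_top]
    refine tsum_congr fun p => (ENNReal.toReal_ofReal ?_).symm
    split_ifs
    · exact modeSq_nonneg T p
    · exact le_rfl
  have hinj : Function.Injective fun a : ℤ => (a, a) := fun a b h => (Prod.mk.inj h).1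
  rw [hq, ENNReal.toReal_sum fun i _ => hi i, quarticInvariant, ofReal_sum]
  refine sum_congr rfl fun i _ => ?_
  rw [ENNReal.tsum_toReal_eq (ha i), ofReal_tsum, ← hinj.tsum_eq]
  · refine tsum_congr fun a => ?_
    rw [colourMatrix_eq hT, if_pos rfl, hAr, ENNReal.toReal_pow, ofReal_pow, sq]
  · intro ab hab
    refine ⟨ab.1, Prod.ext rfl (by_contra fun h => hab ?_)⟩
    simp only
    rw [colourMatrix_eq hT, if_neg h, zero_mul]

/-- Restricted to a box, the quartic invariant is the variance of ∑ u(p) Γ(p). This is what allows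
Gaussian decoupling by the intermediate field. -/
lemma tendsto_gamVariance {u : ClosedMode → ℝ} (hu : ∀ p, 0 ≤ u p) (hfin : quarticSum u ≠ ⊤) :
    Tendsto (fun N => gamVariance (closedBox N) u) atTop (𝓝 (quarticSum u).toReal) := by
  have h0 : ∀ q : ClosedMode × ClosedMode, 0 ≤ (sharedModes q.1.1 q.2.1 : ℝ) * (u q.1 * u q.2) :=
    fun q => mul_nonneg (Nat.cast_nonneg _) (mul_nonneg (hu _) (hu _))
  have hs := (ENNReal.summable_toReal hfin).hasSum
  rw [← ENNReal.tsum_toReal_eq fun _ => ENNReal.ofReal_ne_top] at hs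
  simp only [ENNReal.toReal_ofReal (h0 _)] at hs
  refine (hs.comp (tendsto_atTop_finset_of_monotone (f := fun N => closedBox N ×ˢ closedBox N)
    (fun _ _ h => product_subset_product (closedBox_mono h) (closedBox_mono h)) fun q => ?_)).congr
    fun N => ?_
  · obtain ⟨N, h1, h2⟩ := ((eventually_mem_closedBox q.1).and (eventually_mem_closedBox q.2)).exists
    exact ⟨N, mem_product.2 ⟨h1, h2⟩⟩
  · rw [Function.comp, sum_product, gamVariance]
    exact sum_congr rfl fun p _ => sum_congr rfl fun q _ => by ring

end QuarticInvariant

/-! ### Almost sure finiteness of the quartic invariant -/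

section FieldExpectation

open Finset

variable {m : ℝ}

instance : IsProbabilityMeasure fieldNoise := by unfold fieldNoise; infer_instance

lemma tensorField_eq_zero (m : ℝ) (x : Mode × Fin 2 → ℝ) {p : Mode} (hp : ∑ i, p i ≠ 0) :
    tensorField m x p = 0 := by
  rw [tensorField, propagator, if_neg hp]
  simp

lemma modeSq_tensorField (hm : 0 < m) (x : Mode × Fin 2 → ℝ) (p : ClosedMode) :
    modeSq (tensorField m x) p = C0 m p.1 / 2 * ∑ j, x (p.1, j) ^ 2 := by
  have hC := C0_pos hm p.1
  rw [modeSq, tensorField, propagator, if_pos p.2, norm_mul, mul_pow, norm_real,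
    Real.norm_of_nonneg (Real.sqrt_nonneg _), Real.sq_sqrt (by positivity), mul_comm I,
    Complex.sq_norm, normSq_add_mul_I, Fin.sum_univ_two]

lemma measurable_modeSq (hm : 0 < m) (p : ClosedMode) :
    Measurable fun x => modeSq (tensorField m x) p := by
  simp only [modeSq_tensorField hm]
  fun_prop

lemma lintegral_modeSq_mul_le (hm : 0 < m) (p q : ClosedMode) :
    ∫⁻ x, ENNReal.ofReal (modeSq (tensorField m x) p * modeSq (tensorField m x) q) ∂fieldNoise ≤
      ENNReal.ofReal (C0 m p.1 * C0 m q.1) * ENNReal.ofReal (4 * 96) := by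
  have hC : 0 ≤ C0 m p.1 * C0 m q.1 := mul_nonneg (C0_pos hm _).le (C0_pos hm _).le
  have h1 : ∀ x : Mode × Fin 2 → ℝ,
      ENNReal.ofReal (modeSq (tensorField m x) p * modeSq (tensorField m x) q) ≤
      ENNReal.ofReal (C0 m p.1 * C0 m q.1) *
        (∑ j, ‖x (p.1, j)‖ₑ ^ 4 + ∑ j, ‖x (q.1, j)‖ₑ ^ 4) := by
    intro x
    have h2 : ∀ r : ℝ, ‖r‖ₑ ^ 4 = ENNReal.ofReal (r ^ 4) := fun r => by
      rw [← ofReal_norm_eq_enorm, ← ENNReal.ofReal_pow (norm_nonneg _), ← norm_pow, Real.norm_of_nonneg]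
      positivity
    simp only [h2]
    rw [← ENNReal.ofReal_sum_of_nonneg fun j _ => by positivity,
      ← ENNReal.ofReal_sum_of_nonneg fun j _ => by positivity,
      ← ENNReal.ofReal_add (by positivity) (by positivity), ← ENNReal.ofReal_mul hC,
      modeSq_tensorField hm, modeSq_tensorField hm, mul_mul_mul_comm, Fin.sum_univ_two,
      Fin.sum_univ_two, Fin.sum_univ_two, Fin.sum_univ_two, div_mul_div_comm, div_mul_eq_mul_div]
    refine ENNReal.ofReal_le_ofReal ?_
    rw [mul_div_assoc]
    refine mul_le_mul_of_nonneg_left ?_ hC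
    set a := x (p.1, 0); set b := x (p.1, 1); set c := x (q.1, 0); set d := x (q.1, 1)
    nlinarith [sq_nonneg (a ^ 2 + b ^ 2 - (c ^ 2 + d ^ 2)), sq_nonneg (a ^ 2 - b ^ 2),
      sq_nonneg (c ^ 2 - d ^ 2), sq_nonneg (a ^ 2 + b ^ 2), sq_nonneg (c ^ 2 + d ^ 2)]
  have h3 : ∀ k : Mode × Fin 2, ∫⁻ x, ‖x k‖ₑ ^ 4 ∂fieldNoise ≤ ENNReal.ofReal 96 := by
    intro k
    have h4 := (measurePreserving_eval_infinitePi (fun _ : Mode × Fin 2 => gaussianReal 0 1) k).lintegral_comp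
      (f := fun r : ℝ => ‖r‖ₑ ^ 4) (by fun_prop)
    refine h4.le.trans ((lintegral_pow_four_gaussianReal (V := 1) one_pos (by simp)).trans ?_)
    norm_num
  have hm4 : ∀ k : Mode × Fin 2, Measurable fun x : Mode × Fin 2 → ℝ => ‖x k‖ₑ ^ 4 := fun k => by fun_prop
  refine (lintegral_mono h1).trans ?_
  rw [lintegral_const_mul _ (by fun_prop), lintegral_add_left (by fun_prop),
    lintegral_finsetSum _ fun j _ => hm4 _, lintegral_finsetSum _ fun j _ => hm4 _]
  refine mul_le_mul_right ?_ _
  simp only [Fin.sum_univ_two]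
  refine (add_le_add (add_le_add (h3 _) (h3 _)) (add_le_add (h3 _) (h3 _))).trans (le_of_eq ?_)
  rw [← ENNReal.ofReal_add, ← ENNReal.ofReal_add] <;> norm_num

/-- The quartic invariant of the field. -/
def fieldQuartic (m : ℝ) (x : Mode × Fin 2 → ℝ) : ℝ := (quarticSum (modeSq (tensorField m x))).toReal

lemma measurable_quarticSum (hm : 0 < m) :
    Measurable fun x => quarticSum (modeSq (tensorField m x)) := by
  refine Measurable.ennreal_tsum fun q => ?_
  have := measurable_modeSq hm q.1
  have := measurable_modeSq hm q.2
  fun_prop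

/-- The expectation is finite: up to a constant it is dominated by the pair sum of propagators in
`summable_shared_C0`. -/
lemma ae_quarticSum_ne_top (hm : 0 < m) :
    ∀ᵐ x ∂fieldNoise, quarticSum (modeSq (tensorField m x)) ≠ ⊤ := by
  refine (ae_lt_top (measurable_quarticSum hm) ?_).mono fun x h => h.ne
  have h1 : ∀ q : ClosedMode × ClosedMode, Measurable fun x =>
      modeSq (tensorField m x) q.1 * modeSq (tensorField m x) q.2 := fun q =>
    (measurable_modeSq hm q.1).mul (measurable_modeSq hm q.2)
  have h2 : ∀ q : ClosedMode × ClosedMode, ∫⁻ x, ENNReal.ofReal ((sharedModes q.1.1 q.2.1 : ℝ) *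
      (modeSq (tensorField m x) q.1 * modeSq (tensorField m x) q.2)) ∂fieldNoise ≤
      ENNReal.ofReal ((sharedModes q.1.1 q.2.1 : ℝ) * (C0 m q.1.1 * C0 m q.2.1)) *
        ENNReal.ofReal (4 * 96) := by
    intro q
    simp only [ENNReal.ofReal_mul (Nat.cast_nonneg (sharedModes q.1.1 q.2.1))]
    rw [lintegral_const_mul _ (h1 q).ennreal_ofReal, mul_assoc]
    exact mul_le_mul_right (lintegral_modeSq_mul_le hm q.1 q.2) _
  simp only [quarticSum]
  rw [lintegral_tsum fun q => ((h1 q).const_mul _).ennreal_ofReal.aemeasurable]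
  refine ne_top_of_le_ne_top ?_ (ENNReal.tsum_le_tsum h2)
  rw [ENNReal.tsum_mul_right, ← ENNReal.ofReal_tsum_of_nonneg (fun q => mul_nonneg (Nat.cast_nonneg _)
    (mul_nonneg (C0_pos hm _).le (C0_pos hm _).le)) (summable_shared_C0 hm)]
  exact ENNReal.mul_ne_top ENNReal.ofReal_ne_top ENNReal.ofReal_ne_top

lemma fieldPartitionFunction_eq (hm : 0 < m) (lam : ℂ) :
    fieldPartitionFunction m lam = ∫ x, exp (-(lam * fieldQuartic m x)) ∂fieldNoise := by
  refine integral_congr_ae ?_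
  filter_upwards [ae_quarticSum_ne_top hm] with x hx
  rw [quarticInvariant_eq (fun p => tensorField_eq_zero m x) hx, fieldQuartic, neg_mul]

end FieldExpectation

/-! ### The intermediate field representation -/

section IntermediateField

open Finset

variable {m : ℝ}
  {lam : ℂ} {x : ℝ}

/-- The square accounts for the two real components of each complex mode, and it removes the choice
of a branch of the square root. -/
lemma integral_exp_sq_gaussian (c : ℝ) :
    (∫ x, exp (I * (c * x ^ 2 : ℝ)) ∂(gaussianReal 0 1)) ^ 2 = (1 - 2 * I * c)⁻¹ := by
  have hb : 0 < (1 / 2 - I * c).re := by simp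
  have hb0 : 1 / 2 - I * c ≠ 0 := fun h => by rw [h] at hb; exact lt_irrefl _ hb
  have h1 : ∀ x : ℝ, gaussianPDFReal 0 1 x • exp (I * (c * x ^ 2 : ℝ)) =
      ((√(2 * Real.pi))⁻¹ : ℝ) * exp (-(1 / 2 - I * c) * (x : ℂ) ^ 2) := by
    intro x
    rw [gaussianPDFReal, real_smul, ofReal_mul, mul_assoc, ofReal_exp, ← exp_add]
    norm_num
    left
    congr 1
    ring
  rw [integral_gaussianReal_eq_integral_smul one_ne_zero]
  simp only [h1]
  rw [integral_const_mul, integral_gaussian_complex hb, mul_pow, ← cpow_nat_mul,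
    ← ofReal_pow, inv_pow, Real.sq_sqrt (by positivity)]
  have hpi : (Real.pi : ℂ) ≠ 0 := ofReal_ne_zero.2 Real.pi_ne_zero
  have h2 : 1 - 2 * I * c = 2 * (1 / 2 - I * c) := by ring
  rw [h2]
  norm_num
  field_simp

/-- The average over the field in fixed intermediate fields. -/
lemma integral_exp_modeSq (hm : 0 < m) (Λ : Finset ClosedMode) (a : ClosedMode → ℝ) :
    ∫ x, exp (I * (∑ p ∈ Λ, a p * modeSq (tensorField m x) p : ℝ)) ∂fieldNoise =
      ∏ p ∈ Λ, (1 - I * (a p : ℂ) * C0 m p.1)⁻¹ := by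
  classical
  set s : Finset (Mode × Fin 2) := (Λ.map (Function.Embedding.subtype _)) ×ˢ univ with hs
  set c : Mode × Fin 2 → ℝ := fun k => if h : ∑ i, k.1 i = 0 then a ⟨k.1, h⟩ * (C0 m k.1 / 2) else 0 with hc
  have hcp : ∀ (p : ClosedMode) j, c (p.1, j) = a p * (C0 m p.1 / 2) := fun p j => by rw [hc]; exact dif_pos p.2
  have h := integral_prod_infinitePi (fun _ : Mode × Fin 2 => gaussianReal 0 1) s
    (fun k z => exp (I * (c k * z ^ 2 : ℝ))) (fun k => by fun_prop)
  rw [fieldNoise]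
  refine (integral_congr_ae (.of_forall fun x => ?_)).trans (h.trans ?_)
  · rw [← exp_sum, ← mul_sum, ← ofReal_sum, hs, sum_product, Finset.sum_map]
    congr 3
    refine sum_congr rfl fun p _ => ?_
    rw [modeSq_tensorField hm, ← mul_assoc, mul_sum]
    refine sum_congr rfl fun j _ => ?_
    simp only [Function.Embedding.subtype_apply, hcp]
  · rw [hs, Finset.prod_product, Finset.prod_map]
    refine prod_congr rfl fun p _ => ?_
    simp only [Function.Embedding.subtype_apply, hcp]
    rw [prod_const, card_univ, Fintype.card_fin, integral_exp_sq_gaussian]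
    push_cast
    congr 2
    ring

/-- The average over the intermediate fields in a fixed field. -/
lemma integral_exp_sum_Gam (Λ : Finset ClosedMode) (a : ClosedMode → ℝ) :
    ∫ τ, exp (I * (∑ p ∈ Λ, a p * Gam τ p.1 : ℝ)) ∂vectorGaussian =
      exp (-(gamVariance Λ a / 2 : ℝ)) := by
  have h := charFun_gaussianReal (μ := 0) (v := (gamVariance Λ a).toNNReal) 1
  rw [charFun_apply_real, ← map_sum_Gam, integral_map (measurable_sum_Gam Λ a).aemeasurable
    (by fun_prop)] at h
  convert h using 1
  · refine integral_congr_ae (.of_forall fun τ => ?_)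
    simp only [ofReal_one, one_mul]
    rw [mul_comm]
  · congr 1
    simp [gamVariance_nonneg]

/-- The intermediate field representation with finitely many modes. -/
lemma integral_exp_gamVariance (hm : 0 < m) {r : ℝ} (hr : 0 < r) (N : ℕ) :
    ∫ x, exp (-(((r ^ 2)⁻¹ : ℝ) * (gamVariance (closedBox N) (modeSq (tensorField m x)) : ℝ)))
        ∂fieldNoise = ∫ τ, exp (-boxPotential m r N τ) ∂vectorGaussian := by
  set s := √2 / r with hs
  have hs2 : s ^ 2 / 2 = (r ^ 2)⁻¹ := by
    rw [hs, div_pow, Real.sq_sqrt zero_le_two]; field_simp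
  have h1 : ∀ x, exp (-(((r ^ 2)⁻¹ : ℝ) *
      (gamVariance (closedBox N) (modeSq (tensorField m x)) : ℝ))) =
      ∫ τ, exp (I * (∑ p ∈ closedBox N, s * modeSq (tensorField m x) p * Gam τ p.1 : ℝ))
        ∂vectorGaussian := by
    intro x
    rw [integral_exp_sum_Gam]
    congr 2
    rw [← ofReal_mul, ← hs2, gamVariance, gamVariance, mul_sum, sum_div]
    congr 1
    refine sum_congr rfl fun p _ => ?_
    rw [mul_sum, sum_div]
    exact sum_congr rfl fun q _ => by ring
  have h2 : ∀ τ, exp (-boxPotential m r N τ) =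
      ∫ x, exp (I * (∑ p ∈ closedBox N, s * modeSq (tensorField m x) p * Gam τ p.1 : ℝ))
        ∂fieldNoise := by
    intro τ
    have h3 : ∀ x, ∑ p ∈ closedBox N, s * modeSq (tensorField m x) p * Gam τ p.1 =
        ∑ p ∈ closedBox N, s * Gam τ p.1 * modeSq (tensorField m x) p := fun x =>
      sum_congr rfl fun p _ => by ring
    simp only [h3]
    rw [integral_exp_modeSq hm, boxPotential, ← sum_neg_distrib, exp_sum]
    refine prod_congr rfl fun p _ => ?_
    have hC := C0_pos hm p.1
    have hb : 0 < ((r : ℂ) / C0 m p.1).re := by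
      rw [re_div_C0]; exact div_pos (by simpa using hr) hC
    rw [exp_neg, exp_log (slitPlane_ne_zero (one_sub_mem_slitPlane hb _)), hs, div_div_eq_mul_div]
    push_cast
    congr 2
    ring
  simp only [h1, h2]
  refine integral_integral_swap (Integrable.of_bound (C := 1) (Measurable.aestronglyMeasurable ?_)
    (.of_forall fun q => ?_))
  · have h4 : ∀ p : ClosedMode, Measurable fun q : (Mode × Fin 2 → ℝ) × VectorFields =>
        s * modeSq (tensorField m q.1) p * Gam q.2 p.1 := fun p =>
      (((measurable_modeSq hm p).comp measurable_fst).const_mul s).mul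
        ((measurable_Gam p.1).comp measurable_snd)
    exact ((Finset.measurable_sum _ fun p _ => h4 p).complex_ofReal.const_mul _).cexp
  · simp only [Function.uncurry]
    rw [mul_comm, norm_exp_ofReal_mul_I]

lemma norm_exp_field_le (hl : 0 ≤ lam.re) {u : ℝ} (hu : 0 ≤ u) :
    ‖exp (-(lam * u))‖ ≤ 1 := by
  rw [norm_exp, neg_re, re_mul_ofReal]
  exact Real.exp_le_one_iff.2 (neg_nonpos.2 (mul_nonneg hl hu))

lemma fieldQuartic_nonneg (x : Mode × Fin 2 → ℝ) : 0 ≤ fieldQuartic m x := ENNReal.toReal_nonneg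

lemma measurable_fieldQuartic (hm : 0 < m) : Measurable (fieldQuartic m) :=
  (measurable_quarticSum hm).ennreal_toReal

/-- The intermediate field representation for positive couplings. -/
lemma partitionFunction_eq_of_pos (hm : 0 < m) (hx : 0 < x) (h : (x : ℂ) ∈ domain m) :
    partitionFunction m x = fieldPartitionFunction m x := by
  have hK := Knum_pos hm
  have hκ := Real.sqrt_pos.2 hK
  set r : ℝ := x ^ (-(1 / 2) : ℝ) with hr
  have hr0 : 0 < r := Real.rpow_pos_of_pos hx _
  have h1 : gasParameter x = (r : ℂ) := by
    rw [gasParameter, hr, ofReal_cpow hx.le]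
    norm_num
  have hμ := ((mem_domain_iff hm).1 h).le
  have h2 : (r ^ 2)⁻¹ = x := by
    have := gasParameter_sq (ofReal_ne_zero.2 hx.ne')
    rw [h1] at this
    norm_cast at this
    exact inv_eq_of_mul_eq_one_left this
  rw [(potentialWellDefined_of_mem_domain hm h).2.2]
  refine tendsto_nhds_unique (tendsto_integral_exp_boxPotential ⟨hm, hκ, Real.sq_sqrt hK.le⟩ hμ) ?_
  simp only [h1]
  rw [fieldPartitionFunction_eq hm]
  have h3 := fun N => integral_exp_gamVariance hm hr0 N
  simp only [h2] at h3
  simp only [← h3]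
  refine tendsto_integral_of_dominated_convergence (fun _ => 1) (fun N => ?_) (integrable_const _)
    (fun N => .of_forall fun y => norm_exp_field_le (by simpa using hx.le)
      (gamVariance_nonneg _ _)) ?_
  · have h4 : Measurable fun y => gamVariance (closedBox N) (modeSq (tensorField m y)) :=
      Finset.measurable_sum _ fun p _ => Finset.measurable_sum _ fun q _ =>
        ((measurable_modeSq hm p).mul (measurable_modeSq hm q)).mul_const _
    exact (h4.complex_ofReal.const_mul _).neg.cexp.aestronglyMeasurable
  · filter_upwards [ae_quarticSum_ne_top hm] with y hy
    have h5 := tendsto_gamVariance (modeSq_nonneg (tensorField m y)) hy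
    exact (continuous_exp.tendsto _).comp
      (((continuous_ofReal.tendsto _).comp h5).const_mul (x : ℂ)).neg

lemma ofReal_mem_domain (hm : 0 < m) (hx : 0 < x) (h : x < 1 / Knum m) : (x : ℂ) ∈ domain m := by
  have hK := Knum_pos hm
  rw [mem_domain_iff_norm hm, norm_real, Real.norm_of_nonneg hx.le, ofReal_re]
  rw [lt_div_iff₀ hK] at h
  nlinarith

/-- The partition function of the field in the intermediate field representation. -/
theorem partitionFunction_eq_field (hm : 0 < m) (h : lam ∈ domain m) (hre : 0 ≤ lam.re) :
    partitionFunction m lam = fieldPartitionFunction m lam := by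
  have hK := Knum_pos hm
  set κ := √(Knum m) with hκdef
  have hκ : 0 < κ := Real.sqrt_pos.2 hK
  set G : ℂ → ℂ := fun lam => exp (freeEnergy m (gasParameter lam)) with hG
  have hZ : ∀ z ∈ domain m, partitionFunction m z = G z := fun z hz =>
    (potentialWellDefined_of_mem_domain hm hz).2.2
  have hGa : AnalyticOnNhd ℂ G (domain m) := (analyticOnNhd_freeEnergy hm).cexp
  -- The part of the domain with Re λ > 0. In the variable μ it is the intersection of a half plane
  -- with a sector, hence convex, which gives the connectedness that the identity theorem requires.
  set U : Set ℂ := {z | z ≠ 0 ∧ gasParameter z ∈ {μ : ℂ | κ < μ.re ∧ |μ.im| < μ.re}} with hU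
  have hUconn : IsPreconnected U := by
    refine (isConnected_inv_sq (fun μ hμ => hκ.trans hμ.1) ?_ ⟨((κ + 1 : ℝ) : ℂ), ?_⟩).isPreconnected
    · have : {μ : ℂ | κ < μ.re ∧ |μ.im| < μ.re} =
          {μ | κ < μ.re} ∩ ({μ | 0 < (reLm - imLm) μ} ∩ {μ | 0 < (reLm + imLm) μ}) := by
        ext μ
        simp only [Set.mem_setOf_eq, Set.mem_inter_iff, abs_lt, LinearMap.sub_apply, LinearMap.add_apply,
          reLm_coe, imLm_coe]
        constructor
        · rintro ⟨h1, h2, h3⟩; exact ⟨h1, by linarith, by linarith⟩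
        · rintro ⟨h1, h2, h3⟩; exact ⟨h1, by linarith, by linarith⟩
      rw [this]
      exact (convex_halfSpace_re_gt _).inter ((convex_halfSpace_gt (LinearMap.isLinear _) 0).inter
        (convex_halfSpace_gt (LinearMap.isLinear _) 0))
    · simp only [Set.mem_setOf_eq, ofReal_re, ofReal_im, abs_zero]
      exact ⟨by linarith, by linarith⟩
  have hUiff : ∀ z, z ∈ U ↔ z ∈ domain m ∧ 0 < z.re := by
    intro z
    by_cases hz0 : z = 0
    · simp [hz0, hU]
    have hsq := gasParameter_sq hz0
    -- From λ = μ^(-2): the sign of Re λ is that of (Re μ)² - (Im μ)².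
    have hre2 : z.re * normSq (gasParameter z) ^ 2 = (gasParameter z).re ^ 2 -
        (gasParameter z).im ^ 2 := by
      have h1 : z * ((normSq (gasParameter z) : ℝ) : ℂ) ^ 2 =
          (starRingEnd ℂ (gasParameter z)) ^ 2 := by
        rw [← mul_conj]
        linear_combination (starRingEnd ℂ (gasParameter z)) ^ 2 * hsq
      have h2 := congrArg re h1
      rw [← ofReal_pow, re_mul_ofReal] at h2
      rw [h2, sq, mul_re, conj_re, conj_im]
      ring
    have hn : 0 < normSq (gasParameter z) ^ 2 :=
      pow_pos (normSq_pos.2 (gasParameter_ne_zero hz0)) 2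
    rw [mem_domain_iff hm, ← mul_pos_iff_of_pos_right hn, hre2, sub_pos, sq_lt_sq]
    constructor
    · rintro ⟨-, h1, h2⟩
      exact ⟨h1, by rwa [abs_of_pos (hκ.trans h1)]⟩
    · rintro ⟨h1, h2⟩
      exact ⟨hz0, h1, by rwa [abs_of_pos (hκ.trans h1)] at h2⟩
  have hfd : DifferentiableOn ℂ (fieldPartitionFunction m) {z | 0 < z.re} := by
    have := differentiableOn_laplace (ν := fieldNoise) (A := fun _ => 1) (h := fieldQuartic m) (κ := 0)
      measurable_const (measurable_fieldQuartic hm) (.of_forall fieldQuartic_nonneg) (by simp)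
    simp only [one_mul] at this
    rwa [funext (fieldPartitionFunction_eq hm)]
  have hfa : AnalyticOnNhd ℂ (fieldPartitionFunction m) U :=
    (hfd.analyticOnNhd (isOpen_lt continuous_const continuous_re)).mono fun z hz =>
      ((hUiff z).1 hz).2
  set x0 : ℝ := 1 / (2 * Knum m) with hx0
  have hx00 : 0 < x0 := by positivity
  have hx01 : x0 < 1 / Knum m := by
    rw [hx0]
    exact one_div_lt_one_div_of_lt hK (by linarith)
  have heq : Set.EqOn G (fieldPartitionFunction m) U := by
    refine (hGa.mono fun z hz => ((hUiff z).1 hz).1).eqOn_of_preconnected_of_frequently_eq hfa hUconn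
      (z₀ := (x0 : ℂ)) ((hUiff _).2 ⟨ofReal_mem_domain hm hx00 hx01, by simpa using hx00⟩) ?_
    -- Equality on a real interval around `x0` provides the accumulation point; the approach along
    -- the reals is transferred to `ℂ` through sequences.
    have hr : ∃ᶠ x : ℝ in 𝓝[≠] x0, G x = fieldPartitionFunction m x := by
      refine Eventually.frequently ?_
      filter_upwards [mem_nhdsWithin_of_mem_nhds (Ioo_mem_nhds hx00 hx01)] with x hx
      have hxd := ofReal_mem_domain hm hx.1 hx.2
      rw [← hZ _ hxd, partitionFunction_eq_of_pos hm hx.1 hxd]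
    rw [frequently_iff_seq_forall] at hr ⊢
    obtain ⟨xs, hx_tendsto, hx_eq⟩ := hr
    refine ⟨fun n => xs n, ?_, fun n => hx_eq n⟩
    rw [tendsto_nhdsWithin_iff] at hx_tendsto ⊢
    refine ⟨(continuous_ofReal.tendsto _).comp hx_tendsto.1, ?_⟩
    simpa using hx_tendsto.2
  rcases hre.lt_or_eq with hpos | hzero
  · rw [hZ _ h]
    exact heq ((hUiff _).2 ⟨h, hpos⟩)
  -- On the imaginary axis the field side is in general not covered by the analytic argument; the
  -- point is approached from the right, where the integrands are bounded by `1` and the domain is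
  -- open.
  · have hpath : Tendsto (fun j : ℕ => lam + ((1 / ((j : ℝ) + 1) : ℝ) : ℂ)) atTop (𝓝 lam) := by
      have := ((continuous_ofReal.tendsto 0).comp
        (tendsto_one_div_add_atTop_nhds_zero_nat (𝕜 := ℝ))).const_add lam
      simpa using this
    rw [hZ _ h]
    refine tendsto_nhds_unique ((hGa _ h).continuousAt.tendsto.comp hpath) ?_
    have hlim : Tendsto (fun j : ℕ => fieldPartitionFunction m (lam + ((1 / ((j : ℝ) + 1) : ℝ) : ℂ))) atTop
        (𝓝 (fieldPartitionFunction m lam)) := by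
      simp only [fieldPartitionFunction_eq hm]
      refine tendsto_integral_of_dominated_convergence (fun _ => 1) (fun j => ?_) (integrable_const _)
        (fun j => .of_forall fun y => norm_exp_field_le ?_ (fieldQuartic_nonneg y))
        (.of_forall fun y => ?_)
      · exact (((measurable_fieldQuartic hm).complex_ofReal.const_mul _).neg.cexp).aestronglyMeasurable
      · rw [add_re, ofReal_re]; positivity
      · exact (continuous_exp.tendsto _).comp (hpath.mul_const _).neg
    refine hlim.congr' ?_
    filter_upwards [hpath.eventually_mem ((isOpen_domain hm).mem_nhds h)] with j hj
    refine (heq ((hUiff _).2 ⟨hj, ?_⟩)).symm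
    rw [add_re, ofReal_re, ← hzero]
    positivity

end IntermediateField

end

end TGFT

end

/-! ### The theorem -/

theorem theorem3 (m : ℝ) (hm : 0 < m) :
    -- the domain is the interior of a cardioid
    (IsOpen (TGFT.domain m) ∧ IsConnected (TGFT.domain m) ∧
      Bornology.IsBounded (TGFT.domain m) ∧ frontier (TGFT.domain m) = TGFT.cardioid m) ∧
    -- the partition function is well defined there and is that of the tensor field
    (∀ lam ∈ TGFT.domain m, TGFT.PotentialWellDefined m lam ∧
      (0 ≤ lam.re → TGFT.partitionFunction m lam = TGFT.fieldPartitionFunction m lam)) ∧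
    -- the free energy `F = log Z`, real on the positive axis, is analytic in the domain
    ∃ F : ℂ → ℂ, AnalyticOnNhd ℂ F (TGFT.domain m) ∧
      (∀ lam ∈ TGFT.domain m, Complex.exp (F lam) = TGFT.partitionFunction m lam) ∧
      (∀ x : ℝ, 0 < x → (x : ℂ) ∈ TGFT.domain m →
        F x = Complex.log (TGFT.partitionFunction m x) ∧ (F x).im = 0) ∧
      -- and is the sum of its absolutely convergent tree expansion
      ∀ lam ∈ TGFT.domain m,
        (∀ T : TGFT.LabelledTree, TGFT.AmplitudeWellDefined m lam T.2.1) ∧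
        Summable (fun T : TGFT.LabelledTree => ‖TGFT.treeAmplitude m lam T.2.1‖) ∧
        HasSum (fun T : TGFT.LabelledTree => TGFT.treeAmplitude m lam T.2.1)
          (F lam - TGFT.oneVertexTerm m lam) := by
  have hC : TGFT.Critical m √(TGFT.Knum m) := ⟨hm, Real.sqrt_pos.2 (TGFT.Knum_pos hm),
    Real.sq_sqrt (TGFT.Knum_pos hm).le⟩
  refine ⟨⟨TGFT.isOpen_domain hm, TGFT.isConnected_domain hm, TGFT.isBounded_domain hm,
      TGFT.frontier_domain hm⟩,
    fun lam h => ⟨(TGFT.potentialWellDefined_of_mem_domain hm h).1, TGFT.partitionFunction_eq_field hm h⟩,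
    fun lam => TGFT.freeEnergy m (TGFT.gasParameter lam), TGFT.analyticOnNhd_freeEnergy hm,
    fun lam h => (TGFT.potentialWellDefined_of_mem_domain hm h).2.2.symm,
    fun x hx h => TGFT.freeEnergy_real hm hx h, fun lam h => ?_⟩
  have hμ : √(TGFT.Knum m) ≤ (TGFT.gasParameter lam).re := ((TGFT.mem_domain_iff hm).1 h).le
  have hA := fun T : TGFT.LabelledTree =>
    TGFT.treeAmplitude_eq hC (TGFT.ne_zero_of_mem_domain h) hμ T.1.2 T.2.2
  have hS := TGFT.summable_gasTerm hC hμ Set.univ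
  -- The one-vertex term is the self-energy, so what is left of the free energy is the tree sum of
  -- the gas, whose terms are the amplitudes.
  simp only [hA, (TGFT.potentialWellDefined_of_mem_domain hm h).2.1, TGFT.freeEnergy, add_sub_cancel_left]
  exact ⟨fun T => trivial, hS, hS.of_norm.hasSum⟩
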